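/- **Setting.** Let $A$ be a commutative $\mathbb C$-algebra of finite type, $X=\operatorname{Spec}A$. A *formal category* on $X$ is given by a commutative $\mathbb C$-algebra $F$ with homomorphisms $s,t:A\to F$ (source and target) and $e:F\to A$ (identities), $es=et=1_A$, such that $F$ is complete for the $J$-adic topology, $J=\ker e$, together with an associative composition that makes $X$ and the formal scheme $\operatorname{Spf}F$ (of points $F\to R$ that kill a power of $J$) the objects and the morphisms of a groupoid, functorially in the $\mathbb C$-algebra $R$; $e$ gives the identity morphisms. It is *of smooth type* if $J/J^2$ is a finitely generated projective $A$-module and the canonical map $\operatorname{Sym}_A(J/J^2)\to\bigoplus_nJ^n/J^{n+1}$ is an isomorphism. Its *ring of differential operators* is $$L=\bigcup_n\operatorname{Hom}_{A}\big(F/J^n,A\big),$$ where $\operatorname{Hom}_A$ is taken for the left structure $s$. The product is dual to the composition: with $\mu:F\to \varprojlim_{m,n} F/J^m\otimes_{t,A,s}F/J^n$ the map given by the composition, $uv=u\circ(1\otimes v)\circ\mu$, where $1\otimes v: x\otimes y\mapsto x\,t(v(y))$. The map $a\mapsto a\,e$ is an inclusion of rings $A\to L$, by which $L$ is an $A$-bimodule.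 **Weak complexes.** Let $T^kL=L\otimes_A\cdots\otimes_AL$ ($k$ factors, $T^0L=A$), $TL=\bigoplus_kT^kL$, with $T^kL$ in degree $-k$ and $$\delta(u_1\otimes\cdots\otimes u_k)=\sum_{1\le l<k}(-1)^{l+1}u_1\otimes\cdots\otimes u_lu_{l+1}\otimes\cdots\otimes u_k .$$ For complexes $E,G$ of $A$-modules let $Q(E,G)=\operatorname{Hom}^\bullet_A(TL\otimes_AE,G)$ with the usual differential $d_Qq=d_Gq-(-1)^{|q|}q\,d_{TL\otimes E}$, where $d_{TL\otimes E}(u\otimes x)=\delta u\otimes x+(-1)^ku\otimes dx$ for $u\in T^kL$. Thus an element is a family of functions $q(u_1,\dots,u_k;x)$. The products $Q(G,H)\otimes Q(E,G)\to Q(E,H)$, $$(gf)(u_1,\dots,u_k;x)=\sum_{j=0}^k(-1)^{j|f|}\,g\big(u_1,\dots,u_j;f(u_{j+1},\dots,u_k;x)\big),$$ make this a dg category. Let $\mathrm{wpx}(L)$ be the dg category whose objects are the pairs $(E,\eta)$, with $\eta\in Q^1(E,E)$, such that $d_Q\eta+\eta^2=0$ and such that, for $a,a_i\in A$, $\eta(\,;x)=0$,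 $\eta(a;x)=ax$ and $\eta(a_1,\dots,a_m;x)=0$ if $m\ge2$; the morphism complexes from $(E,\eta)$ to $(G,\varphi)$ are $Q(E,G)$ with the differential $d_{\eta,\varphi}(q)=d_Qq+\varphi q-(-1)^{|q|}q\eta$. Let $\mathrm{wpx}_0(L)$ be the dg subcategory with the same objects, and with those morphisms $q$ for which $q(a_1,\dots,a_m;x)=0$ whenever $m\ge1$ and all $a_i\in A$. The projections $\mathscr P:\mathrm{wpx}(L)\to DG\mathrm{cpx}(A)$ and $\mathscr P_0:\mathrm{wpx}_0(L)\to DG\mathrm{cpx}(A)$ to the dg category of complexes of $A$-modules send $(E,\eta)$ to $E$ and $q$ to its component $q(\,;-)$ on $T^0L\otimes_AE=E$. **The functors.** The *weakification* functor $\mathscr W$ from the dg category of complexes of left $L$-modules to $\mathrm{wpx}(L)$ sends $E$ to $(E|_A,\phi)$, where $\phi(u;x)=ux$ and $\phi(u_1,\dots,u_k;x)=0$ for $k\ne1$, and a cochain $g$ to the $q$ with $q(\,;x)=g(x)$ and $q(u_1,\dots,u_k;x)=0$ for $k>0$. It takes values in $\mathrm{wpx}_0(L)$, and $\mathscr W_0$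 is the same functor with this target. Let $\mathscr P^{\rm str}$ be the restriction of complexes of $L$-modules to $A$. **Finiteness.** Modules over $A$, or over $L$, are *locally free* if they become free, of possibly infinite rank, over the members of some affine open covering of $X$. Let $DG\mathrm{cpx}^{\rm bplf}(A)$ be the dg category of bounded complexes of locally free $A$-modules that are perfect (locally on $X$ quasi-isomorphic to a bounded complex of finitely generated projective modules), $DG\mathrm{cpx}^{\rm bplf}(L)$ that of bounded complexes of locally free $L$-modules that are perfect as complexes of $A$-modules, and $\mathrm{wpx}^{\rm bplf}(L)$, $\mathrm{wpx}^{\rm bplf}_0(L)$ the full dg subcategories of the $(E,\eta)$ with $E\in DG\mathrm{cpx}^{\rm bplf}(A)$. **Theorem.** Let $L$ be the ring of differential operators of a formal category of smooth type on $\operatorname{Spec}A$. Then each object of $DG\mathrm{cpx}^{\rm bplf}(L)$ is, as a complex of $A$-modules, in $DG\mathrm{cpx}^{\rm bplf}(A)$, and the functors $$\mathscr W_0:DG\mathrm{cpx}^{\rm bplf}(L)\to\mathrm{wpx}^{\rm bplf}_0(L),\qquad \mathscr W:DG\mathrm{cpx}^{\rm bplf}(L)\to\mathrm{wpx}^{\rm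 bplf}(L)$$ are quasi-equivalences of dg categories relative to $DG\mathrm{cpx}^{\rm bplf}(A)$. That is, each of them induces quasi-isomorphisms on the morphism complexes; every object of its target is related to an object of the image by an inner equivalence (a closed morphism of degree $0$ that is invertible up to homotopy); and $\mathscr P_0\circ\mathscr W_0=\mathscr P^{\rm str}$, $\mathscr P\circ\mathscr W=\mathscr P^{\rm str}$. -/

import Mathlib

open CategoryTheory CochainComplex CochainComplex.HomComplex

universe w v u

/-! ### Differential graded categories -/

/-- A differential graded category over `k`: the complexes of morphisms are given degree by degree,
and composition is written in diagrammatic order (`comp f g` is `g ∘ f`).  To avoid transports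
along equalities of degrees, the differential and the composition take the degree of their
result together with a proof that it is the right one. -/
structure DGCat (k : Type w) [CommRing k] where
  Obj : Type u
  Hom : Obj → Obj → ℤ → Type v
  [addCommGroup : ∀ x y n, AddCommGroup (Hom x y n)]
  [module : ∀ x y n, Module k (Hom x y n)]
  d : ∀ {x y : Obj} (n m : ℤ), n + 1 = m → Hom x y n →ₗ[k] Hom x y m
  id : ∀ x : Obj, Hom x x 0
  comp : ∀ {x y z : Obj} {a b c : ℤ}, a + b = c → Hom x y a →ₗ[k] Hom y z b →ₗ[k] Hom x z c
  d_d : ∀ {x y : Obj} (n m p : ℤ) (h : n + 1 = m) (h' : m + 1 = p) (f : Hom x y n),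
    d m p h' (d n m h f) = 0
  id_comp : ∀ {x y : Obj} {n : ℤ} (f : Hom x y n), comp (zero_add n) (id x) f = f
  comp_id : ∀ {x y : Obj} {n : ℤ} (f : Hom x y n), comp (add_zero n) f (id y) = f
  assoc : ∀ {x y z t : Obj} {a b c ab bc abc : ℤ} (h₁ : a + b = ab) (h₂ : b + c = bc)
    (h₃ : ab + c = abc) (h₄ : a + bc = abc) (f : Hom x y a) (g : Hom y z b) (h : Hom z t c),
    comp h₃ (comp h₁ f g) h = comp h₄ f (comp h₂ g h)
  d_comp : ∀ {x y z : Obj} {a b c a' b' c' : ℤ} (h : a + b = c) (ha : a + 1 = a')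
    (hb : b + 1 = b') (hc : c + 1 = c') (h₁ : a + b' = c') (h₂ : a' + b = c')
    (f : Hom x y a) (g : Hom y z b),
    d c c' hc (comp h f g) =
      comp h₁ f (d b b' hb g) + b.negOnePow • comp h₂ (d a a' ha f) g

attribute [instance] DGCat.addCommGroup DGCat.module

namespace DGCat

variable {k : Type w} [CommRing k]

/-- A closed morphism of degree `0` is an inner equivalence if it is invertible up to homotopy. -/
def IsInnerEquivalence (C : DGCat.{w, v, u} k) {x y : C.Obj} (f : C.Hom x y 0) : Prop :=
  C.d 0 1 rfl f = 0 ∧ ∃ g : C.Hom y x 0, C.d 0 1 rfl g = 0 ∧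
    (∃ h : C.Hom x x (-1), C.comp (add_zero 0) f g - C.id x = C.d (-1) 0 rfl h) ∧
    (∃ h : C.Hom y y (-1), C.comp (add_zero 0) g f - C.id y = C.d (-1) 0 rfl h)

/-- The full dg subcategory on the objects that satisfy `p`. -/
def full (C : DGCat.{w, v, u} k) (p : C.Obj → Prop) : DGCat.{w, v, u} k where
  Obj := {x : C.Obj // p x}
  Hom x y n := C.Hom x.1 y.1 n
  d := C.d
  id x := C.id x.1
  comp := C.comp
  d_d := C.d_d
  id_comp := C.id_comp
  comp_id := C.comp_id
  assoc := C.assoc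
  d_comp := C.d_comp

/-- The dg subcategory with the same objects and with the morphism complexes `S x y`. -/
def sub (C : DGCat.{w, v, u} k) (S : ∀ x y n, Submodule k (C.Hom x y n))
    (hd : ∀ {x y} (n m) (h : n + 1 = m) (f), f ∈ S x y n → C.d n m h f ∈ S x y m)
    (hid : ∀ x, C.id x ∈ S x x 0)
    (hcomp : ∀ {x y z} {a b c : ℤ} (h : a + b = c) (f g), f ∈ S x y a → g ∈ S y z b →
      C.comp h f g ∈ S x z c) : DGCat.{w, v, u} k where
  Obj := C.Obj
  Hom x y n := S x y n
  d n m h := (C.d n m h).restrict (hd n m h)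
  id x := ⟨C.id x, hid x⟩
  comp {x y z a b c} h := LinearMap.mk₂ k (fun f g => ⟨C.comp h f.1 g.1, hcomp h _ _ f.2 g.2⟩)
    (by intros; ext; simp) (by intros; ext; simp) (by intros; ext; simp) (by intros; ext; simp)
  d_d n m p h h' f := Subtype.ext (C.d_d n m p h h' f.1)
  id_comp f := Subtype.ext (C.id_comp f.1)
  comp_id f := Subtype.ext (C.comp_id f.1)
  assoc h₁ h₂ h₃ h₄ f g h := Subtype.ext (C.assoc h₁ h₂ h₃ h₄ f.1 g.1 h.1)
  d_comp h ha hb hc h₁ h₂ f g := Subtype.ext (C.d_comp h ha hb hc h₁ h₂ f.1 g.1)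

/-- The Maurer–Cartan equation `d η + η ^ 2 = 0` for `η` of degree `1`. -/
def IsMaurerCartan (C : DGCat.{w, v, u} k) {x : C.Obj} (η : C.Hom x x 1) : Prop :=
  C.d 1 2 rfl η + C.comp (c := 2) rfl η η = 0

/-- The twisted differential `q ↦ d q + φ q - (-1) ^ |q| q η`. -/
def twistedD (C : DGCat.{w, v, u} k) {x y : C.Obj} (η : C.Hom x x 1) (φ : C.Hom y y 1)
    (n m : ℤ) (h : n + 1 = m) : C.Hom x y n →ₗ[k] C.Hom x y m :=
  C.d n m h + (C.comp h).flip φ - n.negOnePow • C.comp ((add_comm 1 n).trans h) η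

lemma twistedD_apply (C : DGCat.{w, v, u} k) {x y : C.Obj} (η : C.Hom x x 1) (φ : C.Hom y y 1)
    (n m : ℤ) (h : n + 1 = m) (q : C.Hom x y n) :
    C.twistedD η φ n m h q = C.d n m h q + C.comp h q φ -
      n.negOnePow • C.comp ((add_comm 1 n).trans h) η q := rfl

lemma comp_smul' (C : DGCat.{w, v, u} k) {x y z : C.Obj} {a b c : ℤ} (h : a + b = c)
    (f : C.Hom x y a) (ε : ℤˣ) (g : C.Hom y z b) :
    C.comp h f (ε • g) = ε • C.comp h f g := by
  rcases Int.units_eq_one_or ε with rfl | rfl <;> simp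

lemma smul_comp' (C : DGCat.{w, v, u} k) {x y z : C.Obj} {a b c : ℤ} (h : a + b = c)
    (f : C.Hom x y a) (ε : ℤˣ) (g : C.Hom y z b) :
    C.comp h (ε • f) g = ε • C.comp h f g := by
  rcases Int.units_eq_one_or ε with rfl | rfl <;> simp

lemma d_smul' (C : DGCat.{w, v, u} k) {x y : C.Obj} {a b : ℤ} (h : a + 1 = b)
    (ε : ℤˣ) (f : C.Hom x y a) : C.d a b h (ε • f) = ε • C.d a b h f := by
  rcases Int.units_eq_one_or ε with rfl | rfl <;> simp

lemma twistedD_twistedD (C : DGCat.{w, v, u} k) {x y : C.Obj} {η : C.Hom x x 1}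
    {φ : C.Hom y y 1} (hη : C.IsMaurerCartan η) (hφ : C.IsMaurerCartan φ)
    (n m p : ℤ) (h : n + 1 = m) (h' : m + 1 = p) (q : C.Hom x y n) :
    C.twistedD η φ m p h' (C.twistedD η φ n m h q) = 0 := by
  have e1 := C.d_comp (a := n) (b := 1) (b' := 2) h h rfl h' (by omega) h' q φ
  have e2 := C.d_comp (a := 1) (b := n) (a' := 2) (by omega : 1 + n = m) rfl h h'
    (by omega) (by omega) η q
  have hη' : C.d 1 2 rfl η = - C.comp (c := 2) rfl η η := eq_neg_of_add_eq_zero_left hη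
  have hφ' : C.d 1 2 rfl φ = - C.comp (c := 2) rfl φ φ := eq_neg_of_add_eq_zero_left hφ
  have a1 := C.assoc h (rfl : (1 : ℤ) + 1 = 2) h' (by omega) q φ φ
  have a2 := C.assoc (rfl : (1 : ℤ) + 1 = 2) (by omega : 1 + n = m) (by omega)
    (by omega : 1 + m = p) η η q
  have a3 := C.assoc (by omega : 1 + n = m) h h' (by omega) η q φ
  subst h
  simp only [twistedD_apply, map_add, map_sub, LinearMap.add_apply, LinearMap.sub_apply, C.d_d,
    C.smul_comp', C.comp_smul', C.d_smul', e1, e2, hη', hφ', map_neg, LinearMap.neg_apply, a1, a2,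
    a3, Int.negOnePow_succ, Int.negOnePow_one, Units.neg_smul, one_smul, smul_add, smul_sub,
    smul_neg, smul_smul, neg_mul, Int.units_mul_self]
  abel

/-- The dg category of pairs `(x, η)`, where `η` is a Maurer–Cartan element of `Hom x x` that
satisfies the condition `p`; its morphism complexes are those of `C` with the twisted
differentials. -/
def twist (C : DGCat.{w, v, u} k) (p : ∀ x : C.Obj, C.Hom x x 1 → Prop) :
    DGCat.{w, v, max u v} k where
  Obj := Σ x : C.Obj, {η : C.Hom x x 1 // p x η ∧ C.IsMaurerCartan η}
  Hom x y n := C.Hom x.1 y.1 n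
  d {x y} n m h := C.twistedD x.2.1 y.2.1 n m h
  id x := C.id x.1
  comp := C.comp
  d_d {x y} n m p h h' f := C.twistedD_twistedD x.2.2.2 y.2.2.2 n m p h h' f
  id_comp := C.id_comp
  comp_id := C.comp_id
  assoc := C.assoc
  d_comp {x y z a b c a' b' c'} h ha hb hc h₁ h₂ f g := by
    have e := C.d_comp h ha hb hc h₁ h₂ f g
    have a1 := C.assoc h hb hc h₁ f g z.2.1
    have a2 := C.assoc (by omega : 1 + a = a') h h₂ (by omega) x.2.1 f g
    have a3 := C.assoc ha (by omega : 1 + b = b') h₂ h₁ f y.2.1 g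
    have hs : c.negOnePow = b.negOnePow * a.negOnePow := by
      rw [← h, Int.negOnePow_add, mul_comm]
    simp only [twistedD_apply, map_add, map_sub, LinearMap.add_apply, LinearMap.sub_apply,
      C.smul_comp', C.comp_smul', e, a1, a2, a3, smul_add, smul_sub, smul_smul, hs]
    abel

end DGCat

/-- A dg functor. -/
structure DGFunctor {k : Type w} [CommRing k] (C : DGCat.{w} k) (D : DGCat.{w} k) where
  obj : C.Obj → D.Obj
  map : ∀ {x y : C.Obj} (n : ℤ), C.Hom x y n →ₗ[k] D.Hom (obj x) (obj y) n
  map_d : ∀ {x y : C.Obj} (n m : ℤ) (h : n + 1 = m) (f : C.Hom x y n),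
    map m (C.d n m h f) = D.d n m h (map n f)
  map_id : ∀ x : C.Obj, map 0 (C.id x) = D.id (obj x)
  map_comp : ∀ {x y z : C.Obj} {a b c : ℤ} (h : a + b = c) (f : C.Hom x y a) (g : C.Hom y z b),
    map c (C.comp h f g) = D.comp h (map a f) (map b g)

namespace DGFunctor

variable {k : Type w} [CommRing k]

/-- Composition of dg functors (`F.comp G` is `G ∘ F`). -/
def comp {C D E : DGCat k} (F : DGFunctor C D) (G : DGFunctor D E) : DGFunctor C E where
  obj x := G.obj (F.obj x)
  map n := G.map n ∘ₗ F.map n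
  map_d n m h f := by simp [F.map_d, G.map_d]
  map_id x := by simp [F.map_id, G.map_id]
  map_comp h f g := by simp [F.map_comp, G.map_comp]

/-- The restriction of a dg functor to full dg subcategories. -/
def restrict {C D : DGCat k} (F : DGFunctor C D) {p : C.Obj → Prop} {q : D.Obj → Prop}
    (h : ∀ x, p x → q (F.obj x)) : DGFunctor (C.full p) (D.full q) where
  obj x := ⟨F.obj x.1, h x.1 x.2⟩
  map n := F.map n
  map_d := F.map_d
  map_id x := F.map_id x.1
  map_comp := F.map_comp

/-- The inclusion of a dg subcategory with the same objects. -/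
def subIncl (C : DGCat k) (S : ∀ x y n, Submodule k (C.Hom x y n)) (hd) (hid) (hcomp) :
    DGFunctor (C.sub S hd hid hcomp) C where
  obj x := x
  map n := (S _ _ n).subtype
  map_d _ _ _ _ := rfl
  map_id _ := rfl
  map_comp _ _ _ := rfl

/-- A dg functor is quasi-fully faithful if it induces isomorphisms on the cohomology of the
morphism complexes. -/
def IsQuasiFullyFaithful {C D : DGCat k} (F : DGFunctor C D) : Prop :=
  ∀ (x y : C.Obj) (l n m : ℤ) (hl : l + 1 = n) (hn : n + 1 = m),
    (∀ f : C.Hom x y n, C.d n m hn f = 0 → (∃ g, D.d l n hl g = F.map n f) →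
      ∃ g, C.d l n hl g = f) ∧
    (∀ g : D.Hom (F.obj x) (F.obj y) n, D.d n m hn g = 0 →
      ∃ f : C.Hom x y n, C.d n m hn f = 0 ∧ ∃ h, D.d l n hl h = g - F.map n f)

/-- A dg functor is quasi-essentially surjective if every object of the target is related to one
in the image by an inner equivalence. -/
def IsQuasiEssSurj {C D : DGCat k} (F : DGFunctor C D) : Prop :=
  ∀ y : D.Obj, ∃ (x : C.Obj) (f : D.Hom (F.obj x) y 0), D.IsInnerEquivalence f

/-- Quasi-equivalences of dg categories. -/
def IsQuasiEquivalence {C D : DGCat k} (F : DGFunctor C D) : Prop :=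
  F.IsQuasiFullyFaithful ∧ F.IsQuasiEssSurj

end DGFunctor

/-! ### Cochains on the tensor algebra

A family of cochains `q (u₁, …, u_k ; -) : K → K'` indexed by the words `u₁ … u_k` in `L`; such a
family has degree `i` if the cochain of a word of length `k` has degree `i - k`. -/

section Words

variable {k : Type*} [CommRing k] {C : Type*} [Category* C] [Preadditive C] [Linear k C]
  {L : Type*} {K K₁ K₂ K₃ : CochainComplex C ℤ}

/-- A word in `L` with an integer `n` such that `n + length = i`. -/
structure WordDegree (L : Type*) (i : ℤ) where
  word : List L
  n : ℤ
  hn : n + word.length = i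

/-- Families of cochains of degree `i - k`, for the words of length `k` in `L`. -/
def WordCochain (L : Type*) (K K' : CochainComplex C ℤ) (i : ℤ) :=
  ∀ T : WordDegree L i, Cochain K K' T.n

namespace WordCochain

instance (i : ℤ) : AddCommGroup (WordCochain L K K₁ i) :=
  inferInstanceAs (AddCommGroup (∀ T : WordDegree L i, Cochain K K₁ T.n))

instance (i : ℤ) : Module k (WordCochain L K K₁ i) :=
  inferInstanceAs (Module k (∀ T : WordDegree L i, Cochain K K₁ T.n))

/-- Constructor for `WordCochain`. -/
def mk {i : ℤ} (q : ∀ (u : List L) (n : ℤ), n + u.length = i → Cochain K K₁ n) :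
    WordCochain L K K₁ i := fun ⟨u, n, hn⟩ => q u n hn

/-- The cochain `q (u₁, …, u_k ; -)`, of degree `n = i - k`. -/
def v {i : ℤ} (q : WordCochain L K K₁ i) (u : List L) (n : ℤ) (hn : n + u.length = i) :
    Cochain K K₁ n := q ⟨u, n, hn⟩

section

variable {i : ℤ} (q q' : WordCochain L K K₁ i) (u : List L) (n : ℤ) (hn : n + u.length = i)

@[simp] lemma mk_v (q : ∀ (u : List L) (n : ℤ), n + u.length = i → Cochain K K₁ n) :
    (mk q).v u n hn = q u n hn := rfl

@[simp] lemma add_v : (q + q').v u n hn = q.v u n hn + q'.v u n hn := rfl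

@[simp] lemma sub_v : (q - q').v u n hn = q.v u n hn - q'.v u n hn := rfl

@[simp] lemma neg_v : (-q).v u n hn = -q.v u n hn := rfl

@[simp] lemma zero_v : (0 : WordCochain L K K₁ i).v u n hn = 0 := rfl

@[simp] lemma smul_v (t : k) : (t • q).v u n hn = t • q.v u n hn := rfl

@[simp] lemma units_smul_v (t : ℤˣ) : (t • q).v u n hn = t • q.v u n hn := by
  rcases Int.units_eq_one_or t with rfl | rfl <;> simp

variable {q q'} in
@[ext] lemma ext (h : ∀ u n hn, q.v u n hn = q'.v u n hn) : q = q' := by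
  funext ⟨u, n, hn⟩
  exact h u n hn

end

/-- The cochain `e ↦ g (l ; f (r ; e))`, for words `l` and `r`. -/
def compTerm {a b c : ℤ} (f : WordCochain L K K₁ a) (g : WordCochain L K₁ K₂ b) (h : a + b = c)
    (l r : List L) (n : ℤ) (hn : n + (l ++ r).length = c) : Cochain K K₂ n :=
  (f.v r (a - r.length) (by ring)).comp (g.v l (b - l.length) (by ring))
    (by rw [List.length_append] at hn; omega)

/-- The product, with the sign given by the Koszul rule:
`(g f) (u₁, …, u_k ; e) = ∑ j, (-1) ^ (j |f|) g (u₁, …, u_j ; f (u_{j+1}, …, u_k ; e))`. -/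
def comp {a b c : ℤ} (f : WordCochain L K K₁ a) (g : WordCochain L K₁ K₂ b) (h : a + b = c) :
    WordCochain L K K₂ c := .mk fun u n hn =>
  ∑ j ∈ Finset.range (u.length + 1),
    (a * j).negOnePow • compTerm f g h (u.take j) (u.drop j) n (by rwa [List.take_append_drop])

/-- The family `q (x, - ; -)`. -/
def shift {i j : ℤ} (h : i + 1 = j) (x : L) (q : WordCochain L K K₁ j) : WordCochain L K K₁ i :=
  .mk fun u n hn => q.v (x :: u) n (by simp only [List.length_cons]; omega)

/-- Auxiliary definition for `hochschild`. -/
def hochschildAux [Mul L] : ∀ (u : List L) {i : ℤ} (_ : WordCochain L K K₁ i) (n : ℤ),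
    n + u.length = i + 1 → Cochain K K₁ n
  | [], _, _, _, _ => 0
  | [_], _, _, _, _ => 0
  | x :: y :: u, i, q, n, hn =>
      q.v ((x * y) :: u) n (by simp only [List.length_cons] at hn ⊢; omega) -
        hochschildAux (y :: u) (q.shift (sub_add_cancel i 1) x) n
          (by simp only [List.length_cons] at hn ⊢; omega)

/-- The transpose `q ↦ q ∘ δ` of the partial Hochschild differential
`δ (u₁ ⊗ … ⊗ u_k) = ∑ l, (-1) ^ (l + 1) u₁ ⊗ … ⊗ (u_l u_{l+1}) ⊗ … ⊗ u_k`, which is computed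
recursively by `δ (u₁ ⊗ u₂ ⊗ u) = u₁ u₂ ⊗ u - u₁ ⊗ δ (u₂ ⊗ u)` and vanishes on words of length at
most one. -/
def hochschild [Mul L] {i j : ℤ} (h : i + 1 = j) (q : WordCochain L K K₁ i) :
    WordCochain L K K₁ j := .mk fun u n hn => hochschildAux u q n (by omega)

lemma compTerm_eq {a b c : ℤ} (f : WordCochain L K K₁ a) (g : WordCochain L K₁ K₂ b)
    (h : a + b = c) (l r : List L) (n n₁ n₂ : ℤ) (hn h₁ h₂) (h₁₂ : n₁ + n₂ = n) :
    compTerm f g h l r n hn = (f.v r n₁ h₁).comp (g.v l n₂ h₂) h₁₂ := by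
  obtain rfl : n₁ = a - (r.length : ℤ) := by omega
  obtain rfl : n₂ = b - (l.length : ℤ) := by omega
  rfl

lemma comp_nil {a b c : ℤ} (f : WordCochain L K K₁ a) (g : WordCochain L K₁ K₂ b) (h : a + b = c)
    (n n₁ n₂ : ℤ) (hn h₁ h₂) (h₁₂ : n₁ + n₂ = n) :
    (f.comp g h).v [] n hn = (f.v [] n₁ h₁).comp (g.v [] n₂ h₂) h₁₂ := by
  rw [comp, mk_v, ← compTerm_eq f g h [] [] n n₁ n₂ hn h₁ h₂ h₁₂]
  simp
  rfl

lemma comp_cons {a b c b' c' : ℤ} (f : WordCochain L K K₁ a) (g : WordCochain L K₁ K₂ b)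
    (h : a + b = c) (x : L) (u : List L) (n n₁ n₂ : ℤ) (hn h₁ h₂) (h₁₂ : n₁ + n₂ = n)
    (hb : b' + 1 = b) (hc : a + b' = c') (hn') :
    (f.comp g h).v (x :: u) n hn = (f.v (x :: u) n₁ h₁).comp (g.v [] n₂ h₂) h₁₂ +
      a.negOnePow • (f.comp (g.shift hb x) hc).v u n hn' := by
  rw [comp, mk_v, ← compTerm_eq f g h [] (x :: u) n n₁ n₂ hn h₁ h₂ h₁₂, comp, mk_v, Finset.smul_sum]
  change ∑ j ∈ Finset.range (u.length + 1 + 1), _ = _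
  rw [Finset.sum_range_succ', add_comm]
  congr 1
  · simp
    rfl
  · refine Finset.sum_congr rfl fun j _ => ?_
    have : (a * (j + 1 : ℕ)).negOnePow = (a + a * j).negOnePow := by
      congr 1; push_cast; ring
    rw [smul_smul, ← Int.negOnePow_add, this]
    congr 1
    have h3 := congrArg List.length (List.take_append_drop j u)
    rw [List.length_append] at h3
    have h4 := hn
    rw [List.length_cons] at h4
    rw [compTerm_eq (n₁ := a - ((u.drop j).length : ℤ)) (n₂ := b' - ((u.take j).length : ℤ))]
    rfl

lemma hochschild_nil [Mul L] {i j : ℤ} (h : i + 1 = j) (q : WordCochain L K K₁ i) (n : ℤ) (hn) :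
    (q.hochschild h).v [] n hn = 0 := rfl

lemma hochschild_single [Mul L] {i j : ℤ} (h : i + 1 = j) (q : WordCochain L K K₁ i) (x : L)
    (n : ℤ) (hn) : (q.hochschild h).v [x] n hn = 0 := rfl

lemma hochschild_cons_cons [Mul L] {i j l : ℤ} (h : i + 1 = j) (hl : l + 1 = i)
    (q : WordCochain L K K₁ i) (x y : L) (u : List L) (n : ℤ) (hn h₁ h₂) :
    (q.hochschild h).v (x :: y :: u) n hn =
      q.v ((x * y) :: u) n h₁ - ((q.shift hl x).hochschild hl).v (y :: u) n h₂ := by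
  obtain rfl : l = i - 1 := by omega
  rfl

section

variable {a b c : ℤ} (f f' : WordCochain L K K₁ a) (g g' : WordCochain L K₁ K₂ b) (h : a + b = c)

lemma add_comp : (f + f').comp g h = f.comp g h + f'.comp g h := by
  ext1 u n hn
  simp [comp, compTerm, Finset.sum_add_distrib]

lemma comp_add : f.comp (g + g') h = f.comp g h + f.comp g' h := by
  ext1 u n hn
  simp [comp, compTerm, Finset.sum_add_distrib]

lemma smul_comp (t : k) : (t • f).comp g h = t • f.comp g h := by
  ext1 u n hn
  simp only [comp, compTerm, mk_v, smul_v, Finset.smul_sum, Cochain.smul_comp]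
  exact Finset.sum_congr rfl fun j _ => smul_comm _ _ _

lemma comp_smul (t : k) : f.comp (t • g) h = t • f.comp g h := by
  ext1 u n hn
  simp only [comp, compTerm, mk_v, smul_v, Finset.smul_sum, Cochain.comp_smul]
  exact Finset.sum_congr rfl fun j _ => smul_comm _ _ _

lemma units_smul_comp (t : ℤˣ) : (t • f).comp g h = t • f.comp g h := by
  rcases Int.units_eq_one_or t with rfl | rfl
  · simp
  · ext1 u n hn
    simp [comp, compTerm]

lemma comp_units_smul (t : ℤˣ) : f.comp (t • g) h = t • f.comp g h := by
  rcases Int.units_eq_one_or t with rfl | rfl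
  · simp
  · ext1 u n hn
    simp [comp, compTerm]

lemma sub_comp : (f - f').comp g h = f.comp g h - f'.comp g h := by
  ext1 u n hn
  simp [comp, compTerm, smul_sub]

lemma comp_sub : f.comp (g - g') h = f.comp g h - f.comp g' h := by
  ext1 u n hn
  simp [comp, compTerm, smul_sub]

end

/-- Composition with a cochain that does not depend on words. -/
def postcomp {a b c : ℤ} (q : WordCochain L K K₁ a) (z : Cochain K₁ K₂ b) (h : a + b = c) :
    WordCochain L K K₂ c := .mk fun u n hn => (q.v u (n - b) (by omega)).comp z (by omega)

lemma postcomp_v {a b c : ℤ} (q : WordCochain L K K₁ a) (z : Cochain K₁ K₂ b) (h : a + b = c)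
    (u : List L) (n n' : ℤ) (hn hn') (h₁ : n' + b = n) :
    (q.postcomp z h).v u n hn = (q.v u n' hn').comp z h₁ := by
  obtain rfl : n' = n - b := by omega
  rfl

lemma comp_postcomp {a b c ab bc abc : ℤ} (f : WordCochain L K K₁ a) (g : WordCochain L K₁ K₂ b)
    (z : Cochain K₂ K₃ c) (h₁ : a + b = ab) (h₂ : b + c = bc) (h₃ : ab + c = abc)
    (h₄ : a + bc = abc) : f.comp (g.postcomp z h₂) h₄ = (f.comp g h₁).postcomp z h₃ := by
  ext1 u n hn
  rw [postcomp_v (n' := n - c) (hn' := by omega) (h₁ := by omega), comp, comp, mk_v, mk_v]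
  have : ∀ (s : Finset ℕ) (F : ℕ → Cochain K K₂ (n - c)) (h : n - c + c = n),
      (∑ j ∈ s, F j).comp z h = ∑ j ∈ s, (F j).comp z h := by
    intro s F h
    induction s using Finset.cons_induction with
    | empty => simp
    | cons a s ha ih => rw [Finset.sum_cons, Finset.sum_cons, Cochain.add_comp, ih]
  rw [this]
  refine Finset.sum_congr rfl fun j _ => ?_
  have h3 := congrArg List.length (List.take_append_drop j u)
  rw [List.length_append] at h3
  rw [Cochain.units_smul_comp, compTerm_eq (n₁ := a - ((u.drop j).length : ℤ))
    (n₂ := bc - ((u.take j).length : ℤ)) (h₁ := by omega) (h₂ := by omega) (h₁₂ := by omega),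
    compTerm_eq (n₁ := a - ((u.drop j).length : ℤ)) (n₂ := b - ((u.take j).length : ℤ))
    (h₁ := by omega) (h₂ := by omega) (h₁₂ := by omega),
    postcomp_v (n' := b - ((u.take j).length : ℤ)) (hn' := by omega) (h₁ := by omega),
    Cochain.comp_assoc]
  omega

lemma shift_comp {a b c b' c' a' : ℤ} (f : WordCochain L K K₁ a) (g : WordCochain L K₁ K₂ b)
    (h : a + b = c) (x : L) (hc : c' + 1 = c) (ha : a' + 1 = a) (hb : b' + 1 = b) (h₁ : a' + b = c')
    (h₂ : a + b' = c') :
    (f.comp g h).shift hc x = (f.shift ha x).postcomp (g.v [] b (by simp)) h₁ +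
      a.negOnePow • f.comp (g.shift hb x) h₂ := by
  ext1 u n hn
  rw [shift, mk_v, comp_cons (n₁ := n - b) (n₂ := b) (hb := hb) (hc := h₂) (hn' := hn)
    (h₁ := by rw [List.length_cons]; omega) (h₂ := by simp) (h₁₂ := by omega), add_v,
    postcomp_v (n' := n - b) (hn' := by omega) (h₁ := by omega), units_smul_v]
  rfl

lemma comp_assoc {a b c ab bc abc : ℤ} (f : WordCochain L K K₁ a) (g : WordCochain L K₁ K₂ b)
    (p : WordCochain L K₂ K₃ c) (h₁ : a + b = ab) (h₂ : b + c = bc) (h₃ : ab + c = abc)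
    (h₄ : a + bc = abc) : (f.comp g h₁).comp p h₃ = f.comp (g.comp p h₂) h₄ := by
  ext1 u
  induction u generalizing a b c ab bc abc with
  | nil =>
    intro n hn
    have hn' : n = abc := by simpa using hn
    subst hn'
    rw [comp_nil (n₁ := ab) (n₂ := c) (hn := hn) (h₁ := by simp) (h₂ := by simp) (h₁₂ := h₃),
      comp_nil (n₁ := a) (n₂ := b) (h₁ := by simp) (h₂ := by simp) (h₁₂ := h₁),
      comp_nil (n₁ := a) (n₂ := bc) (hn := hn) (h₁ := by simp) (h₂ := by simp) (h₁₂ := h₄),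
      comp_nil (n₁ := b) (n₂ := c) (h₁ := by simp) (h₂ := by simp) (h₁₂ := h₂),
      Cochain.comp_assoc]
    omega
  | cons x u ih =>
    intro n hn
    have hn' : n + (u.length + 1) = abc := by simpa using hn
    rw [comp_cons (n₁ := ab - (u.length + 1)) (n₂ := c) (b' := c - 1) (c' := abc - 1)
        (hn := hn) (h₁ := by simp) (h₂ := by simp) (h₁₂ := by omega) (hb := by omega)
        (hc := by omega) (hn' := by omega),
      comp_cons (n₁ := a - (u.length + 1)) (n₂ := b) (b' := b - 1) (c' := ab - 1)
        (h₁ := by simp) (h₂ := by simp) (h₁₂ := by omega) (hb := by omega)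
        (hc := by omega) (hn' := by omega),
      comp_cons (n₁ := a - (u.length + 1)) (n₂ := bc) (b' := bc - 1) (c' := abc - 1)
        (hn := hn) (h₁ := by simp) (h₂ := by simp) (h₁₂ := by omega) (hb := by omega)
        (hc := by omega) (hn' := by omega),
      comp_nil (n₁ := b) (n₂ := c) (h₁ := by simp) (h₂ := by simp) (h₁₂ := h₂),
      shift_comp (a' := b - 1) (b' := c - 1) (ha := by omega) (hb := by omega) (h₁ := by omega)
        (h₂ := by omega), comp_add, comp_units_smul, add_v, units_smul_v,
      comp_postcomp (ab := ab - 1) (h₁ := by omega) (h₃ := by omega),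
      postcomp_v (n' := ab - (u.length + 1)) (hn' := by omega) (h₁ := by omega),
      Cochain.add_comp, Cochain.units_smul_comp, ih (bc := bc - 1) (h₂ := by omega) (h₄ := by omega), smul_add,
      smul_smul, ← Int.negOnePow_add, h₁, Cochain.comp_assoc _ _ _ _ h₂ (by omega),
      add_assoc]

/-- The differential `q ↦ d q - (-1) ^ |q| q d` of each member of a family. -/
def delta {i j : ℤ} (h : i + 1 = j) (q : WordCochain L K K₁ i) : WordCochain L K K₁ j :=
  .mk fun u n hn => δ (n - 1) n (q.v u (n - 1) (by omega))

lemma delta_v {i j : ℤ} (h : i + 1 = j) (q : WordCochain L K K₁ i) (u : List L) (n n' : ℤ)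
    (hn hn') (hnn : n' + 1 = n) : (q.delta h).v u n hn = δ n' n (q.v u n' hn') := by
  obtain rfl : n' = n - 1 := by omega
  rfl

lemma delta_delta {i j l : ℤ} (h : i + 1 = j) (h' : j + 1 = l) (q : WordCochain L K K₁ i) :
    (q.delta h).delta h' = 0 := by
  ext1 u n hn
  rw [delta_v (n' := n - 1) (hn' := by omega) (hnn := by omega),
    delta_v (n' := n - 1 - 1) (hn' := by omega) (hnn := by omega), δ_δ, zero_v]

lemma delta_shift {i j i' j' : ℤ} (h : i + 1 = j) (hi : i' + 1 = i) (hj : j' + 1 = j)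
    (h' : i' + 1 = j') (q : WordCochain L K K₁ i) (x : L) :
    (q.delta h).shift hj x = (q.shift hi x).delta h' := rfl

lemma delta_comp {a b c a' b' c' : ℤ} (f : WordCochain L K K₁ a) (g : WordCochain L K₁ K₂ b)
    (h : a + b = c) (ha : a + 1 = a') (hb : b + 1 = b') (hc : c + 1 = c') (h₁ : a + b' = c')
    (h₂ : a' + b = c') : (f.comp g h).delta hc = f.comp (g.delta hb) h₁ +
      b.negOnePow • (f.delta ha).comp g h₂ := by
  ext1 u n hn
  simp only [delta_v hc _ u n (n - 1) hn (by omega) (by omega), add_v, units_smul_v, comp, mk_v,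
    Finset.smul_sum, ← Finset.sum_add_distrib]
  have : ∀ (s : Finset ℕ) (F : ℕ → Cochain K K₂ (n - 1)),
      δ (n - 1) n (∑ j ∈ s, F j) = ∑ j ∈ s, δ (n - 1) n (F j) := fun s F =>
    map_sum (δ_hom ℤ K K₂ (n - 1) n) F s
  rw [this]
  refine Finset.sum_congr rfl fun j hj => ?_
  have hj' : (u.take j).length = j := by
    rw [List.length_take]
    have := Finset.mem_range.1 hj
    omega
  have h3 := congrArg List.length (List.take_append_drop j u)
  rw [List.length_append] at h3
  rw [δ_units_smul, compTerm_eq (n₁ := a - ((u.drop j).length : ℤ))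
    (n₂ := b - ((u.take j).length : ℤ)) (h₁ := by omega) (h₂ := by omega) (h₁₂ := by omega),
    compTerm_eq (n₁ := a - ((u.drop j).length : ℤ))
    (n₂ := b' - ((u.take j).length : ℤ)) (h₁ := by omega) (h₂ := by omega) (h₁₂ := by omega),
    compTerm_eq (n₁ := a' - ((u.drop j).length : ℤ))
    (n₂ := b - ((u.take j).length : ℤ)) (h₁ := by omega) (h₂ := by omega) (h₁₂ := by omega),
    delta_v (n' := b - ((u.take j).length : ℤ)) (hn' := by omega) (hnn := by omega),
    delta_v (n' := a - ((u.drop j).length : ℤ)) (hn' := by omega) (hnn := by omega),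
    δ_comp (m₁ := a' - ((u.drop j).length : ℤ)) (m₂ := b' - ((u.take j).length : ℤ))
      (h₁₂ := by omega) (h₁ := by omega) (h₂ := by omega), smul_add, smul_smul, smul_smul]
  congr 2
  rw [← Int.negOnePow_add, ← Int.negOnePow_add, Int.negOnePow_eq_iff, hj', ← ha]
  exact ⟨-j, by ring⟩

section

variable [Mul L] {i j : ℤ} (h : i + 1 = j) (q q' : WordCochain L K K₁ i)

/-- The family `q (x u₁, u₂, … ; -)`. -/
def mulFirst (x : L) : WordCochain L K K₁ i := .mk fun u n hn =>
  match u, hn with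
  | [], _ => 0
  | y :: u, hn => q.v ((x * y) :: u) n hn

lemma hochschild_add : (q + q').hochschild h = q.hochschild h + q'.hochschild h := by
  ext1 u
  induction u generalizing i j with
  | nil => intro n hn; simp [hochschild_nil]
  | cons x u ih =>
    intro n hn
    cases u with
    | nil => simp [hochschild_single]
    | cons y u =>
      have hn' : n + (u.length + 1 + 1) = j := by simpa using hn
      have e := ih (i := i - 1) (j := i) (by omega) (q.shift (by omega) x)
        (q'.shift (by omega) x) n (by rw [List.length_cons]; omega)
      rw [add_v] at e ⊢
      simp only [hochschild_cons_cons h (sub_add_cancel i 1) _ x y u n hn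
        (by rw [List.length_cons]; omega) (by rw [List.length_cons]; omega), add_v]
      rw [show (q + q').shift (sub_add_cancel i 1) x = q.shift (sub_add_cancel i 1) x +
        q'.shift (sub_add_cancel i 1) x from rfl, e]
      abel

lemma hochschild_smul (t : k) : (t • q).hochschild h = t • q.hochschild h := by
  ext1 u
  induction u generalizing i j with
  | nil => intro n hn; simp [hochschild_nil]
  | cons x u ih =>
    intro n hn
    cases u with
    | nil => simp [hochschild_single]
    | cons y u =>
      have hn' : n + (u.length + 1 + 1) = j := by simpa using hn
      have e := ih (i := i - 1) (j := i) (by omega) (q.shift (by omega) x) n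
        (by rw [List.length_cons]; omega)
      rw [smul_v] at e ⊢
      simp only [hochschild_cons_cons h (sub_add_cancel i 1) _ x y u n hn
        (by rw [List.length_cons]; omega) (by rw [List.length_cons]; omega), smul_v]
      rw [show (t • q).shift (sub_add_cancel i 1) x = t • q.shift (sub_add_cancel i 1) x from rfl,
        e, smul_sub]

lemma hochschild_zero : (0 : WordCochain L K K₁ i).hochschild h = 0 := by
  have := hochschild_add h (0 : WordCochain L K K₁ i) 0
  rwa [add_zero, left_eq_add] at this

lemma hochschild_neg : (-q).hochschild h = -q.hochschild h := by
  rw [eq_neg_iff_add_eq_zero, ← hochschild_add, neg_add_cancel, hochschild_zero]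

lemma hochschild_sub : (q - q').hochschild h = q.hochschild h - q'.hochschild h := by
  rw [sub_eq_add_neg, hochschild_add, hochschild_neg, sub_eq_add_neg]

lemma hochschild_units_smul (t : ℤˣ) : (t • q).hochschild h = t • q.hochschild h := by
  rcases Int.units_eq_one_or t with rfl | rfl
  · simp
  · simp [hochschild_neg]

lemma shift_hochschild {l : ℤ} (hl : l + 1 = i) (x : L) : (q.hochschild h).shift h x =
    q.mulFirst x - (q.shift hl x).hochschild hl := by
  ext1 u n hn
  cases u with
  | nil => simp [shift, hochschild_nil, hochschild_single, mulFirst]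
  | cons y u =>
    have hn' : n + (u.length + 1) = i := by simpa using hn
    exact hochschild_cons_cons h hl q x y u n (by simp only [List.length_cons]; omega) hn hn

lemma shift_mulFirst {l : ℤ} (hl : l + 1 = i) (x y : L) :
    (q.mulFirst x).shift hl y = q.shift hl (x * y) := rfl

lemma delta_hochschild {l : ℤ} (h' : j + 1 = l) :
    (q.hochschild h).delta h' = (q.delta h).hochschild h' := by
  ext1 u
  induction u generalizing i j l with
  | nil =>
    intro n hn
    rw [delta_v h' _ [] n (n - 1) hn (by omega) (by omega)]
    simp [hochschild_nil]
  | cons x u ih =>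
    intro n hn
    cases u with
    | nil =>
      rw [delta_v h' _ [x] n (n - 1) hn (by simp at hn ⊢; omega) (by omega)]
      simp [hochschild_single]
    | cons y u =>
      have hn' : n + (u.length + 1 + 1) = l := by simpa using hn
      have e := ih (i := i - 1) (j := i) (l := j) (by omega) (q.shift (by omega) x) (by omega) n
        (by rw [List.length_cons]; omega)
      rw [delta_v h' _ _ n (n - 1) hn (by simp only [List.length_cons]; omega) (by omega),
        hochschild_cons_cons h (sub_add_cancel i 1) _ x y u _ _
        (by rw [List.length_cons]; omega) (by rw [List.length_cons]; omega), δ_sub,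
        hochschild_cons_cons h' h _ x y u _ _
        (by rw [List.length_cons]; omega) (by rw [List.length_cons]; omega),
        delta_shift h (sub_add_cancel i 1) h (sub_add_cancel i 1), ← e,
        delta_v h _ _ n (n - 1) _ (by rw [List.length_cons]; omega) (by omega),
        delta_v h _ _ n (n - 1) _ (by rw [List.length_cons]; omega) (by omega)]

end

lemma hochschild_hochschild [Semigroup L] {i j l : ℤ} (h : i + 1 = j) (h' : j + 1 = l)
    (q : WordCochain L K K₁ i) : (q.hochschild h).hochschild h' = 0 := by
  ext1 u
  induction u generalizing i j l with
  | nil => intro n hn; rfl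
  | cons x u ih =>
    intro n hn
    match u with
    | [] => rfl
    | [y] =>
      have hn' : n + 2 = l := by simpa using hn
      rw [hochschild_cons_cons h' h _ x y [] n hn (by simp; omega) (by simp; omega)]
      simp [hochschild_single]
    | y :: z :: u =>
      have hn' : n + (u.length + 1 + 1 + 1) = l := by simpa using hn
      have e := ih (i := i - 1) (j := i) (l := j) (by omega) (by omega)
        (q.shift (by omega) x) n (by simp only [List.length_cons]; omega)
      rw [hochschild_cons_cons h' h _ x y _ n hn (by simp only [List.length_cons]; omega)
        (by simp only [List.length_cons]; omega),
        shift_hochschild h q (sub_add_cancel i 1), hochschild_sub, sub_v, e,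
        hochschild_cons_cons h (sub_add_cancel i 1) _ (x * y) z u n _
          (by simp only [List.length_cons]; omega) (by simp only [List.length_cons]; omega),
        hochschild_cons_cons h (sub_add_cancel i 1) _ y z u n _
          (by simp only [List.length_cons]; omega) (by simp only [List.length_cons]; omega),
        shift_mulFirst]
      simp only [mulFirst, mk_v, zero_v, sub_zero, sub_sub_sub_cancel_right, sub_eq_zero]
      congr 2
      exact mul_assoc x y z

lemma hochschild_postcomp [Mul L] {a b c a' c' : ℤ} (q : WordCochain L K K₁ a)
    (z : Cochain K₁ K₂ b) (h : a + b = c) (ha : a + 1 = a') (hc : c + 1 = c') (h' : a' + b = c') :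
    (q.postcomp z h).hochschild hc = (q.hochschild ha).postcomp z h' := by
  ext1 u
  induction u generalizing a c a' c' with
  | nil =>
    intro n hn
    rw [postcomp_v (n' := n - b) (hn' := by omega) (h₁ := by omega)]
    simp [hochschild_nil]
  | cons x u ih =>
    intro n hn
    cases u with
    | nil =>
      rw [postcomp_v (n' := n - b) (hn' := by simp at hn ⊢; omega) (h₁ := by omega)]
      simp [hochschild_single]
    | cons y u =>
      have hn' : n + (u.length + 1 + 1) = c' := by simpa using hn
      have e := ih (a := a - 1) (c := c - 1) (a' := a) (c' := c) (q.shift (by omega) x)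
        (by omega) (by omega) (by omega) (by omega) n (by rw [List.length_cons]; omega)
      rw [postcomp_v (n' := n - b) (hn' := by simp only [List.length_cons]; omega)
          (h₁ := by omega),
        hochschild_cons_cons hc (sub_add_cancel c 1) _ x y u _ _
          (by rw [List.length_cons]; omega) (by rw [List.length_cons]; omega),
        hochschild_cons_cons ha (sub_add_cancel a 1) _ x y u _ _
          (by rw [List.length_cons]; omega) (by rw [List.length_cons]; omega),
        Cochain.sub_comp,
        postcomp_v (n' := n - b) (hn' := by simp only [List.length_cons]; omega)
          (h₁ := by omega)]
      congr 1

lemma hochschild_comp [Mul L] {a b c a' b' c' : ℤ} (f : WordCochain L K K₁ a)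
    (g : WordCochain L K₁ K₂ b) (h : a + b = c) (ha : a + 1 = a') (hb : b + 1 = b')
    (hc : c + 1 = c') (h₁ : a + b' = c') (h₂ : a' + b = c') :
    (f.comp g h).hochschild hc = a.negOnePow • f.comp (g.hochschild hb) h₁ +
      (f.hochschild ha).comp g h₂ := by
  ext1 u
  induction u generalizing b c b' c' with
  | nil =>
    intro n hn
    have hn' : n = c' := by simpa using hn
    rw [hochschild_nil, add_v, units_smul_v, comp_nil (n₁ := a) (n₂ := b') (h₁ := by simp)
      (h₂ := by simp) (h₁₂ := by omega), comp_nil (n₁ := a') (n₂ := b) (h₁ := by simp)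
      (h₂ := by simp) (h₁₂ := by omega)]
    simp [hochschild_nil]
  | cons x u ih =>
    intro n hn
    have hn' : n + (u.length + 1) = c' := by simpa using hn
    rw [add_v, units_smul_v,
      comp_cons f (g.hochschild hb) (n₁ := n - b') (n₂ := b') (b' := b) (c' := c) (h₁ := by simp; omega)
        (h₂ := by simp) (h₁₂ := by omega) (hb := by omega) (hc := by omega) (hn' := by omega),
      comp_cons (f.hochschild ha) g (n₁ := n - b) (n₂ := b) (b' := b - 1) (c' := c) (h₁ := by simp; omega)
        (h₂ := by simp) (h₁₂ := by omega) (hb := by omega) (hc := by omega) (hn' := by omega),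
      hochschild_nil, Cochain.comp_zero, zero_add, smul_smul, Int.units_mul_self, one_smul,
      shift_hochschild hb g (sub_add_cancel b 1), comp_sub, sub_v]
    cases u with
    | nil =>
      rw [comp_nil (n₁ := a) (n₂ := b) (h₁ := by simp) (h₂ := by simp) (h₁₂ := by simp at hn'; omega),
        comp_nil (n₁ := a) (n₂ := b) (h₁ := by simp) (h₂ := by simp) (h₁₂ := by simp at hn'; omega),
        comp_nil (n₁ := a') (n₂ := b - 1) (h₁ := by simp) (h₂ := by simp)
          (h₁₂ := by simp at hn'; omega)]
      simp [hochschild_nil, hochschild_single, mulFirst]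
    | cons y u =>
      rw [List.length_cons] at hn'
      push_cast at hn'
      have e := ih (g.shift (sub_add_cancel b 1) x) (c := c - 1) (b' := b) (c' := c)
        (by omega) (by omega) (by omega) (by omega) (by omega) n
        (by rw [List.length_cons]; omega)
      rw [add_v, units_smul_v] at e
      rw [hochschild_cons_cons hc (sub_add_cancel c 1) _ x y u n _
        (by rw [List.length_cons]; omega) (by rw [List.length_cons]; omega),
        hochschild_cons_cons ha (sub_add_cancel a 1) _ x y u _ _
        (by rw [List.length_cons]; omega) (by rw [List.length_cons]; omega),
        shift_comp (a' := a - 1) (b' := b - 1) (ha := by omega) (hb := by omega) (h₁ := by omega)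
          (h₂ := by omega), hochschild_add, add_v, hochschild_units_smul, units_smul_v, e,
        hochschild_postcomp (ha := sub_add_cancel a 1) (h' := h),
        postcomp_v (n' := n - b) (hn' := by simp only [List.length_cons]; omega)
          (h₁ := by omega),
        comp_cons f g (n₁ := n - b) (n₂ := b) (b' := b - 1) (c' := c - 1)
          (h₁ := by simp only [List.length_cons]; omega)
          (h₂ := by simp) (h₁₂ := by omega) (hb := by omega) (hc := by omega) (hn' := by omega),
        comp_cons f (g.mulFirst x) (n₁ := n - b) (n₂ := b) (b' := b - 1) (c' := c - 1)
          (h₁ := by simp only [List.length_cons]; omega)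
          (h₂ := by simp) (h₁₂ := by omega) (hb := by omega) (hc := by omega) (hn' := by omega),
        shift_mulFirst, Cochain.sub_comp,
        show a'.negOnePow = -a.negOnePow by rw [← ha, Int.negOnePow_succ]]
      simp only [smul_add, smul_smul, Int.units_mul_self, one_smul, Units.neg_smul]
      rw [show (g.mulFirst x).v [] b (by simp) = 0 from rfl, Cochain.comp_zero]
      abel

/-- The differential `d_Q` of families of cochains: `d_Q q = d q - (-1) ^ |q| q d`, where the
differential of `T L ⊗ E` is `δ (u) ⊗ e + (-1) ^ k u ⊗ d e` for a word `u` of length `k`. -/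
def dQ [Mul L] {i j : ℤ} (h : i + 1 = j) (q : WordCochain L K K₁ i) : WordCochain L K K₁ j :=
  q.delta h - i.negOnePow • q.hochschild h

lemma dQ_dQ [Semigroup L] {i j l : ℤ} (h : i + 1 = j) (h' : j + 1 = l)
    (q : WordCochain L K K₁ i) : (q.dQ h).dQ h' = 0 := by
  have hsub : ∀ (p p' : WordCochain L K K₁ j), (p - p').delta h' = p.delta h' - p'.delta h' := by
    intro p p'; ext1 u n hn; simp [delta]
  have hsm : ∀ (t : ℤˣ) (p : WordCochain L K K₁ j), (t • p).delta h' = t • p.delta h' := by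
    intro t p; ext1 u n hn; simp [delta]
  rw [dQ, dQ, hsub, hsm, hochschild_sub, hochschild_units_smul, delta_delta,
    hochschild_hochschild, delta_hochschild h q h',
    show j.negOnePow = -i.negOnePow by rw [← h, Int.negOnePow_succ]]
  simp

lemma dQ_comp [Mul L] {a b c a' b' c' : ℤ} (f : WordCochain L K K₁ a)
    (g : WordCochain L K₁ K₂ b) (h : a + b = c) (ha : a + 1 = a') (hb : b + 1 = b')
    (hc : c + 1 = c') (h₁ : a + b' = c') (h₂ : a' + b = c') :
    (f.comp g h).dQ hc = f.comp (g.dQ hb) h₁ + b.negOnePow • (f.dQ ha).comp g h₂ := by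
  rw [dQ, dQ, dQ, delta_comp f g h ha hb hc h₁ h₂, hochschild_comp f g h ha hb hc h₁ h₂, comp_sub,
    sub_comp, comp_units_smul, units_smul_comp, ← h, Int.negOnePow_add]
  simp only [smul_add, smul_sub, smul_smul, mul_comm a.negOnePow b.negOnePow, mul_assoc,
    Int.units_mul_self, mul_one]
  abel

/-- A cochain, seen as a family concentrated on the empty word. -/
def ofCochain {i : ℤ} (z : Cochain K K₁ i) : WordCochain L K K₁ i := .mk fun u n hn =>
  match u, hn with
  | [], hn => Cochain.mk fun p q hpq => z.v p q (by simp at hn; omega)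
  | _ :: _, _ => 0

lemma ofCochain_nil {i : ℤ} (z : Cochain K K₁ i) (hn) :
    (ofCochain (L := L) z).v [] i hn = z := rfl

lemma ofCochain_cons {i : ℤ} (z : Cochain K K₁ i) (x : L) (u : List L) (n : ℤ) (hn) :
    (ofCochain z).v (x :: u) n hn = 0 := rfl

lemma comp_ofCochain {a b c : ℤ} (f : WordCochain L K K₁ a) (z : Cochain K₁ K₂ b)
    (h : a + b = c) : f.comp (ofCochain z) h = f.postcomp z h := by
  ext1 u n hn
  rw [postcomp_v (n' := n - b) (hn' := by omega) (h₁ := by omega)]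
  cases u with
  | nil =>
    rw [comp_nil (n₁ := n - b) (n₂ := b) (h₁ := by omega) (h₂ := by simp) (h₁₂ := by omega),
      ofCochain_nil]
  | cons x u =>
    have hn' : n + (u.length + 1) = c := by simpa using hn
    rw [comp_cons (n₁ := n - b) (n₂ := b) (b' := b - 1) (c' := c - 1) (h₁ := by omega)
      (h₂ := by simp) (h₁₂ := by omega) (hb := by omega) (hc := by omega) (hn' := by omega),
      ofCochain_nil, show (ofCochain z).shift (sub_add_cancel b 1) x = 0 from rfl]
    simp [comp, compTerm]

lemma ofCochain_comp_v {a b c : ℤ} (z : Cochain K K₁ a) (f : WordCochain L K₁ K₂ b)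
    (h : a + b = c) (u : List L) (n n' : ℤ) (hn hn') (h₁ : a + n' = n) :
    ((ofCochain z).comp f h).v u n hn = (a * u.length).negOnePow • z.comp (f.v u n' hn') h₁ := by
  induction u generalizing b c with
  | nil =>
    rw [comp_nil (n₁ := a) (n₂ := n') (h₁ := by simp) (h₂ := hn') (h₁₂ := h₁), ofCochain_nil]
    simp
  | cons x u ih =>
    have hn'' : n + (u.length + 1) = c := by simpa using hn
    have e := ih (f.shift (sub_add_cancel b 1) x) (c := c - 1) (by omega) (by omega) (by omega)
    rw [comp_cons (n₁ := n - b) (n₂ := b) (b' := b - 1) (c' := c - 1)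
      (h₁ := by simp only [List.length_cons]; omega)
      (h₂ := by simp) (h₁₂ := by omega) (hb := by omega) (hc := by omega) (hn' := by omega),
      ofCochain_cons, Cochain.zero_comp, zero_add, e, smul_smul, ← Int.negOnePow_add]
    congr 2
    simp only [List.length_cons]; push_cast; ring

/-- The unit of the product. -/
def one (K : CochainComplex C ℤ) : WordCochain L K K 0 := ofCochain (Cochain.ofHom (𝟙 K))

lemma one_comp {i : ℤ} (f : WordCochain L K K₁ i) : (one K).comp f (zero_add i) = f := by
  ext1 u n hn
  rw [one, ofCochain_comp_v (n' := n) (hn' := hn) (h₁ := zero_add n)]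
  simp

lemma comp_one {i : ℤ} (f : WordCochain L K K₁ i) : f.comp (one K₁) (add_zero i) = f := by
  ext1 u n hn
  rw [one, comp_ofCochain, postcomp_v (n' := n) (hn' := hn) (h₁ := add_zero n)]
  simp

end WordCochain
end Words

namespace WordCochain

section Balanced

variable {C : Type*} [Category* C] [Preadditive C] {A L : Type*} [Ring L]
  {K K₁ K₂ : CochainComplex C ℤ} (ι : A → L) (m : A → (K ⟶ K)) (m₁ : A → (K₁ ⟶ K₁))
  (m₂ : A → (K₂ ⟶ K₂))

/-- Additivity in each letter, and compatibility with the right actions of `A` on the letters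
(`m` is the action of `A` on `K`). -/
structure IsRightBalanced {i : ℤ} (q : WordCochain L K K₁ i) : Prop where
  add : ∀ (l r : List L) (x y : L) (n : ℤ) (h h' h''),
    q.v (l ++ (x + y) :: r) n h = q.v (l ++ x :: r) n h' + q.v (l ++ y :: r) n h''
  inner : ∀ (l r : List L) (x y : L) (a : A) (n : ℤ) (h h'),
    q.v (l ++ (x * ι a) :: y :: r) n h = q.v (l ++ x :: (ι a * y) :: r) n h'
  last : ∀ (l : List L) (x : L) (a : A) (n : ℤ) (h h'),
    q.v (l ++ [x * ι a]) n h = (Cochain.ofHom (m a)).comp (q.v (l ++ [x]) n h') (zero_add n)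

/-- The families that define `A`-linear maps `T L ⊗ K → K₁`, that is, multilinear functions
`q (u₁, …, u_k ; e)` with `q (a u₁, … ; e) = a q (u₁, … ; e)`,
`q (…, u_i a, u_{i+1}, … ; e) = q (…, u_i, a u_{i+1}, … ; e)` and
`q (…, u_k a ; e) = q (…, u_k ; a e)`; here `m` and `m₁` are the actions of `A` on `K` and `K₁`. -/
structure IsBalanced {i : ℤ} (q : WordCochain L K K₁ i) : Prop
    extends IsRightBalanced ι m q where
  first : ∀ (r : List L) (x : L) (a : A) (n : ℤ) (h h'),
    q.v ((ι a * x) :: r) n h = (q.v (x :: r) n h').comp (Cochain.ofHom (m₁ a)) (add_zero n)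
  nil : ∀ (a : A) (n : ℤ) (h),
    (q.v [] n h).comp (Cochain.ofHom (m₁ a)) (add_zero n) =
      (Cochain.ofHom (m a)).comp (q.v [] n h) (zero_add n)

variable {ι m m₁ m₂}

lemma IsRightBalanced.shift {i j : ℤ} {q : WordCochain L K K₁ j} (hq : IsRightBalanced ι m q)
    (h : i + 1 = j) (x : L) : IsRightBalanced ι m (q.shift h x) where
  add l r y z n _ _ _ := hq.add (x :: l) r y z n _ _ _
  inner l r y z a n _ _ := hq.inner (x :: l) r y z a n _ _
  last l y a n _ _ := hq.last (x :: l) y a n _ _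

lemma IsBalanced.zero {i : ℤ} : IsBalanced ι m m₁ (0 : WordCochain L K K₁ i) where
  add := by simp
  inner := by simp
  last := by simp
  first := by simp
  nil := by simp

lemma IsBalanced.addm {i : ℤ} {q q' : WordCochain L K K₁ i} (hq : IsBalanced ι m m₁ q)
    (hq' : IsBalanced ι m m₁ q') : IsBalanced ι m m₁ (q + q') where
  add l r x y n h h' h'' := by
    simp only [add_v, hq.add l r x y n h h' h'', hq'.add l r x y n h h' h'']; abel
  inner l r x y a n h h' := by
    simp only [add_v, hq.inner l r x y a n h h', hq'.inner l r x y a n h h']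
  last l x a n h h' := by
    simp only [add_v, hq.last l x a n h h', hq'.last l x a n h h', Cochain.comp_add]
  first r x a n h h' := by
    simp only [add_v, hq.first r x a n h h', hq'.first r x a n h h', Cochain.add_comp]
  nil a n h := by
    simp only [add_v, Cochain.add_comp, Cochain.comp_add, hq.nil a n h, hq'.nil a n h]

lemma IsBalanced.smul {k : Type*} [CommRing k] [Linear k C] {i : ℤ} {q : WordCochain L K K₁ i}
    (hq : IsBalanced ι m m₁ q) (t : k) : IsBalanced ι m m₁ (t • q) where
  add l r x y n h h' h'' := by
    simp only [smul_v, hq.add l r x y n h h' h'', smul_add]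
  inner l r x y a n h h' := by
    simp only [smul_v, hq.inner l r x y a n h h']
  last l x a n h h' := by
    simp only [smul_v, hq.last l x a n h h', Cochain.comp_smul]
  first r x a n h h' := by
    simp only [smul_v, hq.first r x a n h h', Cochain.smul_comp]
  nil a n h := by
    simp only [smul_v, Cochain.smul_comp, Cochain.comp_smul, hq.nil a n h]

lemma IsBalanced.neg {i : ℤ} {q : WordCochain L K K₁ i}
    (hq : IsBalanced ι m m₁ q) : IsBalanced ι m m₁ (-q) where
  add l r x y n h h' h'' := by
    simp only [neg_v, hq.add l r x y n h h' h'', neg_add]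
  inner l r x y a n h h' := by
    simp only [neg_v, hq.inner l r x y a n h h']
  last l x a n h h' := by
    simp only [neg_v, hq.last l x a n h h', Cochain.comp_neg]
  first r x a n h h' := by
    simp only [neg_v, hq.first r x a n h h', Cochain.neg_comp]
  nil a n h := by
    simp only [neg_v, Cochain.neg_comp, Cochain.comp_neg, hq.nil a n h]

lemma IsBalanced.units_smul {i : ℤ} {q : WordCochain L K K₁ i}
    (hq : IsBalanced ι m m₁ q) (t : ℤˣ) : IsBalanced ι m m₁ (t • q) := by
  rcases Int.units_eq_one_or t with rfl | rfl
  · simpa using hq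
  · simpa using hq.neg

lemma IsBalanced.delta {i j : ℤ} {q : WordCochain L K K₁ i}
    (hq : IsBalanced ι m m₁ q) (h : i + 1 = j) : IsBalanced ι m m₁ (q.delta h) where
  add l r x y n h h' h'' := by
    simp only [WordCochain.delta, mk_v, hq.add l r x y (n - 1) (by omega) (by omega) (by omega),
      δ_add]
  inner l r x y a n h h' := by
    simp only [WordCochain.delta, mk_v, hq.inner l r x y a (n - 1) (by omega) (by omega)]
  last l x a n h h' := by
    simp only [WordCochain.delta, mk_v, hq.last l x a (n - 1) (by omega) (by omega), δ_ofHom_comp]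
  first r x a n h h' := by
    simp only [WordCochain.delta, mk_v, hq.first r x a (n - 1) (by omega) (by omega), δ_comp_ofHom]
  nil a n h := by
    simp only [WordCochain.delta, mk_v]
    rw [← δ_comp_ofHom, ← δ_ofHom_comp, hq.nil a (n - 1) (by omega)]

lemma hcc {i j : ℤ} (h : i + 1 = j) (q : WordCochain L K K₁ i) (x y : L) (u : List L) (n : ℤ)
    (hn) : (q.hochschild h).v (x :: y :: u) n hn =
      q.v ((x * y) :: u) n (by simp only [List.length_cons] at hn ⊢; omega) -
        ((q.shift (sub_add_cancel i 1) x).hochschild (sub_add_cancel i 1)).v (y :: u) n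
          (by simp only [List.length_cons] at hn ⊢; omega) :=
  hochschild_cons_cons h (sub_add_cancel i 1) q x y u n hn _ _

lemma v_congr {i : ℤ} (q : WordCochain L K K₁ i) {u u' : List L} (h : u = u') (n : ℤ) (hn) :
    q.v u n hn = q.v u' n (h ▸ hn) := by
  subst h; rfl

lemma IsRightBalanced.hochschild {i j : ℤ} {q : WordCochain L K K₁ i}
    (hq : IsRightBalanced ι m q) (h : i + 1 = j) : IsRightBalanced ι m (q.hochschild h) := by
  have hadd1 : ∀ {i j : ℤ} {q : WordCochain L K K₁ i}, IsRightBalanced ι m q → ∀ (h : i + 1 = j)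
      (x y : L) (r : List L) (n : ℤ) (h' h'' h'''), (q.hochschild h).v ((x + y) :: r) n h' =
        (q.hochschild h).v (x :: r) n h'' + (q.hochschild h).v (y :: r) n h''' := by
    intro i j q hq h x y r n h' _ _
    cases r with
    | nil => simp [hochschild_single]
    | cons z r =>
      simp only [List.length_cons] at h'
      have e : q.shift (sub_add_cancel i 1) (x + y) = q.shift (sub_add_cancel i 1) x +
          q.shift (sub_add_cancel i 1) y := by
        ext1 u n hn
        exact hq.add [] u x y n _ _ _
      have e' := hq.add [] r (x * z) (y * z) n (by simp; omega) (by simp; omega) (by simp; omega)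
      simp only [List.nil_append] at e'
      rw [hcc, hcc, hcc, e, hochschild_add, add_v, q.v_congr (congrArg (· :: r) (add_mul x y z)),
        e']
      abel
  have hinner1 : ∀ {i j : ℤ} {q : WordCochain L K K₁ i}, IsRightBalanced ι m q → ∀ (h : i + 1 = j)
      (x y : L) (a : A) (r : List L) (n : ℤ) (h' h''), (q.hochschild h).v ((x * ι a) :: y :: r) n h' =
        (q.hochschild h).v (x :: (ι a * y) :: r) n h'' := by
    intro i j q hq h x y a r n h' _
    simp only [List.length_cons] at h'
    rw [hcc, hcc, q.v_congr (congrArg (· :: r) (mul_assoc x (ι a) y))]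
    congr 1
    cases r with
    | nil => simp [hochschild_single]
    | cons z r =>
      simp only [List.length_cons] at h'
      have e : (q.shift (sub_add_cancel i 1) (x * ι a)).shift (sub_add_cancel (i - 1) 1) y =
          (q.shift (sub_add_cancel i 1) x).shift (sub_add_cancel (i - 1) 1) (ι a * y) := by
        ext1 u n hn
        exact hq.inner [] u x y a n _ _
      rw [hcc, hcc, e, (q.shift _ x).v_congr (congrArg (· :: r) (mul_assoc (ι a) y z))]
      congr 1
      exact hq.inner [] r x (y * z) a n _ _
  refine ⟨fun l => ?_, fun l => ?_, fun l => ?_⟩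
  · induction l generalizing i j with
    | nil => exact fun r x y n h' h'' h''' => hadd1 hq h x y r n h' h'' h'''
    | cons z l ih =>
      intro r x y n h' h'' h'''
      simp only [List.length_cons, List.cons_append, List.length_append] at h' h'' h'''
      have e := ih (hq.shift (sub_add_cancel i 1) z) (sub_add_cancel i 1) r x y n
          (by simp; omega) (by simp; omega) (by simp; omega)
      cases l with
      | nil =>
        have e' := hq.add [] r (z * x) (z * y) n (by simp at h' ⊢; omega) (by simp at h' ⊢; omega)
          (by simp at h' ⊢; omega)
        simp only [List.cons_append, List.nil_append] at e e' ⊢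
        rw [hcc, hcc, hcc, e, q.v_congr (congrArg (· :: r) (mul_add z x y)), e']
        abel
      | cons w l =>
        have e' := hq.add ((z * w) :: l) r x y n (by simp at h' ⊢; omega) (by simp at h' ⊢; omega)
          (by simp at h' ⊢; omega)
        simp only [List.cons_append] at e e' ⊢
        rw [hcc, hcc, hcc, e, e']
        abel
  · induction l generalizing i j with
    | nil => exact fun r x y a n h' h'' => hinner1 hq h x y a r n h' h''
    | cons z l ih =>
      intro r x y a n h' h''
      simp only [List.length_cons, List.cons_append, List.length_append] at h' h''
      have e := ih (hq.shift (sub_add_cancel i 1) z) (sub_add_cancel i 1) r x y a n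
          (by simp; omega) (by simp; omega)
      cases l with
      | nil =>
        have e' := hq.inner [] r (z * x) y a n (by simp at h' ⊢; omega) (by simp at h' ⊢; omega)
        simp only [List.cons_append, List.nil_append] at e e' ⊢
        rw [hcc h q, hcc h q, e, q.v_congr (congrArg (· :: y :: r) (mul_assoc z x (ι a)).symm), e']
      | cons w l =>
        have e' := hq.inner ((z * w) :: l) r x y a n (by simp at h' ⊢; omega)
          (by simp at h' ⊢; omega)
        simp only [List.cons_append] at e e' ⊢
        rw [hcc, hcc, e, e']
  · induction l generalizing i j with
    | nil => intro x a n h' h''; simp [hochschild_single]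
    | cons z l ih =>
      intro x a n h' h''
      simp only [List.length_cons, List.cons_append, List.length_append, List.length_nil] at h' h''
      have e := ih (hq.shift (sub_add_cancel i 1) z) (sub_add_cancel i 1) x a n
          (by simp; omega) (by simp; omega)
      cases l with
      | nil =>
        have e' := hq.last [] (z * x) a n (by simp at h' ⊢; omega) (by simp at h' ⊢; omega)
        simp only [List.cons_append, List.nil_append] at e e' ⊢
        rw [hcc, hcc, e, q.v_congr (congrArg (· :: []) (mul_assoc z x (ι a)).symm), e',
          Cochain.comp_sub]
      | cons w l =>
        have e' := hq.last ((z * w) :: l) x a n (by simp at h' ⊢; omega)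
          (by simp at h' ⊢; omega)
        simp only [List.cons_append] at e e' ⊢
        rw [hcc, hcc, e, e', Cochain.comp_sub]

lemma IsBalanced.hochschild {i j : ℤ} {q : WordCochain L K K₁ i}
    (hq : IsBalanced ι m m₁ q) (h : i + 1 = j) : IsBalanced ι m m₁ (q.hochschild h) where
  __ := hq.toIsRightBalanced.hochschild h
  first r x a n h' h'' := by
    cases r with
    | nil => simp [hochschild_single]
    | cons y r =>
      simp only [List.length_cons] at h'
      have e' := hq.first r (x * y) a n (by simp at h' ⊢; omega) (by simp at h' ⊢; omega)
      have e : ((q.shift (sub_add_cancel i 1) (ι a * x)).hochschild (sub_add_cancel i 1)) =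
          ((q.shift (sub_add_cancel i 1) x).hochschild (sub_add_cancel i 1)).postcomp
            (Cochain.ofHom (m₁ a)) (add_zero i) := by
        rw [← hochschild_postcomp (h := add_zero (i - 1)) (hc := sub_add_cancel i 1)]
        congr 1
        ext1 u n hn
        rw [postcomp_v (n' := n) (hn' := by omega) (h₁ := add_zero n)]
        exact hq.first u x a n _ _
      rw [hcc, hcc, e, q.v_congr (congrArg (· :: r) (mul_assoc (ι a) x y)), e', Cochain.sub_comp,
        postcomp_v (n' := n) (h₁ := add_zero n)]
  nil a n h := by simp [hochschild_nil]

lemma IsBalanced.dQ {i j : ℤ} {q : WordCochain L K K₁ i}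
    (hq : IsBalanced ι m m₁ q) (h : i + 1 = j) : IsBalanced ι m m₁ (q.dQ h) := by
  rw [WordCochain.dQ, sub_eq_add_neg]
  exact (hq.delta h).addm ((hq.hochschild h).units_smul _).neg

lemma comp_cons' {a b c : ℤ} (f : WordCochain L K K₁ a) (g : WordCochain L K₁ K₂ b)
    (h : a + b = c) (x : L) (u : List L) (n : ℤ) (hn) :
    (f.comp g h).v (x :: u) n hn =
      (f.v (x :: u) (n - b) (by omega)).comp (g.v [] b (by simp)) (sub_add_cancel n b) +
      a.negOnePow • (f.comp (g.shift (sub_add_cancel b 1) x) (c := c - 1) (by omega)).v u n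
        (by simp only [List.length_cons] at hn; omega) :=
  comp_cons f g h x u n _ _ _ _ _ _ _ _ _

lemma comp_nil' {a b c : ℤ} (f : WordCochain L K K₁ a) (g : WordCochain L K₁ K₂ b)
    (h : a + b = c) (n : ℤ) (hn) :
    (f.comp g h).v [] n hn =
      (f.v [] (n - b) (by omega)).comp (g.v [] b (by simp)) (sub_add_cancel n b) :=
  comp_nil f g h n _ _ _ _ _ _

lemma IsRightBalanced.comp {a b c : ℤ} {f : WordCochain L K K₁ a} {g : WordCochain L K₁ K₂ b}
    (hf : IsBalanced ι m m₁ f) (hg : IsRightBalanced ι m₁ g) (h : a + b = c) :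
    IsRightBalanced ι m (f.comp g h) := by
  refine ⟨fun l => ?_, fun l => ?_, fun l => ?_⟩
  · induction l generalizing b c with
    | nil =>
      intro r x y n h' h'' h'''
      have e : g.shift (sub_add_cancel b 1) (x + y) = g.shift (sub_add_cancel b 1) x +
          g.shift (sub_add_cancel b 1) y := by
        ext1 u n hn
        exact hg.add [] u x y n _ _ _
      simp only [List.nil_append, List.length_cons] at h' h'' ⊢
      have e' := hf.add [] r x y (n - b) (by simp; omega) (by simp; omega) (by simp; omega)
      simp only [List.nil_append] at e'
      rw [comp_cons', comp_cons', comp_cons', e, e', comp_add, add_v, Cochain.add_comp, smul_add]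
      abel
    | cons z l ih =>
      intro r x y n h' h'' h'''
      simp only [List.length_cons, List.cons_append, List.length_append] at h' h'' h'''
      have e := ih (hg.shift (sub_add_cancel b 1) z) (c := c - 1) (by omega) r x y n
          (by simp; omega) (by simp; omega) (by simp; omega)
      have e' := hf.add (z :: l) r x y (n - b) (by simp; omega) (by simp; omega) (by simp; omega)
      simp only [List.cons_append] at e' ⊢
      rw [comp_cons', comp_cons', comp_cons', e, e', Cochain.add_comp, smul_add]
      abel
  · induction l generalizing b c with
    | nil =>
      intro r x y α n h' h''
      have e1 : (g.shift (sub_add_cancel b 1) (x * ι α)).v [] (b - 1) (by simp) =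
          (Cochain.ofHom (m₁ α)).comp ((g.shift (sub_add_cancel b 1) x).v [] (b - 1) (by simp))
            (zero_add _) := hg.last [] x α (b - 1) (by simp) (by simp)
      have e2 : ∀ y : L,
          (g.shift (sub_add_cancel b 1) (x * ι α)).shift (sub_add_cancel (b - 1) 1) y =
          (g.shift (sub_add_cancel b 1) x).shift (sub_add_cancel (b - 1) 1) (ι α * y) := by
        intro y
        ext1 u n hn
        exact hg.inner [] u x y α n _ _
      simp only [List.nil_append, List.length_cons] at h' h'' ⊢
      have e3 := hf.inner [] r x y α (n - b) (by simp; omega) (by simp; omega)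
      have e4 := hf.first r y α (n - (b - 1)) (by simp; omega) (by simp; omega)
      simp only [List.nil_append] at e3
      rw [comp_cons', comp_cons', e3, comp_cons', comp_cons', e1, e2, e4, Cochain.comp_assoc]
      omega
    | cons z l ih =>
      intro r x y α n h' h''
      simp only [List.length_cons, List.cons_append, List.length_append] at h' h''
      have e := ih (hg.shift (sub_add_cancel b 1) z) (c := c - 1) (by omega) r x y α n
          (by simp; omega) (by simp; omega)
      have e' := hf.inner (z :: l) r x y α (n - b) (by simp; omega) (by simp; omega)
      simp only [List.cons_append] at e' ⊢
      rw [comp_cons', comp_cons', e, e']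
  · induction l generalizing b c with
    | nil =>
      intro x α n h' h''
      have e1 : (g.shift (sub_add_cancel b 1) (x * ι α)).v [] (b - 1) (by simp) =
          (Cochain.ofHom (m₁ α)).comp ((g.shift (sub_add_cancel b 1) x).v [] (b - 1) (by simp))
            (zero_add _) := hg.last [] x α (b - 1) (by simp) (by simp)
      simp only [List.nil_append, List.length_cons] at h' h'' ⊢
      have e3 := hf.last [] x α (n - b) (by simp at h'; simp; omega) (by simp at h'; simp; omega)
      have e4 := hf.nil α (n - (b - 1)) (by simp at h' ⊢; omega)
      simp only [List.nil_append] at e3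
      rw [comp_cons', comp_cons', e3, comp_nil', comp_nil', e1, Cochain.comp_add,
        Cochain.comp_units_smul,
        ← Cochain.comp_assoc_of_second_is_zero_cochain, e4,
        Cochain.comp_assoc_of_first_is_zero_cochain,
        Cochain.comp_assoc_of_first_is_zero_cochain]
    | cons z l ih =>
      intro x α n h' h''
      simp only [List.length_cons, List.cons_append, List.length_append, List.length_nil] at h' h''
      have e := ih (hg.shift (sub_add_cancel b 1) z) (c := c - 1) (by omega) x α n
          (by simp; omega) (by simp; omega)
      have e' := hf.last (z :: l) x α (n - b) (by simp; omega) (by simp; omega)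
      simp only [List.cons_append] at e' ⊢
      rw [comp_cons', comp_cons', e, e', Cochain.comp_add,
        Cochain.comp_units_smul, Cochain.comp_assoc_of_first_is_zero_cochain]

lemma IsBalanced.comp {a b c : ℤ} {f : WordCochain L K K₁ a} {g : WordCochain L K₁ K₂ b}
    (hf : IsBalanced ι m m₁ f) (hg : IsBalanced ι m₁ m₂ g) (h : a + b = c) :
    IsBalanced ι m m₂ (f.comp g h) where
  __ := IsRightBalanced.comp hf hg.toIsRightBalanced h
  first r x α n h' h'' := by
    simp only [List.length_cons] at h' h''
    have e1 := hf.first r x α (n - b) (by simp; omega) (by simp; omega)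
    have e2 : g.shift (sub_add_cancel b 1) (ι α * x) = (g.shift (sub_add_cancel b 1) x).postcomp
        (Cochain.ofHom (m₂ α)) (add_zero _) := by
      ext1 u n hn
      rw [postcomp_v (n' := n) (hn' := by omega) (h₁ := add_zero n)]
      exact hg.first u x α n _ _
    have e3 := hg.nil α b (by simp)
    rw [comp_cons', comp_cons', e1, e2,
      comp_postcomp (ab := c - 1) (h₁ := by omega) (h₃ := add_zero _),
      postcomp_v (n' := n) (hn' := by omega) (h₁ := add_zero n), Cochain.add_comp,
      Cochain.units_smul_comp, Cochain.comp_assoc_of_second_is_zero_cochain, ← e3,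
      Cochain.comp_assoc_of_third_is_zero_cochain]
  nil α n h' := by
    have e1 := hf.nil α (n - b) (by simp at h' ⊢; omega)
    have e3 := hg.nil α b (by simp)
    rw [comp_nil', Cochain.comp_assoc_of_third_is_zero_cochain, e3,
      ← Cochain.comp_assoc_of_second_is_zero_cochain, e1,
      Cochain.comp_assoc_of_first_is_zero_cochain]

lemma IsBalanced.ofCochain {i : ℤ} {z : Cochain K K₁ i}
    (hz : ∀ a, z.comp (Cochain.ofHom (m₁ a)) (add_zero i) =
      (Cochain.ofHom (m a)).comp z (zero_add i)) :
    IsBalanced ι m m₁ (ofCochain (L := L) z) where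
  add l r x y n h h' h'' := by cases l <;> simp [ofCochain_cons]
  inner l r x y a n h h' := by cases l <;> simp [ofCochain_cons]
  last l x a n h h' := by cases l <;> simp [ofCochain_cons]
  first r x a n h h' := by simp [ofCochain_cons]
  nil a n h := by
    obtain rfl : n = i := by simpa using h
    exact hz a

end Balanced
end WordCochain

/-! ### The dg category of complexes of modules -/

section Complexes

variable (k : Type w) [Field k]

/-- The dg category of (unbounded) complexes of left `R`-modules, for a `k`-algebra `R`. -/
def dgCpx (R : Type u) [Ring R] [Algebra k R] : DGCat.{w, v, max u (v + 1)} k where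
  Obj := CochainComplex (ModuleCat.{v} R) ℤ
  Hom K K' n := Cochain K K' n
  d {K K'} n m _ := δ_hom k K K' n m
  id K := Cochain.ofHom (𝟙 K)
  comp h := LinearMap.mk₂ k (fun f g => f.comp g h) (by simp) (by simp) (by simp) (by simp)
  d_d n m p h h' f := δ_δ n m p f
  id_comp f := Cochain.id_comp f
  comp_id f := Cochain.comp_id f
  assoc h₁ h₂ h₃ h₄ f g h := Cochain.comp_assoc f g h h₁ h₂ (by omega)
  d_comp h ha hb hc h₁ h₂ f g := δ_comp f g h _ _ _ hc ha hb

end Complexes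

/-! ### Complexes with weak module structures -/

section Weak

variable {k : Type w} [Field k] {A L : Type u} [CommRing A] [Algebra k A] [Ring L] [Algebra k L]

/-- The complex of `k`-modules that underlies a complex of `A`-modules. -/
noncomputable abbrev toBase (k : Type w) [Field k] {A : Type u} [CommRing A] [Algebra k A]
    (E : CochainComplex (ModuleCat.{v} A) ℤ) : CochainComplex (ModuleCat.{v} k) ℤ :=
  ((ModuleCat.restrictScalars (algebraMap k A)).mapHomologicalComplex _).obj E

/-- Multiplication by `a` on a complex of `A`-modules. -/
noncomputable def mulHom (k : Type w) [Field k] {A : Type u} [CommRing A] [Algebra k A]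
    (E : CochainComplex (ModuleCat.{v} A) ℤ) (a : A) : toBase k E ⟶ toBase k E :=
  ((ModuleCat.restrictScalars (algebraMap k A)).mapHomologicalComplex _).map
    { f := fun i => ModuleCat.ofHom (LinearMap.lsmul A (E.X i) a)
      comm' := fun i j _ => by ext x; simp }

@[simp] lemma mulHom_f_apply (E : CochainComplex (ModuleCat.{v} A) ℤ) (a : A) (i : ℤ)
    (x : E.X i) : ((mulHom k E a).f i).hom x = a • x := rfl

variable (ι : A →ₐ[k] L)

/-- The elements of degree `i` of `Q (E, F) = Hom_A (T L ⊗_A E, F)`, as multilinear functions. -/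
def weakHom (E F : CochainComplex (ModuleCat.{v} A) ℤ) (i : ℤ) :
    Submodule k (WordCochain L (toBase k E) (toBase k F) i) where
  carrier := {q | q.IsBalanced ι (mulHom k E) (mulHom k F)}
  add_mem' h h' := h.addm h'
  zero_mem' := WordCochain.IsBalanced.zero
  smul_mem' t _ h := h.smul t

lemma WordCochain.dQ_add {C : Type*} [Category* C] [Preadditive C] {L : Type*} [Mul L]
    {K K₁ : CochainComplex C ℤ} {i j : ℤ} (h : i + 1 = j) (q q' : WordCochain L K K₁ i) :
    (q + q').dQ h = q.dQ h + q'.dQ h := by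
  have : (q + q').delta h = q.delta h + q'.delta h := by ext1 u n hn; simp [delta]
  rw [dQ, dQ, dQ, this, hochschild_add, smul_add]
  abel

lemma WordCochain.dQ_smul {k : Type*} [CommRing k] {C : Type*} [Category* C] [Preadditive C]
    [Linear k C] {L : Type*} [Mul L]
    {K K₁ : CochainComplex C ℤ} {i j : ℤ} (h : i + 1 = j) (t : k) (q : WordCochain L K K₁ i) :
    (t • q).dQ h = t • q.dQ h := by
  have : (t • q).delta h = t • q.delta h := by ext1 u n hn; simp [delta]
  rw [dQ, dQ, this, hochschild_smul, smul_sub, smul_comm]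

/-- The dg category of complexes of `A`-modules, with the morphism complexes `Q (E, F)`. -/
noncomputable def weakQ : DGCat.{w, max u v, max u (v + 1)} k where
  Obj := CochainComplex (ModuleCat.{v} A) ℤ
  Hom E F i := weakHom ι E F i
  d n m h :=
    { toFun q := ⟨q.1.dQ h, q.2.dQ h⟩
      map_add' q q' := Subtype.ext (WordCochain.dQ_add h _ _)
      map_smul' t q := Subtype.ext (WordCochain.dQ_smul h _ _) }
  id E := ⟨.one _, .ofCochain fun a => by rw [Cochain.id_comp, Cochain.comp_id]⟩
  comp h := LinearMap.mk₂ k (fun f g => ⟨f.1.comp g.1 h, f.2.comp g.2 h⟩)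
    (fun _ _ _ => Subtype.ext (WordCochain.add_comp _ _ _ _))
    (fun _ _ _ => Subtype.ext (WordCochain.smul_comp _ _ _ _))
    (fun _ _ _ => Subtype.ext (WordCochain.comp_add _ _ _ _))
    (fun _ _ _ => Subtype.ext (WordCochain.comp_smul _ _ _ _))
  d_d n m p h h' f := Subtype.ext (f.1.dQ_dQ h h')
  id_comp f := Subtype.ext f.1.one_comp
  comp_id f := Subtype.ext f.1.comp_one
  assoc h₁ h₂ h₃ h₄ f g h := Subtype.ext (WordCochain.comp_assoc _ _ _ h₁ h₂ h₃ h₄)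
  d_comp h ha hb hc h₁ h₂ f g := Subtype.ext (WordCochain.dQ_comp _ _ h ha hb hc h₁ h₂)

/-- The normalization `P (η) = 1_E (1)`, where `P` is the restriction to `T A ⊗_A E`. -/
def IsNormalizedMC (E : CochainComplex (ModuleCat.{v} A) ℤ)
    (η : WordCochain L (toBase k E) (toBase k E) 1) : Prop :=
  (∀ n hn, η.v [] n hn = 0) ∧
  (∀ (a : A) (hn), η.v [ι a] 0 hn = Cochain.ofHom (mulHom k E a)) ∧
  (∀ (l : List A) (n hn), 2 ≤ l.length → η.v (l.map ι) n hn = 0)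

/-- The dg category of complexes with weak `L`-module structures: its objects are the pairs
`(E, η)` of a complex of `A`-modules and a normalized Maurer–Cartan element `η` of `Q (E, E)`. -/
noncomputable abbrev wpx : DGCat.{w, max u v, max u (v + 1)} k := (weakQ ι).twist fun E η => IsNormalizedMC ι E η.1

/-- Families of cochains that vanish on the nonempty words in `A`. -/
def WordCochain.IsNormalized {C : Type*} [Category* C] [Preadditive C] {L A : Type*} (ι : A → L)
    {K K₁ : CochainComplex C ℤ} {i : ℤ} (q : WordCochain L K K₁ i) : Prop :=
  ∀ (l : List A) (n : ℤ) (hn), l ≠ [] → q.v (l.map ι) n hn = 0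

section

variable {C : Type*} [Category* C] [Preadditive C] {K K₁ K₂ : CochainComplex C ℤ}

lemma WordCochain.IsNormalized.hochschild {i j : ℤ} (h : i + 1 = j) {q : WordCochain L K K₁ i}
    (hq : q.IsNormalized ι) : (q.hochschild h).IsNormalized ι := by
  intro l
  induction l generalizing i j with
  | nil => intro _ _ h; exact absurd rfl h
  | cons a l ih =>
    intro n hn _
    cases l with
    | nil => rfl
    | cons b l =>
      have e1 : ((q.shift (sub_add_cancel i 1) (ι a)).hochschild (sub_add_cancel i 1)).v
          (ι b :: l.map ι) n (by simp at hn ⊢; omega) = 0 :=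
        ih (sub_add_cancel i 1) (fun l n hn _ => hq (a :: l) n _ (by simp)) n _ (by simp)
      have e2 : q.v (ι (a * b) :: l.map ι) n (by simp at hn ⊢; omega) = 0 :=
        hq ((a * b) :: l) n _ (by simp)
      change (q.hochschild h).v (ι a :: ι b :: l.map ι) n hn = 0
      rw [WordCochain.hcc, e1, q.v_congr (congrArg (· :: l.map ι) (map_mul ι a b).symm), e2, sub_zero]

lemma WordCochain.comp_single {a b c : ℤ} (f : WordCochain L K K₁ a) (g : WordCochain L K₁ K₂ b)
    (h : a + b = c) (x : L) (n n₁ n₂ : ℤ) (hn h₁ h₂) (h₁₂ : n₁ + b = n) (h₁₂' : a + n₂ = n) :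
    (f.comp g h).v [x] n hn = (f.v [x] n₁ h₁).comp (g.v [] b (by simp)) h₁₂ +
      a.negOnePow • (f.v [] a (by simp)).comp (g.v [x] n₂ h₂) h₁₂' := by
  simp only [List.length_cons, List.length_nil] at hn h₁ h₂
  rw [WordCochain.comp_cons (n₁ := n₁) (n₂ := b) (b' := n₂) (c' := n) (h₁ := by simp; omega)
        (h₂ := by simp) (h₁₂ := by omega) (hb := by omega) (hc := by omega) (hn' := by simp),
      WordCochain.comp_nil (n₁ := a) (n₂ := n₂) (h₁ := by simp) (h₂ := by simp) (h₁₂ := by omega)]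
  rfl

lemma WordCochain.comp_v_eq_zero {a b c : ℤ} {f : WordCochain L K K₁ a}
    {g : WordCochain L K₁ K₂ b} (h : a + b = c) (u : List L) (n : ℤ) (hn)
    (H : ∀ (l r : List L), l ++ r = u → (∀ n hn, f.v r n hn = 0) ∨ (∀ n hn, g.v l n hn = 0)) :
    (f.comp g h).v u n hn = 0 := by
  rw [comp, mk_v]
  refine Finset.sum_eq_zero fun j _ => ?_
  rw [compTerm]
  rcases H (u.take j) (u.drop j) (List.take_append_drop j u) with H | H
  · rw [H, Cochain.zero_comp, smul_zero]
  · rw [H, Cochain.comp_zero, smul_zero]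

lemma WordCochain.IsNormalized.comp {a b c : ℤ} (h : a + b = c) {f : WordCochain L K K₁ a}
    {g : WordCochain L K₁ K₂ b} (hf : f.IsNormalized ι) (hg : g.IsNormalized ι) :
    (f.comp g h).IsNormalized ι := by
  intro u n hn hu
  refine comp_v_eq_zero h _ n hn fun l r hlr => ?_
  obtain ⟨l', r', rfl, rfl, rfl⟩ := List.append_eq_map_iff.1 hlr
  by_cases h' : r' = []
  · subst h'
    exact Or.inr fun n hn => hg _ n hn (by simpa using hu)
  · exact Or.inl fun n hn => hf _ n hn h'

end

/-- The morphisms `f` of which `P (f)` vanishes on `T^m A ⊗_A E` for all `m > 0`. -/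
def normalizedHom (x y : (wpx.{w, v, u} ι).Obj) (n : ℤ) :
    Submodule k ((wpx.{w, v, u} ι).Hom x y n) where
  carrier := {q | q.1.IsNormalized ι}
  add_mem' {q q'} h h' l n hn hl := by
    change q.1.v _ n hn + q'.1.v _ n hn = 0
    rw [h l n hn hl, h' l n hn hl, add_zero]
  zero_mem' _ _ _ _ := rfl
  smul_mem' t q h l n hn hl := by
    change t • q.1.v _ n hn = 0
    rw [h l n hn hl, smul_zero]

lemma normalizedHom_d {x y : (wpx.{w, v, u} ι).Obj} (n m : ℤ) (h : n + 1 = m)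
    (f : (wpx.{w, v, u} ι).Hom x y n) (hf : f ∈ normalizedHom ι x y n) :
    (wpx ι).d n m h f ∈ normalizedHom ι x y m := by
  have hη := x.2.2.1
  have hφ := y.2.2.1
  intro l p hp hl
  change (f.1.dQ h + f.1.comp y.2.1.1 h - n.negOnePow • x.2.1.1.comp f.1 _).v _ p hp = 0
  have e1 : (f.1.dQ h).v (l.map ι) p hp = 0 := by
    rw [WordCochain.dQ, WordCochain.sub_v, WordCochain.units_smul_v,
      WordCochain.IsNormalized.hochschild ι h hf l p hp hl, smul_zero, sub_zero,
      WordCochain.delta, WordCochain.mk_v, hf l (p - 1) _ hl, δ_zero]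
  rw [WordCochain.sub_v, WordCochain.add_v, e1, zero_add, WordCochain.units_smul_v]
  match l, hl with
  | [a], _ =>
    have hp' : p = n := by simp at hp; omega
    subst hp'
    have e2 := f.2.nil a p (by simp)
    change (f.1.comp y.2.1.1 h).v [ι a] p hp -
      p.negOnePow • (x.2.1.1.comp f.1 ((add_comm 1 p).trans h)).v [ι a] p hp = 0
    rw [WordCochain.comp_single (n₁ := p - 1) (n₂ := 0) (h₁ := by simp) (h₂ := by simp)
        (h₁₂ := by omega) (h₁₂' := by omega),
      WordCochain.comp_single (n₁ := 0) (n₂ := p - 1) (h₁ := by simp) (h₂ := by simp)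
        (h₁₂ := by omega) (h₁₂' := by omega), hφ.1, hη.1]
    erw [hη.2.1 a (by simp), hφ.2.1 a (by simp)]
    rw [Cochain.comp_zero, Cochain.zero_comp, smul_zero]
    refine (congrArg₂ (· - ·) (zero_add _) (congrArg _ (add_zero _))).trans ?_
    rw [e2]
    exact sub_self _
  | a :: b :: l, _ =>
    have e2 : (f.1.comp y.2.1.1 h).v ((a :: b :: l).map ι) p hp = 0 := by
      refine WordCochain.comp_v_eq_zero h _ p hp fun u r hr => ?_
      obtain ⟨l', r', e, rfl, rfl⟩ := List.append_eq_map_iff.1 hr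
      match l', e with
      | [], _ => exact Or.inr fun n hn => hφ.1 n hn
      | [a'], e =>
        refine Or.inl fun n hn => hf _ n hn ?_
        rintro rfl
        simp at e
      | a' :: b' :: l', _ => exact Or.inr fun n hn => hφ.2.2 _ n hn (by simp)
    have e3 : (x.2.1.1.comp f.1 ((add_comm 1 n).trans h)).v ((a :: b :: l).map ι) p hp = 0 := by
      refine WordCochain.comp_v_eq_zero _ _ p hp fun u r hr => ?_
      obtain ⟨l', r', e, rfl, rfl⟩ := List.append_eq_map_iff.1 hr
      match r', e with
      | [], _ => exact Or.inl fun n hn => hη.1 n hn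
      | [a'], e =>
        refine Or.inr fun n hn => hf _ n hn ?_
        rintro rfl
        simp at e
      | a' :: b' :: l', _ => exact Or.inl fun n hn => hη.2.2 _ n hn (by simp)
    rw [e2, e3, smul_zero, sub_zero]

/-- The dg category of complexes with weak `L`-module structures and normalized morphisms. -/
noncomputable abbrev wpx₀ : DGCat.{w, max u v, max u (v + 1)} k :=
  (wpx.{w, v, u} ι).sub (normalizedHom ι) (normalizedHom_d ι)
    (fun x l n hn hl => by
      obtain ⟨a, l, rfl⟩ := List.exists_cons_of_ne_nil hl
      rfl)
    (fun h f g hf hg => WordCochain.IsNormalized.comp ι h hf hg)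

end Weak

section WeakFunctors

variable {k : Type w} [Field k] {A L : Type u} [CommRing A] [Algebra k A] [Ring L] [Algebra k L]
  (ι : A →ₐ[k] L)

/-- The complex of `A`-modules that underlies a complex of `L`-modules. -/
noncomputable abbrev resCpx (E : CochainComplex (ModuleCat.{v} L) ℤ) :
    CochainComplex (ModuleCat.{v} A) ℤ :=
  ((ModuleCat.restrictScalars ι.toRingHom).mapHomologicalComplex _).obj E

/-- The action of an element of `L` on a complex of `L`-modules. -/
noncomputable def actHom (E : CochainComplex (ModuleCat.{v} L) ℤ) (u : L) :
    toBase k (resCpx ι E) ⟶ toBase k (resCpx ι E) where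
  f i := ModuleCat.ofHom
    (X := (toBase k (resCpx ι E)).X i) (Y := (toBase k (resCpx ι E)).X i)
    { toFun := fun x : E.X i => u • x
      map_add' := fun x y : E.X i => smul_add u x y
      map_smul' := fun t (x : E.X i) => by
        change u • ι (algebraMap k A t) • x = ι (algebraMap k A t) • u • x
        rw [AlgHom.commutes, smul_smul, smul_smul, Algebra.commutes] }
  comm' i j _ := by
    ext x
    exact ((E.d i j).hom.map_smul u x)

@[simp] lemma actHom_f_apply (E : CochainComplex (ModuleCat.{v} L) ℤ) (u : L) (i : ℤ)
    (x : E.X i) : ((actHom ι E u).f i).hom x = u • x := rfl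

lemma actHom_add (E : CochainComplex (ModuleCat.{v} L) ℤ) (x y : L) :
    actHom ι E (x + y) = actHom ι E x + actHom ι E y := by
  ext i e
  exact add_smul (M := E.X i) x y e

lemma actHom_mul (E : CochainComplex (ModuleCat.{v} L) ℤ) (x y : L) :
    actHom ι E (x * y) = actHom ι E y ≫ actHom ι E x := by
  ext i e
  exact mul_smul (β := E.X i) x y e

lemma actHom_algHom (E : CochainComplex (ModuleCat.{v} L) ℤ) (a : A) :
    actHom ι E (ι a) = mulHom k (resCpx ι E) a := rfl

/-- The family of cochains concentrated on words of length one that is defined by a family of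
morphisms of complexes. -/
def WordCochain.ofLetters {C : Type*} [Category* C] [Preadditive C] {L : Type*}
    {K K₁ : CochainComplex C ℤ} (m : L → (K ⟶ K₁)) : WordCochain L K K₁ 1 := .mk fun u n hn =>
  match u, hn with
  | [x], hn => Cochain.mk fun p q hpq => (Cochain.ofHom (m x)).v p q (by simp at hn; omega)
  | _, _ => 0

lemma WordCochain.ofLetters_single {C : Type*} [Category* C] [Preadditive C] {L : Type*}
    {K K₁ : CochainComplex C ℤ} (m : L → (K ⟶ K₁)) (x : L) (hn) :
    (ofLetters m).v [x] 0 hn = Cochain.ofHom (m x) := rfl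

lemma WordCochain.ofLetters_nil {C : Type*} [Category* C] [Preadditive C] {L : Type*}
    {K K₁ : CochainComplex C ℤ} (m : L → (K ⟶ K₁)) (n : ℤ) (hn) :
    (ofLetters m).v [] n hn = 0 := rfl

lemma WordCochain.ofLetters_cons_cons {C : Type*} [Category* C] [Preadditive C] {L : Type*}
    {K K₁ : CochainComplex C ℤ} (m : L → (K ⟶ K₁)) (x y : L) (u : List L) (n : ℤ) (hn) :
    (ofLetters m).v (x :: y :: u) n hn = 0 := rfl

lemma isBalanced_ofLetters_actHom (E : CochainComplex (ModuleCat.{v} L) ℤ) :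
    (WordCochain.ofLetters (actHom ι E)).IsBalanced ι (mulHom k (resCpx ι E))
      (mulHom k (resCpx ι E)) where
  add l r x y n h h' h'' := by
    match l, r with
    | [], [] =>
      obtain rfl : n = 0 := by simpa using h
      change Cochain.ofHom (actHom ι E (x + y)) =
        Cochain.ofHom (actHom ι E x) + Cochain.ofHom (actHom ι E y)
      rw [← Cochain.ofHom_add, actHom_add]
    | [], _ :: _ => simp [WordCochain.ofLetters_cons_cons]
    | [_], _ => simp [WordCochain.ofLetters_cons_cons]
    | _ :: _ :: _, _ => simp [WordCochain.ofLetters_cons_cons]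
  inner l r x y a n h h' := by
    match l with
    | [] => simp [WordCochain.ofLetters_cons_cons]
    | [_] => simp [WordCochain.ofLetters_cons_cons]
    | _ :: _ :: _ => simp [WordCochain.ofLetters_cons_cons]
  last l x a n h h' := by
    match l with
    | [] =>
      obtain rfl : n = 0 := by simpa using h
      change Cochain.ofHom (actHom ι E (x * ι a)) =
        (Cochain.ofHom _).comp (Cochain.ofHom (actHom ι E x)) _
      rw [← Cochain.ofHom_comp, actHom_mul]
      rfl
    | [_] => simp [WordCochain.ofLetters_cons_cons]
    | _ :: _ :: _ => simp [WordCochain.ofLetters_cons_cons]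
  first r x a n h h' := by
    match r with
    | [] =>
      obtain rfl : n = 0 := by simpa using h
      change Cochain.ofHom (actHom ι E (ι a * x)) =
        (Cochain.ofHom (actHom ι E x)).comp (Cochain.ofHom _) _
      rw [← Cochain.ofHom_comp, actHom_mul]
      rfl
    | _ :: _ => simp [WordCochain.ofLetters_cons_cons]
  nil a n h := by simp [WordCochain.ofLetters_nil]

/-- The strict Maurer–Cartan element `φ (u ; e) = u e` of a complex of `L`-modules. -/
noncomputable def strictMC (E : CochainComplex (ModuleCat.{v} L) ℤ) :
    weakHom ι (resCpx ι E) (resCpx ι E) 1 :=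
  ⟨.ofLetters (actHom ι E), isBalanced_ofLetters_actHom ι E⟩

lemma isNormalizedMC_strictMC (E : CochainComplex (ModuleCat.{v} L) ℤ) :
    IsNormalizedMC ι (resCpx ι E) (strictMC ι E).1 := by
  refine ⟨fun _ _ => rfl, fun a hn => rfl, fun l n hn hl => ?_⟩
  match l, hl with
  | _ :: _ :: _, _ => rfl

lemma isMaurerCartan_strictMC (E : CochainComplex (ModuleCat.{v} L) ℤ) :
    (weakQ.{w, v, u} ι).IsMaurerCartan (x := resCpx ι E) (strictMC ι E) := by
  refine Subtype.ext ?_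
  change (strictMC ι E).1.dQ (j := 2) rfl + (strictMC ι E).1.comp (strictMC ι E).1 (c := 2) rfl = 0
  ext1 u n hn
  rw [WordCochain.dQ, WordCochain.add_v, WordCochain.sub_v, WordCochain.units_smul_v,
    WordCochain.zero_v]
  match u with
  | [] =>
    rw [WordCochain.hochschild_nil, WordCochain.comp_nil (n₁ := 1) (n₂ := 1) (h₁ := by simp)
      (h₂ := by simp) (h₁₂ := by simpa using hn.symm)]
    simp [strictMC, WordCochain.delta, WordCochain.ofLetters_nil]
  | [x] =>
    obtain rfl : n = 1 := by simp at hn; omega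
    rw [WordCochain.hochschild_single, WordCochain.comp_single (n₁ := 0) (n₂ := 0) (h₁ := by simp)
      (h₂ := by simp) (h₁₂ := by simp) (h₁₂' := by simp),
      WordCochain.delta_v (n' := 0) (hn' := by simp) (hnn := by simp)]
    simp [strictMC, WordCochain.ofLetters_nil, WordCochain.ofLetters_single]
  | [x, y] =>
    obtain rfl : n = 0 := by simpa using hn
    rw [WordCochain.hcc, WordCochain.hochschild_single,
      WordCochain.comp_cons (n₁ := -1) (n₂ := 1) (b' := 0) (c' := 1) (h₁ := by simp)
        (h₂ := by simp) (h₁₂ := by omega) (hb := by omega) (hc := by omega) (hn' := by simp),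
      WordCochain.comp_single (n₁ := 0) (n₂ := -1) (h₁ := by simp)
        (h₂ := by simp) (h₁₂ := by simp) (h₁₂' := by simp),
      WordCochain.delta_v (n' := -1) (hn' := by simp) (hnn := by simp)]
    change δ _ _ 0 - _ • (Cochain.ofHom (actHom ι E (x * y)) - 0) + ((0 : Cochain _ _ _).comp _ _ +
      _ • ((Cochain.ofHom (actHom ι E y)).comp (Cochain.ofHom (actHom ι E x)) _ +
        _ • (0 : Cochain _ _ _).comp _ _)) = 0
    rw [← Cochain.ofHom_comp, actHom_mul]
    simp
  | x :: y :: z :: u =>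
    have e1 : (WordCochain.hochschild (rfl : (1 : ℤ) + 1 = 2) (strictMC ι E).1).v
        (x :: y :: z :: u) n hn = 0 := by
      rw [WordCochain.hcc, WordCochain.hcc]
      have : ∀ (u : List L) (n) (hn), (((strictMC ι E).1.shift (sub_add_cancel 1 1) x).shift
        (sub_add_cancel (1 - 1) 1) y).v u n hn = 0 := fun _ _ _ => rfl
      have e : ((strictMC ι E).1.shift (sub_add_cancel 1 1) x).shift
        (sub_add_cancel (1 - 1) 1) y = 0 := by ext1 u n hn; rfl
      rw [e, WordCochain.hochschild_zero]
      change (0 : Cochain _ _ _) - (0 - 0) = 0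
      simp
    have e2 : ((strictMC ι E).1.comp (strictMC ι E).1 (c := 2) rfl).v (x :: y :: z :: u) n hn
        = 0 := by
      refine WordCochain.comp_v_eq_zero _ _ n hn fun l r hlr => ?_
      match l, r, hlr with
      | [], _, _ => exact Or.inr fun _ _ => rfl
      | _ :: _ :: _, _, _ => exact Or.inr fun _ _ => rfl
      | [_], _ :: _ :: _, _ => exact Or.inl fun _ _ => rfl
    rw [e1, e2]
    change δ _ _ 0 - _ + _ = _
    simp

/-- The effect of restriction of scalars on cochains. -/
noncomputable def resMap {E F : CochainComplex (ModuleCat.{v} L) ℤ} (n : ℤ) :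
    Cochain E F n →ₗ[k] Cochain (resCpx ι E) (resCpx ι F) n where
  toFun z := z.map (ModuleCat.restrictScalars ι.toRingHom)
  map_add' z z' := Cochain.map_add _ _ _
  map_smul' t z := by
    ext i j hij x
    change algebraMap k L t • (z.v i j hij).hom x = ι (algebraMap k A t) • (z.v i j hij).hom x
    rw [AlgHom.commutes]

/-- The effect of restriction of scalars to the base field on cochains. -/
noncomputable def baseMap {E F : CochainComplex (ModuleCat.{v} A) ℤ} (n : ℤ) :
    Cochain E F n →ₗ[k] Cochain (toBase k E) (toBase k F) n where
  toFun z := z.map (ModuleCat.restrictScalars (algebraMap k A))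
  map_add' z z' := Cochain.map_add _ _ _
  map_smul' t z := by
    ext i j hij x
    rfl

lemma WordCochain.ofCochain_v_nil {C : Type*} [Category* C] [Preadditive C] {L : Type*}
    {K K₁ : CochainComplex C ℤ} {i : ℤ} (z : Cochain K K₁ i) (n : ℤ) (hn : n = i) (hn') :
    (ofCochain (L := L) z).v [] n hn' = (hn ▸ z : Cochain K K₁ n) := by
  subst hn
  rfl

/-- A cochain that is linear over `A`, as an element of `Q`. -/
noncomputable def weakHomOfCochain (E F : CochainComplex (ModuleCat.{v} A) ℤ) (n : ℤ) :
    Cochain E F n →ₗ[k] weakHom ι E F n where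
  toFun z := ⟨.ofCochain (baseMap (k := k) n z), .ofCochain fun a => by
    ext i j hij x
    rw [Cochain.comp_v _ _ _ i j j hij (add_zero j), Cochain.comp_v _ _ _ i i j (add_zero i) hij,
      Cochain.ofHom_v, Cochain.ofHom_v]
    exact ((z.v i j hij).hom.map_smul a x).symm⟩
  map_add' z z' := Subtype.ext <| by
    ext1 u n' hn
    match u with
    | [] =>
      obtain rfl : n' = n := by simpa using hn
      exact map_add (baseMap (k := k) n') z z'
    | _ :: _ => exact (add_zero _).symm
  map_smul' t z := Subtype.ext <| by
    ext1 u n' hn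
    match u with
    | [] =>
      obtain rfl : n' = n := by simpa using hn
      exact map_smul (baseMap (k := k) n') t z
    | _ :: _ => exact (smul_zero t).symm

/-- The component `P₀ (q) = q (; -)` of an element of `Q`. -/
noncomputable def weakHomProj (E F : CochainComplex (ModuleCat.{v} A) ℤ) (n : ℤ) :
    weakHom ι E F n →ₗ[k] Cochain E F n where
  toFun q := Cochain.mk fun i j hij => ModuleCat.ofHom
    { toFun := fun x : E.X i => (((q.1.v [] n (by simp)).v i j hij).hom x : F.X j)
      map_add' := fun x y => ((q.1.v [] n (by simp)).v i j hij).hom.map_add x y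
      map_smul' := fun a x => by
        have e := Cochain.congr_v (q.2.nil a n (by simp)) i j hij
        rw [Cochain.comp_v _ _ _ i j j hij (add_zero j),
          Cochain.comp_v _ _ _ i i j (add_zero i) hij, Cochain.ofHom_v, Cochain.ofHom_v] at e
        exact (DFunLike.congr_fun (ModuleCat.hom_ext_iff.1 e) x).symm }
  map_add' _ _ := rfl
  map_smul' _ _ := rfl

/-- The weak complex that is defined by a complex of `L`-modules. -/
noncomputable def weakifyObj (E : (dgCpx.{w, v, u} k L).Obj) : (wpx.{w, v, u} ι).Obj :=
  ⟨resCpx ι E, strictMC ι E, isNormalizedMC_strictMC ι E, isMaurerCartan_strictMC ι E⟩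

/-- The weak morphism that is defined by a cochain that is linear over `L`. -/
noncomputable def weakifyMap {E F : (dgCpx.{w, v, u} k L).Obj} (n : ℤ) :
    (dgCpx.{w, v, u} k L).Hom E F n →ₗ[k]
      (wpx.{w, v, u} ι).Hom (weakifyObj ι E) (weakifyObj ι F) n :=
  weakHomOfCochain ι (resCpx ι E) (resCpx ι F) n ∘ₗ resMap ι n

lemma weakifyMap_coe {E F : (dgCpx.{w, v, u} k L).Obj} (n : ℤ)
    (z : (dgCpx.{w, v, u} k L).Hom E F n) :
    (weakifyMap ι n z).1 = .ofCochain (baseMap (k := k) n (resMap ι (k := k) n z)) := rfl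

lemma weakifyMap_mem {E F : (dgCpx.{w, v, u} k L).Obj} (n : ℤ)
    (z : (dgCpx.{w, v, u} k L).Hom E F n) :
    weakifyMap ι n z ∈ normalizedHom ι (weakifyObj ι E) (weakifyObj ι F) n := by
  intro l n hn hl
  obtain ⟨a, l, rfl⟩ := List.exists_cons_of_ne_nil hl
  rfl

lemma resMap_δ {E F : CochainComplex (ModuleCat.{v} L) ℤ} (n m : ℤ) (z : Cochain E F n) :
    resMap ι (k := k) m (δ n m z) = δ n m (resMap ι (k := k) n z) :=
  (δ_map n m z (ModuleCat.restrictScalars ι.toRingHom)).symm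

lemma baseMap_δ {E F : CochainComplex (ModuleCat.{v} A) ℤ} (n m : ℤ) (z : Cochain E F n) :
    baseMap (k := k) m (δ n m z) = δ n m (baseMap (k := k) n z) :=
  (δ_map n m z (ModuleCat.restrictScalars (algebraMap k A))).symm

lemma resMap_comp {E F G : CochainComplex (ModuleCat.{v} L) ℤ} {a b c : ℤ} (h : a + b = c)
    (f : Cochain E F a) (g : Cochain F G b) : resMap ι (k := k) c (f.comp g h) =
      (resMap ι (k := k) a f).comp (resMap ι (k := k) b g) h :=
  Cochain.map_comp _ f g h (ModuleCat.restrictScalars ι.toRingHom)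

lemma baseMap_comp {E F G : CochainComplex (ModuleCat.{v} A) ℤ} {a b c : ℤ} (h : a + b = c)
    (f : Cochain E F a) (g : Cochain F G b) : baseMap (k := k) c (f.comp g h) =
      (baseMap (k := k) a f).comp (baseMap (k := k) b g) h :=
  Cochain.map_comp _ f g h (ModuleCat.restrictScalars (algebraMap k A))

lemma resMap_id (E : CochainComplex (ModuleCat.{v} L) ℤ) :
    resMap ι (k := k) 0 (Cochain.ofHom (𝟙 E)) = Cochain.ofHom (𝟙 (resCpx ι E)) := by
  change Cochain.map _ (ModuleCat.restrictScalars ι.toRingHom) = _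
  rw [Cochain.map_ofHom, CategoryTheory.Functor.map_id]

lemma baseMap_id (E : CochainComplex (ModuleCat.{v} A) ℤ) :
    baseMap (k := k) 0 (Cochain.ofHom (𝟙 E)) = Cochain.ofHom (𝟙 (toBase k E)) := by
  change Cochain.map _ (ModuleCat.restrictScalars (algebraMap k A)) = _
  rw [Cochain.map_ofHom, CategoryTheory.Functor.map_id]

lemma WordCochain.dQ_ofCochain {C : Type*} [Category* C] [Preadditive C] {L : Type*} [Mul L]
    {K K₁ : CochainComplex C ℤ} {n m : ℤ} (h : n + 1 = m) (z : Cochain K K₁ n) :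
    (ofCochain (L := L) z).dQ h = ofCochain (δ n m z) := by
  ext1 u p hp
  rw [dQ, sub_v, units_smul_v]
  match u with
  | [] =>
    obtain rfl : p = m := by simpa using hp
    rw [hochschild_nil, smul_zero, sub_zero, ofCochain_nil,
      delta_v (n' := n) (hn' := by simp) (hnn := h), ofCochain_nil]
  | [x] =>
    rw [hochschild_single, delta, mk_v, ofCochain_cons, ofCochain_cons]
    simp
  | x :: y :: u =>
    have e : (ofCochain (L := L) z).shift (sub_add_cancel n 1) x = 0 := by ext1 u n hn; rfl
    rw [hochschild_cons_cons h (sub_add_cancel n 1) _ x y u _ _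
          (by simp only [List.length_cons] at hp ⊢; omega)
          (by simp only [List.length_cons] at hp ⊢; omega), e, hochschild_zero, delta, mk_v,
      ofCochain_cons, ofCochain_cons, ofCochain_cons]
    simp

lemma WordCochain.ofCochain_comp_ofCochain {C : Type*} [Category* C] [Preadditive C] {L : Type*}
    {K K₁ K₂ : CochainComplex C ℤ} {a b c : ℤ} (h : a + b = c) (f : Cochain K K₁ a)
    (g : Cochain K₁ K₂ b) :
    (ofCochain (L := L) f).comp (ofCochain g) h = ofCochain (f.comp g h) := by
  rw [comp_ofCochain]
  ext1 u p hp
  rw [postcomp_v (n' := p - b) (hn' := by omega) (h₁ := by omega)]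
  match u with
  | [] =>
    obtain rfl : p = c := by simpa using hp
    obtain rfl : a = p - b := by omega
    rfl
  | x :: u => rw [ofCochain_cons, ofCochain_cons, Cochain.zero_comp]

lemma dQ_ofCochain_resMap {E F : CochainComplex (ModuleCat.{v} L) ℤ} {n m : ℤ} (h : n + 1 = m)
    (z : Cochain E F n) :
    WordCochain.ofCochain (baseMap (k := k) m (resMap ι (k := k) m (δ n m z))) =
      (WordCochain.ofCochain (baseMap (k := k) n (resMap ι (k := k) n z))).dQ h +
      (WordCochain.ofCochain (baseMap (k := k) n (resMap ι (k := k) n z))).comp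
        (WordCochain.ofLetters (actHom ι F)) h -
      n.negOnePow • (WordCochain.ofLetters (actHom ι E)).comp
        (WordCochain.ofCochain (baseMap (k := k) n (resMap ι (k := k) n z)))
        ((add_comm 1 n).trans h) := by
  set t : Cochain (toBase k (resCpx ι E)) (toBase k (resCpx ι F)) n :=
    baseMap (k := k) n (resMap ι (k := k) n z) with ht'
  have ht : ∀ x : L, t.comp (Cochain.ofHom (actHom ι F x)) (add_zero n) =
      (Cochain.ofHom (actHom ι E x)).comp t (zero_add n) := fun x => by
    ext i j hij e
    rw [Cochain.comp_v _ _ _ i j j hij (add_zero j), Cochain.comp_v _ _ _ i i j (add_zero i) hij,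
      Cochain.ofHom_v, Cochain.ofHom_v]
    exact ((Cochain.v z i j hij).hom.map_smul x e).symm
  rw [WordCochain.dQ_ofCochain, resMap_δ, baseMap_δ, add_sub_assoc, left_eq_add, sub_eq_zero]
  ext1 u p hp
  rw [WordCochain.units_smul_v, WordCochain.comp_ofCochain,
    WordCochain.ofCochain_comp_v (n' := p - n) (hn' := by omega) (h₁ := by omega),
    WordCochain.postcomp_v (n' := p - n) (hn' := by omega) (h₁ := by omega)]
  match u with
  | [] => simp [WordCochain.ofLetters_nil]
  | [x] =>
    obtain rfl : p = n := by simp at hp; omega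
    have : ∀ (q : ℤ) (hq : q = 0) (h₁) (h₂ : p + q = p) (h₃ : q + p = p),
        t.comp ((WordCochain.ofLetters (actHom ι F)).v [x] q h₁) h₂ =
        ((WordCochain.ofLetters (actHom ι E)).v [x] q h₁).comp t h₃ := by
      rintro q rfl _ _ _
      exact ht x
    rw [this (p - p) (sub_self p) _ _ (by omega)]
    simp
  | x :: y :: u => simp [WordCochain.ofLetters_cons_cons]

lemma ofCochain_resMap_comp {E F G : CochainComplex (ModuleCat.{v} L) ℤ} {a b c : ℤ}
    (h : a + b = c) (f : Cochain E F a) (g : Cochain F G b) :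
    WordCochain.ofCochain (L := L)
      (baseMap (k := k) c (resMap ι (k := k) c (Cochain.comp f g h))) =
    (WordCochain.ofCochain (baseMap (k := k) a (resMap ι (k := k) a f))).comp
      (WordCochain.ofCochain (baseMap (k := k) b (resMap ι (k := k) b g))) h := by
  rw [WordCochain.ofCochain_comp_ofCochain, resMap_comp, baseMap_comp]

lemma ofCochain_resMap_id (E : CochainComplex (ModuleCat.{v} L) ℤ) :
    WordCochain.ofCochain (L := L)
      (baseMap (k := k) 0 (resMap ι (k := k) 0 (Cochain.ofHom (𝟙 E)))) =
    WordCochain.one (toBase k (resCpx ι E)) := by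
  rw [resMap_id, baseMap_id]
  rfl

/-- The weakification functor with values in normalized weak complexes. -/
noncomputable def weakify₀ : DGFunctor (dgCpx.{w, v, u} k L) (wpx₀.{w, v, u} ι) where
  obj E := (weakifyObj ι E : (wpx.{w, v, u} ι).Obj)
  map {x y} n := LinearMap.codRestrict (normalizedHom ι (weakifyObj ι x) (weakifyObj ι y) n)
    (weakifyMap ι n) (weakifyMap_mem ι n)
  map_d n m h z := Subtype.ext (Subtype.ext (dQ_ofCochain_resMap ι h z))
  map_id E := Subtype.ext (Subtype.ext (ofCochain_resMap_id ι E))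
  map_comp h f g := Subtype.ext (Subtype.ext (ofCochain_resMap_comp ι h f g))

/-- The weakification functor. -/
noncomputable def weakify : DGFunctor (dgCpx.{w, v, u} k L) (wpx.{w, v, u} ι) :=
  (weakify₀ ι).comp (.subIncl _ _ _ _ _)

/-- The underlying complex of a weak complex. -/
def wpxProjObj (x : (wpx.{w, v, u} ι).Obj) : (dgCpx.{w, v, u} k A).Obj := x.1

lemma weakHomProj_δ {E F : CochainComplex (ModuleCat.{v} A) ℤ} {n m : ℤ} (h : n + 1 = m)
    (f : weakHom ι E F n) (g : weakHom ι E F m)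
    (e : g.1.v [] m (by simp) = δ n m (f.1.v [] n (by simp))) :
    weakHomProj ι E F m g = δ n m (weakHomProj ι E F n f) := by
  ext i j hij a
  refine (DFunLike.congr_fun (ModuleCat.hom_ext_iff.1 (Cochain.congr_v e i j hij)) a).trans ?_
  rw [δ_v n m h _ i j hij (j - 1) (i + 1) rfl rfl, δ_v n m h _ i j hij (j - 1) (i + 1) rfl rfl]
  rcases Int.units_eq_one_or m.negOnePow with hm | hm
  · rw [hm, one_smul, one_smul]
    rfl
  · rw [hm, Units.neg_smul, Units.neg_smul, one_smul, one_smul]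
    rfl

lemma weakHomProj_comp {E F G : CochainComplex (ModuleCat.{v} A) ℤ} {a b c : ℤ} (h : a + b = c)
    (f : weakHom ι E F a) (g : weakHom ι F G b) (p : weakHom ι E G c)
    (e : p.1.v [] c (by simp) = (f.1.v [] a (by simp)).comp (g.1.v [] b (by simp)) h) :
    weakHomProj ι E G c p = (weakHomProj ι E F a f).comp (weakHomProj ι F G b g) h := by
  ext i j hij t
  refine (DFunLike.congr_fun (ModuleCat.hom_ext_iff.1 (Cochain.congr_v e i j hij)) t).trans ?_
  rw [Cochain.comp_v _ _ h i (i + a) j rfl (by omega),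
    Cochain.comp_v _ _ h i (i + a) j rfl (by omega)]
  rfl

lemma wpx_d_nil {x y : (wpx.{w, v, u} ι).Obj} (n m : ℤ) (h : n + 1 = m)
    (f : (wpx.{w, v, u} ι).Hom x y n) :
    ((wpx.{w, v, u} ι).d n m h f).1.v [] m (by simp) = δ n m (f.1.v [] n (by simp)) := by
  change (f.1.dQ h + f.1.comp y.2.1.1 h - n.negOnePow • x.2.1.1.comp f.1 _).v [] m (by simp) = _
  rw [WordCochain.sub_v, WordCochain.add_v, WordCochain.units_smul_v, WordCochain.dQ,
    WordCochain.sub_v, WordCochain.units_smul_v, WordCochain.hochschild_nil,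
    WordCochain.comp_v_eq_zero, WordCochain.comp_v_eq_zero,
    WordCochain.delta_v (n' := n) (hn' := by simp) (hnn := h)]
  · simp
  · intro l r hlr
    obtain ⟨rfl, rfl⟩ := List.append_eq_nil_iff.1 hlr
    exact Or.inl x.2.2.1.1
  · intro l r hlr
    obtain ⟨rfl, rfl⟩ := List.append_eq_nil_iff.1 hlr
    exact Or.inr y.2.2.1.1

lemma weakHomProj_id (E : CochainComplex (ModuleCat.{v} A) ℤ) (p : weakHom ι E E 0)
    (e : p.1 = WordCochain.one _) : weakHomProj ι E E 0 p = Cochain.ofHom (𝟙 E) := by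
  ext i t
  have e' : (p.1.v [] 0 (by simp)).v i i (add_zero i) = 𝟙 _ := by
    rw [e]
    change (Cochain.ofHom (𝟙 (toBase k E))).v i i (add_zero i) = 𝟙 _
    rw [Cochain.ofHom_v]
    rfl
  rw [Cochain.ofHom_v]
  exact DFunLike.congr_fun (ModuleCat.hom_ext_iff.1 e') t

/-- The functor that sends a weak complex to its underlying complex, and a morphism `q` to its
component `P₀ (q) = q (; -)`. -/
noncomputable def wpxProj : DGFunctor (wpx.{w, v, u} ι) (dgCpx.{w, v, u} k A) where
  obj := wpxProjObj ι
  map n := weakHomProj ι _ _ n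
  map_d n m h f := weakHomProj_δ ι h _ _ (wpx_d_nil ι n m h f)
  map_id _ := weakHomProj_id ι _ _ rfl
  map_comp h f g :=
    weakHomProj_comp ι h _ _ _ (WordCochain.comp_nil f.1 g.1 h _ _ _ _ _ _ _)

/-- The restriction of `wpxProj` to normalized morphisms. -/
noncomputable def wpxProj₀ : DGFunctor (wpx₀.{w, v, u} ι) (dgCpx.{w, v, u} k A) :=
  DGFunctor.comp (.subIncl _ _ _ _ _) (wpxProj ι)

/-- The underlying complex of `A`-modules of a complex of `L`-modules. -/
noncomputable def strictProjObj (E : (dgCpx.{w, v, u} k L).Obj) : (dgCpx.{w, v, u} k A).Obj :=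
  resCpx ι E

/-- The functor that sends a complex of `L`-modules to the underlying complex of `A`-modules. -/
noncomputable def strictProj : DGFunctor (dgCpx.{w, v, u} k L) (dgCpx.{w, v, u} k A) where
  obj := strictProjObj ι
  map n := resMap ι n
  map_d n m h f := resMap_δ ι n m f
  map_id E := resMap_id ι E
  map_comp h f g := resMap_comp ι h f g


end WeakFunctors

/-! ### Bounded, locally free and perfect complexes -/

section Finiteness

/-- Bounded complexes. -/
def IsBoundedCpx {R : Type u} [Ring R] (E : CochainComplex (ModuleCat.{v} R) ℤ) : Prop :=
  ∃ a b : ℤ, E.IsStrictlyGE a ∧ E.IsStrictlyLE b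

/-- Let `R` be a ring with a homomorphism from the commutative ring `A`.  An `R`-module `M` is
locally free if the spectrum of `A` is covered by open sets `D (f)` over which `M` is isomorphic
to a free `R`-module, of possibly infinite rank: there is an `R`-module that is a localization at
`f` both of `M` and of the free `R`-module on some set. -/
def IsLocallyFreeOver {A R : Type u} [CommRing A] [Ring R] (ι : A →+* R)
    (M : ModuleCat.{u} R) : Prop :=
  ∃ S : Set A, Ideal.span S = ⊤ ∧ ∀ f ∈ S, ∃ (I : Type u) (N : ModuleCat.{u} R)
    (g : M ⟶ N) (h : ModuleCat.of R (I →₀ R) ⟶ N),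
    IsLocalizedModule (.powers f) ((ModuleCat.restrictScalars ι).map g).hom ∧
    IsLocalizedModule (.powers f) ((ModuleCat.restrictScalars ι).map h).hom

/-- Strictly perfect complexes: bounded complexes of finitely generated projective modules. -/
def IsStrictlyPerfect {B : Type u} [CommRing B] (P : CochainComplex (ModuleCat.{u} B) ℤ) : Prop :=
  IsBoundedCpx P ∧ ∀ i, Module.Finite B (P.X i) ∧ Module.Projective B (P.X i)

/-- Perfect complexes: the spectrum of `A` is covered by open sets `D (f)` over which the complex
is quasi-isomorphic to a strictly perfect complex. -/
def IsPerfectCpx {A : Type u} [CommRing A] (E : CochainComplex (ModuleCat.{u} A) ℤ) : Prop :=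
  ∃ S : Set A, Ideal.span S = ⊤ ∧ ∀ f ∈ S,
    ∃ (P Z : CochainComplex (ModuleCat.{u} (Localization (Submonoid.powers f))) ℤ)
      (p : Z ⟶ P) (q : Z ⟶ ((ModuleCat.localizedModuleFunctor
        (Submonoid.powers f)).mapHomologicalComplex (ComplexShape.up ℤ)).obj E),
      IsStrictlyPerfect P ∧ QuasiIso p ∧ QuasiIso q

/-- Bounded perfect complexes of locally free `A`-modules. -/
def IsBplf {A : Type u} [CommRing A] (E : CochainComplex (ModuleCat.{u} A) ℤ) : Prop :=
  IsBoundedCpx E ∧ (∀ i, IsLocallyFreeOver (RingHom.id A) (E.X i)) ∧ IsPerfectCpx E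

variable {k : Type w} [Field k] {A L : Type u} [CommRing A] [Algebra k A] [Ring L] [Algebra k L]
  (ι : A →ₐ[k] L)

/-- The dg category of bounded perfect complexes of locally free `A`-modules. -/
noncomputable abbrev dgCpxBplf (k : Type w) [Field k] (A : Type u) [CommRing A] [Algebra k A] :
    DGCat.{w, u, u + 1} k :=
  (dgCpx.{w, u, u} k A).full fun E : CochainComplex (ModuleCat.{u} A) ℤ => IsBplf E

/-- Bounded complexes of locally free `L`-modules that are perfect over `A`. -/
def IsBplfOver (E : CochainComplex (ModuleCat.{u} L) ℤ) : Prop :=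
  IsBoundedCpx E ∧ (∀ i, IsLocallyFreeOver ι.toRingHom (E.X i)) ∧ IsPerfectCpx (resCpx ι E)

/-- The dg category of bounded complexes of locally free `L`-modules that are perfect over `A`. -/
noncomputable abbrev dgCpxBplfOver : DGCat.{w, u, u + 1} k :=
  (dgCpx.{w, u, u} k L).full fun E : CochainComplex (ModuleCat.{u} L) ℤ => IsBplfOver ι E

/-- The dg category of weak complexes with bounded, locally free and perfect underlying complex. -/
noncomputable abbrev wpxBplf : DGCat.{w, u, u + 1} k :=
  (wpx.{w, u, u} ι).full fun x => IsBplf (A := A) x.1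

/-- The dg category of weak complexes with bounded, locally free and perfect underlying complex,
and normalized morphisms. -/
noncomputable abbrev wpxBplf₀ : DGCat.{w, u, u + 1} k :=
  (wpx₀.{w, u, u} ι).full fun x : (wpx.{w, u, u} ι).Obj => IsBplf (A := A) x.1

end Finiteness

/-! ### Formal categories and their rings of differential operators -/

section Formal

open scoped TensorProduct

/-- The morphisms from `Spec R` to the formal scheme `Spf F`, where `F` carries the topology
defined by the kernel of `e : F → A`: the homomorphisms `F → R` that vanish on a power of it. -/
structure FormalPoint {A F : Type u} [CommRing A] [Algebra ℂ A] [CommRing F] [Algebra ℂ F]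
    (e : F →ₐ[ℂ] A) (R : Type u) [CommRing R] [Algebra ℂ R] where
  hom : F →ₐ[ℂ] R
  exists_pow : ∃ n : ℕ, ∀ x ∈ RingHom.ker e ^ n, hom x = 0

namespace FormalPoint

variable {A F : Type u} [CommRing A] [Algebra ℂ A] [CommRing F] [Algebra ℂ F] {e : F →ₐ[ℂ] A}
  {R R' : Type u} [CommRing R] [Algebra ℂ R] [CommRing R'] [Algebra ℂ R']

lemma ext {p q : FormalPoint e R} (h : ∀ x, p.hom x = q.hom x) : p = q := by
  cases p; cases q; congr; exact AlgHom.ext h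

/-- Functoriality of points. -/
def map (g : R →ₐ[ℂ] R') (p : FormalPoint e R) : FormalPoint e R' :=
  ⟨g.comp p.hom, p.exists_pow.imp fun _ h x hx => by simp [h x hx]⟩

@[simp] lemma map_hom_apply (g : R →ₐ[ℂ] R') (p : FormalPoint e R) (x : F) :
    (p.map g).hom x = g (p.hom x) := rfl

variable (e) in
/-- The point that a point of `Spec A` defines through the closed embedding into `Spf F`. -/
def unit (x : A →ₐ[ℂ] R) : FormalPoint e R :=
  ⟨x.comp e, 1, fun y hy => by
    have : e y = 0 := by simpa using hy
    simp [this]⟩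

end FormalPoint

/-- A formal category on `X = Spec A`, with formal scheme of morphisms `Spf F`: for each
`ℂ`-algebra `R`, the points of `X` with values in `R` are the objects, and those of `Spf F` are the
morphisms of a groupoid, which depends functorially on `R`.  Here `s`, `t : A → F` (source and
target) define the left and the right `A`-algebra structure of `F`, the homomorphism `e : F → A`
corresponds to the embedding of identity morphisms, and `F` is complete for the topology defined by
the kernel of `e`. -/
structure FormalCategory (A F : Type u) [CommRing A] [Algebra ℂ A] [CommRing F] [Algebra ℂ F] where
  s : A →ₐ[ℂ] F
  t : A →ₐ[ℂ] F
  e : F →ₐ[ℂ] A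
  e_s : ∀ a, e (s a) = a
  e_t : ∀ a, e (t a) = a
  complete : IsAdicComplete (RingHom.ker e) F
  comp : ∀ {R : Type u} [CommRing R] [Algebra ℂ R] (p q : FormalPoint e R),
    (∀ a, p.hom (t a) = q.hom (s a)) → FormalPoint e R
  comp_s : ∀ {R : Type u} [CommRing R] [Algebra ℂ R] (p q : FormalPoint e R) (h) (a : A),
    (comp p q h).hom (s a) = p.hom (s a)
  comp_t : ∀ {R : Type u} [CommRing R] [Algebra ℂ R] (p q : FormalPoint e R) (h) (a : A),
    (comp p q h).hom (t a) = q.hom (t a)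
  map_comp : ∀ {R R' : Type u} [CommRing R] [Algebra ℂ R] [CommRing R'] [Algebra ℂ R']
    (g : R →ₐ[ℂ] R') (p q : FormalPoint e R) (h h'),
    (comp p q h).map g = comp (p.map g) (q.map g) h'
  unit_comp : ∀ {R : Type u} [CommRing R] [Algebra ℂ R] (p : FormalPoint e R) (h),
    comp (.unit e (p.hom.comp s)) p h = p
  comp_unit : ∀ {R : Type u} [CommRing R] [Algebra ℂ R] (p : FormalPoint e R) (h),
    comp p (.unit e (p.hom.comp t)) h = p
  assoc : ∀ {R : Type u} [CommRing R] [Algebra ℂ R] (p q r : FormalPoint e R) (h₁ h₂ h₃ h₄),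
    comp (comp p q h₁) r h₂ = comp p (comp q r h₃) h₄
  exists_inv : ∀ {R : Type u} [CommRing R] [Algebra ℂ R] (p : FormalPoint e R),
    ∃ (q : FormalPoint e R) (h : ∀ a, p.hom (t a) = q.hom (s a)) (h' : ∀ a, q.hom (t a) = p.hom (s a)),
      comp p q h = .unit e (p.hom.comp s) ∧ comp q p h' = .unit e (p.hom.comp t)

namespace FormalCategory

variable {A F : Type u} [CommRing A] [Algebra ℂ A] [CommRing F] [Algebra ℂ F]

/-- The ideal of the identity morphisms. -/
abbrev J (C : FormalCategory A F) : Ideal F := RingHom.ker C.e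

/-- Formal categories of smooth type: `J / J ^ 2` is locally free of finite rank, and the canonical
homomorphism from its symmetric algebra to the graded ring `⨁ n, J ^ n / J ^ (n + 1)` is an
isomorphism.  The graded ring is the quotient of the Rees algebra `⨁ n, J ^ n` by the ideal that
is generated by `J` in degree `0`. -/
structure IsSmoothType (C : FormalCategory A F) : Prop where
  finite : Module.Finite (F ⧸ C.J) C.J.Cotangent
  projective : Module.Projective (F ⧸ C.J) C.J.Cotangent
  gr : ∃ Φ : SymmetricAlgebra (F ⧸ C.J) C.J.Cotangent ≃+*
      reesAlgebra C.J ⧸ C.J.map (algebraMap F (reesAlgebra C.J)),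
    (∀ x : F, Φ (algebraMap _ _ (Ideal.Quotient.mk C.J x)) =
      Ideal.Quotient.mk _ (algebraMap F _ x)) ∧
    (∀ j : C.J, Φ (SymmetricAlgebra.ι _ _ (C.J.toCotangent j)) =
      Ideal.Quotient.mk _ ⟨Polynomial.monomial 1 j.1,
        reesAlgebra.monomial_mem.2 (by simpa only [pow_one] using j.2)⟩)

/-- The ring `L = ⋃ k, Hom_{A, left} (F / J ^ k, A)` of differential operators, as an additive
group. -/
def diffOp (C : FormalCategory A F) : AddSubgroup (F →+ A) where
  carrier := {φ | (∀ a x, φ (C.s a * x) = a * φ x) ∧ ∃ n : ℕ, ∀ x ∈ C.J ^ n, φ x = 0}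
  zero_mem' := ⟨by simp, 0, by simp⟩
  add_mem' := by
    rintro φ ψ ⟨h, n, hn⟩ ⟨h', n', hn'⟩
    refine ⟨fun a x => by simp [h, h', mul_add], max n n', fun x hx => ?_⟩
    rw [AddMonoidHom.add_apply, hn x (Ideal.pow_le_pow_right (le_max_left _ _) hx),
      hn' x (Ideal.pow_le_pow_right (le_max_right _ _) hx), add_zero]
  neg_mem' := by
    rintro φ ⟨h, n, hn⟩
    exact ⟨fun a x => by simp [h], n, fun x hx => by simp [hn x hx]⟩

variable (C : FormalCategory A F)

/-- The ring of differential operators. -/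
def DiffOp : Type u := C.diffOp

end FormalCategory
end Formal

section Pushout

open scoped TensorProduct

variable {A R B T : Type u} [CommRing A] [Algebra ℂ A] [CommRing R] [Algebra ℂ R] [CommRing B]
  [Algebra ℂ B] [CommRing T] [Algebra ℂ T]

/-- The ring `R`, seen as an `A`-algebra through `f`. -/
def AlgVia (_ : A →ₐ[ℂ] R) : Type u := R

namespace AlgVia

instance (f : A →ₐ[ℂ] R) : CommRing (AlgVia f) := inferInstanceAs (CommRing R)
instance (f : A →ₐ[ℂ] R) : Algebra ℂ (AlgVia f) := inferInstanceAs (Algebra ℂ R)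
instance (f : A →ₐ[ℂ] R) : Algebra A (AlgVia f) := f.toRingHom.toAlgebra
instance (f : A →ₐ[ℂ] R) : IsScalarTower ℂ A (AlgVia f) :=
  IsScalarTower.of_algebraMap_eq fun c => (f.commutes c).symm

end AlgVia

/-- The pushout `R ⊗_A B`. -/
abbrev Pushout (f : A →ₐ[ℂ] R) (g : A →ₐ[ℂ] B) : Type u := AlgVia f ⊗[A] AlgVia g

namespace Pushout

variable (f : A →ₐ[ℂ] R) (g : A →ₐ[ℂ] B)

/-- The first coprojection. -/
def inl : R →ₐ[ℂ] Pushout f g := (Algebra.TensorProduct.includeLeft : AlgVia f →ₐ[ℂ] _)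

/-- The second coprojection. -/
def inr : B →ₐ[ℂ] Pushout f g :=
  ((Algebra.TensorProduct.includeRight : AlgVia g →ₐ[A] AlgVia f ⊗[A] AlgVia g).restrictScalars ℂ :
    AlgVia g →ₐ[ℂ] _)

lemma inl_eq_inr (a : A) : inl f g (f a) = inr f g (g a) :=
  Algebra.TensorProduct.tmul_one_eq_one_tmul (A := AlgVia f) (B := AlgVia g) a

variable {f g}

lemma induction {P : Pushout f g → Prop} (zero : P 0)
    (mul : ∀ r x, P (inl f g r * inr f g x)) (add : ∀ x y, P x → P y → P (x + y))
    (x : Pushout f g) : P x := by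
  induction x using TensorProduct.induction_on with
  | zero => exact zero
  | tmul r x =>
    have : inl f g r * inr f g x = r ⊗ₜ[A] x := by
      change (r ⊗ₜ[A] 1 : AlgVia f ⊗[A] AlgVia g) * (1 ⊗ₜ[A] x) = _
      rw [Algebra.TensorProduct.tmul_mul_tmul, mul_one, one_mul]
    exact this ▸ mul r x
  | add x y hx hy => exact add x y hx hy

/-- The universal property. -/
def desc (i : R →ₐ[ℂ] T) (j : B →ₐ[ℂ] T) (h : ∀ a, i (f a) = j (g a)) : Pushout f g →ₐ[ℂ] T :=
  letI : Algebra A T := (i.comp f).toRingHom.toAlgebra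
  haveI : IsScalarTower ℂ A T := IsScalarTower.of_algebraMap_eq fun c => ((i.comp f).commutes c).symm
  (Algebra.TensorProduct.lift
    ({ (i : R →+* T) with commutes' := fun _ => rfl } : AlgVia f →ₐ[A] T)
    ({ (j : B →+* T) with commutes' := fun a => (h a).symm } : AlgVia g →ₐ[A] T)
    (fun _ _ => Commute.all _ _)).restrictScalars ℂ

lemma desc_inl (i : R →ₐ[ℂ] T) (j : B →ₐ[ℂ] T) (h : ∀ a, i (f a) = j (g a)) (r : R) :
    desc i j h (inl f g r) = i r := by
  change i r * j 1 = _
  rw [map_one, mul_one]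

lemma desc_inr (i : R →ₐ[ℂ] T) (j : B →ₐ[ℂ] T) (h : ∀ a, i (f a) = j (g a)) (x : B) :
    desc i j h (inr f g x) = j x := by
  change i 1 * j x = _
  rw [map_one, one_mul]

/-- The biadditive map `(r, x) ↦ r f (ψ x)`. -/
def linAux (f : A →ₐ[ℂ] R) (ψ : B →+ A) : R →+ B →+ R :=
  (AddMonoidHom.mul (R := R)).compl₂ ((f : A →+ R).comp ψ)

/-- The homomorphism `r ⊗ x ↦ r f (ψ x)`, for an `A`-linear map `ψ : B → A`. -/
def lin (f : A →ₐ[ℂ] R) (g : A →ₐ[ℂ] B) (ψ : B →+ A) (hψ : ∀ a x, ψ (g a * x) = a * ψ x) :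
    Pushout f g →+ R :=
  TensorProduct.liftAddHom (M := AlgVia f) (N := AlgVia g)
    (linAux f ψ)
    (by
      intro a (r : R) (x : B)
      change (f a * r) * f (ψ x) = r * f (ψ (g a * x))
      rw [hψ, map_mul]; ring)

lemma lin_mul (ψ : B →+ A) (hψ : ∀ a x, ψ (g a * x) = a * ψ x) (r : R) (x : B) :
    lin f g ψ hψ (inl f g r * inr f g x) = r * f (ψ x) := by
  change lin f g ψ hψ (((show AlgVia f from r) ⊗ₜ[A] 1 : AlgVia f ⊗[A] AlgVia g) *
    (1 ⊗ₜ[A] (show AlgVia g from x))) = _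
  rw [Algebra.TensorProduct.tmul_mul_tmul, mul_one, one_mul]
  rfl

lemma lin_inr (ψ : B →+ A) (hψ : ∀ a x, ψ (g a * x) = a * ψ x) (x : B) :
    lin f g ψ hψ (inr f g x) = f (ψ x) := by
  have := lin_mul (f := f) ψ hψ 1 x
  rwa [map_one, one_mul, one_mul] at this

lemma lin_inl_mul (ψ : B →+ A) (hψ : ∀ a x, ψ (g a * x) = a * ψ x) (r : R) (x : Pushout f g) :
    lin f g ψ hψ (inl f g r * x) = r * lin f g ψ hψ x := by
  induction x using Pushout.induction with
  | zero => simp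
  | mul r' x => rw [← mul_assoc, ← map_mul, lin_mul, lin_mul, mul_assoc]
  | add x y hx hy => rw [mul_add, map_add, map_add, hx, hy, mul_add]

end Pushout
end Pushout

namespace FormalCategory

variable {A F : Type u} [CommRing A] [Algebra ℂ A] [CommRing F] [Algebra ℂ F]
  (C : FormalCategory A F)

namespace DiffOp

variable {C}

instance : AddCommGroup C.DiffOp := inferInstanceAs (AddCommGroup C.diffOp)

instance : FunLike C.DiffOp F A where
  coe φ x := φ.1 x
  coe_injective φ ψ h := Subtype.ext (DFunLike.coe_injective h)

instance : AddMonoidHomClass C.DiffOp F A where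
  map_add φ := φ.1.map_add
  map_zero φ := φ.1.map_zero

@[ext] lemma ext {φ ψ : C.DiffOp} (h : ∀ x, φ x = ψ x) : φ = ψ := DFunLike.ext _ _ h

lemma map_s (φ : C.DiffOp) (a : A) (x : F) : φ (C.s a * x) = a * φ x := φ.2.1 a x

lemma exists_pow (φ : C.DiffOp) : ∃ n : ℕ, ∀ x ∈ C.J ^ n, φ x = 0 := φ.2.2

@[simp] lemma add_apply (φ ψ : C.DiffOp) (x : F) : (φ + ψ) x = φ x + ψ x := rfl

@[simp] lemma zero_apply (x : F) : (0 : C.DiffOp) x = 0 := rfl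

/-- The map `F / J ^ n → A` induced by a differential operator. -/
def bar (φ : C.DiffOp) (n : ℕ) (hn : ∀ x ∈ C.J ^ n, φ x = 0) : F ⧸ C.J ^ n →+ A :=
  QuotientAddGroup.lift (C.J ^ n).toAddSubgroup φ.1 hn

@[simp] lemma bar_mk (φ : C.DiffOp) (n : ℕ) (hn : ∀ x ∈ C.J ^ n, φ x = 0) (x : F) :
    φ.bar n hn (Ideal.Quotient.mkₐ ℂ _ x) = φ x := rfl

end DiffOp

/-- The point `F → F / J ^ n`. -/
def quotPoint (n : ℕ) : FormalPoint C.e (F ⧸ C.J ^ n) :=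
  ⟨Ideal.Quotient.mkₐ ℂ _, n, fun _ hx => Ideal.Quotient.eq_zero_iff_mem.2 hx⟩

lemma quotPoint_eq_zero {n m : ℕ} (h : n ≤ m) {x : F} (hx : x ∈ C.J ^ m) :
    (C.quotPoint n).hom x = 0 := Ideal.Quotient.eq_zero_iff_mem.2 (Ideal.pow_le_pow_right h hx)

lemma comp_congr {R : Type u} [CommRing R] [Algebra ℂ R] {p p' q q' : FormalPoint C.e R} (h)
    (hp : p = p') (hq : q = q') : C.comp p q h = C.comp p' q' (hp ▸ hq ▸ h) := by
  subst hp hq; rfl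

section Act

variable {C} {R T : Type u} [CommRing R] [Algebra ℂ R] [CommRing T] [Algebra ℂ T]

/-- The ring `R ⊗_A F / J ^ n`, where `R` is an `A`-algebra through the target of an `R`-point. -/
abbrev Ext (p : FormalPoint C.e R) (n : ℕ) : Type u :=
  Pushout (p.hom.comp C.t) ((C.quotPoint n).hom.comp C.s)

/-- The coprojection `R → R ⊗_A F / J ^ n`. -/
abbrev extL (p : FormalPoint C.e R) (n : ℕ) : R →ₐ[ℂ] Ext p n := Pushout.inl _ _

/-- The coprojection `F → F / J ^ n → R ⊗_A F / J ^ n`. -/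
def extR (p : FormalPoint C.e R) (n : ℕ) : FormalPoint C.e (Ext p n) :=
  (C.quotPoint n).map (Pushout.inr _ _)

lemma ext_comm (p : FormalPoint C.e R) (n : ℕ) (a : A) :
    (p.map (extL p n)).hom (C.t a) = (extR p n).hom (C.s a) := Pushout.inl_eq_inr _ _ a

lemma bar_s (φ : C.DiffOp) (n : ℕ) (hn : ∀ x ∈ C.J ^ n, φ x = 0) (a : A) (x : F ⧸ C.J ^ n) :
    φ.bar n hn (((C.quotPoint n).hom.comp C.s) a * x) = a * φ.bar n hn x := by
  obtain ⟨x, rfl⟩ := Ideal.Quotient.mkₐ_surjective ℂ _ x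
  exact φ.map_s a x

/-- The map `R ⊗_A F / J ^ n → R`, `r ⊗ x ↦ r p (t (ψ x))`. -/
def extLin (p : FormalPoint C.e R) (ψ : C.DiffOp) (n : ℕ) (hn : ∀ x ∈ C.J ^ n, ψ x = 0) :
    Ext p n →+ R :=
  Pushout.lin (p.hom.comp C.t) ((C.quotPoint n).hom.comp C.s) (ψ.bar n hn) (bar_s ψ n hn)

lemma extLin_L (p : FormalPoint C.e R) (ψ : C.DiffOp) (n : ℕ) (hn : ∀ x ∈ C.J ^ n, ψ x = 0)
    (r : R) (x : Ext p n) : extLin p ψ n hn (extL p n r * x) = r * extLin p ψ n hn x :=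
  Pushout.lin_inl_mul _ _ _ _

lemma extLin_R (p : FormalPoint C.e R) (ψ : C.DiffOp) (n : ℕ) (hn : ∀ x ∈ C.J ^ n, ψ x = 0)
    (x : F) : extLin p ψ n hn ((extR p n).hom x) = p.hom (C.t (ψ x)) :=
  Pushout.lin_inr _ _ _

lemma ext_induction {p : FormalPoint C.e R} {n : ℕ} {P : Ext p n → Prop} (zero : P 0)
    (mul : ∀ r x, P (extL p n r * (extR p n).hom x)) (add : ∀ x y, P x → P y → P (x + y))
    (x : Ext p n) : P x := by
  induction x using Pushout.induction with
  | zero => exact zero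
  | mul r x =>
    obtain ⟨x, rfl⟩ := Ideal.Quotient.mkₐ_surjective ℂ _ x
    exact mul r x
  | add x y hx hy => exact add x y hx hy

lemma exists_desc (p : FormalPoint C.e R) (n : ℕ) (i : R →ₐ[ℂ] T) (q : FormalPoint C.e T)
    (hqn : ∀ x ∈ C.J ^ n, q.hom x = 0) (h : ∀ a, (p.map i).hom (C.t a) = q.hom (C.s a)) :
    ∃ b : Ext p n →ₐ[ℂ] T, (∀ r, b (extL p n r) = i r) ∧ (extR p n).map b = q := by
  let j : F ⧸ C.J ^ n →ₐ[ℂ] T := Ideal.Quotient.liftₐ (C.J ^ n) q.hom hqn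
  exact ⟨Pushout.desc (f := p.hom.comp C.t) (g := (C.quotPoint n).hom.comp C.s) i j h,
    Pushout.desc_inl i j h, FormalPoint.ext fun x => Pushout.desc_inr i j h _⟩

/-- Auxiliary definition for `act`. -/
def actAux (p : FormalPoint C.e R) (ψ : C.DiffOp) (n : ℕ) (hn : ∀ x ∈ C.J ^ n, ψ x = 0) : F →+ R :=
  (extLin p ψ n hn).comp
    ((C.comp (p.map (extL p n)) (extR p n) (ext_comm p n)).hom : F →+ Ext p n)

lemma actAux_eq (p : FormalPoint C.e R) (ψ : C.DiffOp) (n : ℕ) (hn : ∀ x ∈ C.J ^ n, ψ x = 0)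
    (i : R →ₐ[ℂ] T) (q : FormalPoint C.e T) (hqn : ∀ x ∈ C.J ^ n, q.hom x = 0)
    (h : ∀ a, (p.map i).hom (C.t a) = q.hom (C.s a)) (l : T →+ R)
    (hl : ∀ r x, l (i r * x) = r * l x) (hq : ∀ x, l (q.hom x) = p.hom (C.t (ψ x))) (x : F) :
    actAux p ψ n hn x = l ((C.comp (p.map i) q h).hom x) := by
  obtain ⟨b, hb, e2⟩ := exists_desc p n i q hqn h
  have e1 : (p.map (extL p n)).map b = p.map i := FormalPoint.ext fun x => hb _
  have e3 := C.map_comp b (p.map (extL p n)) (extR p n) (ext_comm p n)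
    (by rw [e1, e2]; exact h)
  rw [C.comp_congr _ e1 e2] at e3
  rw [← e3]
  have e4 : ∀ z, extLin p ψ n hn z = l (b z) := by
    intro z
    induction z using ext_induction with
    | zero => simp
    | mul r y =>
      rw [extLin_L, extLin_R, map_mul, hb, hl, ← FormalPoint.map_hom_apply, e2, hq]
    | add y z hy hz => rw [map_add, map_add, map_add, hy, hz]
  exact e4 _

/-- The operator `F → R` that is defined by a differential operator `ψ` and an `R`-point `p`: it is
`(p ⊗ ψ) ∘ m`, where `m : F → F ⊗_A F / J ^ n` is the dual of the composition and
`p ⊗ ψ : F ⊗_A F / J ^ n → R` sends `x ⊗ y` to `p (x t (ψ y))`; here `n` is any integer such that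
`ψ` vanishes on `J ^ n`. -/
noncomputable def act (p : FormalPoint C.e R) (ψ : C.DiffOp) : F →+ R :=
  actAux p ψ ψ.exists_pow.choose ψ.exists_pow.choose_spec

lemma act_eq_actAux (p : FormalPoint C.e R) (ψ : C.DiffOp) (n : ℕ)
    (hn : ∀ x ∈ C.J ^ n, ψ x = 0) : act p ψ = actAux p ψ n hn := by
  have key : ∀ (n m : ℕ) (_ : m ≤ n) (hn : ∀ x ∈ C.J ^ n, ψ x = 0)
      (hm : ∀ x ∈ C.J ^ m, ψ x = 0), actAux p ψ n hn = actAux p ψ m hm := by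
    intro n m hnm hn hm
    ext x
    refine actAux_eq p ψ n hn (extL p m) (extR p m) (fun x hx => ?_) (ext_comm p m)
      (extLin p ψ m hm) (extLin_L p ψ m hm) (extLin_R p ψ m hm) x
    rw [extR, FormalPoint.map_hom_apply, C.quotPoint_eq_zero hnm hx, map_zero]
  exact (key (max n _) _ (le_max_right _ _)
    (fun x hx => hn x (Ideal.pow_le_pow_right (le_max_left _ _) hx)) _).symm.trans
    (key _ _ (le_max_left _ _) _ _)

lemma act_eq (p : FormalPoint C.e R) (ψ : C.DiffOp)
    (i : R →ₐ[ℂ] T) (q : FormalPoint C.e T)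
    (h : ∀ a, (p.map i).hom (C.t a) = q.hom (C.s a)) (l : T →+ R)
    (hl : ∀ r x, l (i r * x) = r * l x) (hq : ∀ x, l (q.hom x) = p.hom (C.t (ψ x))) (x : F) :
    act p ψ x = l ((C.comp (p.map i) q h).hom x) := by
  obtain ⟨n, hn⟩ := ψ.exists_pow
  obtain ⟨m, hm⟩ := q.exists_pow
  rw [act_eq_actAux p ψ (max n m)
    (fun x hx => hn x (Ideal.pow_le_pow_right (le_max_left _ _) hx))]
  exact actAux_eq p ψ _ _ i q
    (fun x hx => hm x (Ideal.pow_le_pow_right (le_max_right _ _) hx)) h l hl hq x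

lemma act_eq_extLin (p : FormalPoint C.e R) (ψ : C.DiffOp) (n : ℕ)
    (hn : ∀ x ∈ C.J ^ n, ψ x = 0) (x : F) : act p ψ x =
      extLin p ψ n hn ((C.comp (p.map (extL p n)) (extR p n) (ext_comm p n)).hom x) := by
  rw [act_eq_actAux p ψ n hn]
  rfl

lemma act_s (p : FormalPoint C.e R) (ψ : C.DiffOp) (a : A) (x : F) :
    act p ψ (C.s a * x) = p.hom (C.s a) * act p ψ x := by
  obtain ⟨n, hn⟩ := ψ.exists_pow
  rw [act_eq_extLin p ψ n hn, act_eq_extLin p ψ n hn, map_mul, C.comp_s]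
  exact extLin_L p ψ n hn _ _

lemma exists_pow_act (p : FormalPoint C.e R) (ψ : C.DiffOp) :
    ∃ n : ℕ, ∀ x ∈ C.J ^ n, act p ψ x = 0 := by
  obtain ⟨n, hn⟩ := ψ.exists_pow
  obtain ⟨m, hm⟩ := (C.comp (p.map (extL p n)) (extR p n) (ext_comm p n)).exists_pow
  exact ⟨m, fun x hx => by rw [act_eq_extLin p ψ n hn, hm x hx, map_zero]⟩

lemma act_add (p : FormalPoint C.e R) (φ ψ : C.DiffOp) (x : F) :
    act p (φ + ψ) x = act p φ x + act p ψ x := by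
  obtain ⟨n, hn⟩ := φ.exists_pow
  obtain ⟨m, hm⟩ := ψ.exists_pow
  have hn' : ∀ x ∈ C.J ^ (max n m), φ x = 0 := fun x hx =>
    hn x (Ideal.pow_le_pow_right (le_max_left _ _) hx)
  have hm' : ∀ x ∈ C.J ^ (max n m), ψ x = 0 := fun x hx =>
    hm x (Ideal.pow_le_pow_right (le_max_right _ _) hx)
  rw [act_eq_extLin p φ _ hn', act_eq_extLin p ψ _ hm']
  refine act_eq p (φ + ψ) _ _ (ext_comm p _) (extLin p φ _ hn' + extLin p ψ _ hm')
    (fun r x => ?_) (fun x => ?_) x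
  · rw [AddMonoidHom.add_apply, AddMonoidHom.add_apply, extLin_L, extLin_L, mul_add]
  · rw [AddMonoidHom.add_apply, DiffOp.add_apply, map_add, map_add, extLin_R, extLin_R]

lemma act_map (g : R →ₐ[ℂ] T) (p : FormalPoint C.e R) (ψ : C.DiffOp) (x : F) :
    act (p.map g) ψ x = g (act p ψ x) := by
  obtain ⟨n, hn⟩ := ψ.exists_pow
  have h : ∀ a, (p.map ((extL (p.map g) n).comp g)).hom (C.t a) =
      (extR (p.map g) n).hom (C.s a) := ext_comm (p.map g) n
  obtain ⟨b, hb, e2⟩ := exists_desc p n ((extL (p.map g) n).comp g) (extR (p.map g) n)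
    (fun x hx => by rw [extR, FormalPoint.map_hom_apply, C.quotPoint_eq_zero le_rfl hx, map_zero]) h
  have e1 : (p.map (extL p n)).map b = (p.map g).map (extL (p.map g) n) :=
    FormalPoint.ext fun x => hb _
  have e3 := C.map_comp b (p.map (extL p n)) (extR p n) (ext_comm p n)
    (by rw [e1, e2]; exact h)
  rw [C.comp_congr _ e1 e2] at e3
  rw [act_eq_extLin p ψ n hn, act_eq_extLin (p.map g) ψ n hn, ← e3, FormalPoint.map_hom_apply]
  generalize (C.comp (p.map (extL p n)) (extR p n) (ext_comm p n)).hom x = z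
  induction z using ext_induction with
  | zero => simp
  | mul r y =>
    rw [map_mul, hb, ← FormalPoint.map_hom_apply b, e2, AlgHom.comp_apply, extLin_L, extLin_L,
      extLin_R, extLin_R, map_mul, FormalPoint.map_hom_apply]
  | add y z hy hz => simp only [map_add, hy, hz]

lemma act_e (ψ : C.DiffOp) (p : FormalPoint C.e A) (hp : ∀ x, p.hom x = C.e x) (x : F) :
    act p ψ x = ψ x := by
  obtain ⟨n, hn⟩ := ψ.exists_pow
  have h : ∀ a, (p.map ((C.quotPoint n).hom.comp C.s)).hom (C.t a) =
      (C.quotPoint n).hom (C.s a) := fun a => by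
    rw [FormalPoint.map_hom_apply, hp, C.e_t, AlgHom.comp_apply]
  have e : p.map ((C.quotPoint n).hom.comp C.s) = .unit C.e ((C.quotPoint n).hom.comp C.s) :=
    FormalPoint.ext fun x => by rw [FormalPoint.map_hom_apply, hp]; rfl
  rw [act_eq p ψ ((C.quotPoint n).hom.comp C.s) (C.quotPoint n) h (ψ.bar n hn) (bar_s ψ n hn)
    (fun x => by rw [hp, C.e_t]; exact ψ.bar_mk n hn x), C.comp_congr _ e rfl, C.unit_comp]
  exact ψ.bar_mk n hn x

/-- The operator of multiplication by an element of `A`. -/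
def ofA (C : FormalCategory A F) (b : A) : C.DiffOp :=
  ⟨(AddMonoidHom.mulLeft b).comp (C.e : F →+ A), fun a x => by simp [C.e_s]; ring, 1, fun x hx => by
    have : C.e x = 0 := by simpa using hx
    simp [this]⟩

@[simp] lemma ofA_apply (b : A) (x : F) : C.ofA b x = b * C.e x := rfl

lemma act_ofA (p : FormalPoint C.e R) (b : A) (x : F) :
    act p (C.ofA b) x = p.hom (C.t b) * p.hom x := by
  have h : ∀ a, (p.map (AlgHom.id ℂ R)).hom (C.t a) =
      (FormalPoint.unit C.e (p.hom.comp C.t)).hom (C.s a) := fun a =>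
    congrArg (fun y => p.hom (C.t y)) (C.e_s a).symm
  rw [act_eq p _ (AlgHom.id ℂ R) (.unit C.e (p.hom.comp C.t)) h
    (AddMonoidHom.mulLeft (p.hom (C.t b))) (fun r x => mul_left_comm _ _ _) (fun x => ?_)]
  · exact congrArg (fun q : FormalPoint C.e R => p.hom (C.t b) * q.hom x) (C.comp_unit p h)
  · rw [ofA_apply, map_mul, map_mul]
    rfl

end Act

namespace DiffOp

variable {C}

/-- Auxiliary definition for the product of differential operators. -/
noncomputable def mulAux (φ ψ : C.DiffOp) (n : ℕ) (hn : ∀ x ∈ C.J ^ n, φ x = 0) : F →+ A :=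
  (φ.bar n hn).comp (act (C.quotPoint n) ψ)

lemma bar_surj {n m : ℕ} (h : n ≤ m) (φ : C.DiffOp) (hn : ∀ x ∈ C.J ^ n, φ x = 0)
    (hm : ∀ x ∈ C.J ^ m, φ x = 0) : ∃ g : F ⧸ C.J ^ m →ₐ[ℂ] F ⧸ C.J ^ n,
      (C.quotPoint m).map g = C.quotPoint n ∧ ∀ x, φ.bar n hn (g x) = φ.bar m hm x := by
  refine ⟨Ideal.Quotient.liftₐ (C.J ^ m) (C.quotPoint n).hom
    (fun x hx => C.quotPoint_eq_zero h hx), FormalPoint.ext fun x => rfl, fun x => ?_⟩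
  obtain ⟨x, rfl⟩ := Ideal.Quotient.mkₐ_surjective ℂ _ x
  rfl

lemma mulAux_eq (φ ψ : C.DiffOp) (n m : ℕ) (hn : ∀ x ∈ C.J ^ n, φ x = 0)
    (hm : ∀ x ∈ C.J ^ m, φ x = 0) : mulAux φ ψ n hn = mulAux φ ψ m hm := by
  have key : ∀ (n m : ℕ) (_ : n ≤ m) (hn : ∀ x ∈ C.J ^ n, φ x = 0)
      (hm : ∀ x ∈ C.J ^ m, φ x = 0), mulAux φ ψ n hn = mulAux φ ψ m hm := by
    intro n m h hn hm
    obtain ⟨g, hg, hg'⟩ := bar_surj h φ hn hm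
    ext x
    change φ.bar n hn (act (C.quotPoint n) ψ x) = φ.bar m hm (act (C.quotPoint m) ψ x)
    rw [← hg, act_map, hg']
  rcases le_total n m with h | h
  · exact key n m h hn hm
  · exact (key m n h hm hn).symm

lemma mulAux_s (φ ψ : C.DiffOp) (n : ℕ) (hn : ∀ x ∈ C.J ^ n, φ x = 0) (a : A) (x : F) :
    mulAux φ ψ n hn (C.s a * x) = a * mulAux φ ψ n hn x := by
  change φ.bar n hn (act _ _ _) = a * φ.bar n hn (act _ _ _)
  rw [act_s]
  exact bar_s φ n hn _ _

lemma exists_pow_mulAux (φ ψ : C.DiffOp) (n : ℕ) (hn : ∀ x ∈ C.J ^ n, φ x = 0) :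
    ∃ m : ℕ, ∀ x ∈ C.J ^ m, mulAux φ ψ n hn x = 0 :=
  (exists_pow_act (C.quotPoint n) ψ).imp fun m hm x hx => by
    change φ.bar n hn (act _ _ _) = 0
    rw [hm x hx, map_zero]

/-- The product of differential operators: `φ ψ` is the composite of
`(id ⊗ ψ) ∘ m : F → F / J ^ n` with the map `F / J ^ n → A` induced by `φ`, where `m` is the dual of
the composition and `n` is any integer such that `φ` vanishes on `J ^ n`. -/
noncomputable instance : Mul C.DiffOp where
  mul φ ψ := ⟨mulAux φ ψ φ.exists_pow.choose φ.exists_pow.choose_spec,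
    mulAux_s φ ψ _ _, exists_pow_mulAux φ ψ _ _⟩

lemma mul_apply (φ ψ : C.DiffOp) (n : ℕ) (hn : ∀ x ∈ C.J ^ n, φ x = 0) (x : F) :
    (φ * ψ) x = φ.bar n hn (act (C.quotPoint n) ψ x) :=
  DFunLike.congr_fun
    (mulAux_eq φ ψ φ.exists_pow.choose n φ.exists_pow.choose_spec hn) x

lemma act_mul {R : Type u} [CommRing R] [Algebra ℂ R] (p : FormalPoint C.e R) (φ ψ : C.DiffOp)
    (n : ℕ) (hn : ∀ x ∈ C.J ^ n, φ x = 0) (x : F) :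
    act p (φ * ψ) x = extLin p φ n hn
      (act (C.comp (p.map (extL p n)) (extR p n) (ext_comm p n)) ψ x) := by
  obtain ⟨m, hm⟩ := ψ.exists_pow
  set r := C.comp (p.map (extL p n)) (extR p n) (ext_comm p n) with hr
  have hq : ∀ a, ((extR p n).map (extL r m)).hom (C.t a) = (extR r m).hom (C.s a) := fun a => by
    rw [← ext_comm r m, FormalPoint.map_hom_apply, FormalPoint.map_hom_apply, hr, C.comp_t]
  have hpq : ∀ a, ((p.map (extL p n)).map (extL r m)).hom (C.t a) =
      ((extR p n).map (extL r m)).hom (C.s a) := fun a =>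
    congrArg (extL r m) (ext_comm p n a)
  have hp : ∀ a, (p.map ((extL r m).comp (extL p n))).hom (C.t a) =
      (C.comp ((extR p n).map (extL r m)) (extR r m) hq).hom (C.s a) := fun a => by
    rw [C.comp_s]
    exact hpq a
  have e1 : C.comp (p.map ((extL r m).comp (extL p n)))
      (C.comp ((extR p n).map (extL r m)) (extR r m) hq) hp =
      C.comp (r.map (extL r m)) (extR r m) (ext_comm r m) := by
    have e2 : r.map (extL r m) =
        C.comp ((p.map (extL p n)).map (extL r m)) ((extR p n).map (extL r m)) hpq :=
      C.map_comp _ _ _ _ _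
    rw [C.comp_congr _ e2 rfl]
    exact (C.assoc _ _ _ _ _ _ _).symm
  rw [act_eq p (φ * ψ) ((extL r m).comp (extL p n)) (C.comp ((extR p n).map (extL r m)) (extR r m) hq)
    hp ((extLin p φ n hn).comp (extLin r ψ m hm)) (fun y z => ?_) (fun y => ?_), e1,
    act_eq_extLin r ψ m hm]
  · rfl
  · rw [AddMonoidHom.comp_apply, AddMonoidHom.comp_apply, AlgHom.comp_apply, extLin_L, extLin_L]
  · have e3 := act_eq (extR p n) ψ (extL r m) (extR r m) hq (extLin r ψ m hm) (extLin_L r ψ m hm)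
      (fun x => by rw [extLin_R, hr, C.comp_t]) y
    rw [AddMonoidHom.comp_apply, ← e3, mul_apply φ ψ n hn, extR, act_map]
    generalize act (C.quotPoint n) ψ y = z
    obtain ⟨z, rfl⟩ := Ideal.Quotient.mkₐ_surjective ℂ _ z
    exact extLin_R p φ n hn z

lemma mul_assoc' (φ ψ χ : C.DiffOp) : φ * ψ * χ = φ * (ψ * χ) := by
  ext x
  obtain ⟨n, hn⟩ := φ.exists_pow
  obtain ⟨m, hm⟩ := ψ.exists_pow
  rw [mul_apply φ (ψ * χ) n hn, act_mul _ _ _ m hm]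
  set p := C.quotPoint n
  set r := C.comp (p.map (extL p m)) (extR p m) (ext_comm p m) with hr
  have key : ∀ y, φ.bar n hn (extLin p ψ m hm (r.hom y)) = (φ * ψ) y := fun y => by
    rw [mul_apply φ ψ n hn, act_eq_extLin _ ψ m hm]
  obtain ⟨N, hN⟩ := (φ * ψ).exists_pow
  obtain ⟨M, hM⟩ := r.exists_pow
  have hN' : ∀ x ∈ C.J ^ (max N M), (φ * ψ) x = 0 := fun x hx =>
    hN x (Ideal.pow_le_pow_right (le_max_left _ _) hx)
  let g : F ⧸ C.J ^ (max N M) →ₐ[ℂ] Ext p m := Ideal.Quotient.liftₐ _ r.hom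
    fun x hx => hM x (Ideal.pow_le_pow_right (le_max_right _ _) hx)
  have hg : (C.quotPoint (max N M)).map g = r := FormalPoint.ext fun x => rfl
  rw [mul_apply (φ * ψ) χ _ hN', ← hg, act_map]
  generalize act (C.quotPoint (max N M)) χ x = y
  obtain ⟨y, rfl⟩ := Ideal.Quotient.mkₐ_surjective ℂ _ y
  exact (key y).symm

lemma ofA_mul (a : A) (ψ : C.DiffOp) (x : F) : (C.ofA a * ψ) x = a * ψ x := by
  have h1 : ∀ x ∈ C.J ^ 1, C.ofA a x = 0 := fun x hx => by
    have : C.e x = 0 := by simpa using hx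
    simp [this]
  let g : F ⧸ C.J ^ 1 →ₐ[ℂ] A := Ideal.Quotient.liftₐ _ C.e fun x hx => by simpa using hx
  have key : ∀ z, (C.ofA a).bar 1 h1 z = a * g z := fun z => by
    obtain ⟨z, rfl⟩ := Ideal.Quotient.mkₐ_surjective ℂ _ z
    rfl
  rw [mul_apply _ ψ 1 h1, key, ← act_map, act_e ψ _ fun x => rfl]

lemma mul_ofA (φ : C.DiffOp) (a : A) (x : F) : (φ * C.ofA a) x = φ (C.t a * x) := by
  obtain ⟨n, hn⟩ := φ.exists_pow
  rw [mul_apply φ _ n hn, act_ofA, ← map_mul]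
  rfl

lemma mul_add' (φ ψ χ : C.DiffOp) : φ * (ψ + χ) = φ * ψ + φ * χ := by
  ext x
  obtain ⟨n, hn⟩ := φ.exists_pow
  rw [add_apply, mul_apply φ _ n hn, mul_apply φ _ n hn, mul_apply φ _ n hn, act_add, map_add]

lemma add_mul' (φ ψ χ : C.DiffOp) : (φ + ψ) * χ = φ * χ + ψ * χ := by
  ext x
  obtain ⟨n, hn⟩ := φ.exists_pow
  obtain ⟨m, hm⟩ := ψ.exists_pow
  have hn' : ∀ x ∈ C.J ^ (max n m), φ x = 0 := fun x hx =>
    hn x (Ideal.pow_le_pow_right (le_max_left _ _) hx)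
  have hm' : ∀ x ∈ C.J ^ (max n m), ψ x = 0 := fun x hx =>
    hm x (Ideal.pow_le_pow_right (le_max_right _ _) hx)
  have h : ∀ x ∈ C.J ^ (max n m), (φ + ψ) x = 0 := fun x hx => by
    rw [add_apply, hn' x hx, hm' x hx, add_zero]
  rw [add_apply, mul_apply _ _ _ h, mul_apply _ _ _ hn', mul_apply _ _ _ hm']
  generalize act (C.quotPoint (max n m)) χ x = y
  obtain ⟨y, rfl⟩ := Ideal.Quotient.mkₐ_surjective ℂ _ y
  rfl

noncomputable instance : Ring C.DiffOp where
  __ := (inferInstance : AddCommGroup C.DiffOp)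
  __ := (inferInstance : Mul C.DiffOp)
  one := C.ofA 1
  one_mul ψ := by
    ext x
    exact (ofA_mul 1 ψ x).trans (one_mul _)
  mul_one φ := by
    ext x
    refine (mul_ofA φ 1 x).trans ?_
    rw [map_one, one_mul]
  left_distrib := mul_add'
  right_distrib := add_mul'
  zero_mul φ := by
    have := add_mul' 0 0 φ
    rwa [add_zero, left_eq_add] at this
  mul_zero φ := by
    have := mul_add' φ 0 0
    rwa [add_zero, left_eq_add] at this
  mul_assoc := mul_assoc'

lemma one_apply (x : F) : (1 : C.DiffOp) x = C.e x := one_mul (C.e x)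

/-- The inclusion `A → L`. -/
def ofARingHom (C : FormalCategory A F) : A →+* C.DiffOp where
  toFun := C.ofA
  map_one' := rfl
  map_zero' := by ext x; simp
  map_add' a b := by ext x; simp [add_mul]
  map_mul' a b := by ext x; simp [ofA_mul, mul_assoc]

noncomputable instance : Algebra ℂ C.DiffOp :=
  ((ofARingHom C).comp (algebraMap ℂ A)).toAlgebra' fun c φ => by
    ext x
    refine (ofA_mul _ φ x).trans ((mul_ofA φ _ x).trans ?_).symm
    rw [AlgHom.commutes, ← C.s.commutes, map_s]

end DiffOp

/-- The homomorphism from `A` to the ring of differential operators. -/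
noncomputable def incl : A →ₐ[ℂ] C.DiffOp where
  __ := DiffOp.ofARingHom C
  commutes' _ := rfl

end FormalCategory

/-! ### The weakification functors on bounded, locally free and perfect complexes -/

section Main

variable {k : Type w} [Field k] {A L : Type u} [CommRing A] [Algebra k A] [Ring L] [Algebra k L]
  (ι : A →ₐ[k] L)

/-- The `A`-perfect bounded complexes of locally free `L`-modules are perfect complexes of locally
free `A`-modules. -/
def ResPreservesBplf : Prop :=
  ∀ E : CochainComplex (ModuleCat.{u} L) ℤ, IsBplfOver ι E → IsBplf (resCpx ι E)

variable {ι} (h : ResPreservesBplf.{w, u} ι)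

/-- The weakification functor with values in normalized weak complexes. -/
noncomputable def weakifyBplf₀ : DGFunctor (dgCpxBplfOver ι) (wpxBplf₀ ι) :=
  (weakify₀ ι).restrict h

/-- The weakification functor. -/
noncomputable def weakifyBplf : DGFunctor (dgCpxBplfOver ι) (wpxBplf ι) :=
  (weakify ι).restrict h

/-- The projection from complexes of `L`-modules to complexes of `A`-modules. -/
noncomputable def strictProjBplf : DGFunctor (dgCpxBplfOver ι) (dgCpxBplf k A) :=
  (strictProj ι).restrict h

variable (ι)

/-- The projection from normalized weak complexes to complexes of `A`-modules. -/
noncomputable def wpxProjBplf₀ : DGFunctor (wpxBplf₀ ι) (dgCpxBplf k A) :=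
  (wpxProj₀ ι).restrict fun _ hx => hx

/-- The projection from weak complexes to complexes of `A`-modules. -/
noncomputable def wpxProjBplf : DGFunctor (wpxBplf ι) (dgCpxBplf k A) :=
  (wpxProj ι).restrict fun _ hx => hx

end Main

/-!
The functors are quasi-fully faithful because the complex of weak morphisms out of a complex of
projective `L`-modules is small. The words in `L` that occur in a weak morphism form a bar
construction. For a complex that is concentrated in one degree and consists of a direct summand of a
free module, inserting the coordinates of an element, as a new letter at the end of a word, is a
contracting homotopy of the complex of weak morphisms modulo the strict ones
(`ev_insertion_dQ`); bounded complexes follow by induction on the degree, which gives `qffAt_weakify`.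
Every weak morphism is cohomologous to a normalized one (`qffAt_wpx₀Incl`), so that the
statement for `wpx₀` follows from that for `wpx`.

For essential surjectivity, let `Y` be a weak complex. Free `L`-modules can be attached to a
complex `P` of `L`-modules with a weak morphism to `Y` (`exists_wpx_attach`): the obstruction to
extending the weak morphism over a free module in one degree is the obstruction for its
generators. As in the construction of a CW approximation, this gives from the top degree downwards a
complex `P` of free modules and a weak morphism to `Y` whose mapping cone is exact in high degrees
(`exists_isPartialResolution`). Below the degrees of `Y`, the cycles of `P` are successive syzygies
of an `L`-module that is projective over `A`. As these have bounded projective dimension over `L`,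
the cycles eventually become projective, and an Eilenberg swindle ends the resolution with a
bounded complex of free modules (`exists_resolution`). Its morphism to `Y` is a homotopy
equivalence over `A`, since all terms are projective, and hence an inner equivalence of weak
complexes: a weak inverse and the homotopies are constructed by successive approximation on the
length of words (`wpx_isInnerEquivalence`).

What remains are facts on modules over `L`. Elements of `A` act on `L` by locally nilpotent
commutators, so that localization at powers of `f ∈ A` satisfies the Ore condition. Locally, `L` is
free over `A` on the ordered monomials in derivations dual to local coordinates, the pairing with
monomials in the coordinates being triangular (`isLocallyFreeOver_restrictScalars`). The bound on the
projective dimension comes from a Koszul resolution `L ⊗ Hom (⋀ᵖ Ω, M)`, which is built step by step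
over the filtration by the order of operators, where `Ω = J / J²`
(`exists_hasProjectiveDimensionLT`). Finally, locally free modules of infinite rank are projective
(`projective_of_isLocallyFreeOver`): Kaplansky's dévissage (`projective_of_charts`) reduces this
to countably generated modules, where a Mittag-Leffler argument (`projective_of_countable_charts`)
works by induction on the projective dimension.
-/

/-! ### Evaluation of families of cochains -/

namespace WordCochain

section Evaluation

variable {k : Type w} [Field k] {L : Type*} {K K' K₁ K₂ : CochainComplex (ModuleCat.{v} k) ℤ}

/-- The value `q (u ; x)`. -/
noncomputable def ev {i : ℤ} (q : WordCochain L K K₁ i) (u : List L) (n : ℤ)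
    (hn : n + u.length = i) (p r : ℤ) (h : p + n = r) (x : K.X p) : K₁.X r :=
  ((q.v u n hn).v p r h).hom x

section

variable {i : ℤ} (q q' : WordCochain L K K₁ i) (u : List L) (n : ℤ) (hn : n + u.length = i)
  (p r : ℤ) (h : p + n = r) (x : K.X p)

lemma ev_add : (q + q').ev u n hn p r h x = q.ev u n hn p r h x + q'.ev u n hn p r h x := rfl

lemma ev_sub : (q - q').ev u n hn p r h x = q.ev u n hn p r h x - q'.ev u n hn p r h x := rfl

lemma ev_neg : (-q).ev u n hn p r h x = -q.ev u n hn p r h x := rfl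

lemma ev_units_smul (t : ℤˣ) : (t • q).ev u n hn p r h x = t • q.ev u n hn p r h x := by
  rcases Int.units_eq_one_or t with rfl | rfl
  · simp
  · simp [ev_neg]

lemma ev_map_zero : q.ev u n hn p r h 0 = 0 := map_zero ((q.v u n hn).v p r h).hom

lemma ev_map_sum {ι' : Type*} (s : Finset ι') (y : ι' → K.X p) :
    q.ev u n hn p r h (∑ j ∈ s, y j) = ∑ j ∈ s, q.ev u n hn p r h (y j) :=
  map_sum ((q.v u n hn).v p r h).hom y s

variable {q q'} in
lemma ext_ev (H : ∀ u n hn p r h x, q.ev u n hn p r h x = q'.ev u n hn p r h x) : q = q' := by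
  ext1 u n hn
  ext p r h x
  exact H u n hn p r h x

end

lemma ev_comp {a b c : ℤ} (f : WordCochain L K K₁ a) (g : WordCochain L K₁ K₂ b) (h : a + b = c)
    (u : List L) (n : ℤ) (hn) (p r : ℤ) (hp : p + n = r) (x : K.X p) :
    (f.comp g h).ev u n hn p r hp x = ∑ j ∈ Finset.range (u.length + 1), (a * j).negOnePow •
      g.ev (u.take j) (b - (u.take j).length) (by omega) (p + (a - (u.drop j).length)) r
        (by have h3 := congrArg List.length (List.take_append_drop j u)
            rw [List.length_append] at h3
            omega)
        (f.ev (u.drop j) (a - (u.drop j).length) (by omega) p _ rfl x) := by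
  have key : ∀ (s : Finset ℕ) (F : ℕ → Cochain K K₂ n),
      ((∑ j ∈ s, F j).v p r hp).hom x = ∑ j ∈ s, ((F j).v p r hp).hom x := by
    intro s F
    induction s using Finset.cons_induction with
    | empty => rfl
    | cons a s ha ih =>
      rw [Finset.sum_cons, Finset.sum_cons, Cochain.add_v, ModuleCat.hom_add, LinearMap.add_apply,
        ih]
  have key2 : ∀ (t : ℤˣ) (z : Cochain K K₂ n), ((t • z).v p r hp).hom x = t • (z.v p r hp).hom x := by
    intro t z
    rcases Int.units_eq_one_or t with rfl | rfl
    · simp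
    · simp
  rw [ev, comp, mk_v, key]
  refine Finset.sum_congr rfl fun j _ => ?_
  rw [key2]
  congr 1

lemma ev_comp_nil {a b c : ℤ} (f : WordCochain L K K₁ a) (g : WordCochain L K₁ K₂ b)
    (h : a + b = c) (n : ℤ) (hn) (p r : ℤ) (hp : p + n = r) (s : ℤ) (hs : p + a = s)
    (x : K.X p) (h₂ : s + b = r) :
    (f.comp g h).ev [] n hn p r hp x =
      g.ev [] b (by simp) s r h₂ (f.ev [] a (by simp) p s hs x) := by
  subst hs
  rw [ev, comp_nil (n₁ := a) (n₂ := b) (h₁ := by simp) (h₂ := by simp) (h₁₂ := by simp at hn; omega),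
    Cochain.comp_v _ _ _ p (p + a) r rfl (by omega)]
  rfl

lemma ev_delta {i j : ℤ} (h : i + 1 = j) (q : WordCochain L K K₁ i) (u : List L) (n n' : ℤ) (hn hn')
    (hnn : n' + 1 = n) (p r p' r' : ℤ) (hp : p + n = r) (hp' : p + 1 = p') (hr : r' + 1 = r)
    (x : K.X p) : (q.delta h).ev u n hn p r hp x =
      (K₁.d r' r).hom (q.ev u n' hn' p r' (by omega) x) +
      n.negOnePow • q.ev u n' hn' p' r (by omega) ((K.d p p').hom x) := by
  rw [ev, delta_v (n' := n') (hn' := hn') (hnn := hnn), δ_v n' n hnn _ p r hp r' p' (by omega) hp']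
  rcases Int.units_eq_one_or n.negOnePow with hs | hs
  · simp [hs, ev]
  · simp [hs, ev]

section Hochschild

variable [Mul L]

/-- The Hochschild operator and products from the left are computed on the words, and so commute
with changing the variable `x`. -/
lemma ev_hochschild_congr {ι' : Type*} (s : Finset ι') {i j : ℤ} (h : i + 1 = j)
    (f : WordCochain L K K₁ i) (g : ι' → WordCochain L K' K₁ i) (p : ℤ) (x : K.X p)
    (y : ι' → K'.X p) (H : ∀ u n hn r hr, f.ev u n hn p r hr x =
      ∑ m ∈ s, (g m).ev u n hn p r hr (y m)) (u : List L) (n : ℤ) (hn) (r : ℤ) (hr) :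
    (f.hochschild h).ev u n hn p r hr x =
      ∑ m ∈ s, ((g m).hochschild h).ev u n hn p r hr (y m) := by
  induction u generalizing i j with
  | nil => exact Finset.sum_const_zero.symm
  | cons l u ih =>
    cases u with
    | nil => exact Finset.sum_const_zero.symm
    | cons l' u =>
      have hn' : n + (u.length + 1 + 1) = j := by simpa using hn
      have e : ∀ {K : CochainComplex (ModuleCat.{v} k) ℤ} (f : WordCochain L K K₁ i) (x : K.X p),
        (f.hochschild h).ev (l :: l' :: u) n hn p r hr x =
          f.ev ((l * l') :: u) n (by simp; omega) p r hr x -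
          ((f.shift (sub_add_cancel i 1) l).hochschild (sub_add_cancel i 1)).ev (l' :: u) n
            (by simp; omega) p r hr x := by
        intro K f x
        rw [ev, hochschild_cons_cons h (sub_add_cancel i 1) _ l l' u n hn (by simp; omega)
          (by simp; omega)]
        rfl
      rw [e, Finset.sum_congr rfl fun m _ => e (g m) (y m), Finset.sum_sub_distrib, H,
        ih (sub_add_cancel i 1) (f.shift _ l) (fun m => (g m).shift _ l)
          (fun u n hn r hr => H (l :: u) n (by rw [List.length_cons]; push_cast; omega) r hr)]

end Hochschild

lemma ev_comp_congr {ι' : Type*} (s : Finset ι') {a b c : ℤ} (h : a + b = c)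
    (f : WordCochain L K K₁ a) (g : ι' → WordCochain L K' K₁ a) (φ : WordCochain L K₁ K₂ b)
    (p : ℤ) (x : K.X p)
    (y : ι' → K'.X p) (H : ∀ u n hn r hr, f.ev u n hn p r hr x =
      ∑ m ∈ s, (g m).ev u n hn p r hr (y m)) (u : List L) (n : ℤ) (hn) (r : ℤ) (hr) :
    (f.comp φ h).ev u n hn p r hr x =
      ∑ m ∈ s, ((g m).comp φ h).ev u n hn p r hr (y m) := by
  rw [ev_comp, Finset.sum_congr rfl fun m _ => ev_comp (g m) φ h u n hn p r hr (y m),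
    Finset.sum_comm]
  refine Finset.sum_congr rfl fun j _ => ?_
  rw [H, ev_map_sum, Finset.smul_sum]

end Evaluation

section LastLetter

variable {C : Type*} [Category* C] [Preadditive C] {L : Type*} [Ring L]
  {K K₁ K₂ : CochainComplex C ℤ}

set_option linter.unusedSectionVars false

/-- The family `± q (-, l ; -)`, with the sign `(-1) ^ k` on the words of length `k`. -/
def lastLetter {i j : ℤ} (h : i + 1 = j) (l : L) (q : WordCochain L K K₁ j) :
    WordCochain L K K₁ i :=
  .mk fun u n hn => (u.length : ℤ).negOnePow • q.v (u ++ [l]) n (by simp; omega)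

/-- The family `q (u₁, …, u_{k-1}, u_k l ; -)`. -/
def mulLast {i : ℤ} (q : WordCochain L K K₁ i) (l : L) : WordCochain L K K₁ i :=
  .mk fun u n hn => match u.getLast? with
    | none => 0
    | some x => if h : u = [] then 0 else q.v (u.dropLast ++ [x * l]) n (by
        have := List.length_pos_iff.2 h
        simp; omega)

lemma mulLast_nil {i : ℤ} (q : WordCochain L K K₁ i) (l : L) (n : ℤ) (hn) :
    (q.mulLast l).v [] n hn = 0 := rfl

lemma mulLast_append {i : ℤ} (q : WordCochain L K K₁ i) (l x : L) (u : List L) (n : ℤ)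
    (hn hn') : (q.mulLast l).v (u ++ [x]) n hn = q.v (u ++ [x * l]) n hn' := by
  have : ∀ (w : List L) (hw), w = u ++ [x] → (q.mulLast l).v w n hw = q.v (u ++ [x * l]) n hn' := by
    intro w hw e
    have e1 : w.getLast? = some x := by simp [e]
    have e2 : w ≠ [] := by simp [e]
    have e3 : w.dropLast = u := by simp [e]
    rw [mulLast, mk_v]
    split
    · simp_all
    · rename_i y hy
      obtain rfl : x = y := by simpa [e1] using hy
      rw [dif_neg e2]
      exact q.v_congr (by rw [e3]) n _
  exact this _ _ rfl

lemma lastLetter_delta {i j i' j' : ℤ} (h : i + 1 = j) (h' : i' + 1 = j') (hi : i + 1 = i')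
    (hj : j + 1 = j') (l : L)
    (q : WordCochain L K K₁ j) : (q.delta hj).lastLetter h' l = (q.lastLetter h l).delta hi := by
  ext1 u n hn
  rw [delta_v (n' := n - 1) (hn' := by omega) (hnn := by omega), lastLetter, lastLetter, mk_v, mk_v,
    delta_v (n' := n - 1) (hn' := by simp; omega) (hnn := by omega), δ_units_smul]

/-- Fixing the last letter anticommutes with the Hochschild differential, except for the term in which
the last letter is multiplied with the one before it. -/
lemma lastLetter_hochschild {i j l : ℤ} (h : i + 1 = j) (hj : j + 1 = l) (x : L)
    (q : WordCochain L K K₁ j) : (q.hochschild hj).lastLetter hj x =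
      - (q.lastLetter h x).hochschild h - q.mulLast x := by
  ext1 u
  induction u generalizing i j l with
  | nil =>
    intro n hn
    simp [lastLetter, hochschild_nil, hochschild_single, mulLast_nil]
  | cons y u ih =>
    intro n hn
    have hn' : n + (u.length + 1) = j := by simpa using hn
    cases u with
    | nil =>
      rw [sub_v, neg_v, hochschild_single, lastLetter, mk_v]
      change _ • (q.hochschild hj).v [y, x] n (by simp at hn ⊢; omega) =
        _ - (q.mulLast x).v ([] ++ [y]) n _
      rw [mulLast_append _ _ _ _ _ _ (by simpa using hn), hcc, hochschild_single]
      simp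
    | cons z u =>
      have hn' : n + (u.length + 1 + 1) = j := by simpa using hn
      have e := ih (i := i - 1) (j := i) (l := j) (by omega) (by omega) (q.shift h y) n
        (by simp; omega)
      rw [sub_v, neg_v] at e
      have e1 : ((q.hochschild hj).lastLetter hj x).v (y :: z :: u) n hn =
          -(q.lastLetter h x).v ((y * z) :: u) n (by simp; omega) +
          (((q.shift h y).hochschild h).lastLetter h x).v (z :: u) n (by simp; omega) := by
        simp only [lastLetter, mk_v]
        change _ • (q.hochschild hj).v (y :: z :: (u ++ [x])) n (by simp; omega) = _
        rw [hochschild_cons_cons hj h _ _ _ _ _ _ (by simp; omega) (by simp; omega)]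
        simp only [List.length_cons, Nat.cast_add, Nat.cast_one, Int.negOnePow_succ, neg_neg,
          smul_sub, Units.neg_smul, List.cons_append]
        abel
      have e2 : (q.lastLetter h x).shift (sub_add_cancel i 1) y =
          -(q.shift h y).lastLetter (sub_add_cancel i 1) x := by
        ext1 u n hn
        simp only [lastLetter, shift, mk_v, neg_v, List.length_cons, Nat.cast_add, Nat.cast_one,
          Int.negOnePow_succ, Units.neg_smul, List.cons_append]
      have e3 : (q.mulLast x).v (y :: z :: u) n hn =
          ((q.shift h y).mulLast x).v (z :: u) n (by simp; omega) := by
        obtain ⟨u', z', hu⟩ : ∃ u' z', z :: u = u' ++ [z'] :=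
          ⟨(z :: u).dropLast, (z :: u).getLast (by simp), (List.dropLast_append_getLast _).symm⟩
        have hl := congrArg List.length hu
        simp at hl
        rw [(q.mulLast x).v_congr (congrArg (y :: ·) hu), ((q.shift h y).mulLast x).v_congr hu]
        change (q.mulLast x).v ((y :: u') ++ [z']) n _ = _
        rw [mulLast_append _ _ _ _ _ _ (by simp; omega),
          mulLast_append _ _ _ _ _ _ (by simp; omega)]
        rfl
      rw [e1, e, sub_v, neg_v, hochschild_cons_cons h (sub_add_cancel i 1) _ _ _ _ _ _
        (by simp; omega) (by simp; omega), e2, hochschild_neg, e3, neg_v]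
      abel

/-- In a product, the last letter goes to the factor that is applied first, except in the last summand:
there that factor is evaluated on the empty word, and the other one takes all letters. -/
lemma lastLetter_comp {a b c a' c' : ℤ} (f : WordCochain L K K₁ a) (g : WordCochain L K₁ K₂ b)
    (h : a + b = c) (ha : a' + 1 = a) (hc : c' + 1 = c) (h' : a' + b = c') (l : L) (u : List L)
    (n n' : ℤ) (hn hn') (hnn : a + n' = n) : ((f.comp g h).lastLetter hc l).v u n hn =
      ((f.lastLetter ha l).comp g h').v u n hn +
      ((u.length : ℤ).negOnePow * (a * (u.length + 1)).negOnePow) •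
        (f.v [] a (by simp)).comp (g.v (u ++ [l]) n' hn') hnn := by
  rw [lastLetter, mk_v, comp, mk_v, comp, mk_v]
  rw [show (u ++ [l]).length + 1 = (u.length + 1) + 1 by simp, Finset.sum_range_succ, smul_add]
  congr 1
  · rw [Finset.smul_sum]
    refine Finset.sum_congr rfl fun j hj => ?_
    have hj' : j ≤ u.length := by have := Finset.mem_range.1 hj; omega
    have e1 : (u ++ [l]).take j = u.take j := by rw [List.take_append_of_le_length hj']
    have e2 : (u ++ [l]).drop j = u.drop j ++ [l] := by rw [List.drop_append_of_le_length hj']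
    have h3 := congrArg List.length (List.take_append_drop j u)
    rw [List.length_append] at h3
    have hj2 : (u.take j).length = j := by simp [hj']
    rw [compTerm_eq (n₁ := a' - ((u.drop j).length : ℤ)) (n₂ := b - ((u.take j).length : ℤ))
      (h₁ := by rw [e2]; simp; omega) (h₂ := by rw [e1]; omega) (h₁₂ := by omega),
      compTerm_eq (n₁ := a' - ((u.drop j).length : ℤ)) (n₂ := b - ((u.take j).length : ℤ))
      (h₁ := by omega) (h₂ := by omega) (h₁₂ := by omega), f.v_congr e2, g.v_congr e1,
      lastLetter, mk_v, Cochain.units_smul_comp, smul_smul, smul_smul, ← Int.negOnePow_add,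
      ← Int.negOnePow_add]
    congr 1
    rw [Int.negOnePow_eq_iff]
    refine ⟨j, ?_⟩
    have : (u.length : ℤ) = j + (u.drop j).length := by omega
    rw [this, ← ha]
    ring
  · rw [smul_smul]
    have e1 : (u ++ [l]).take (u.length + 1) = u ++ [l] := List.take_of_length_le (by simp)
    have e2 : (u ++ [l]).drop (u.length + 1) = [] := List.drop_of_length_le (by simp)
    rw [compTerm_eq (n₁ := a) (n₂ := n') (h₁ := by rw [e2]; simp) (h₂ := by rw [e1]; exact hn')
      (h₁₂ := by omega), f.v_congr e2, g.v_congr e1]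
    push_cast
    rfl

end LastLetter

end WordCochain

/-! ### Insertion of coordinates -/

section

variable {k : Type w} [Field k] {A L : Type u} [CommRing A] [Algebra k A] [Ring L] [Algebra k L]
  {ι : A →ₐ[k] L}

namespace WordCochain

/-- The conditions for a family to be balanced, in terms of its values on elements. -/
lemma IsBalanced.of_ev {E F : CochainComplex (ModuleCat.{v} A) ℤ} {i : ℤ}
    {q : WordCochain L (toBase k E) (toBase k F) i}
    (add : ∀ (l r : List L) (x y : L) (n : ℤ) (h h' h'') (p s : ℤ) (hp) (e : (toBase k E).X p),
      q.ev (l ++ (x + y) :: r) n h p s hp e =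
        q.ev (l ++ x :: r) n h' p s hp e + q.ev (l ++ y :: r) n h'' p s hp e)
    (inner : ∀ (l r : List L) (x y : L) (a : A) (n : ℤ) (h h') (p s : ℤ) (hp) (e : (toBase k E).X p),
      q.ev (l ++ (x * ι a) :: y :: r) n h p s hp e = q.ev (l ++ x :: (ι a * y) :: r) n h' p s hp e)
    (last : ∀ (l : List L) (x : L) (a : A) (n : ℤ) (h h') (p s : ℤ) (hp) (e : (toBase k E).X p),
      q.ev (l ++ [x * ι a]) n h p s hp e = q.ev (l ++ [x]) n h' p s hp (((mulHom k E a).f p).hom e))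
    (first : ∀ (r : List L) (x : L) (a : A) (n : ℤ) (h h') (p s : ℤ) (hp) (e : (toBase k E).X p),
      q.ev ((ι a * x) :: r) n h p s hp e = ((mulHom k F a).f s).hom (q.ev (x :: r) n h' p s hp e))
    (nil : ∀ (a : A) (n : ℤ) (h) (p s : ℤ) (hp) (e : (toBase k E).X p),
      ((mulHom k F a).f s).hom (q.ev [] n h p s hp e) = q.ev [] n h p s hp (((mulHom k E a).f p).hom e)) :
    q.IsBalanced ι (mulHom k E) (mulHom k F) where
  add l r x y n h h' h'' := by
    ext p s hp e
    exact add l r x y n h h' h'' p s hp e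
  inner l r x y a n h h' := by
    ext p s hp e
    exact inner l r x y a n h h' p s hp e
  last l x a n h h' := by
    ext p s hp e
    rw [Cochain.comp_v _ _ _ p p s (add_zero p) hp, Cochain.ofHom_v]
    exact last l x a n h h' p s hp e
  first r x a n h h' := by
    ext p s hp e
    rw [Cochain.comp_v _ _ _ p s s hp (add_zero s), Cochain.ofHom_v]
    exact first r x a n h h' p s hp e
  nil a n h := by
    ext p s hp e
    rw [Cochain.comp_v _ _ _ p s s hp (add_zero s), Cochain.comp_v _ _ _ p p s (add_zero p) hp,
      Cochain.ofHom_v, Cochain.ofHom_v]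
    exact nil a n h p s hp e

variable {E F : CochainComplex (ModuleCat.{v} A) ℤ} {i : ℤ}
    {q : WordCochain L (toBase k E) (toBase k F) i}

lemma IsBalanced.ev_add_letter (hq : q.IsBalanced ι (mulHom k E) (mulHom k F)) (l r : List L)
    (x y : L) (n : ℤ) (h h' h'') (p s : ℤ) (hp) (e : (toBase k E).X p) :
    q.ev (l ++ (x + y) :: r) n h p s hp e =
      q.ev (l ++ x :: r) n h' p s hp e + q.ev (l ++ y :: r) n h'' p s hp e := by
  exact DFunLike.congr_fun (ModuleCat.hom_ext_iff.1
    (Cochain.congr_v (hq.add l r x y n h h' h'') p s hp)) e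

lemma IsBalanced.ev_inner (hq : q.IsBalanced ι (mulHom k E) (mulHom k F)) (l r : List L)
    (x y : L) (a : A) (n : ℤ) (h h') (p s : ℤ) (hp) (e : (toBase k E).X p) :
    q.ev (l ++ (x * ι a) :: y :: r) n h p s hp e =
      q.ev (l ++ x :: (ι a * y) :: r) n h' p s hp e := by
  exact DFunLike.congr_fun (ModuleCat.hom_ext_iff.1
    (Cochain.congr_v (hq.inner l r x y a n h h') p s hp)) e

lemma IsBalanced.ev_first (hq : q.IsBalanced ι (mulHom k E) (mulHom k F)) (r : List L)
    (x : L) (a : A) (n : ℤ) (h h') (p s : ℤ) (hp) (e : (toBase k E).X p) :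
    q.ev ((ι a * x) :: r) n h p s hp e = ((mulHom k F a).f s).hom (q.ev (x :: r) n h' p s hp e) := by
  have := Cochain.congr_v (hq.first r x a n h h') p s hp
  rw [Cochain.comp_v _ _ _ p s s hp (add_zero s), Cochain.ofHom_v] at this
  exact DFunLike.congr_fun (ModuleCat.hom_ext_iff.1 this) e

lemma IsBalanced.ev_zero_letter (hq : q.IsBalanced ι (mulHom k E) (mulHom k F)) (l r : List L)
    (n : ℤ) (h) (p s : ℤ) (hp) (e : (toBase k E).X p) : q.ev (l ++ 0 :: r) n h p s hp e = 0 := by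
  have := hq.ev_add_letter l r 0 0 n (by rwa [add_zero]) h h p s hp e
  have h0 : q.ev (l ++ (0 + 0) :: r) n (by rwa [add_zero]) p s hp e =
    q.ev (l ++ 0 :: r) n h p s hp e := by
    simp only [add_zero]
  rwa [h0, left_eq_add] at this

lemma IsBalanced.ev_smul_letter (hq : q.IsBalanced ι (mulHom k E) (mulHom k F)) (l r : List L)
    (x : L) (t : k) (n : ℤ) (h h') (p s : ℤ) (hp) (e : (toBase k E).X p) :
    q.ev (l ++ (algebraMap k L t * x) :: r) n h p s hp e =
      t • q.ev (l ++ x :: r) n h' p s hp e := by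
  induction l using List.reverseRecOn generalizing x r with
  | nil =>
    have := hq.ev_first r x (algebraMap k A t) n (by simpa using h) h' p s hp e
    simp only [AlgHom.commutes] at this
    exact this
  | append_singleton l y ih =>
    have e1 := hq.ev_inner l r y x (algebraMap k A t) n (by simp at h ⊢; omega)
      (by simp at h ⊢; omega) p s hp e
    simp only [AlgHom.commutes] at e1
    have e2 := ih (x :: r) y (by simp at h ⊢; omega) (by simp at h ⊢; omega)
    have e3 : ∀ (u u' : List L) (hu : u = u') (h h'), q.ev u n h p s hp e = q.ev u' n h' p s hp e :=
      by rintro u _ rfl _ _; rfl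
    rw [e3 _ (l ++ y :: (algebraMap k L t * x) :: r) (by simp) _ (by simp at h ⊢; omega), ← e1,
      e3 (l ++ [y] ++ x :: r) (l ++ y :: x :: r) (by simp) _ (by simp at h ⊢; omega), ← e2]
    exact e3 _ _ (by rw [Algebra.commutes]) _ _

end WordCochain

open WordCochain

variable {E : CochainComplex (ModuleCat.{v} L) ℤ} {K Y : CochainComplex (ModuleCat.{v} A) ℤ}

variable (ι E) in
/-- A linear map from the term of degree `p` of a complex of `L`-modules to a free module, as a
function on the underlying complex of `k`-modules. -/
structure Coordinates (p : ℤ) (I : Type*) where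
  /-- The family of coordinates of an element. -/
  toFun : (toBase k (resCpx ι E)).X p → (I →₀ L)
  map_add : ∀ x x', toFun (x + x') = toFun x + toFun x'
  map_act : ∀ (l : L) x, toFun (((actHom ι E l).f p).hom x) = l • toFun x

instance (p : ℤ) (I : Type*) : CoeFun (Coordinates ι E p I)
    fun _ => (toBase k (resCpx ι E)).X p → (I →₀ L) := ⟨Coordinates.toFun⟩

variable (ι) in
/-- The coordinates that are given by a linear map. -/
noncomputable def Coordinates.ofLinearMap {p : ℤ} {I : Type*} (c : E.X p →ₗ[L] (I →₀ L)) :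
    Coordinates ι E p I where
  toFun x := c (show E.X p from x)
  map_add x x' := c.map_add (show E.X p from x) (show E.X p from x')
  map_act l x := c.map_smul l (show E.X p from x)

variable {p : ℤ} {I : Type*} (c : Coordinates ι E p I) (y : I → (toBase k K).X p)


set_option linter.unusedSectionVars false in
lemma ev_lastLetter {K K₁ : CochainComplex (ModuleCat.{v} k) ℤ} {i j : ℤ} (h : i + 1 = j) (l : L)
    (q : WordCochain L K K₁ j) (u : List L) (n : ℤ) (hn) (hn') (r s : ℤ) (hr) (x : K.X r) :
    (q.lastLetter h l).ev u n hn r s hr x =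
      (u.length : ℤ).negOnePow • q.ev (u ++ [l]) n hn' r s hr x := by
  change (((u.length : ℤ).negOnePow • q.v (u ++ [l]) n hn').v r s hr).hom x = _
  rcases Int.units_eq_one_or (u.length : ℤ).negOnePow with hs | hs
  · simp [hs, ev]
  · rw [hs, Units.neg_smul, Units.neg_smul, one_smul, one_smul]
    rfl

lemma ev_lastLetter_add {i j : ℤ} (h : i + 1 = j) (q : weakHom ι K Y j) (l l' : L) (u : List L)
    (n : ℤ) (hn) (r s : ℤ) (hr) (x : (toBase k K).X r) : (q.1.lastLetter h (l + l')).ev u n hn r s hr x =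
      (q.1.lastLetter h l).ev u n hn r s hr x + (q.1.lastLetter h l').ev u n hn r s hr x := by
  have hn' : n + (u.length + 1) = j := by omega
  rw [ev_lastLetter h _ _ _ _ _ (by simpa using hn'),
    ev_lastLetter h _ _ _ _ _ (by simpa using hn'), ev_lastLetter h _ _ _ _ _ (by simpa using hn'),
    q.2.ev_add_letter u [] l l' n _ (by simpa using hn') (by simpa using hn'), smul_add]

lemma ev_lastLetter_zero {i j : ℤ} (h : i + 1 = j) (q : weakHom ι K Y j) (u : List L)
    (n : ℤ) (hn) (r s : ℤ) (hr) (x : (toBase k K).X r) :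
    (q.1.lastLetter h 0).ev u n hn r s hr x = 0 := by
  have hn' : n + (u.length + 1) = j := by omega
  rw [ev_lastLetter h _ _ _ _ _ (by simpa using hn'), q.2.ev_zero_letter u [] n, smul_zero]

/-- The component in degree `p` of `insertion`. -/
noncomputable def insertionMap {i j : ℤ} (h : i + 1 = j) (q : weakHom ι K Y j) (u : List L) (n : ℤ)
    (hn : n + u.length = i) (r : ℤ) (hr : p + n = r) :
    (toBase k (resCpx ι E)).X p →ₗ[k] (toBase k Y).X r where
  toFun x := (c x).sum fun m l => (q.1.lastLetter h l).ev u n hn p r hr (y m)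
  map_add' x x' := by
    refine (congrArg (Finsupp.sum · _) (c.map_add x x')).trans (Finsupp.sum_add_index' ?_ ?_)
    · intro m
      exact ev_lastLetter_zero h q u n hn p r hr (y m)
    · intro m l l'
      exact ev_lastLetter_add h q l l' u n hn p r hr (y m)
  map_smul' t x := by
    have hn' : n + (u.length + 1) = j := by omega
    refine (congrArg (Finsupp.sum · _) (c.map_act (ι (algebraMap k A t)) x)).trans
      ((Finsupp.sum_smul_index' ?_).trans ?_)
    · intro m
      exact ev_lastLetter_zero h q u n hn p r hr (y m)
    · rw [Finsupp.smul_sum]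
      refine Finsupp.sum_congr fun m _ => ?_
      rw [ev_lastLetter h _ _ _ _ _ (by simpa using hn'), ev_lastLetter h _ _ _ _ _ (by simpa using hn'),
        RingHom.id_apply]
      simp only [AlgHom.commutes, smul_eq_mul]
      rw [q.2.ev_smul_letter u [] _ t n _ (by simpa using hn')]
      exact smul_comm (M := ℤˣ) (N := k) _ t _

/-- The family `x ↦ ± ∑ m, q (-, c_m x ; y_m)` for `x` of degree `p`, and zero in the other
degrees; the sign is `(-1) ^ k` on words of length `k`. -/
noncomputable def insertion {i j : ℤ} (h : i + 1 = j) (q : weakHom ι K Y j) :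
    WordCochain L (toBase k (resCpx ι E)) (toBase k Y) i :=
  .mk fun u n hn => Cochain.mk fun p₀ r hr =>
    if hp : p₀ = p then ((toBase k (resCpx ι E)).XIsoOfEq hp).hom ≫
      ModuleCat.ofHom (X := (toBase k (resCpx ι E)).X p) (Y := (toBase k Y).X r)
        (insertionMap c y h q u n hn r (by omega)) else 0

lemma ev_insertion {i j : ℤ} (h : i + 1 = j) (q : weakHom ι K Y j) (u : List L) (n : ℤ)
    (hn : n + u.length = i) (r : ℤ) (hr : p + n = r) (x : (toBase k (resCpx ι E)).X p) :
    (insertion c y h q).ev u n hn p r hr x =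
      (c x).sum fun m l => (q.1.lastLetter h l).ev u n hn p r hr (y m) := by
  unfold ev insertion
  rw [mk_v, Cochain.mk_v, dif_pos rfl]
  rfl

lemma ev_insertion_of_ne {i j : ℤ} (h : i + 1 = j) (q : weakHom ι K Y j) (u : List L) (n : ℤ)
    (hn : n + u.length = i) (p₀ r : ℤ) (hr : p₀ + n = r) (x : (toBase k (resCpx ι E)).X p₀) (hp : p₀ ≠ p) :
    (insertion c y h q).ev u n hn p₀ r hr x = 0 := by
  unfold ev insertion
  rw [mk_v, Cochain.mk_v, dif_neg hp]
  rfl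

/-- The family that inserts coordinates is balanced in all letters, including the new last one: this
uses that the coordinates are `L`-linear, and that the family itself is balanced. -/
lemma isBalanced_insertion {i j : ℤ} (h : i + 1 = j) (q : weakHom ι K Y j) :
    (insertion c y h q).IsBalanced ι (mulHom k (resCpx ι E)) (mulHom k Y) := by
  refine .of_ev ?_ ?_ ?_ ?_ ?_
  · intro l r a b n h₁ h₂ h₃ p₀ s hp e
    simp only [List.length_append, List.length_cons] at h₁
    by_cases hpp : p₀ = p
    · subst hpp
      simp only [ev_insertion]
      rw [← Finsupp.sum_add]
      refine Finsupp.sum_congr fun m _ => ?_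
      rw [ev_lastLetter h _ _ _ _ _ (by simp; omega), ev_lastLetter h _ _ _ _ _ (by simp; omega),
        ev_lastLetter h _ _ _ _ _ (by simp; omega)]
      simp only [List.append_assoc, List.cons_append, List.length_append, List.length_cons]
      rw [q.2.ev_add_letter, smul_add]
    · simp only [ev_insertion_of_ne _ _ _ _ _ _ _ _ _ _ _ hpp, add_zero]
  · intro l r a b t n h₁ h₂ p₀ s hp e
    simp only [List.length_append, List.length_cons] at h₁
    by_cases hpp : p₀ = p
    · subst hpp
      simp only [ev_insertion]
      refine Finsupp.sum_congr fun m _ => ?_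
      rw [ev_lastLetter h _ _ _ _ _ (by simp; omega), ev_lastLetter h _ _ _ _ _ (by simp; omega)]
      simp only [List.append_assoc, List.cons_append, List.length_append, List.length_cons]
      rw [q.2.ev_inner]
    · simp only [ev_insertion_of_ne _ _ _ _ _ _ _ _ _ _ _ hpp]
  · intro l b t n h₁ h₂ p₀ s hp e
    simp only [List.length_append, List.length_cons, List.length_nil] at h₁
    by_cases hpp : p₀ = p
    · subst hpp
      rw [ev_insertion]
      rw [ev_insertion, ← actHom_algHom, c.map_act, Finsupp.sum_smul_index' fun m => ev_lastLetter_zero h q _ n _ _ s _ (y m)]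
      refine Finsupp.sum_congr fun m _ => ?_
      rw [ev_lastLetter h _ _ _ _ _ (by simp; omega), ev_lastLetter h _ _ _ _ _ (by simp; omega)]
      simp only [List.append_assoc, List.cons_append, List.length_append, List.length_cons,
        List.nil_append]
      rw [q.2.ev_inner]
      rfl
    · simp only [ev_insertion_of_ne _ _ _ _ _ _ _ _ _ _ _ hpp]
  · intro r b t n h₁ h₂ p₀ s hp e
    simp only [List.length_cons] at h₁
    by_cases hpp : p₀ = p
    · subst hpp
      simp only [ev_insertion]
      rw [map_finsuppSum]
      refine Finsupp.sum_congr fun m _ => ?_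
      rw [ev_lastLetter h _ _ _ _ _ (by simp; omega), ev_lastLetter h _ _ _ _ _ (by simp; omega)]
      simp only [List.cons_append, List.length_cons]
      rw [q.2.ev_first]
      rcases Int.units_eq_one_or ((r.length + 1 : ℕ) : ℤ).negOnePow with hs | hs
      · rw [hs, one_smul, one_smul]
      · rw [hs, Units.neg_smul, Units.neg_smul, one_smul, one_smul, map_neg]
    · simp only [ev_insertion_of_ne _ _ _ _ _ _ _ _ _ _ _ hpp, map_zero]
  · intro t n h₁ p₀ s hp e
    by_cases hpp : p₀ = p
    · subst hpp
      rw [ev_insertion]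
      rw [ev_insertion, ← actHom_algHom, c.map_act, Finsupp.sum_smul_index' fun m => ev_lastLetter_zero h q _ n _ _ s _ (y m),
        map_finsuppSum]
      refine Finsupp.sum_congr fun m _ => ?_
      simp only [List.length_nil, Nat.cast_zero, add_zero] at h₁
      rw [ev_lastLetter h _ _ _ _ _ (by simp; omega), ev_lastLetter h _ _ _ _ _ (by simp; omega)]
      simp only [List.nil_append, List.length_nil, Nat.cast_zero, Int.negOnePow_zero, one_smul,
        smul_eq_mul]
      rw [q.2.ev_first [] _ t _ _ (by simp; omega)]
    · simp only [ev_insertion_of_ne _ _ _ _ _ _ _ _ _ _ _ hpp, map_zero]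

end

/-! ### The contracting homotopy -/

namespace WordCochain

section

variable {C : Type*} [Category* C] [Preadditive C] {L : Type*} {K K₁ K₂ : CochainComplex C ℤ}

lemma ofLetters_comp_nil {b c : ℤ} (m : L → (K ⟶ K₁)) (f : WordCochain L K₁ K₂ b) (h : 1 + b = c)
    (n : ℤ) (hn) : ((ofLetters m).comp f h).v [] n hn = 0 := by
  rw [comp_nil (n₁ := 1) (n₂ := b) (h₁ := by simp) (h₂ := by simp) (h₁₂ := by simp at hn; omega),
    ofLetters_nil, Cochain.zero_comp]

lemma ofLetters_comp_append {b c : ℤ} (m : L → (K ⟶ K₁)) (f : WordCochain L K₁ K₂ b) (h : 1 + b = c)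
    (u : List L) (x : L) (n : ℤ) (hn hn') : ((ofLetters m).comp f h).v (u ++ [x]) n hn =
      (u.length : ℤ).negOnePow • (Cochain.ofHom (m x)).comp (f.v u n hn') (zero_add n) := by
  induction u generalizing b c with
  | nil =>
    have hn'' : n = b := by simpa using hn'
    subst hn''
    change ((ofLetters m).comp f h).v [x] n hn = _
    rw [comp_cons (n₁ := 0) (n₂ := n) (b' := n - 1) (c' := n) (h₁ := by simp) (h₂ := by simp)
        (h₁₂ := by omega) (hb := by omega) (hc := by omega) (hn' := by simp), ofLetters_single,
      ofLetters_comp_nil]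
    simp
  | cons y u ih =>
    have hn'' : n + (u.length + 1) = b := by simpa using hn'
    change ((ofLetters m).comp f h).v (y :: (u ++ [x])) n hn = _
    rw [comp_cons (n₁ := n - b) (n₂ := b) (b' := b - 1) (c' := b) (h₁ := by simp; omega)
      (h₂ := by simp)
      (h₁₂ := by omega) (hb := by omega) (hc := by omega) (hn' := by simp; omega),
      ih (f.shift _ y) (by omega) _ (by omega)]
    have : ∀ (u : List L) (n : ℤ) (hn), (ofLetters m).v (y :: (u ++ [x])) n hn = 0 := by
      rintro (_ | ⟨z, u⟩) n hn <;> rfl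
    rw [this, Cochain.zero_comp, zero_add, smul_smul, ← Int.negOnePow_add, List.length_cons,
      Nat.cast_add, Nat.cast_one, add_comm 1]
    rfl

end

end WordCochain

section

variable {k : Type w} [Field k] {A L : Type u} [CommRing A] [Algebra k A] [Ring L] [Algebra k L]
  {ι : A →ₐ[k] L}

open WordCochain

variable {E : CochainComplex (ModuleCat.{v} L) ℤ} {K Y : CochainComplex (ModuleCat.{v} A) ℤ}
variable {p : ℤ} {I : Type*} (c : Coordinates ι E p I) (y : I → (toBase k K).X p)

lemma ev_ofLetters_comp_append {K K₁ K₂ : CochainComplex (ModuleCat.{v} k) ℤ} {b c : ℤ} (m : L → (K ⟶ K₁))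
    (f : WordCochain L K₁ K₂ b) (h : 1 + b = c)
    (u : List L) (l : L) (n : ℤ) (hn hn') (p r : ℤ) (hr) (x : K.X p) :
    ((ofLetters m).comp f h).ev (u ++ [l]) n hn p r hr x =
      (u.length : ℤ).negOnePow • f.ev u n hn' p r hr (((m l).f p).hom x) := by
  unfold ev
  rw [ofLetters_comp_append m f h u l n hn hn']
  rcases Int.units_eq_one_or (u.length : ℤ).negOnePow with hs | hs <;>
  · rw [hs]
    simp [Cochain.comp_v _ _ (zero_add n) p p r (add_zero p) hr]

lemma ev_ofLetters_comp_insertion {i j : ℤ} (h : i + 1 = j) (q : weakHom ι K Y j) (u : List L) (n : ℤ)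
    (hn) (r : ℤ) (hr) (x) : ((ofLetters (actHom ι E)).comp (insertion c y h q)
      ((add_comm 1 i).trans h)).ev u n hn p r hr x =
      (c x).sum fun m l => (q.1.mulLast l).ev u n hn p r hr (y m) := by
  induction u using List.reverseRecOn with
  | nil =>
    unfold ev
    rw [ofLetters_comp_nil]
    exact Finset.sum_const_zero.symm
  | append_singleton u z _ =>
    simp only [List.length_append, List.length_cons, List.length_nil] at hn
    rw [ev_ofLetters_comp_append (hn' := by omega), ev_insertion, c.map_act,
      Finsupp.sum_smul_index' fun m => ev_lastLetter_zero h q _ n _ _ _ _ (y m), Finsupp.smul_sum]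
    refine Finsupp.sum_congr fun m _ => ?_
    rw [ev_lastLetter h _ _ _ _ _ (by simp; omega), smul_smul, Int.units_mul_self, one_smul]
    unfold ev
    rw [mulLast_append _ _ _ _ _ _ (by simp; omega)]
    rfl

/-- Insertion of coordinates into a family `q` commutes with the part `q ↦ d_Q q + φ q` of the
differential, up to the terms in which `φ` is applied to the last letter. -/
lemma ev_insertion_dQ {i j l : ℤ} (h : i + 1 = j) (hl : j + 1 = l) (q : weakHom ι K Y j)
    (φ : WordCochain L (toBase k Y) (toBase k Y) 1) (u : List L) (n : ℤ)
    (hn) (r : ℤ) (hr) (x)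
    (hy : ∀ m ∈ (c x).support, ∀ u n hn r hr, q.1.ev u n hn (p + 1) r hr
      (((toBase k K).d p (p + 1)).hom (y m)) = 0) :
    ((insertion c y h q).dQ h + (insertion c y h q).comp φ h - i.negOnePow •
      (ofLetters (actHom ι E)).comp (insertion c y h q) ((add_comm 1 i).trans h)).ev u n hn p r hr x =
    ((c x).sum fun m l => ((q.1.dQ hl + q.1.comp φ hl).lastLetter hl l).ev u n hn p r hr (y m)) -
    ((u.length : ℤ).negOnePow * (j * (u.length + 1)).negOnePow) • (c x).sum fun m l =>
      φ.ev (u ++ [l]) (n - j) (by simp; omega) (p + j) r (by omega)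
        (q.1.ev [] j (by simp) p (p + j) rfl (y m)) := by
  have H : ∀ u n hn r hr, (insertion c y h q).ev u n hn p r hr x =
      ∑ m ∈ (c x).support, (q.1.lastLetter h (c x m)).ev u n hn p r hr (y m) :=
    fun u n hn r hr => ev_insertion c y h q u n hn r hr x
  have e1 : ((insertion c y h q).delta h).ev u n hn p r hr x =
      ∑ m ∈ (c x).support, ((q.1.lastLetter h (c x m)).delta h).ev u n hn p r hr (y m) := by
    rw [ev_delta (n' := n - 1) (hn' := by omega) (hnn := by omega) (r' := r - 1) (hp' := rfl)
      (hr := by omega), H, ev_insertion_of_ne _ _ _ _ _ _ _ _ _ _ _ (by omega), smul_zero, add_zero,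
      map_sum]
    refine Finset.sum_congr rfl fun m hm => ?_
    rw [ev_delta (n' := n - 1) (hn' := by omega) (hnn := by omega) (r' := r - 1) (hp' := rfl)
      (hr := by omega), ev_lastLetter _ _ _ _ (n - 1) _ (by simp; omega) (p + 1), hy m hm, smul_zero,
      smul_zero, add_zero]
  have e2 := ev_hochschild_congr (c x).support h _ (fun m => q.1.lastLetter h (c x m)) p x y H u n hn r hr
  have e3 := ev_comp_congr (c x).support h _ (fun m => q.1.lastLetter h (c x m)) φ p x y H u n hn r hr
  have e4 := ev_ofLetters_comp_insertion c y h q u n hn r hr x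
  have hij : j.negOnePow = - i.negOnePow := by rw [← h, Int.negOnePow_succ]
  rw [dQ, ev_sub, ev_add, ev_sub, ev_units_smul, ev_units_smul, e1, e2, e3, e4]
  simp only [Finsupp.sum, Finset.smul_sum, ← Finset.sum_sub_distrib, ← Finset.sum_add_distrib]
  refine Finset.sum_congr rfl fun m _ => ?_
  have d1 : (q.1.dQ hl + q.1.comp φ hl).lastLetter hl (c x m) =
      (q.1.delta hl).lastLetter hl (c x m) - j.negOnePow • (q.1.hochschild hl).lastLetter hl (c x m) +
        (q.1.comp φ hl).lastLetter hl (c x m) := by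
    ext1 u n hn
    simp only [lastLetter, mk_v, add_v, dQ, sub_v, units_smul_v, smul_add, smul_sub]
    rw [smul_comm]
  have d2 : ((q.1.comp φ hl).lastLetter hl (c x m)).ev u n hn p r hr (y m) =
      ((q.1.lastLetter h (c x m)).comp φ h).ev u n hn p r hr (y m) +
      ((u.length : ℤ).negOnePow * (j * (u.length + 1)).negOnePow) •
      φ.ev (u ++ [c x m]) (n - j) (by simp; omega) (p + j) r (by omega)
        (q.1.ev [] j (by simp) p (p + j) rfl (y m)) := by
    unfold ev
    rw [lastLetter_comp (ha := h) (h' := h) (n' := n - j) (hn' := by simp; omega) (hnn := by omega)]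
    rcases Int.units_eq_one_or ((u.length : ℤ).negOnePow * (j * (u.length + 1)).negOnePow)
      with hs | hs <;>
    · rw [hs]
      simp [Cochain.comp_v _ _ (by omega : j + (n - j) = n) p (p + j) r rfl (by omega)]
  rw [d1, ev_add, ev_sub, ev_units_smul, d2, lastLetter_delta h hl h hl, lastLetter_hochschild h hl,
    ev_sub, ev_neg, hij]
  simp only [Units.neg_smul, smul_sub, smul_neg]
  abel

end

namespace WordCochain

section

variable {C : Type*} [Category* C] [Preadditive C] {L : Type*} [Mul L] {K K₁ : CochainComplex C ℤ}
  (η : WordCochain L K K 1) (φ : WordCochain L K₁ K₁ 1)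

/-- The differential `q ↦ d_Q q + φ q - (-1) ^ |q| q η` of families of cochains. -/
def twD {n m : ℤ} (h : n + 1 = m) (q : WordCochain L K K₁ n) : WordCochain L K K₁ m :=
  q.dQ h + q.comp φ h - n.negOnePow • η.comp q ((add_comm 1 n).trans h)

lemma twD_add {n m : ℤ} (h : n + 1 = m) (q q' : WordCochain L K K₁ n) :
    twD η φ h (q + q') = twD η φ h q + twD η φ h q' := by
  rw [twD, twD, twD, dQ_add, add_comp, comp_add, smul_add]
  abel

lemma twD_zero {n m : ℤ} (h : n + 1 = m) : twD η φ h (0 : WordCochain L K K₁ n) = 0 := by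
  have := twD_add η φ h (0 : WordCochain L K K₁ n) 0
  rwa [add_zero, left_eq_add] at this

lemma twD_neg {n m : ℤ} (h : n + 1 = m) (q : WordCochain L K K₁ n) :
    twD η φ h (-q) = -twD η φ h q := by
  rw [eq_neg_iff_add_eq_zero, ← twD_add, neg_add_cancel, twD_zero]

lemma twD_sub {n m : ℤ} (h : n + 1 = m) (q q' : WordCochain L K K₁ n) :
    twD η φ h (q - q') = twD η φ h q - twD η φ h q' := by
  rw [sub_eq_add_neg, twD_add, twD_neg, sub_eq_add_neg]

lemma twD_units_smul {n m : ℤ} (h : n + 1 = m) (q : WordCochain L K K₁ n) (t : ℤˣ) :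
    twD η φ h (t • q) = t • twD η φ h q := by
  rcases Int.units_eq_one_or t with rfl | rfl
  · simp
  · rw [Units.neg_smul, Units.neg_smul, one_smul, one_smul, twD_neg]

end

end WordCochain

section

variable {k : Type w} [Field k] {A L : Type u} [CommRing A] [Algebra k A] [Ring L] [Algebra k L]
  {ι : A →ₐ[k] L}

open WordCochain

variable {E F : CochainComplex (ModuleCat.{v} L) ℤ} {K Y : CochainComplex (ModuleCat.{v} A) ℤ}

/-- The insertion of coordinates, as a morphism of weak complexes. -/
noncomputable def insertHom {p : ℤ} {I : Type*} (c : Coordinates ι E p I)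
    (y : I → (toBase k K).X p) {i j : ℤ} (h : i + 1 = j) (q : weakHom ι K Y j) :
    weakHom ι (resCpx ι E) Y i := ⟨insertion c y h q, isBalanced_insertion c y h q⟩

variable (ι) in
/-- The morphism of weak complexes that is defined by a cochain that is linear over `L`. -/
noncomputable def strictHom (n : ℤ) :
    Cochain E F n →ₗ[k] weakHom ι (resCpx ι E) (resCpx ι F) n :=
  weakHomOfCochain ι (resCpx ι E) (resCpx ι F) n ∘ₗ resMap ι n

variable (ι) in
/-- The family defined by a cochain that is linear over `L`. -/
noncomputable def strictFamily {n : ℤ} (g : Cochain E F n) :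
    WordCochain L (toBase k (resCpx ι E)) (toBase k (resCpx ι F)) n :=
  (strictHom (k := k) ι n g).1

lemma strictFamily_ev_nil {n : ℤ} (g : Cochain E F n) (hn) (p r : ℤ) (hr : p + n = r) (x : E.X p) :
    (strictFamily (k := k) ι g).ev [] n hn p r hr x = (g.v p r hr).hom x := rfl

lemma strictFamily_injective {n : ℤ} :
    Function.Injective (strictFamily (k := k) ι (E := E) (F := F) (n := n)) := by
  intro g g' h
  ext p r hr x
  exact congrArg (fun q : WordCochain L (toBase k (resCpx ι E)) (toBase k (resCpx ι F)) n =>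
    q.ev [] n (by simp) p r hr x) h

lemma strictFamily_add {n : ℤ} (g g' : Cochain E F n) :
    strictFamily (k := k) ι (g + g') = strictFamily ι g + strictFamily ι g' :=
  congrArg Subtype.val ((strictHom (k := k) ι n).map_add g g')

lemma strictFamily_sub {n : ℤ} (g g' : Cochain E F n) :
    strictFamily (k := k) ι (g - g') = strictFamily ι g - strictFamily ι g' :=
  congrArg Subtype.val ((strictHom (k := k) ι n).map_sub g g')

lemma strictFamily_zero {n : ℤ} :
    strictFamily (k := k) ι (0 : Cochain E F n) = 0 :=
  congrArg Subtype.val (strictHom (k := k) ι n).map_zero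

lemma twD_strictFamily {n m : ℤ} (h : n + 1 = m) (g : Cochain E F n) :
    twD (ofLetters (actHom ι E)) (ofLetters (actHom ι F)) h (strictFamily (k := k) ι g) =
      strictFamily ι (δ n m g) := congrArg Subtype.val ((weakify (k := k) ι).map_d n m h g).symm

lemma twD_twD_strict {n m l : ℤ} (h : n + 1 = m) (h' : m + 1 = l)
    (q : weakHom ι (resCpx ι E) (resCpx ι F) n) :
    twD (ofLetters (actHom ι E)) (ofLetters (actHom ι F)) h'
      (twD (ofLetters (actHom ι E)) (ofLetters (actHom ι F)) h q.1) = 0 :=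
  congrArg Subtype.val ((wpx ι).d_d (x := weakifyObj ι E) (y := weakifyObj ι F) n m l h h' q)

/-- The differential enlarges the set of degrees of the source in which a family is nonzero
by at most one. -/
lemma ev_twD_eq_zero (φ : WordCochain L (toBase k Y) (toBase k Y) 1) {n m : ℤ} (h : n + 1 = m)
    (q : WordCochain L (toBase k (resCpx ι E)) (toBase k Y) n) (s : ℤ)
    (h₁ : ∀ u a ha r hr x, q.ev u a ha s r hr x = 0)
    (h₂ : ∀ u a ha r hr x, q.ev u a ha (s + 1) r hr x = 0) (u : List L) (a : ℤ) (ha) (r : ℤ) (hr) (x) :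
    (twD (ofLetters (actHom ι E)) φ h q).ev u a ha s r hr x = 0 := by
  have : ((ofLetters (actHom ι E)).comp q ((add_comm 1 n).trans h)).ev u a ha s r hr x = 0 := by
    induction u using List.reverseRecOn with
    | nil => unfold ev; rw [ofLetters_comp_nil]; rfl
    | append_singleton u z _ =>
      rw [ev_ofLetters_comp_append (hn' := by simp at ha; omega), h₁, smul_zero]
  rw [twD, dQ, ev_sub, ev_add, ev_sub, ev_units_smul, ev_units_smul,
    ev_delta (n' := a - 1) (hn' := by omega) (hnn := by omega) (r' := r - 1) (hp' := rfl)
      (hr := by omega), h₁, h₂,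
    ev_hochschild_congr (K' := toBase k Y) (ι' := PEmpty.{1}) ∅ h q (fun _ => 0) s x (fun _ => 0)
      (fun u n hn r hr => h₁ u n hn r hr x),
    ev_comp_congr (K' := toBase k Y) (ι' := PEmpty.{1}) ∅ h q (fun _ => 0) φ s x (fun _ => 0)
      (fun u n hn r hr => h₁ u n hn r hr x), this]
  simp

/-- Insertion of coordinates is a contracting homotopy, up to the last term. -/
lemma ev_twD_insertHom {p : ℤ} {I : Type*} (c : Coordinates ι E p I)
    (y : I → (toBase k (resCpx ι E)).X p)
    (hc : ∀ x, ((c x).sum fun m l => ((actHom ι E l).f p).hom (y m)) = x)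
    (φ : WordCochain L (toBase k Y) (toBase k Y) 1) {i j l : ℤ} (h : i + 1 = j)
    (hl : j + 1 = l) (q : weakHom ι (resCpx ι E) Y j)
    (x) (hy : ∀ m ∈ (c x).support, ∀ u n hn r hr, q.1.ev u n hn (p + 1) r hr
      (((toBase k (resCpx ι E)).d p (p + 1)).hom (y m)) = 0) (u : List L) (n : ℤ)
    (hn) (r : ℤ) (hr) :
    (twD (ofLetters (actHom ι E)) φ h (insertHom c y h q).1).ev u n hn p r hr x =
      ((c x).sum fun m l => ((twD (ofLetters (actHom ι E)) φ hl q.1).lastLetter hl l).ev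
        u n hn p r hr (y m)) +
      j.negOnePow • q.1.ev u n hn p r hr x -
      ((u.length : ℤ).negOnePow * (j * (u.length + 1)).negOnePow) • (c x).sum fun m l =>
      φ.ev (u ++ [l]) (n - j) (by simp; omega) (p + j) r (by omega)
        (q.1.ev [] j (by simp) p (p + j) rfl (y m)) := by
  refine (ev_insertion_dQ c y h hl q φ u n hn r hr x hy).trans ?_
  congr 1
  have e : q.1.ev u n hn p r hr x = (c x).sum fun m l =>
      q.1.ev u n hn p r hr (((actHom ι E l).f p).hom (y m)) := by
    conv_lhs => rw [← hc x]
    rw [Finsupp.sum, ev_map_sum]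
    rfl
  rw [e, Finsupp.smul_sum, ← Finsupp.sum_add]
  refine Finsupp.sum_congr fun m _ => ?_
  rw [ev_lastLetter _ _ _ _ _ _ (by simp; omega), ev_lastLetter _ _ _ _ _ _ (by simp; omega), twD,
    ev_sub, ev_units_smul, ev_ofLetters_comp_append _ _ _ _ _ _ _ hn]
  rw [smul_sub, smul_comm (u.length : ℤ).negOnePow,
    smul_smul (u.length : ℤ).negOnePow (u.length : ℤ).negOnePow, Int.units_mul_self,
    one_smul, sub_add_cancel]

lemma ofLetters_ev_append {u : List L} (z : L) (l' : L) (n : ℤ) (hn) (s r : ℤ) (hr) (x) :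
    (ofLetters (actHom (k := k) ι F)).ev (z :: u ++ [l']) n hn s r hr x = 0 := by
  rcases u with _ | ⟨z', u⟩ <;> rfl

/-- If the differential of a morphism between strict objects is strict, the morphism is strict up
to a boundary. -/
lemma exists_eq_strictFamily_add_twD (hproj : ∀ i, Module.Projective L (E.X i)) (a : ℤ)
    (ha : ∀ s, s ≤ a → Subsingleton (E.X s)) {i j l : ℤ} (h : i + 1 = j) (hl : j + 1 = l) (t : ℕ)
    (q : weakHom ι (resCpx ι E) (resCpx ι F) j)
    (hq : ∀ s, a + t < s → ∀ u n hn r hr x, q.1.ev u n hn s r hr x = 0)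
    (hdq : ∃ g', twD (ofLetters (actHom ι E)) (ofLetters (actHom ι F)) hl q.1 = strictFamily ι g') :
    ∃ (g : Cochain E F j) (r : weakHom ι (resCpx ι E) (resCpx ι F) i),
      q.1 = strictFamily ι g + twD (ofLetters (actHom ι E)) (ofLetters (actHom ι F)) h r.1 := by
  -- induction on the number of degrees in which `q` need not vanish
  induction t generalizing q with
  | zero =>
    refine ⟨0, 0, ?_⟩
    rw [strictFamily_zero, ZeroMemClass.coe_zero, twD_zero, add_zero]
    refine ext_ev fun u n hn s r hr x => ?_
    by_cases hs : a < s
    · exact hq s (by simpa using hs) _ _ _ _ _ _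
    · have : Subsingleton (E.X s) := ha s (by omega)
      obtain rfl : x = 0 := Subsingleton.elim (α := E.X s) x 0
      rw [ev_map_zero]
      rfl
  | succ t ih =>
    -- in the highest degree `p`, elements are combinations of elements `y m`, with coordinates `c`;
    -- the strict part of `q` in this degree is the `L`-linear extension of its values on the `y m`
    set p : ℤ := a + (t + 1 : ℕ) with hp
    obtain ⟨c₀, hc₀⟩ := Module.projective_def.1 (hproj p)
    let c := Coordinates.ofLinearMap (k := k) ι c₀
    let y : E.X p → (toBase k (resCpx ι E)).X p := fun m => m
    have hc : ∀ x, ((c x).sum fun m l => ((actHom ι E l).f p).hom (y m)) = x := hc₀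
    let g : Cochain E F j := Cochain.mk fun p₀ r hr =>
      if hp : p₀ = p then (E.XIsoOfEq hp).hom ≫ ModuleCat.ofHom
        (Finsupp.linearCombination L (fun m : E.X p =>
          (q.1.ev [] j (by simp) p r (by omega) (y m) : F.X r)) ∘ₗ c₀) else 0
    have hg : ∀ hn r hr x, (strictFamily (k := k) ι g).ev [] j hn p r hr x = (c x).sum fun m l =>
        ((actHom ι F l).f r).hom (q.1.ev [] j (by simp) p r hr (y m)) := by
      intro hn r hr x
      refine (strictFamily_ev_nil g hn p r hr x).trans ?_
      dsimp only [g]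
      rw [Cochain.mk_v, dif_pos rfl]
      rfl
    have hg' : ∀ u n hn s r hr x, s ≠ p → (strictFamily (k := k) ι g).ev u n hn s r hr x = 0 := by
      intro u n hn s r hr x hs
      cases u with
      | nil =>
        obtain rfl : n = j := by simpa using hn
        refine (strictFamily_ev_nil g hn s r hr x).trans ?_
        dsimp only [g]
        rw [Cochain.mk_v, dif_neg hs]
        rfl
      | cons => rfl
    obtain ⟨g', hg''⟩ := hdq
    -- without this strict part and the boundary of the inserted coordinates, `q` vanishes in degree `p`
    let H := insertHom c y h q
    let dH : weakHom ι (resCpx ι E) (resCpx ι F) j :=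
      (wpx ι).d (x := weakifyObj ι E) (y := weakifyObj ι F) i j h H
    let q' : weakHom ι (resCpx ι E) (resCpx ι F) j := q - strictHom ι j g - j.negOnePow • dH
    have e0 : q'.1 = q.1 - strictFamily ι g -
        j.negOnePow • twD (ofLetters (actHom ι E)) (ofLetters (actHom ι F)) h H.1 := by
      rcases Int.units_eq_one_or j.negOnePow with hs | hs
      · simp only [q', hs, one_smul]
        rfl
      · simp only [q', hs, Units.neg_smul, one_smul]
        rfl
    have hq'1 : ∀ s, a + t < s → ∀ u n hn r hr x, q'.1.ev u n hn s r hr x = 0 := by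
      intro s hs u n hn r hr x
      rw [e0, ev_sub, ev_sub, ev_units_smul]
      by_cases hsp : s = p
      · subst hsp
        rw [ev_twD_insertHom c y hc _ h hl q x (fun m _ u n hn r hr => hq _ (by omega) _ _ _ _ _ _)]
        have e1 : ((c x).sum fun m l =>
            ((twD (ofLetters (actHom ι E)) (ofLetters (actHom ι F)) hl q.1).lastLetter hl l).ev u n hn
              p r hr (y m)) = 0 := by
          refine Finset.sum_eq_zero fun m _ => ?_
          dsimp only
          rw [hg'', ev_lastLetter _ _ _ _ _ _ (by simp; omega)]
          cases u with
          | nil => exact smul_zero _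
          | cons _ _ => exact smul_zero _
        rw [e1, zero_add, smul_sub, smul_smul, Int.units_mul_self, one_smul]
        cases u with
        | nil =>
          obtain rfl : n = j := by simpa using hn
          rw [hg]
          simp only [List.length_nil, Nat.cast_zero, Int.negOnePow_zero, one_mul, zero_add, mul_one]
          rw [smul_smul, Int.units_mul_self, one_smul, sub_sub_sub_cancel_left, sub_eq_zero]
          subst hr
          refine Finsupp.sum_congr fun m _ => ?_
          have : ∀ (b : ℤ) (hb : b = 0) (l : L) (z) (h₁) (h₂), (ofLetters (actHom ι F)).ev ([] ++ [l]) b h₁ (p + n) (p + n) h₂ z =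
              ((actHom (k := k) ι F l).f (p + n)).hom z := by
            rintro b rfl l z h₁ h₂
            change ((Cochain.ofHom (actHom ι F l)).v (p + n) (p + n) _).hom z = _
            rw [Cochain.ofHom_v]
          exact this (n - n) (sub_self n) _ _ _ _
        | cons z u =>
          rw [show (strictFamily (k := k) ι g).ev (z :: u) n hn p r hr x = 0 from rfl]
          simp only [ofLetters_ev_append]
          simp
      · rw [hq _ (by omega), ev_twD_eq_zero _ h H.1 s
          (fun u a ha r hr x => ev_insertion_of_ne c y h q u a ha s r hr x hsp)
          (fun u a ha r hr x => ev_insertion_of_ne c y h q u a ha _ r hr x (by omega)), hg' _ _ _ _ _ _ _ hsp]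
        simp
    obtain ⟨g₁, r₁, e⟩ := ih q' hq'1 ⟨g' - δ j l g, by
      rw [e0, twD_sub, twD_sub, twD_units_smul, twD_twD_strict, smul_zero, sub_zero,
        hg'', twD_strictFamily, strictFamily_sub]⟩
    have e' : q.1 = strictFamily ι (g + g₁) +
        (twD (ofLetters (actHom ι E)) (ofLetters (actHom ι F)) h r₁.1 +
        j.negOnePow • twD (ofLetters (actHom ι E)) (ofLetters (actHom ι F)) h H.1) := by
      rw [e0, sub_eq_iff_eq_add, sub_eq_iff_eq_add] at e
      rw [e, strictFamily_add]
      abel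
    rw [e', ← twD_units_smul, ← twD_add]
    rcases Int.units_eq_one_or j.negOnePow with hs | hs
    · exact ⟨g + g₁, r₁ + H, by rw [hs, one_smul]; rfl⟩
    · exact ⟨g + g₁, r₁ - H, by rw [hs, Units.neg_smul, one_smul, ← sub_eq_add_neg]; rfl⟩

end

/-! ### Quasi-fully faithful dg functors -/

namespace DGFunctor

variable {k : Type*} [CommRing k]

/-- The dg functor `F` induces isomorphisms on the cohomology of the complex of morphisms from
`x` to `y`. -/
def QFFAt {C D : DGCat k} (F : DGFunctor C D) (x y : C.Obj) : Prop :=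
  ∀ (l n m : ℤ) (hl : l + 1 = n) (hn : n + 1 = m),
    (∀ f : C.Hom x y n, C.d n m hn f = 0 → (∃ g, D.d l n hl g = F.map n f) →
      ∃ g, C.d l n hl g = f) ∧
    (∀ g : D.Hom (F.obj x) (F.obj y) n, D.d n m hn g = 0 →
      ∃ f : C.Hom x y n, C.d n m hn f = 0 ∧ ∃ h, D.d l n hl h = g - F.map n f)

variable {C D E : DGCat k} {F : DGFunctor C D} {G : DGFunctor D E}

lemma QFFAt.of_comp {x y : C.Obj} (h : (F.comp G).QFFAt x y) (hG : G.QFFAt (F.obj x) (F.obj y)) :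
    F.QFFAt x y := by
  intro l n m hl hn
  obtain ⟨h₁, h₂⟩ := h l n m hl hn
  obtain ⟨g₁, g₂⟩ := hG l n m hl hn
  refine ⟨fun f hf ⟨g, hg⟩ => h₁ f hf ⟨G.map l g, ?_⟩, fun g hg => ?_⟩
  · exact (G.map_d l n hl g).symm.trans (congrArg (G.map n) hg)
  · obtain ⟨f, hf, t, ht⟩ := h₂ (G.map n g) 
      ((G.map_d n m hn g).symm.trans ((congrArg (G.map m) hg).trans (map_zero (G.map m))))
    refine ⟨f, hf, g₁ _ ?_ ⟨t, ?_⟩⟩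
    · rw [map_sub, hg, ← F.map_d, hf, map_zero, sub_zero]
    · exact ht.trans (map_sub (G.map n) g (F.map n f)).symm

/-- A quasi-fully faithful dg functor reflects the relation of being connected by an inner
equivalence. -/
lemma QFFAt.exists_isInnerEquivalence {x y : C.Obj} (hxy : F.QFFAt x y) (hyx : F.QFFAt y x)
    (hxx : F.QFFAt x x) (hyy : F.QFFAt y y) {f : D.Hom (F.obj x) (F.obj y) 0}
    (hf : D.IsInnerEquivalence f) : ∃ f₀ : C.Hom x y 0, C.IsInnerEquivalence f₀ := by
  obtain ⟨df, g, dg, ⟨s, hs⟩, ⟨t, ht⟩⟩ := hf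
  obtain ⟨f₀, df₀, a, ha⟩ := (hxy (-1) 0 1 rfl rfl).2 f df
  obtain ⟨g₀, dg₀, b, hb⟩ := (hyx (-1) 0 1 rfl rfl).2 g dg
  have key : ∀ {x y z : C.Obj} (f : D.Hom (F.obj x) (F.obj y) 0) (g : D.Hom (F.obj y) (F.obj z) 0)
      (f₀ : C.Hom x y 0) (g₀ : C.Hom y z 0) (a) (b), D.d 0 1 rfl f = 0 → D.d 0 1 rfl g = 0 →
      C.d 0 1 rfl f₀ = 0 → C.d 0 1 rfl g₀ = 0 → D.d (-1) 0 rfl a = f - F.map 0 f₀ →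
      D.d (-1) 0 rfl b = g - F.map 0 g₀ → C.d 0 1 rfl (C.comp (add_zero 0) f₀ g₀) = 0 ∧
      ∃ c, D.d (-1) 0 rfl c =
        D.comp (add_zero 0) f g - F.map 0 (C.comp (add_zero 0) f₀ g₀) := by
    intro x y z f g f₀ g₀ a b hf hg hf₀ hg₀ ha hb
    constructor
    · rw [C.d_comp (a' := 1) (b' := 1) (c' := 1) (add_zero 0) (zero_add 1) (zero_add 1)
        (zero_add 1) (zero_add 1) (add_zero 1), hf₀, hg₀]
      simp
    · refine ⟨D.comp (add_zero (-1)) a g + D.comp (zero_add (-1)) (F.map 0 f₀) b, ?_⟩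
      rw [map_add, D.d_comp (a' := 0) (b' := 1) (c' := 0) (add_zero (-1)) rfl rfl rfl rfl rfl,
        D.d_comp (a' := 1) (b' := 0) (c' := 0) (zero_add (-1)) rfl rfl rfl rfl rfl, hg, ha, hb, ← F.map_d, hf₀, F.map_comp]
      simp
  refine ⟨f₀, df₀, g₀, dg₀, ?_, ?_⟩
  · obtain ⟨h₁, c, hc⟩ := key f g f₀ g₀ a b df dg df₀ dg₀ ha hb
    have h1 : C.d 0 1 rfl (C.id x) = 0 := by
      have := C.d_comp (a' := 1) (b' := 1) (c' := 1) (add_zero 0) (zero_add 1) (zero_add 1)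
        (zero_add 1) (zero_add 1) (add_zero 1) (C.id x) (C.id x)
      rw [C.id_comp] at this
      have e1 := C.id_comp (C.d 0 1 rfl (C.id x))
      have e2 := C.comp_id (C.d 0 1 rfl (C.id x))
      rw [e1, e2] at this
      simpa using this
    obtain ⟨h, hh⟩ := (hxx (-1) 0 1 rfl rfl).1 (C.comp (add_zero 0) f₀ g₀ - C.id x)
      (by rw [map_sub, h₁, h1, sub_zero]) ⟨s - c, by
        rw [map_sub, hc, ← hs, map_sub, F.map_id]; abel⟩
    exact ⟨h, hh.symm⟩
  · obtain ⟨h₁, c, hc⟩ := key g f g₀ f₀ b a dg df dg₀ df₀ hb ha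
    have h1 : C.d 0 1 rfl (C.id y) = 0 := by
      have := C.d_comp (a' := 1) (b' := 1) (c' := 1) (add_zero 0) (zero_add 1) (zero_add 1)
        (zero_add 1) (zero_add 1) (add_zero 1) (C.id y) (C.id y)
      rw [C.id_comp] at this
      have e1 := C.id_comp (C.d 0 1 rfl (C.id y))
      have e2 := C.comp_id (C.d 0 1 rfl (C.id y))
      rw [e1, e2] at this
      simpa using this
    obtain ⟨h, hh⟩ := (hyy (-1) 0 1 rfl rfl).1 (C.comp (add_zero 0) g₀ f₀ - C.id y)
      (by rw [map_sub, h₁, h1, sub_zero]) ⟨t - c, by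
        rw [map_sub, hc, ← ht, map_sub, F.map_id]; abel⟩
    exact ⟨h, hh.symm⟩

end DGFunctor

/-! ### Normalization of morphisms -/

section

variable {k : Type w} [Field k] {A L : Type u} [CommRing A] [Algebra k A] [Ring L] [Algebra k L]
  {ι : A →ₐ[k] L}

open WordCochain

namespace WordCochain

variable {C : Type*} [Category* C] [Preadditive C] {K K₁ K₂ : CochainComplex C ℤ}

/-- The coefficient is the sum of the `m` alternating signs in the Hochschild differential of
`1 ⊗ … ⊗ 1`. -/
lemma hochschild_replicate {i j : ℤ} (h : i + 1 = j) (q : WordCochain L K K₁ i) (m : ℕ) (n : ℤ)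
    (hn hn') : (q.hochschild h).v (List.replicate (m + 1) 1) n hn =
      (if Odd m then (1 : ℤ) else 0) • q.v (List.replicate m 1) n hn' := by
  induction m generalizing i j with
  | zero => simp [hochschild_single]
  | succ m ih =>
    simp only [List.length_replicate] at hn hn'
    change (q.hochschild h).v (1 :: 1 :: List.replicate m 1) n _ = _
    rw [hochschild_cons_cons h (sub_add_cancel i 1) _ _ _ _ _ _ (by simp; omega) (by simp; omega),
      q.v_congr (congrArg (· :: List.replicate m 1) (mul_one (1 : L)))]
    have := ih (sub_add_cancel i 1) (q.shift (sub_add_cancel i 1) 1) (by simp; omega)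
      (by simp; omega)
    change ((q.shift (sub_add_cancel i 1) 1).hochschild (sub_add_cancel i 1)).v (1 :: List.replicate m 1)
      n _ = _ • q.v (List.replicate (m + 1) 1) n _ at this
    rw [this]
    change q.v (List.replicate (m + 1) 1) n _ - _ = _
    by_cases hm : Odd m
    · rw [if_pos hm, if_neg (by simpa [Nat.odd_add_one] using hm)]; simp
    · rw [if_neg hm, if_pos (by simpa [Nat.odd_add_one] using hm)]; simp

/-- On words that consist of the letter `1`, the product with a unital element on the side of the
target removes one letter, up to a sign. -/
lemma comp_replicate {a b c : ℤ} (f : WordCochain L K K₁ a) (g : WordCochain L K₁ K₁ b)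
    (h : a + b = c) (hb : b = 1) (m : ℕ) (n : ℤ) (hn hn') (g₀ : ∀ n hn, g.v [] n hn = 0)
    (g₁ : ∀ hn, g.v [1] 0 hn = Cochain.ofHom (𝟙 K₁))
    (g₂ : ∀ m n hn, 2 ≤ m → g.v (List.replicate m 1) n hn = 0) :
    (f.comp g h).v (List.replicate (m + 1) 1) n hn =
      a.negOnePow • f.v (List.replicate m 1) n hn' := by
  subst hb
  have hn'' : n + m = a := by simpa using hn'
  change (f.comp g h).v (1 :: List.replicate m 1) n hn = _
  rw [comp_cons (n₁ := n - 1) (n₂ := 1) (b' := 0) (c' := a) (h₁ := by simp; omega) (h₂ := by simp)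
    (h₁₂ := by omega) (hb := by omega) (hc := by omega) (hn' := by simpa using hn'), g₀,
    Cochain.comp_zero, zero_add]
  congr 1
  have g₁' : ∀ hn, (g.shift (zero_add 1) 1).v [] 0 hn = Cochain.ofHom (𝟙 K₁) := fun hn => g₁ _
  cases m with
  | zero =>
    change (f.comp _ _).v [] n _ = f.v [] n _
    rw [comp_nil (n₁ := n) (n₂ := 0) (h₁ := hn') (h₂ := by simp)
      (h₁₂ := by simp), g₁', Cochain.comp_id]
  | succ m =>
    change (f.comp (g.shift _ 1) _).v (1 :: List.replicate m 1) n hn' = f.v (1 :: List.replicate m 1) n hn'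
    push_cast at hn''
    rw [comp_cons (n₁ := n) (n₂ := 0) (b' := -1) (c' := a - 1) (h₁ := by simp; omega)
      (h₂ := by simp) (h₁₂ := by omega) (hb := by omega) (hc := by omega) (hn' := by simp; omega), g₁',
      Cochain.comp_id, comp_v_eq_zero, smul_zero, add_zero]
    intro l r hlr
    refine Or.inr fun n' hn' => ?_
    obtain ⟨r', -, hr⟩ : ∃ r', r' ≤ m ∧ l = List.replicate r' 1 :=
      ⟨l.length, by have := congrArg List.length hlr; simp at this; omega,
        List.eq_replicate_iff.2 ⟨rfl, fun b hb => by
          have : b ∈ List.replicate m (1 : L) := hlr ▸ List.mem_append_left r hb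
          exact List.eq_of_mem_replicate this⟩⟩
    subst hr
    exact g₂ (r' + 2) n' (by simp at hn' ⊢; omega) (by omega)

/-- On words that consist of the letter `1`, the product with a unital element on the side of the
source removes one letter, up to a sign. -/
lemma replicate_comp {b c : ℤ} (g : WordCochain L K K 1) (f : WordCochain L K K₁ b)
    (h : 1 + b = c) (m : ℕ) (n : ℤ) (hn hn') (g₀ : ∀ n hn, g.v [] n hn = 0)
    (g₁ : ∀ hn, g.v [1] 0 hn = Cochain.ofHom (𝟙 K))
    (g₂ : ∀ m n hn, 2 ≤ m → g.v (List.replicate m 1) n hn = 0) :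
    (g.comp f h).v (List.replicate (m + 1) 1) n hn =
      (m : ℤ).negOnePow • f.v (List.replicate m 1) n hn' := by
  induction m generalizing b c with
  | zero =>
    have hn'' : n = b := by simpa using hn'
    subst hn''
    change (g.comp f h).v [1] n hn = _
    rw [comp_cons (n₁ := 0) (n₂ := n) (b' := n - 1) (c' := n) (h₁ := by simp)
      (h₂ := by simp) (h₁₂ := by omega) (hb := by omega) (hc := by omega) (hn' := by simp), g₁,
      comp_nil (n₁ := 1) (n₂ := n - 1) (h₁ := by simp) (h₂ := by simp) (h₁₂ := by omega), g₀]
    simp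
  | succ m ih =>
    simp only [List.length_replicate] at hn hn'
    push_cast at hn hn'
    have := ih (f.shift (sub_add_cancel b 1) 1) (c := b) (by omega) (by simp; omega) (by simp; omega)
    change (g.comp f h).v (1 :: List.replicate (m + 1) 1) n _ = _
    rw [comp_cons (n₁ := n - b) (n₂ := b) (b' := b - 1) (c' := b) (h₁ := by simp; omega)
      (h₂ := by simp) (h₁₂ := by omega) (hb := by omega) (hc := by omega) (hn' := by simp; omega), this,
      show g.v (1 :: List.replicate (m + 1) 1) (n - b) (by simp; omega) = 0 from
        g₂ (m + 2) _ _ (by omega), Cochain.zero_comp, zero_add, smul_smul, ← Int.negOnePow_add,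
        add_comm 1, Nat.cast_add, Nat.cast_one]
    rfl

end WordCochain

variable {E F : CochainComplex (ModuleCat.{v} A) ℤ}

lemma mulHom_one : mulHom k E 1 = 𝟙 _ := by
  ext i x
  exact one_smul A (show E.X i from x)

lemma WordCochain.IsBalanced.v_replicate_append {i : ℤ} {q : WordCochain L (toBase k E) (toBase k F) i}
    (hq : q.IsBalanced ι (mulHom k E) (mulHom k F)) (j : ℕ) (a : A) (r : List L) (n : ℤ) (hn hn') :
    q.v (List.replicate j 1 ++ ι a :: r) n hn =
      (q.v (List.replicate (j + 1) 1 ++ r) n hn').comp (Cochain.ofHom (mulHom k F a)) (add_zero n) := by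
  induction j generalizing r with
  | zero =>
    have := hq.first r 1 a n (by simpa using hn') (by simpa using hn')
    exact (q.v_congr (by simp) _ _).trans this
  | succ j ih =>
    simp only [List.length_append, List.length_replicate, List.length_cons] at hn hn'
    have := hq.inner (List.replicate j 1) r 1 1 a n (by simp; omega) (by simp; omega)
    rw [q.v_congr (show List.replicate (j + 1) 1 ++ ι a :: r =
      List.replicate j 1 ++ 1 :: (ι a * 1) :: r by simp [List.replicate_succ'])
      _ _, ← this, q.v_congr (show List.replicate j 1 ++ (1 * ι a) :: 1 :: r =
        List.replicate j 1 ++ ι a :: 1 :: r by simp), ih (1 :: r) (by simp; omega) (by simp; omega)]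
    congr 1
    exact q.v_congr (by simp [List.replicate_succ']) _ _

lemma WordCochain.IsBalanced.isNormalized {i : ℤ} {q : WordCochain L (toBase k E) (toBase k F) i}
    (hq : q.IsBalanced ι (mulHom k E) (mulHom k F))
    (h : ∀ m n hn, 0 < m → q.v (List.replicate m 1) n hn = 0) : q.IsNormalized ι := by
  have key : ∀ (l : List A) (j : ℕ) (n : ℤ) (hn), 0 < j + l.length →
      q.v (List.replicate j 1 ++ l.map ι) n hn = 0 := by
    intro l
    induction l with
    | nil =>
      intro j n hn hj
      exact (q.v_congr (by simp) n hn).trans (h j n (by simpa using hn) (by simpa using hj))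
    | cons a l ih =>
      intro j n hn _
      simp only [List.length_append, List.length_replicate, List.map_cons, List.length_cons,
        List.length_map] at hn
      change q.v (List.replicate j 1 ++ ι a :: l.map ι) n _ = 0
      rw [hq.v_replicate_append j a _ n _ (by simp; omega), ih (j + 1) n (by simp; omega) (by omega),
        Cochain.zero_comp]
  intro l n hn hl
  have := key l 0 n (by simpa using hn) (by simpa using List.length_pos_iff.2 hl)
  simpa using this

/-- The family `q (-, 1 ; -)` on the words of odd length. -/
def WordCochain.oddLast {C : Type*} [Category* C] [Preadditive C] {K K₁ : CochainComplex C ℤ}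
    {i j : ℤ} (h : i + 1 = j) (q : WordCochain L K K₁ j) : WordCochain L K K₁ i :=
  .mk fun u n hn => if Odd u.length then q.v (u ++ [1]) n (by simp; omega) else 0

lemma WordCochain.isBalanced_oddLast {i j : ℤ} (h : i + 1 = j)
    {q : WordCochain L (toBase k E) (toBase k F) j}
    (hq : q.IsBalanced ι (mulHom k E) (mulHom k F)) :
    (q.oddLast h).IsBalanced ι (mulHom k E) (mulHom k F) where
  add l r x y n h₁ h₂ h₃ := by
    simp only [oddLast, mk_v, List.length_append, List.length_cons] at h₁ ⊢
    by_cases ho : Odd (l.length + (r.length + 1))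
    · simp only [if_pos ho]
      have := hq.add l (r ++ [1]) x y n (by simp; omega) (by simp; omega) (by simp; omega)
      exact (q.v_congr (by simp) _ _).trans (this.trans (congrArg₂ (· + ·)
        (q.v_congr (by simp) _ _) (q.v_congr (by simp) _ _)))
    · simp only [if_neg ho, add_zero]
  inner l r x y a n h₁ h₂ := by
    simp only [oddLast, mk_v, List.length_append, List.length_cons] at h₁ ⊢
    by_cases ho : Odd (l.length + (r.length + 1 + 1))
    · simp only [if_pos ho]
      have := hq.inner l (r ++ [1]) x y a n (by simp; omega) (by simp; omega)
      exact (q.v_congr (by simp) _ _).trans (this.trans (q.v_congr (by simp) _ _))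
    · simp only [if_neg ho]
  last l x a n h₁ h₂ := by
    simp only [List.length_append, List.length_cons, List.length_nil] at h₁
    simp only [oddLast, mk_v, List.length_append, List.length_cons, List.length_nil]
    by_cases ho : Odd (l.length + (0 + 1))
    · simp only [if_pos ho]
      have e1 := hq.inner l [] x 1 a n (by simp; omega) (by simp; omega)
      have e2 := hq.last (l ++ [x]) 1 a n (by simp; omega) (by simp; omega)
      refine (q.v_congr (by simp) _ _).trans (e1.trans ((q.v_congr (by simp) _ _).trans
        (e2.trans ?_)))
      congr 1
    · simp only [if_neg ho, Cochain.comp_zero]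
  first r x a n h₁ h₂ := by
    simp only [oddLast, mk_v, List.length_cons] at h₁ ⊢
    by_cases ho : Odd (r.length + 1)
    · simp only [if_pos ho, List.cons_append]
      exact hq.first _ _ _ _ _ _
    · simp only [if_neg ho, Cochain.zero_comp]
  nil a n h₁ := by
    simp [oddLast]

/-- The differential of a weak morphism on the words `1 … 1`. -/
lemma wpx_d_replicate {X Y : (wpx.{w, v, u} ι).Obj} {n m : ℤ} (h : n + 1 = m)
    (q : (wpx.{w, v, u} ι).Hom X Y n) (r : ℕ) (b : ℤ) (hb hb') :
    ((wpx.{w, v, u} ι).d n m h q).1.v (List.replicate (r + 1) 1) b hb =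
      (q.1.delta h).v (List.replicate (r + 1) 1) b hb +
      (if Odd r then n.negOnePow • q.1.v (List.replicate r 1) b hb' else 0) := by
  have hX : IsNormalizedMC ι X.1 X.2.1.1 := X.2.2.1
  have hY : IsNormalizedMC ι Y.1 Y.2.1.1 := Y.2.2.1
  have key : ∀ (X : CochainComplex (ModuleCat.{v} A) ℤ) (η : WordCochain L (toBase k X) (toBase k X) 1),
      IsNormalizedMC ι X η → (∀ hn, η.v [1] 0 hn = Cochain.ofHom (𝟙 _)) ∧
      (∀ m n hn, 2 ≤ m → η.v (List.replicate m 1) n hn = 0) := by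
    intro X η hη
    constructor
    · intro hn
      have := hη.2.1 1 (by simp)
      rw [mulHom_one] at this
      rw [← this]
      exact η.v_congr (by simp) _ _
    · intro m n hn hm
      have := hη.2.2 (List.replicate m 1) n (by simpa using hn) (by simpa using hm)
      rw [← this]
      exact η.v_congr (by simp) _ _
  have e1 := hochschild_replicate h q.1 r b hb hb'
  have e2 := comp_replicate q.1 Y.2.1.1 h rfl r b hb hb' hY.1 (key _ _ hY).1 (key _ _ hY).2
  have e3 := replicate_comp X.2.1.1 q.1 ((add_comm 1 n).trans h) r b hb hb' hX.1 (key _ _ hX).1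
    (key _ _ hX).2
  change (q.1.dQ h + q.1.comp Y.2.1.1 h - n.negOnePow • X.2.1.1.comp q.1 _).v _ b hb = _
  rw [sub_v, add_v, units_smul_v, dQ, sub_v, units_smul_v]
  erw [e1, e2, e3]
  by_cases hr : Odd r
  · rw [if_pos hr, if_pos hr, Int.negOnePow_odd (r : ℤ) (by exact_mod_cast hr)]
    simp
  · rw [if_neg hr, if_neg hr, Int.negOnePow_even (r : ℤ)
      ((Int.even_coe_nat r).2 (Nat.not_odd_iff_even.1 hr))]
    simp

/-- A morphism whose differential is normalized becomes normalized after subtracting the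
differential of some morphism: the restriction to words in `A` of the complex of morphisms that
vanish on the empty word is contractible. -/
lemma exists_sub_d_normalized {X Y : (wpx.{w, v, u} ι).Obj} {l n m : ℤ} (hl : l + 1 = n)
    (h : n + 1 = m) (q : (wpx.{w, v, u} ι).Hom X Y n)
    (hq : (wpx.{w, v, u} ι).d n m h q ∈ normalizedHom ι X Y m) :
    ∃ p : (wpx.{w, v, u} ι).Hom X Y l, q - (wpx.{w, v, u} ι).d l n hl p ∈ normalizedHom ι X Y n := by
  let p : (wpx.{w, v, u} ι).Hom X Y l :=
    l.negOnePow • (⟨q.1.oddLast hl, WordCochain.isBalanced_oddLast hl q.2⟩ : weakHom ι X.1 Y.1 l)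
  have hp : p.1 = l.negOnePow • q.1.oddLast hl := by
    dsimp only [p]
    rcases Int.units_eq_one_or l.negOnePow with hs | hs
    · rw [hs, one_smul, one_smul]
    · rw [hs, Units.neg_smul, Units.neg_smul, one_smul, one_smul]; rfl
  refine ⟨p, WordCochain.IsBalanced.isNormalized (q - (wpx.{w, v, u} ι).d l n hl p).2 ?_⟩
  intro r b hb hr
  obtain ⟨r, rfl⟩ : ∃ r', r = r' + 1 := ⟨r - 1, by omega⟩
  simp only [List.length_replicate] at hb
  push_cast at hb
  change q.1.v _ b _ - ((wpx.{w, v, u} ι).d l n hl p).1.v _ b _ = 0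
  rw [wpx_d_replicate hl p r b (by simp; omega) (by simp; omega), hp]
  have hlast : ∀ r : ℕ, List.replicate r (1 : L) ++ [1] = List.replicate (r + 1) 1 := fun r => by
    simp [List.replicate_succ']
  by_cases ho : Odd r
  · have e1 : ((l.negOnePow • q.1.oddLast hl).delta hl).v (List.replicate (r + 1) 1) b (by simp; omega) = 0 := by
      rw [delta_v (n' := b - 1) (hn' := by simp; omega) (hnn := by omega), units_smul_v, oddLast, mk_v,
        if_neg (by simpa [Nat.odd_add_one] using ho)]
      simp
    rw [e1, if_pos ho, zero_add, units_smul_v, smul_smul, Int.units_mul_self, one_smul, oddLast, mk_v,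
      if_pos (by simpa using ho), q.1.v_congr (hlast r), sub_self]
  · have hs : n.negOnePow = -l.negOnePow := by rw [← hl, Int.negOnePow_succ]
    have hq' : ((wpx.{w, v, u} ι).d n m h q).1.v (List.replicate (r + 1 + 1) 1) b (by simp; omega) = 0 := by
      have := hq (List.replicate (r + 1 + 1) 1) b (by simp; omega) (by simp)
      rw [← this]
      exact v_congr _ (by simp) _ _
    rw [wpx_d_replicate h q (r + 1) b (by simp; omega) (by simp; omega),
      if_pos (by simpa [Nat.odd_add_one] using ho)] at hq'
    rw [if_neg ho, add_zero, delta_v (n' := b - 1) (hn' := by simp; omega) (hnn := by omega),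
      units_smul_v, oddLast, mk_v, if_pos (by simpa [Nat.odd_add_one] using ho), δ_units_smul,
      q.1.v_congr (hlast (r + 1)), ← delta_v h q.1 _ b (b - 1) (by simp; omega) (by simp; omega) (by omega),
      eq_neg_of_add_eq_zero_left hq', hs]
    simp [smul_smul]

variable (ι) in
/-- The inclusion of the normalized morphisms. -/
noncomputable abbrev wpx₀Incl : DGFunctor (wpx₀.{w, v, u} ι) (wpx.{w, v, u} ι) :=
  .subIncl _ _ _ _ _

lemma qffAt_wpx₀Incl (X Y : (wpx.{w, v, u} ι).Obj) :
    (wpx₀Incl ι).QFFAt (C := wpx₀.{w, v, u} ι) X Y := by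
  intro l n m hl hn
  constructor
  · rintro f - ⟨(g : (wpx.{w, v, u} ι).Hom X Y l), hg⟩
    have hg' : (wpx.{w, v, u} ι).d (x := X) (y := Y) l n hl g = f.1 := hg
    obtain ⟨p, hp⟩ := exists_sub_d_normalized (X := X) (Y := Y) (sub_add_cancel l 1) hl g
      (hg' ▸ f.2)
    refine ⟨⟨_, hp⟩, Subtype.ext (Eq.trans (b := (wpx.{w, v, u} ι).d (x := X) (y := Y) l n hl
      (g - (wpx.{w, v, u} ι).d (x := X) (y := Y) (l - 1) l (sub_add_cancel l 1) p)) rfl ?_)⟩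
    rw [map_sub, (wpx.{w, v, u} ι).d_d, sub_zero, hg']
  · rintro (g : (wpx.{w, v, u} ι).Hom X Y n) hg
    have hg' : (wpx.{w, v, u} ι).d (x := X) (y := Y) n m hn g = 0 := hg
    obtain ⟨p, hp⟩ := exists_sub_d_normalized (X := X) (Y := Y) hl hn g (hg' ▸ zero_mem _)
    refine ⟨⟨_, hp⟩, Subtype.ext (Eq.trans (b := (wpx.{w, v, u} ι).d (x := X) (y := Y) n m hn
      (g - (wpx.{w, v, u} ι).d (x := X) (y := Y) l n hl p)) rfl ?_), p, ?_⟩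
    · rw [map_sub, (wpx.{w, v, u} ι).d_d, sub_zero, hg']
      rfl
    · exact (sub_sub_cancel (G := (wpx.{w, v, u} ι).Hom X Y n) _ _).symm

variable {E F : CochainComplex (ModuleCat.{v} L) ℤ}

lemma exists_eq_strictFamily_add_twD_of_bounded (hE : IsBoundedCpx E)
    (hproj : ∀ i, Module.Projective L (E.X i)) {l n m : ℤ} (hl : l + 1 = n) (hn : n + 1 = m)
    (q : weakHom ι (resCpx ι E) (resCpx ι F) n)
    (hq : ∃ g', twD (ofLetters (actHom ι E)) (ofLetters (actHom ι F)) hn q.1 =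
      strictFamily ι g') :
    ∃ (g : Cochain E F n) (r : weakHom ι (resCpx ι E) (resCpx ι F) l),
      q.1 = strictFamily ι g +
        twD (ofLetters (actHom ι E)) (ofLetters (actHom ι F)) hl r.1 := by
  obtain ⟨a, b, ha, hb⟩ := hE
  refine exists_eq_strictFamily_add_twD hproj (a - 1) (fun s hs => ?_) hl hn (b - (a - 1)).toNat q
    (fun s hs u c hc r hr x => ?_) hq
  · exact ModuleCat.subsingleton_of_isZero (E.isZero_of_isStrictlyGE a s (by omega))
  · have : Subsingleton (E.X s) :=
      ModuleCat.subsingleton_of_isZero (E.isZero_of_isStrictlyLE b s (by omega))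
    obtain rfl : x = 0 := Subsingleton.elim (α := E.X s) x 0
    exact ev_map_zero _ _ _ _ _ _ _

lemma wpx_d_coe {X Y : (wpx.{w, v, u} ι).Obj} {n m : ℤ} (h : n + 1 = m)
    (q : (wpx.{w, v, u} ι).Hom X Y n) :
    ((wpx.{w, v, u} ι).d n m h q).1 = twD X.2.1.1 Y.2.1.1 h q.1 := rfl

lemma weakifyMap_coe_eq (n : ℤ) (g : Cochain E F n) :
    (weakifyMap (E := E) (F := F) ι n g).1 = strictFamily (k := k) ι g := rfl

/-- Weakification is quasi-fully faithful on bounded complexes of projective modules. -/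
lemma qffAt_weakify (hE : IsBoundedCpx E) (hproj : ∀ i, Module.Projective L (E.X i)) :
    (weakify (k := k) ι).QFFAt (C := dgCpx.{w, v, u} k L) E F := by
  intro l n m hl hn
  constructor
  · rintro f - ⟨g, hg⟩
    have e1 : twD (ofLetters (actHom ι E)) (ofLetters (actHom ι F)) hl g.1 =
        strictFamily (k := k) ι f :=
      (wpx_d_coe (X := weakifyObj ι E) (Y := weakifyObj ι F) hl g).symm.trans
        ((congrArg Subtype.val hg).trans (weakifyMap_coe_eq n f))
    obtain ⟨g', r, e⟩ := exists_eq_strictFamily_add_twD_of_bounded hE hproj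
      (sub_add_cancel l 1) hl g ⟨f, e1⟩
    refine ⟨g', ?_⟩
    rw [e, twD_add, twD_twD_strict, add_zero, twD_strictFamily] at e1
    exact strictFamily_injective e1
  · intro g hg
    have e1 : twD (ofLetters (actHom ι E)) (ofLetters (actHom ι F)) hn g.1 = 0 :=
      (wpx_d_coe (X := weakifyObj ι E) (Y := weakifyObj ι F) hn g).symm.trans
        (congrArg Subtype.val hg)
    obtain ⟨g', r, e⟩ := exists_eq_strictFamily_add_twD_of_bounded hE hproj hl hn g
      ⟨0, e1.trans (strictFamily_zero (k := k)).symm⟩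
    refine ⟨g', ?_, r, ?_⟩
    · rw [e, twD_add, twD_twD_strict, add_zero, twD_strictFamily,
        ← strictFamily_zero (k := k) (ι := ι)] at e1
      exact strictFamily_injective e1
    · refine Subtype.ext ((wpx_d_coe (X := weakifyObj ι E) (Y := weakifyObj ι F) hl r).trans ?_)
      exact (sub_eq_of_eq_add' e).symm

end

/-! ### Reflection of inner equivalences by the projection to complexes of modules -/

namespace WordCochain

section

variable {C : Type*} [Category* C] [Preadditive C] {L : Type*} [Ring L] {K K₁ K₂ : CochainComplex C ℤ}

/-- The family `q` vanishes on the words with less than `N` letters. -/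
def VanishesBelow {i : ℤ} (q : WordCochain L K K₁ i) (N : ℕ) : Prop :=
  ∀ (u : List L) (n : ℤ) (hn), u.length < N → q.v u n hn = 0

lemma VanishesBelow.hochschild_v {i j : ℤ} (h : i + 1 = j) {q : WordCochain L K K₁ i} {N : ℕ}
    (hq : q.VanishesBelow N) (u : List L) (n : ℤ) (hn) (hu : u.length ≤ N) :
    (q.hochschild h).v u n hn = 0 := by
  induction u generalizing i j N with
  | nil => rfl
  | cons x u ih =>
    cases u with
    | nil => rfl
    | cons y u =>
      simp only [List.length_cons] at hu hn
      rw [hcc h, hq _ _ _ (by simp; omega), ih (sub_add_cancel i 1) (N := N - 1)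
        (q := q.shift (sub_add_cancel i 1) x)
        (fun u n hn h => hq (x :: u) n _ (by simp; omega)) _ (by simp; omega), sub_zero]

lemma VanishesBelow.comp_v {a b c : ℤ} (h : a + b = c) {q : WordCochain L K K₁ a} {N : ℕ}
    (hq : q.VanishesBelow N) (f : WordCochain L K₁ K₂ b) (u : List L) (n n' : ℤ) (hn hn' hb)
    (h' : n' + b = n) (hu : u.length ≤ N) :
    (q.comp f h).v u n hn = (q.v u n' hn').comp (f.v [] b hb) h' := by
  cases u with
  | nil => exact comp_nil q f h _ _ _ _ _ _ _
  | cons x u =>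
    simp only [List.length_cons] at hu hn hn'
    push_cast at hn hn'
    rw [comp_cons q f h x u n n' b _ _ (by simp) h' (sub_add_cancel b 1) (c' := c - 1) (by omega)
      (by omega), comp_v_eq_zero, smul_zero, add_zero]
    intro l r hlr
    have := congrArg List.length hlr
    rw [List.length_append] at this
    exact Or.inl fun n hn => hq r n hn (by omega)

/-- If a family vanishes on words of fewer than `N` letters, its twisted differential on words of at
most `N` letters is the differential of its components: all other terms involve shorter words. -/
lemma VanishesBelow.twD_v {η : WordCochain L K K 1} {φ : WordCochain L K₁ K₁ 1} {i j : ℤ}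
    (hη : ∀ n hn, η.v [] n hn = 0) (hφ : ∀ n hn, φ.v [] n hn = 0)
    (h : i + 1 = j) {q : WordCochain L K K₁ i} {N : ℕ}
    (hq : q.VanishesBelow N) (u : List L) (n n' : ℤ) (hn hn') (h' : n' + 1 = n)
    (hu : u.length ≤ N) :
    (twD η φ h q).v u n hn = δ n' n (q.v u n' hn') := by
  have key : ∀ (l r : List L), l ++ r = u → l ≠ [] → r.length < N ∧ l.length ≤ N := by
    intro l r hlr hl
    have := congrArg List.length hlr
    have := List.length_pos_iff.2 hl
    rw [List.length_append] at *
    omega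
  rw [twD, sub_v, add_v, units_smul_v, dQ, sub_v, units_smul_v, hq.hochschild_v h u n _ hu,
    comp_v_eq_zero h, comp_v_eq_zero, delta_v h q u n n' _ hn' h']
  · simp
  · intro l r hlr
    by_cases hr : r = []
    · subst hr
      exact Or.inl hη
    · refine Or.inr fun n hn => hq _ _ _ ?_
      have := congrArg List.length hlr
      have := List.length_pos_iff.2 hr
      rw [List.length_append] at *
      omega
  · intro l r hlr
    by_cases hl : l = []
    · subst hl
      exact Or.inr hφ
    · exact Or.inl fun n hn => hq _ _ _ (key l r hlr hl).1

lemma IsBalanced.of_forall_length {A : Type*} {ι : A → L} {m : A → (K ⟶ K)} {m₁ : A → (K₁ ⟶ K₁)}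
    {i : ℤ} {q : WordCochain L K K₁ i}
    (h : ∀ N : ℕ, ∃ q' : WordCochain L K K₁ i, q'.IsBalanced ι m m₁ ∧
      (q - q').VanishesBelow N) : q.IsBalanced ι m m₁ := by
  have e : ∀ {q' : WordCochain L K K₁ i} {N : ℕ}, (q - q').VanishesBelow N → ∀ u n hn,
      u.length < N → q.v u n hn = q'.v u n hn := fun h u n hn hu => sub_eq_zero.1 (h u n hn hu)
  constructor
  · constructor
    · intro l r x y n h₁ h₂ h₃
      obtain ⟨q', hq', h'⟩ := h ((l ++ (x + y) :: r).length + 1)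
      rw [e h' _ _ _ (by simp), e h' _ _ _ (by simp), e h' _ _ _ (by simp)]
      exact hq'.add _ _ _ _ _ _ _ _
    · intro l r x y a n h₁ h₂
      obtain ⟨q', hq', h'⟩ := h ((l ++ (x * ι a) :: y :: r).length + 1)
      rw [e h' _ _ _ (by simp), e h' _ _ _ (by simp)]
      exact hq'.inner _ _ _ _ _ _ _ _
    · intro l x a n h₁ h₂
      obtain ⟨q', hq', h'⟩ := h ((l ++ [x * ι a]).length + 1)
      rw [e h' _ _ _ (by simp), e h' _ _ _ (by simp)]
      exact hq'.last _ _ _ _ _ _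
  · intro r x a n h₁ h₂
    obtain ⟨q', hq', h'⟩ := h (((ι a * x) :: r).length + 1)
    rw [e h' _ _ _ (by simp), e h' _ _ _ (by simp)]
    exact hq'.first _ _ _ _ _ _
  · intro a n h₁
    obtain ⟨q', hq', h'⟩ := h 1
    rw [e h' _ _ _ (by simp)]
    exact hq'.nil _ _ _

end

end WordCochain

/-- Cochains with values in the two ends of a homotopy equivalence: if the image under `f` of a
cocycle `a` is the coboundary of `b`, then `a` is a coboundary `δ a'`, and `b - f a'` is a
coboundary as well. -/
lemma exists_δ_eq_of_homotopyEquiv {C : Type*} [Category* C] [Preadditive C]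
    {K E G : CochainComplex C ℤ} {l n m p : ℤ} (hl : l + 1 = n) (hn : n + 1 = m) (hm : m + 1 = p)
    {f : Cochain E G 0} {g : Cochain G E 0} {s : Cochain E E (-1)} {t : Cochain G G (-1)}
    (hf : δ 0 1 f = 0) (hg : δ 0 1 g = 0)
    (hs : f.comp g (add_zero 0) - .ofHom (𝟙 E) = δ (-1) 0 s)
    (ht : g.comp f (add_zero 0) - .ofHom (𝟙 G) = δ (-1) 0 t)
    {a : Cochain K E m} (ha : δ m p a = 0)
    {b : Cochain K G n} (hb : a.comp f (add_zero m) = δ n m b) (a' c : _) (b' : Cochain K G l)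
    (ha' : a' = b.comp g (add_zero n) - a.comp s (by omega)) (hc : c = b - a'.comp f (add_zero n))
    (hb' : b' = -c.comp t (by omega)) :
    a = δ n m (a' + c.comp g (add_zero n)) ∧
      b = (a' + c.comp g (add_zero n)).comp f (add_zero n) + δ l n b' := by
  have e1 : a = δ n m a' := by
    have h1 := δ_comp b g (add_zero n) m 1 m (by omega) hn rfl
    have h2 := δ_comp a s (show m + (-1) = n by omega) p 0 m hn hm rfl
    have h3 := congrArg (fun z => a.comp z (add_zero m)) hs
    rw [hg, Cochain.comp_zero, zero_add, ← hb, Int.negOnePow_zero, one_smul] at h1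
    rw [ha, Cochain.zero_comp, smul_zero, add_zero, ← hs, Cochain.comp_sub, Cochain.comp_id,
      ← Cochain.comp_assoc a f g (add_zero m) (add_zero 0) (by omega)] at h2
    rw [ha', δ_sub, h1, h2]
    abel
  have e2 : δ n m c = 0 := by
    have h1 := δ_comp a' f (add_zero n) m 1 m (by omega) hn rfl
    rw [hf, Cochain.comp_zero, zero_add, ← e1, hb, Int.negOnePow_zero, one_smul] at h1
    rw [hc, δ_sub, h1, sub_self]
  refine ⟨?_, ?_⟩
  · have h1 := δ_comp c g (add_zero n) m 1 m (by omega) hn rfl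
    rw [hg, Cochain.comp_zero, zero_add, e2, Cochain.zero_comp, smul_zero] at h1
    rw [δ_add, h1, add_zero, e1]
  · have h2 := δ_comp c t (show n + (-1) = l by omega) m 0 n (by omega) hn rfl
    rw [e2, Cochain.zero_comp, smul_zero, add_zero, ← ht, Cochain.comp_sub, Cochain.comp_id,
      ← Cochain.comp_assoc c g f (add_zero n) (add_zero 0) (by omega)] at h2
    rw [hb', δ_neg, h2, Cochain.add_comp, hc]
    abel

section

variable {k : Type w} [Field k] {A L : Type u} [CommRing A] [Algebra k A] [Ring L] [Algebra k L]
  {ι : A →ₐ[k] L}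

open WordCochain

/-- An infinite sum of morphisms has a meaning if its terms vanish on longer and longer words, as each
of its components is then a finite sum. -/
lemma wpx_exists_eq_sum {X Y : (wpx.{w, v, u} ι).Obj} {n : ℤ}
    (q : ℕ → (wpx.{w, v, u} ι).Hom X Y n) (hq : ∀ j, (q j).1.VanishesBelow j) :
    ∃ p : (wpx.{w, v, u} ι).Hom X Y n, ∀ N,
      (p - ∑ j ∈ Finset.range N, q j : (wpx.{w, v, u} ι).Hom X Y n).1.VanishesBelow N := by
  have hsum : ∀ (s : Finset ℕ) u m hm,
      (∑ j ∈ s, q j : (wpx.{w, v, u} ι).Hom X Y n).1.v u m hm = ∑ j ∈ s, (q j).1.v u m hm := by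
    intro s u m hm
    induction s using Finset.cons_induction with
    | empty => rfl
    | cons j s hj ih =>
      rw [Finset.sum_cons, Finset.sum_cons, ← ih]
      rfl
  let p : WordCochain L (toBase k X.1) (toBase k Y.1) n :=
    .mk fun u m hm => ∑ j ∈ Finset.range (u.length + 1), (q j).1.v u m hm
  have hp : ∀ N, (p - (∑ j ∈ Finset.range N, q j : (wpx.{w, v, u} ι).Hom X Y n).1).VanishesBelow N := by
    intro N u m hm hu
    rw [sub_v, hsum, sub_eq_zero]
    change ∑ j ∈ Finset.range (u.length + 1), (q j).1.v u m hm = _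
    refine Finset.sum_subset (fun j hj => ?_) fun j _ hj => hq j u m hm ?_
    · simp only [Finset.mem_range] at *; omega
    · simp only [Finset.mem_range] at *; omega
  exact ⟨⟨p, IsBalanced.of_forall_length fun N => ⟨_, (∑ j ∈ Finset.range N, q j :
    (wpx.{w, v, u} ι).Hom X Y n).2, hp N⟩⟩, hp⟩

lemma VanishesBelow.wpx_comp {X Y Z : (wpx.{w, v, u} ι).Obj} {a b c : ℤ} (h : a + b = c) {N : ℕ}
    {q : (wpx.{w, v, u} ι).Hom X Y a} (hq : q.1.VanishesBelow N) (f : (wpx.{w, v, u} ι).Hom Y Z b) :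
    ((wpx.{w, v, u} ι).comp h q f).1.VanishesBelow N := fun u n hn hu =>
  (hq.comp_v h f.1 u n (n - b) hn (by omega) (by simp) (by omega) hu.le).trans
    (by rw [hq _ _ _ hu, Cochain.zero_comp])

lemma VanishesBelow.wpx_d {X Y : (wpx.{w, v, u} ι).Obj} {n m : ℤ} (h : n + 1 = m) {N : ℕ}
    {q : (wpx.{w, v, u} ι).Hom X Y n} (hq : q.1.VanishesBelow N) :
    ((wpx.{w, v, u} ι).d n m h q).1.VanishesBelow N := fun u j hj hu =>
  (hq.twD_v X.2.2.1.1 Y.2.2.1.1 h u j (j - 1) hj (by omega) (by omega) hu.le).trans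
    (by rw [hq _ _ _ hu, δ_zero])

/-- The correction on the words with `N` letters, in the proof that weak morphisms with an
invertible component on the empty word are invertible. -/
lemma wpx_exists_correction {X Y Z : (wpx.{w, v, u} ι).Obj} {l n m p : ℤ}
    (hl : l + 1 = n) (hn : n + 1 = m) (hm : m + 1 = p) {f : (wpx.{w, v, u} ι).Hom X Y 0}
    {f₀ : Cochain (toBase k X.1) (toBase k Y.1) 0} {g : weakHom ι Y.1 X.1 0}
    {g₀ : Cochain (toBase k Y.1) (toBase k X.1) 0} {s : weakHom ι X.1 X.1 (-1)}
    {s₀ : Cochain (toBase k X.1) (toBase k X.1) (-1)} {t : weakHom ι Y.1 Y.1 (-1)}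
    {t₀ : Cochain (toBase k Y.1) (toBase k Y.1) (-1)} (ef : ∀ h, f.1.v [] 0 h = f₀)
    (eg : ∀ h, g.1.v [] 0 h = g₀) (es : ∀ h, s.1.v [] (-1) h = s₀)
    (et : ∀ h, t.1.v [] (-1) h = t₀) (hf : δ 0 1 f₀ = 0) (hg : δ 0 1 g₀ = 0)
    (hs : f₀.comp g₀ (add_zero 0) - .ofHom (𝟙 _) = δ (-1) 0 s₀)
    (ht : g₀.comp f₀ (add_zero 0) - .ofHom (𝟙 _) = δ (-1) 0 t₀) (N : ℕ)
    (a : (wpx.{w, v, u} ι).Hom Z X m) (ha : (wpx.{w, v, u} ι).d m p hm a = 0)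
    (b : (wpx.{w, v, u} ι).Hom Z Y n)
    (hb : (wpx.{w, v, u} ι).comp (add_zero m) a f = (wpx.{w, v, u} ι).d n m hn b)
    (haN : a.1.VanishesBelow N) (hbN : b.1.VanishesBelow N) :
    ∃ (a' : (wpx.{w, v, u} ι).Hom Z X n) (b' : (wpx.{w, v, u} ι).Hom Z Y l),
      a'.1.VanishesBelow N ∧ b'.1.VanishesBelow N ∧
      (a - (wpx.{w, v, u} ι).d n m hn a' : (wpx.{w, v, u} ι).Hom Z X m).1.VanishesBelow (N + 1) ∧
      (b - ((wpx.{w, v, u} ι).comp (add_zero n) a' f + (wpx.{w, v, u} ι).d l n hl b') :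
        (wpx.{w, v, u} ι).Hom Z Y n).1.VanishesBelow (N + 1) := by
  let D := wpx.{w, v, u} ι
  let a₀ : D.Hom Z X n := D.comp (add_zero n) b g - D.comp (by omega : m + (-1) = n) a s
  let c : D.Hom Z Y n := b - D.comp (add_zero n) a₀ f
  let a' : D.Hom Z X n := a₀ + D.comp (add_zero n) c g
  let b' : D.Hom Z Y l := - D.comp (by omega : n + (-1) = l) c t
  have h₀ : a₀.1.VanishesBelow N := fun u j hj hu => by
    change (D.comp (add_zero n) b g).1.v u j hj - (D.comp _ a s).1.v u j hj = 0
    rw [VanishesBelow.wpx_comp (add_zero n) hbN g u j hj hu,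
      VanishesBelow.wpx_comp _ haN s u j hj hu, sub_zero]
  have hc : c.1.VanishesBelow N := fun u j hj hu => by
    change b.1.v u j hj - (D.comp (add_zero n) a₀ f).1.v u j hj = 0
    rw [VanishesBelow.wpx_comp (add_zero n) h₀ f u j hj hu, hbN u j hj hu, sub_zero]
  have ha' : a'.1.VanishesBelow N := fun u j hj hu => by
    change a₀.1.v u j hj + (D.comp (add_zero n) c g).1.v u j hj = 0
    rw [VanishesBelow.wpx_comp (add_zero n) hc g u j hj hu, h₀ u j hj hu, add_zero]
  have hb' : b'.1.VanishesBelow N := fun u j hj hu => by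
    change -(D.comp _ c t).1.v u j hj = 0
    rw [VanishesBelow.wpx_comp _ hc t u j hj hu, neg_zero]
  -- the components on a word with at most `N` letters satisfy the hypotheses of
  -- `exists_δ_eq_of_homotopyEquiv`
  have key : ∀ (u : List L) (hu : u.length ≤ N) (j : ℤ) (hj : j + u.length = n),
      a.1.v u (j + 1) (by omega) = δ j (j + 1) (a'.1.v u j hj) ∧
      b.1.v u j hj = (a'.1.v u j hj).comp f₀ (add_zero j) +
        δ (j - 1) j (b'.1.v u (j - 1) (by omega)) := by
    intro u hu j hj
    have e1 : a₀.1.v u j hj = (b.1.v u j hj).comp g₀ (add_zero j) -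
        (a.1.v u (j + 1) (by omega)).comp s₀ (by omega) := by
      rw [← eg (by simp), ← es (by simp)]
      exact congrArg₂ (· - ·) (hbN.comp_v (add_zero n) g.1 u j j hj hj _ _ hu)
        (haN.comp_v (by omega : m + (-1) = n) s.1 u j (j + 1) hj (by omega) _ (by omega) hu)
    have e2 : c.1.v u j hj = b.1.v u j hj - (a₀.1.v u j hj).comp f₀ (add_zero j) := by
      rw [← ef (by simp)]
      exact congrArg (b.1.v u j hj - ·) (h₀.comp_v (add_zero n) f.1 u j j hj hj _ _ hu)
    have e3 : a'.1.v u j hj = a₀.1.v u j hj + (c.1.v u j hj).comp g₀ (add_zero j) := by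
      rw [← eg (by simp)]
      exact congrArg (a₀.1.v u j hj + ·) (hc.comp_v (add_zero n) g.1 u j j hj hj _ _ hu)
    have e4 : b'.1.v u (j - 1) (by omega) = -(c.1.v u j hj).comp t₀ (by omega) := by
      rw [← et (by simp)]
      exact congrArg (- ·) (hc.comp_v (by omega : n + (-1) = l) t.1 u (j - 1) j (by omega) hj _
        (by omega) hu)
    have e5 : δ (j + 1) (j + 2) (a.1.v u (j + 1) (by omega)) = 0 := by
      rw [← haN.twD_v Z.2.2.1.1 X.2.2.1.1 hm u (j + 2) (j + 1) (by omega) (by omega) (by omega) hu]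
      exact congrArg (fun q : weakHom ι Z.1 X.1 p => q.1.v u (j + 2) (by omega)) ha
    have e6 : (a.1.v u (j + 1) (by omega)).comp f₀ (add_zero (j + 1)) =
        δ j (j + 1) (b.1.v u j hj) := by
      rw [← hbN.twD_v Z.2.2.1.1 Y.2.2.1.1 hn u (j + 1) j (by omega) hj rfl hu, ← ef (by simp),
        ← haN.comp_v (add_zero m) f.1 u (j + 1) (j + 1) (by omega) (by omega) _ _ hu]
      exact congrArg (fun q : weakHom ι Z.1 Y.1 m => q.1.v u (j + 1) (by omega)) hb
    have := exists_δ_eq_of_homotopyEquiv (show j - 1 + 1 = j by omega) rfl (by omega) hf hg hs ht e5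
      e6 _ _ _ e1 e2 e4
    rwa [← e3] at this
  refine ⟨a', b', ha', hb', fun u j hj hu => ?_, fun u j hj hu => ?_⟩
  · obtain ⟨i, rfl⟩ : ∃ i, j = i + 1 := ⟨j - 1, by omega⟩
    refine (congrArg (a.1.v u (i + 1) hj - ·) (ha'.twD_v Z.2.2.1.1 X.2.2.1.1 hn u (i + 1) i hj
      (by omega) rfl (by omega))).trans ?_
    exact sub_eq_zero.2 (key u (by omega) i (by omega)).1
  · refine (congrArg (b.1.v u j hj - ·) (congrArg₂ (· + ·)
      (ha'.comp_v (add_zero n) f.1 u j j hj hj (by simp) (add_zero j) (by omega))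
      (hb'.twD_v Z.2.2.1.1 Y.2.2.1.1 hl u j (j - 1) hj (by omega) (by omega) (by omega)))).trans ?_
    rw [ef]
    exact sub_eq_zero.2 (key u (by omega) j (by omega)).2

/-- The inverse up to homotopy of a homotopy equivalence of complexes of modules, and the homotopies,
seen over the base ring. -/
lemma exists_baseMap_homotopy {E G : CochainComplex (ModuleCat.{v} A) ℤ} {f : Cochain E G 0}
    (hf : (dgCpx.{w, v, u} k A).IsInnerEquivalence (x := E) (y := G) f) :
    δ 0 1 (baseMap (k := k) 0 f) = 0 ∧ ∃ (g : Cochain G E 0) (s : Cochain E E (-1))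
      (t : Cochain G G (-1)), δ 0 1 (baseMap (k := k) 0 g) = 0 ∧
      (baseMap (k := k) 0 f).comp (baseMap (k := k) 0 g) (add_zero 0) - .ofHom (𝟙 _) =
        δ (-1) 0 (baseMap (k := k) (-1) s) ∧
      (baseMap (k := k) 0 g).comp (baseMap (k := k) 0 f) (add_zero 0) - .ofHom (𝟙 _) =
        δ (-1) 0 (baseMap (k := k) (-1) t) := by
  obtain ⟨hf₀, (g : Cochain G E 0), hg, ⟨(s : Cochain E E (-1)), hs⟩,
    ⟨(t : Cochain G G (-1)), ht⟩⟩ := hf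
  have hf₀' : δ 0 1 f = 0 := hf₀
  have hg' : δ 0 1 g = 0 := hg
  refine ⟨by rw [← baseMap_δ, hf₀', map_zero], g, s, t, by rw [← baseMap_δ, hg', map_zero], ?_, ?_⟩
  · rw [← baseMap_comp, ← baseMap_id, ← baseMap_δ, ← map_sub]
    exact congrArg (baseMap (k := k) 0) hs
  · rw [← baseMap_comp, ← baseMap_id, ← baseMap_δ, ← map_sub]
    exact congrArg (baseMap (k := k) 0) ht

/-- Let `f` be a closed morphism of weak complexes, the underlying map of complexes of modules
of which is a homotopy equivalence. If the composite of a closed morphism `a` with `f` is the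
differential of `b`, then `a` is the differential of some `a'`, and `b - f a'` is a
differential. -/
lemma wpx_exists_eq_d {X Y Z : (wpx.{w, v, u} ι).Obj} {f : (wpx.{w, v, u} ι).Hom X Y 0}
    (df : (wpx.{w, v, u} ι).d 0 1 rfl f = 0)
    (hf : (dgCpx.{w, v, u} k A).IsInnerEquivalence ((wpxProj ι).map 0 f)) {l n m p : ℤ}
    (hl : l + 1 = n) (hn : n + 1 = m) (hm : m + 1 = p)
    (a : (wpx.{w, v, u} ι).Hom Z X m) (ha : (wpx.{w, v, u} ι).d m p hm a = 0)
    (b : (wpx.{w, v, u} ι).Hom Z Y n)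
    (hb : (wpx.{w, v, u} ι).comp (add_zero m) a f = (wpx.{w, v, u} ι).d n m hn b) :
    ∃ (a' : (wpx.{w, v, u} ι).Hom Z X n) (b' : (wpx.{w, v, u} ι).Hom Z Y l),
      a = (wpx.{w, v, u} ι).d n m hn a' ∧
      b = (wpx.{w, v, u} ι).comp (add_zero n) a' f + (wpx.{w, v, u} ι).d l n hl b' := by
  obtain ⟨hf₀, g, s, t, hg, hs, ht⟩ := exists_baseMap_homotopy hf
  have step := wpx_exists_correction (Z := Z) hl hn hm (f := f)
    (f₀ := baseMap (k := k) 0 (weakHomProj ι X.1 Y.1 0 f))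
    (g := weakHomOfCochain ι _ _ 0 g) (g₀ := baseMap (k := k) 0 g)
    (s := weakHomOfCochain ι _ _ (-1) s) (s₀ := baseMap (k := k) (-1) s)
    (t := weakHomOfCochain ι _ _ (-1) t) (t₀ := baseMap (k := k) (-1) t)
    (fun _ => rfl) (fun _ => rfl) (fun _ => rfl) (fun _ => rfl) hf₀ hg hs ht
  -- the errors `a₁` and `b₁` of an approximate solution are made to vanish on longer and longer words
  let D := wpx.{w, v, u} ι
  let a₁ (P : D.Hom Z X n) : D.Hom Z X m := a - D.d n m hn P
  let b₁ (P : D.Hom Z X n) (Q : D.Hom Z Y l) : D.Hom Z Y n :=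
    b - (D.comp (add_zero n) P f + D.d l n hl Q)
  let S (N : ℕ) : Type _ := {PQ : D.Hom Z X n × D.Hom Z Y l //
    (a₁ PQ.1).1.VanishesBelow N ∧ (b₁ PQ.1 PQ.2).1.VanishesBelow N}
  have next : ∀ N (σ : S N), ∃ τ : S (N + 1),
      (τ.1.1 - σ.1.1 : D.Hom Z X n).1.VanishesBelow N ∧
      (τ.1.2 - σ.1.2 : D.Hom Z Y l).1.VanishesBelow N := by
    rintro N ⟨⟨P, Q⟩, h₁, h₂⟩
    have h₃ : D.d m p hm (a₁ P) = 0 := by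
      rw [map_sub, D.d_d, sub_zero]
      exact ha
    have h₄ : D.comp (add_zero m) (a₁ P) f = D.d n m hn (b₁ P Q) := by
      have e := D.d_comp (add_zero n) hn (zero_add 1) hn hn (add_zero m) P f
      have df' : D.d 0 1 (zero_add 1) f = 0 := df
      have hb' : D.comp (add_zero m) a f = D.d n m hn b := hb
      rw [df', map_zero, zero_add, Int.negOnePow_zero, one_smul] at e
      rw [map_sub, map_sub, map_add, D.d_d, add_zero, LinearMap.sub_apply, hb', e]
    obtain ⟨a', b', h₅, h₆, h₇, h₈⟩ := step N (a₁ P) h₃ (b₁ P Q) h₄ h₁ h₂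
    refine ⟨⟨(P + a', Q + b'), ?_, ?_⟩, ?_, ?_⟩
    · have : a₁ (P + a') = a₁ P - D.d n m hn a' := by
        change a - D.d n m hn (P + a') = _
        rw [map_add, sub_add_eq_sub_sub]
      exact (congrArg (fun q : D.Hom Z X m => q.1.VanishesBelow (N + 1)) this).mpr h₇
    · have : b₁ (P + a') (Q + b') = b₁ P Q - (D.comp (add_zero n) a' f + D.d l n hl b') := by
        change b - (D.comp (add_zero n) (P + a') f + D.d l n hl (Q + b')) =
          b - (D.comp (add_zero n) P f + D.d l n hl Q) - _
        rw [map_add, map_add, LinearMap.add_apply]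
        abel
      exact (congrArg (fun q : D.Hom Z Y n => q.1.VanishesBelow (N + 1)) this).mpr h₈
    · exact (congrArg (fun q : D.Hom Z X n => q.1.VanishesBelow N) (add_sub_cancel_left P a')).mpr h₅
    · exact (congrArg (fun q : D.Hom Z Y l => q.1.VanishesBelow N) (add_sub_cancel_left Q b')).mpr h₆
  choose nx hnx using next
  let σ : ∀ N, S N := fun N => Nat.rec
    ⟨(0, 0), fun u n hn h => absurd h (Nat.not_lt_zero _), fun u n hn h => absurd h (Nat.not_lt_zero _)⟩
    (fun N τ => nx N τ) N
  -- the solution is the sum of the corrections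
  obtain ⟨a', ha'⟩ := wpx_exists_eq_sum (fun N => (σ (N + 1)).1.1 - (σ N).1.1)
    fun N => (hnx N (σ N)).1
  obtain ⟨b', hb'⟩ := wpx_exists_eq_sum (fun N => (σ (N + 1)).1.2 - (σ N).1.2)
    fun N => (hnx N (σ N)).2
  have zero_of : ∀ {X Y : D.Obj} {n : ℤ} (q : D.Hom X Y n), (∀ N, q.1.VanishesBelow N) → q = 0 :=
    fun q hq => Subtype.ext (WordCochain.ext fun u n hn => hq (u.length + 1) u n hn (by simp))
  have e1 : ∀ N, ∑ j ∈ Finset.range N, ((σ (j + 1)).1.1 - (σ j).1.1) = (σ N).1.1 := fun N => by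
    rw [Finset.sum_range_sub (fun j => (σ j).1.1)]
    exact sub_zero _
  have e2 : ∀ N, ∑ j ∈ Finset.range N, ((σ (j + 1)).1.2 - (σ j).1.2) = (σ N).1.2 := fun N => by
    rw [Finset.sum_range_sub (fun j => (σ j).1.2)]
    exact sub_zero _
  have add_van : ∀ {X Y : D.Obj} {n : ℤ} {q q' : D.Hom X Y n} {N : ℕ}, q.1.VanishesBelow N →
      q'.1.VanishesBelow N → (q - q').1.VanishesBelow N := fun h h' u n hn hu =>
    (congrArg₂ (· - ·) (h u n hn hu) (h' u n hn hu)).trans (sub_zero _)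
  have ha'' : ∀ N, (a' - (σ N).1.1 : D.Hom Z X n).1.VanishesBelow N := fun N => e1 N ▸ ha' N
  have hb'' : ∀ N, (b' - (σ N).1.2 : D.Hom Z Y l).1.VanishesBelow N := fun N => e2 N ▸ hb' N
  refine ⟨a', b', sub_eq_zero.1 (zero_of (X := Z) (Y := X) _ fun N => ?_),
    sub_eq_zero.1 (zero_of (X := Z) (Y := Y) _ fun N => ?_)⟩
  · have : a - D.d n m hn a' = a₁ (σ N).1.1 - D.d n m hn (a' - (σ N).1.1) := by
      change _ = a - D.d n m hn (σ N).1.1 - _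
      rw [map_sub]
      abel
    exact (congrArg (fun q : D.Hom Z X m => q.1.VanishesBelow N) this).mpr
      (add_van (σ N).2.1 (VanishesBelow.wpx_d hn (ha'' N)))
  · have : b - (D.comp (add_zero n) a' f + D.d l n hl b') =
        b₁ (σ N).1.1 (σ N).1.2 - D.comp (add_zero n) (a' - (σ N).1.1) f -
          D.d l n hl (b' - (σ N).1.2) := by
      change _ = b - (D.comp (add_zero n) (σ N).1.1 f + D.d l n hl (σ N).1.2) - _ - _
      rw [map_sub, map_sub, LinearMap.sub_apply]
      abel
    exact (congrArg (fun q : D.Hom Z Y n => q.1.VanishesBelow N) this).mpr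
      (add_van (add_van (σ N).2.2 (VanishesBelow.wpx_comp (add_zero n) (ha'' N) f))
        (VanishesBelow.wpx_d hl (hb'' N)))

/-- The projection from weak complexes to complexes of modules reflects inner equivalences. -/
lemma wpx_isInnerEquivalence {X Y : (wpx.{w, v, u} ι).Obj} {f : (wpx.{w, v, u} ι).Hom X Y 0}
    (df : (wpx.{w, v, u} ι).d 0 1 rfl f = 0)
    (hf : (dgCpx.{w, v, u} k A).IsInnerEquivalence ((wpxProj ι).map 0 f)) :
    (wpx.{w, v, u} ι).IsInnerEquivalence f := by
  let D := wpx.{w, v, u} ι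
  have d_id : ∀ X : D.Obj, D.d 0 1 rfl (D.id X) = 0 := fun X => by
    have := D.d_comp (a' := 1) (b' := 1) (c' := 1) (add_zero 0) (zero_add 1) (zero_add 1)
        (zero_add 1) (zero_add 1) (add_zero 1) (D.id X) (D.id X)
    rw [D.id_comp, D.id_comp (D.d 0 1 _ (D.id X)), D.comp_id (D.d 0 1 _ (D.id X))] at this
    simpa using this
  obtain ⟨g, t, hg, ht⟩ := wpx_exists_eq_d df hf (Z := Y) (l := -1) (n := 0) (m := 1) (p := 2) rfl
    rfl rfl 0 (map_zero _) (D.id Y) ((d_id Y).symm ▸ by rw [map_zero, LinearMap.zero_apply])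
  have dg : D.d 0 1 rfl g = 0 := hg.symm
  have ht' : D.comp (add_zero 0) g f = D.id Y - D.d (-1) 0 rfl t := eq_sub_of_add_eq ht.symm
  have df' : D.d 0 1 (zero_add 1) f = 0 := df
  have h₁ : D.d 0 1 rfl (D.comp (add_zero 0) f g - D.id X) = 0 := by
    rw [map_sub, d_id X, sub_zero, D.d_comp (a' := 1) (b' := 1) (c' := 1) (add_zero 0) (zero_add 1)
      (zero_add 1) (zero_add 1) (zero_add 1) (add_zero 1) f g, dg, df']
    simp
  have h₂ : D.comp (add_zero 0) (D.comp (add_zero 0) f g - D.id X) f =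
      D.d (-1) 0 rfl (-D.comp (zero_add (-1)) f t) := by
    rw [map_neg, D.d_comp (a' := 1) (b' := 0) (c' := 0) (zero_add (-1)) (zero_add 1) rfl rfl
      (add_zero 0) rfl f t, df', map_sub, LinearMap.sub_apply, D.id_comp,
      D.assoc (add_zero 0) (add_zero 0) (add_zero 0) (add_zero 0) f g f, ht', map_sub, D.comp_id]
    simp
  obtain ⟨s, -, hs, -⟩ := wpx_exists_eq_d df hf (Z := X) (l := -2) (n := -1) (m := 0) (p := 1) rfl
    rfl rfl _ h₁ _ h₂
  exact ⟨df, g, dg, ⟨s, hs⟩, -t, by rw [map_neg, ht']; abel⟩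

end

/-! ### Attaching cells -/

section

variable {k : Type w} [Field k] {A L : Type u} [CommRing A] [Algebra k A] [Ring L] [Algebra k L]
  {ι : A →ₐ[k] L}

open WordCochain

variable {E : CochainComplex (ModuleCat.{v} L) ℤ} {Y : CochainComplex (ModuleCat.{v} A) ℤ}
  {p : ℤ} {I : Type*}

/-- On a complex concentrated in one degree, a closed morphism whose component on the empty word
vanishes on the generators is the differential of the insertion of coordinates into it. -/
lemma twD_insertHom_eq (hE : ∀ s, s ≠ p → Subsingleton (E.X s)) (c : Coordinates ι E p I)
    (y : I → (toBase k (resCpx ι E)).X p)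
    (hc : ∀ x, ((c x).sum fun m l => ((actHom ι E l).f p).hom (y m)) = x)
    (φ : WordCochain L (toBase k Y) (toBase k Y) 1) {i j l : ℤ} (h : i + 1 = j)
    (hl : j + 1 = l) (q : weakHom ι (resCpx ι E) Y j)
    (hq : twD (ofLetters (actHom ι E)) φ hl q.1 = 0)
    (hq₀ : ∀ m, q.1.ev [] j (by simp) p (p + j) rfl (y m) = 0) :
    twD (ofLetters (actHom ι E)) φ h (insertHom c y h q).1 = j.negOnePow • q.1 := by
  refine ext_ev fun u n hn s r hr x => ?_
  by_cases hs : s = p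
  · subst hs
    rw [ev_twD_insertHom c y hc φ h hl q x (fun m _ u n hn r hr => ?_) u n hn r hr, ev_units_smul,
      Finsupp.sum, Finset.sum_eq_zero, Finsupp.sum, Finset.sum_eq_zero, smul_zero, zero_add, sub_zero]
    · intro m _
      rw [hq₀, ev_map_zero]
    · intro m _
      rw [hq]
      exact (ev_lastLetter hl _ _ u n hn (by simp; omega) _ _ _ _).trans (smul_zero _)
    · have : Subsingleton (E.X (s + 1)) := hE _ (by omega)
      rw [show ((toBase k (resCpx ι E)).d s (s + 1)).hom (y m) = 0 from
        Subsingleton.elim (α := E.X (s + 1)) _ _]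
      exact ev_map_zero _ _ _ _ _ _ _
  · have : Subsingleton (E.X s) := hE s hs
    obtain rfl : x = 0 := Subsingleton.elim (α := E.X s) x 0
    rw [ev_map_zero, ev_map_zero]

/-- The morphism defined on a free module by a family of cycles of a weak complex. -/
lemma twD_insertHom_mc (hE : ∀ s, s ≠ p → Subsingleton (E.X s)) (c : Coordinates ι E p I)
    (η : weakHom ι Y Y 1) (hη : η.1.dQ (rfl : (1 : ℤ) + 1 = 2) + η.1.comp η.1 rfl = 0)
    (hη₀ : ∀ n hn, η.1.v [] n hn = 0) (e : I → (toBase k Y).X p)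
    (he : ∀ m, ((toBase k Y).d p (p + 1)).hom (e m) = 0) :
    twD (ofLetters (actHom ι E)) η.1 (zero_add 1) (insertHom c e (zero_add 1) η).1 = 0 := by
  refine ext_ev fun u n hn s r hr x => ?_
  by_cases hs : s = p
  · subst hs
    refine (ev_insertion_dQ c e (zero_add 1) (rfl : (1 : ℤ) + 1 = 2) η η.1 u n hn r hr x
      (fun m _ u n hn r hr => ?_)).trans ?_
    · rw [he, ev_map_zero]
    · rw [Finsupp.sum, Finset.sum_eq_zero, Finsupp.sum, Finset.sum_eq_zero, smul_zero, sub_zero]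
      · rfl
      · intro m _
        rw [show η.1.ev [] 1 (by simp) s (s + 1) rfl (e m) = 0 by unfold ev; rw [hη₀]; rfl, ev_map_zero]
      · intro m _
        rw [hη]
        exact (ev_lastLetter rfl _ _ u n (by omega) (by simp; omega) _ _ _ _).trans (smul_zero _)
  · have : Subsingleton (E.X s) := hE s hs
    obtain rfl : x = 0 := Subsingleton.elim (α := E.X s) x 0
    rw [ev_map_zero, ev_map_zero]

lemma ev_insertHom_mc_nil (c : Coordinates ι E p I) (η : weakHom ι Y Y 1)
    (hη : IsNormalizedMC ι Y η.1) (e : I → (toBase k Y).X p) (x) (m : I)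
    (hx : c x = Finsupp.single m 1) (hn) (hr) :
    (insertHom c e (zero_add 1) η).1.ev [] 0 hn p p hr x = e m := by
  refine (ev_insertion c e (zero_add 1) η [] 0 hn p hr x).trans ?_
  rw [hx]
  refine (Finsupp.sum_single_index (ev_lastLetter_zero (zero_add 1) η [] 0 hn p p hr (e m))).trans ?_
  rw [ev_lastLetter _ _ _ _ _ _ (by simp)]
  have h1 := hη.2.1 1 (by simp)
  rw [mulHom_one] at h1
  have h2 : η.1.v ([] ++ [1]) 0 (by simp) = Cochain.ofHom (𝟙 (toBase k Y)) :=
    (η.1.v_congr (by simp) _ _).trans h1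
  unfold ev
  rw [h2, Cochain.ofHom_v]
  simp

lemma ev_wpx_d_nil {X Z : (wpx.{w, v, u} ι).Obj} {n m : ℤ} (h : n + 1 = m)
    (q : (wpx.{w, v, u} ι).Hom X Z n) (hm hn) (p r p' r' : ℤ) (hr : p + m = r) (hp' : p + 1 = p')
    (hr' : p + n = r') (hr'' : p' + n = r) (x : (toBase k X.1).X p) :
    ((wpx.{w, v, u} ι).d n m h q).1.ev [] m hm p r hr x =
      ((toBase k Z.1).d r' r).hom (q.1.ev [] n hn p r' hr' x) +
      m.negOnePow • q.1.ev [] n hn p' r hr'' (((toBase k X.1).d p p').hom x) := by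
  refine Eq.trans ?_ (ev_delta h q.1 [] m n hm hn h p r p' r' hr hp' (by omega) x)
  have := wpx_d_nil ι n m h q
  unfold ev
  rw [this, delta_v h q.1 [] m n hm hn h]

lemma ev_weakifyMap_comp_nil {E G : CochainComplex (ModuleCat.{v} L) ℤ} {Z : (wpx.{w, v, u} ι).Obj}
    {a b c : ℤ} (h : a + b = c)
    (g : Cochain E G a) (q : (wpx.{w, v, u} ι).Hom (weakifyObj ι G) Z b) (hn hn') (p r s : ℤ)
    (hr : p + c = r) (hs : p + a = s) (hs' : s + b = r) (x : E.X p) :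
    ((wpx.{w, v, u} ι).comp h (weakifyMap (E := E) (F := G) ι a g) q).1.ev [] c hn p r hr x = q.1.ev [] b hn' s r hs' ((g.v p s hs).hom x) :=
  ev_comp_nil (strictFamily (k := k) ι g) q.1 h c hn p r hr s hs x hs'

lemma wpx_d_weakifyMap {E G : CochainComplex (ModuleCat.{v} L) ℤ} {n m : ℤ} (h : n + 1 = m)
    (g : Cochain E G n) : (wpx.{w, v, u} ι).d n m h
      (weakifyMap (E := E) (F := G) ι n g) = weakifyMap (E := E) (F := G) ι m (δ n m g) :=
  ((weakify (k := k) ι).map_d n m h g).symm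

variable {J : Type*} {F F' : CochainComplex (ModuleCat.{v} L) ℤ} {r : ℤ}

/-- A morphism from a free module, placed in one degree, to a weak complex, with prescribed values
on the generators; it is closed if these are cycles. -/
lemma exists_wpx_hom_of_family (hF : ∀ s, s ≠ p → Subsingleton (F.X s))
    (hF' : ∀ s, s ≠ r → Subsingleton (F'.X s)) (β : F.X p ≃ₗ[L] (J →₀ L))
    (β' : F'.X r ≃ₗ[L] (J →₀ L)) (Y : (wpx.{w, v, u} ι).Obj) {i j : ℤ} (h : i + 1 = j)
    (hr : p + i = r) (e : J → (toBase k Y.1).X r) :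
    ∃ q : (wpx.{w, v, u} ι).Hom (weakifyObj ι F) Y i,
      (∀ m hn, q.1.ev [] i hn p r hr (β.symm (Finsupp.single m 1)) = e m) ∧
      ((∀ m, ((toBase k Y.1).d r (r + 1)).hom (e m) = 0) → (wpx.{w, v, u} ι).d i j h q = 0) := by
  let S : Cochain F F' i := Cochain.single (ModuleCat.ofHom (β.trans β'.symm).toLinearMap) i
  have hS : δ i j S = 0 := by
    ext s t hst x
    by_cases hs : s = p
    · have : Subsingleton (F'.X t) := hF' t (by omega)
      exact Subsingleton.elim _ _
    · have : Subsingleton (F.X s) := hF s hs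
      obtain rfl : x = 0 := Subsingleton.elim x 0
      rw [map_zero, map_zero]
  let c : Coordinates ι F' r J := Coordinates.ofLinearMap ι β'.toLinearMap
  let ψ : (wpx.{w, v, u} ι).Hom (weakifyObj ι F') Y 0 := insertHom c e (zero_add 1) Y.2.1
  refine ⟨(wpx.{w, v, u} ι).comp (add_zero i)
    (weakifyMap (E := F) (F := F') ι i S) ψ,
    fun m hn => ?_, fun he => ?_⟩
  · refine (ev_weakifyMap_comp_nil (add_zero i) S ψ hn (by simp) p r r hr hr (add_zero r) _).trans ?_
    refine ev_insertHom_mc_nil c Y.2.1 Y.2.2.1 e _ m ?_ _ _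
    dsimp only [S]
    rw [Cochain.single_v]
    change β' (β'.symm (β (β.symm (Finsupp.single m 1)))) = _
    rw [LinearEquiv.apply_symm_apply, LinearEquiv.apply_symm_apply]
  · have hψ : (wpx.{w, v, u} ι).d 0 1 (zero_add 1) ψ = 0 :=
      Subtype.ext (twD_insertHom_mc hF' c Y.2.1 (congrArg Subtype.val Y.2.2.2) Y.2.2.1.1 e he)
    rw [(wpx.{w, v, u} ι).d_comp (add_zero i) h (zero_add 1) h h (add_zero j), hψ, wpx_d_weakifyMap, hS]
    have h0 : weakifyMap (E := F) (F := F') ι j (0 : Cochain F F' j) = 0 :=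
      Subtype.ext strictFamily_zero
    rw [h0]
    simp

/-- Extension of a weak morphism over cells: a closed morphism `f` from a free module, placed in one
degree, to a weak complex is the differential of a morphism that has prescribed values `e` on the
generators `y`, if `d e = f (; y)`. -/
lemma exists_wpx_extension (hF : ∀ s, s ≠ p → Subsingleton (F.X s))
    (hF' : ∀ s, s ≠ r → Subsingleton (F'.X s)) (β : F.X p ≃ₗ[L] (J →₀ L))
    (β' : F'.X r ≃ₗ[L] (J →₀ L)) (Y : (wpx.{w, v, u} ι).Obj) {i j l : ℤ} (h : i + 1 = j)
    (hl : j + 1 = l) (hr : p + i = r) (e : J → (toBase k Y.1).X r)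
    (f : (wpx.{w, v, u} ι).Hom (weakifyObj ι F) Y j) (hf : (wpx.{w, v, u} ι).d j l hl f = 0)
    (hfe : ∀ m hn, f.1.ev [] j hn p (r + 1) (by omega) (β.symm (Finsupp.single m 1)) =
      ((toBase k Y.1).d r (r + 1)).hom (e m)) :
    ∃ q : (wpx.{w, v, u} ι).Hom (weakifyObj ι F) Y i, (wpx.{w, v, u} ι).d i j h q = f ∧
      (∀ m hn, q.1.ev [] i hn p r hr (β.symm (Finsupp.single m 1)) = e m) := by
  let y : J → (toBase k (resCpx ι F)).X p := fun m => β.symm (Finsupp.single m 1)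
  -- the differential, evaluated on the generators
  have hd : ∀ (q : (wpx.{w, v, u} ι).Hom (weakifyObj ι F) Y i) m hn hn',
      ((wpx.{w, v, u} ι).d i j h q).1.ev [] j hn p (r + 1) (by omega) (y m) =
        ((toBase k Y.1).d r (r + 1)).hom (q.1.ev [] i hn' p r hr (y m)) := by
    intro q m hn hn'
    have : Subsingleton (F.X (p + 1)) := hF _ (by omega)
    rw [ev_wpx_d_nil h q hn hn' p (r + 1) (p + 1) r (by omega) rfl hr (by omega) (y m),
      show ((toBase k (weakifyObj ι F).1).d p (p + 1)).hom (y m) = 0 from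
        Subsingleton.elim (α := F.X (p + 1)) _ _, ev_map_zero, smul_zero, add_zero]
  obtain ⟨q₀, hq₀, -⟩ := exists_wpx_hom_of_family hF hF' β β' Y h hr e
  let f₁ : (wpx.{w, v, u} ι).Hom (weakifyObj ι F) Y j := f - (wpx.{w, v, u} ι).d i j h q₀
  have hf₁ : (wpx.{w, v, u} ι).d j l hl f₁ = 0 := by
    rw [map_sub, hf, (wpx.{w, v, u} ι).d_d, sub_zero]
  let c : Coordinates ι F p J := Coordinates.ofLinearMap ι β.toLinearMap
  have hc : ∀ x, ((c x).sum fun m l => ((actHom ι F l).f p).hom (y m)) = x := by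
    intro x
    change (β x).sum (fun m l => l • β.symm (Finsupp.single m 1)) = x
    conv_rhs => rw [← β.symm_apply_apply x, ← Finsupp.sum_single (β x), map_finsuppSum]
    refine Finsupp.sum_congr fun m _ => ?_
    rw [← map_smul, Finsupp.smul_single, smul_eq_mul, mul_one]
  let q' : (wpx.{w, v, u} ι).Hom (weakifyObj ι F) Y i := insertHom c y h f₁
  let q₁ : (wpx.{w, v, u} ι).Hom (weakifyObj ι F) Y i := j.negOnePow • q'
  have hq₁ : (wpx.{w, v, u} ι).d i j h q₁ = f₁ := by
    have e1 : (wpx.{w, v, u} ι).d i j h q' = j.negOnePow • f₁ := by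
      refine Subtype.ext ((twD_insertHom_eq hF c y hc Y.2.1.1 h hl f₁ (congrArg Subtype.val hf₁)
        fun m => ?_).trans ?_)
      · have e2 := hd q₀ m (by simp) (by simp)
        rw [hq₀] at e2
        have e3 := hfe m (by simp)
        have : p + j = r + 1 := by omega
        have e4 : ∀ t (ht : p + j = t), t = r + 1 → f₁.1.ev [] j (by simp) p t ht (y m) = 0 := by
          rintro t ht rfl
          exact (congrArg₂ (· - ·) e3 e2).trans (sub_self _)
        exact e4 _ _ this
      · rcases Int.units_eq_one_or j.negOnePow with hs | hs
        · rw [hs, one_smul, one_smul]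
        · rw [hs, Units.neg_smul, Units.neg_smul, one_smul, one_smul]
          rfl
    refine ((wpx.{w, v, u} ι).d_smul' h j.negOnePow _).trans ?_
    rw [e1, smul_smul, Int.units_mul_self, one_smul]
  let q₂ : (wpx.{w, v, u} ι).Hom (weakifyObj ι F) Y i := q₁ + q₀
  have hq₂ : (wpx.{w, v, u} ι).d i j h q₂ = f := by
    rw [map_add, hq₁, sub_add_cancel]
  obtain ⟨q₃, hq₃, hq₃'⟩ := exists_wpx_hom_of_family hF hF' β β' Y h hr
    (fun m => e m - q₂.1.ev [] i (by simp) p r hr (y m))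
  refine ⟨q₂ + q₃, ?_, fun m hn => ?_⟩
  · rw [map_add, hq₂, hq₃', add_zero]
    intro m
    rw [map_sub, ← hd q₂ m (by simp) (by simp), hq₂, ← hfe m (by simp)]
    exact sub_self _
  · refine (congrArg (q₂.1.ev [] i hn p r hr (y m) + ·) (hq₃ m hn)).trans ?_
    rw [add_sub_cancel]

end

section

variable {k : Type w} [Field k] {A L : Type u} [CommRing A] [Algebra k A] [Ring L] [Algebra k L]
  {ι : A →ₐ[k] L}

open WordCochain

section

variable {F P : CochainComplex (ModuleCat.{v} L) ℤ} {Y : (wpx.{w, v, u} ι).Obj}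

/-- The component of a weak morphism of degree `0` on the empty word. -/
noncomputable def emptyWord {X Y : (wpx.{w, v, u} ι).Obj} (f : (wpx.{w, v, u} ι).Hom X Y 0) (i : ℤ) :
    (toBase k X.1).X i →ₗ[k] (toBase k Y.1).X i :=
  ((f.1.v [] 0 (by simp)).v i i (add_zero i)).hom

/-- The extension of a weak morphism to a mapping cone. -/
lemma exists_wpx_desc (φ : F ⟶ P) (f : (wpx.{w, v, u} ι).Hom (weakifyObj ι P) Y 0)
    (hf : (wpx.{w, v, u} ι).d 0 1 rfl f = 0) (q : (wpx.{w, v, u} ι).Hom (weakifyObj ι F) Y (-1))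
    (hq : (wpx.{w, v, u} ι).d (-1) 0 rfl q = (wpx.{w, v, u} ι).comp (add_zero 0)
      (weakifyMap (E := F) (F := P) ι 0 (Cochain.ofHom φ)) f) :
    ∃ f' : (wpx.{w, v, u} ι).Hom (weakifyObj ι (mappingCone φ)) Y 0,
      (wpx.{w, v, u} ι).d 0 1 rfl f' = 0 ∧
      (∀ i (x : P.X i), emptyWord f' i (((mappingCone.inr φ).f i).hom x) = emptyWord f i x) ∧
      ∀ i j (hij : j + 1 = i) (x : F.X i) hn,
        emptyWord f' j (((mappingCone.inl φ).v i j (by omega)).hom x) =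
          q.1.ev [] (-1) hn i j (by omega) x := by
  let D := wpx.{w, v, u} ι
  let s : D.Hom (weakifyObj ι (mappingCone φ)) (weakifyObj ι P) 0 :=
    weakifyMap (E := mappingCone φ) (F := P) ι 0 (mappingCone.snd φ)
  let t : D.Hom (weakifyObj ι (mappingCone φ)) (weakifyObj ι F) 1 :=
    weakifyMap (E := mappingCone φ) (F := F) ι 1 (mappingCone.fst φ).1
  have ht : D.d 1 2 rfl t = 0 := by
    refine (wpx_d_weakifyMap (rfl : (1 : ℤ) + 1 = 2) (mappingCone.fst φ).1).trans ?_
    rw [Cocycle.δ_eq_zero]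
    exact Subtype.ext strictFamily_zero
  have hs : D.d 0 1 (zero_add 1) s = -D.comp (add_zero 1) t
      (weakifyMap (E := F) (F := P) ι 0 (Cochain.ofHom φ)) := by
    refine (wpx_d_weakifyMap (zero_add 1) (mappingCone.snd φ)).trans ?_
    rw [mappingCone.δ_snd]
    refine (show weakifyMap (E := mappingCone φ) (F := P) ι 1
      (-(mappingCone.fst φ).1.comp (Cochain.ofHom φ) (add_zero 1)) =
        -weakifyMap (E := mappingCone φ) (F := P) ι 1
          ((mappingCone.fst φ).1.comp (Cochain.ofHom φ) (add_zero 1)) from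
      Subtype.ext ((strictHom (k := k) ι 1).map_neg _ |> congrArg Subtype.val)).trans
      (congrArg (- ·) ?_)
    exact ((weakify (k := k) ι).map_comp (x := mappingCone φ) (y := F) (z := P) (add_zero 1)
      (mappingCone.fst φ).1 (Cochain.ofHom φ))
  have hf' : D.d 0 1 (zero_add 1) f = 0 := hf
  have hq' : D.d (-1) 0 rfl q = _ := hq
  let f' : D.Hom (weakifyObj ι (mappingCone φ)) Y 0 :=
    D.comp (add_zero 0) s f + D.comp (add_neg_cancel 1) t q
  have ev_f' : ∀ i j (hij : i + 1 = j) (x : (mappingCone φ).X i), emptyWord f' i x =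
      emptyWord f i (((mappingCone.snd φ).v i i (add_zero i)).hom x) +
      q.1.ev [] (-1) (by simp) j i (by omega) (((mappingCone.fst φ).1.v i j hij).hom x) := by
    intro i j hij x
    change (D.comp (add_zero 0) s f).1.ev [] 0 _ i i _ x +
      (D.comp (add_neg_cancel 1) t q).1.ev [] 0 _ i i _ x = _
    refine congrArg₂ (· + ·) ?_ ?_
    · exact ev_weakifyMap_comp_nil (add_zero 0) (mappingCone.snd φ) f (by simp) (by simp) i i i
        (add_zero i) (add_zero i) (add_zero i) x
    · exact ev_weakifyMap_comp_nil (add_neg_cancel 1) (mappingCone.fst φ).1 q (by simp) (by simp)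
        i i j (add_zero i) hij (by omega) x
  refine ⟨f', ?_, fun i x => ?_, fun i j hij x hn => ?_⟩
  · change D.d 0 1 (zero_add 1) (D.comp (add_zero 0) s f + D.comp (add_neg_cancel 1) t q) = 0
    rw [map_add, D.d_comp (a' := 1) (b' := 1) (c' := 1) (add_zero 0) (zero_add 1) (zero_add 1)
        (zero_add 1) (zero_add 1) (add_zero 1) s f,
      D.d_comp (a' := 2) (b' := 0) (c' := 1) (add_neg_cancel 1) rfl rfl
        (zero_add 1) (add_zero 1) rfl t q, hf', ht, hs, hq',
      ← D.assoc (add_zero 1) (add_zero 0) (add_zero 1) (add_zero 1)]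
    simp
  · refine (ev_f' i (i + 1) rfl _).trans ?_
    have e1 : ((mappingCone.snd φ).v i i (add_zero i)).hom (((mappingCone.inr φ).f i).hom x) = x :=
      DFunLike.congr_fun (ModuleCat.hom_ext_iff.1 (mappingCone.inr_f_snd_v φ i)) x
    have e2 : ((mappingCone.fst φ).1.v i (i + 1) rfl).hom (((mappingCone.inr φ).f i).hom x) = 0 :=
      DFunLike.congr_fun (ModuleCat.hom_ext_iff.1 (mappingCone.inr_f_fst_v φ i (i + 1) rfl)) x
    rw [e1, e2]
    exact (congrArg (emptyWord f i x + ·) (ev_map_zero _ _ _ _ _ _ _)).trans (add_zero _)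
  · refine (ev_f' j i hij _).trans ?_
    have e1 : ((mappingCone.snd φ).v j j (add_zero j)).hom
        (((mappingCone.inl φ).v i j (by omega)).hom x) = 0 :=
      DFunLike.congr_fun (ModuleCat.hom_ext_iff.1 (mappingCone.inl_v_snd_v φ i j (by omega))) x
    have e2 : ((mappingCone.fst φ).1.v j i hij).hom
        (((mappingCone.inl φ).v i j (by omega)).hom x) = x :=
      DFunLike.congr_fun (ModuleCat.hom_ext_iff.1 (mappingCone.inl_v_fst_v φ i j hij)) x
    rw [e1, e2]
    exact (congrArg (· + _) (map_zero (emptyWord f j))).trans (zero_add _)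

end

section

variable {P : CochainComplex (ModuleCat.{u} L) ℤ} {Y : (wpx.{w, u, u} ι).Obj}

/-- Attaching free generators, in degree `n`, to a complex `P` with a weak morphism to `Y`: the
generators are mapped to given cycles of `P` of degree `n + 1`, and to given elements of `Y`. -/
lemma exists_wpx_attach (n : ℤ) {J : Type u} (φ : (J →₀ L) →ₗ[L] P.X (n + 1))
    (hφ : ∀ m, (P.d (n + 1) (n + 2)).hom (φ m) = 0)
    (f : (wpx.{w, u, u} ι).Hom (weakifyObj ι P) Y 0) (hf : (wpx.{w, u, u} ι).d 0 1 rfl f = 0)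
    (e : J → (toBase k Y.1).X n)
    (he : ∀ j, ((toBase k Y.1).d n (n + 1)).hom (e j) =
      emptyWord f (n + 1) (φ (Finsupp.single j 1))) :
    ∃ (P' : CochainComplex (ModuleCat.{u} L) ℤ)
      (f' : (wpx.{w, u, u} ι).Hom (weakifyObj ι P') Y 0) (inr : ∀ i, P.X i →ₗ[L] P'.X i)
      (b : (J →₀ L) →ₗ[L] P'.X n), (wpx.{w, u, u} ι).d 0 1 rfl f' = 0 ∧
      (∀ i j x, (P'.d i j).hom (inr i x) = inr j ((P.d i j).hom x)) ∧
      (∀ m, (P'.d n (n + 1)).hom (b m) = inr (n + 1) (φ m)) ∧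
      (∀ i x, emptyWord f' i (inr i x) = emptyWord f i x) ∧
      (∀ j, emptyWord f' n (b (Finsupp.single j 1)) = e j) ∧
      (∀ i, i ≠ n → Function.Bijective (inr i)) ∧
      Function.Bijective (fun x : (J →₀ L) × P.X n => b x.1 + inr n x.2) := by
  let M : ModuleCat.{u} L := ModuleCat.of L (J →₀ L)
  let F := (HomologicalComplex.single (ModuleCat.{u} L) (ComplexShape.up ℤ) (n + 1)).obj M
  let F' := (HomologicalComplex.single (ModuleCat.{u} L) (ComplexShape.up ℤ) n).obj M
  have hF : ∀ s, s ≠ n + 1 → Subsingleton (F.X s) := fun s hs =>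
    ModuleCat.subsingleton_of_isZero (HomologicalComplex.isZero_single_obj_X _ _ _ _ hs)
  have hF' : ∀ s, s ≠ n → Subsingleton (F'.X s) := fun s hs =>
    ModuleCat.subsingleton_of_isZero (HomologicalComplex.isZero_single_obj_X _ _ _ _ hs)
  let β : F.X (n + 1) ≃ₗ[L] (J →₀ L) :=
    (HomologicalComplex.singleObjXSelf (ComplexShape.up ℤ) (n + 1) M).toLinearEquiv
  let β' : F'.X n ≃ₗ[L] (J →₀ L) :=
    (HomologicalComplex.singleObjXSelf (ComplexShape.up ℤ) n M).toLinearEquiv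
  let Φ : F ⟶ P := HomologicalComplex.mkHomFromSingle (ModuleCat.ofHom φ) (fun j hj => by
    obtain rfl : j = n + 2 := by
      have : n + 1 + 1 = j := hj
      omega
    ext m
    exact congrArg (P.d (n + 1) (n + 2)).hom rfl |>.trans (hφ _))
  have hΦ : ∀ m, (Φ.f (n + 1)).hom (β.symm m) = φ m := by
    intro m
    have : Φ.f (n + 1) = (HomologicalComplex.singleObjXSelf (ComplexShape.up ℤ) (n + 1) M).hom ≫
      ModuleCat.ofHom φ := HomologicalComplex.mkHomFromSingle_f _ _
    rw [this]
    exact congrArg φ (β.apply_symm_apply m)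
  let g : (wpx.{w, u, u} ι).Hom (weakifyObj ι F) Y 0 := (wpx.{w, u, u} ι).comp (add_zero 0)
    (weakifyMap (E := F) (F := P) ι 0 (Cochain.ofHom Φ)) f
  have hg : (wpx.{w, u, u} ι).d 0 1 (zero_add 1) g = 0 := by
    have hf' : (wpx.{w, u, u} ι).d 0 1 (zero_add 1) f = 0 := hf
    have h0 : weakifyMap (E := F) (F := P) ι 1 (0 : Cochain F P 1) = 0 := Subtype.ext strictFamily_zero
    rw [(wpx.{w, u, u} ι).d_comp (a' := 1) (b' := 1) (c' := 1) (add_zero 0) (zero_add 1) (zero_add 1)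
        (zero_add 1) (zero_add 1) (add_zero 1), hf', wpx_d_weakifyMap, δ_ofHom, h0]
    simp
  obtain ⟨q, hq, hqe⟩ := exists_wpx_extension hF hF' β β' Y (neg_add_cancel 1) (zero_add 1)
    (by omega) e g hg (fun j hn => by
      refine Eq.trans ?_ (he j).symm
      refine (ev_weakifyMap_comp_nil (add_zero 0) (Cochain.ofHom Φ) f hn (by simp) (n + 1) (n + 1)
        (n + 1) (by omega) (by omega) (by omega) _).trans ?_
      rw [Cochain.ofHom_v, hΦ]
      rfl)
  obtain ⟨f', hf', hr, hl⟩ := exists_wpx_desc Φ f hf q hq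
  refine ⟨mappingCone Φ, f', fun i => ((mappingCone.inr Φ).f i).hom,
    ((mappingCone.inl Φ).v (n + 1) n (by omega)).hom ∘ₗ β.symm.toLinearMap, hf', ?_, ?_, hr, ?_, ?_, ?_⟩
  · intro i j x
    exact DFunLike.congr_fun (ModuleCat.hom_ext_iff.1 (mappingCone.inr_f_d Φ i j)) x
  · intro m
    have e1 := DFunLike.congr_fun (ModuleCat.hom_ext_iff.1
      (mappingCone.inl_v_d Φ (n + 1) n (n + 2) (by omega) (by omega))) (β.symm m)
    refine e1.trans ?_
    have : Subsingleton (F.X (n + 2)) := hF _ (by omega)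
    refine (congrArg (_ - ·) (congrArg ((mappingCone.inl Φ).v (n + 2) (n + 1) (by omega)).hom
      (Subsingleton.elim ((F.d (n + 1) (n + 2)).hom (β.symm m)) 0))).trans ?_
    rw [map_zero, sub_zero]
    exact congrArg ((mappingCone.inr Φ).f (n + 1)).hom (hΦ m)
  · intro j
    exact (hl (n + 1) n rfl _ (by simp)).trans (hqe j _)
  · intro i hi
    have : Subsingleton (F.X (i + 1)) := hF _ (by omega)
    have e1 : ∀ x, ((mappingCone.snd Φ).v i i (add_zero i)).hom (((mappingCone.inr Φ).f i).hom x) = x :=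
      fun x => DFunLike.congr_fun (ModuleCat.hom_ext_iff.1 (mappingCone.inr_f_snd_v Φ i)) x
    refine ⟨Function.LeftInverse.injective e1, fun x =>
      ⟨((mappingCone.snd Φ).v i i (add_zero i)).hom x, ?_⟩⟩
    have e2 := DFunLike.congr_fun (ModuleCat.hom_ext_iff.1 (mappingCone.id_X Φ i (i + 1) rfl)) x
    refine Eq.trans ?_ e2
    refine ((congrArg (· + _) ?_).trans (zero_add _)).symm
    exact (congrArg ((mappingCone.inl Φ).v (i + 1) i (by omega)).hom
      (Subsingleton.elim (((mappingCone.fst Φ).1.v i (i + 1) rfl).hom x) 0)).trans (map_zero _)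
  · have e1 : ∀ x, ((mappingCone.snd Φ).v n n (add_zero n)).hom (((mappingCone.inr Φ).f n).hom x) = x :=
      fun x => DFunLike.congr_fun (ModuleCat.hom_ext_iff.1 (mappingCone.inr_f_snd_v Φ n)) x
    have e2 : ∀ x, ((mappingCone.fst Φ).1.v n (n + 1) rfl).hom (((mappingCone.inr Φ).f n).hom x) = 0 :=
      fun x => DFunLike.congr_fun (ModuleCat.hom_ext_iff.1
        (mappingCone.inr_f_fst_v Φ n (n + 1) rfl)) x
    have e3 : ∀ x, ((mappingCone.snd Φ).v n n (add_zero n)).hom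
        (((mappingCone.inl Φ).v (n + 1) n (by omega)).hom x) = 0 := fun x =>
      DFunLike.congr_fun (ModuleCat.hom_ext_iff.1 (mappingCone.inl_v_snd_v Φ (n + 1) n (by omega))) x
    have e4 : ∀ x, ((mappingCone.fst Φ).1.v n (n + 1) rfl).hom
        (((mappingCone.inl Φ).v (n + 1) n (by omega)).hom x) = x := fun x =>
      DFunLike.congr_fun (ModuleCat.hom_ext_iff.1 (mappingCone.inl_v_fst_v Φ (n + 1) n rfl)) x
    constructor
    · rintro ⟨m, x⟩ ⟨m', x'⟩ h
      have h₁ := congrArg ((mappingCone.fst Φ).1.v n (n + 1) rfl).hom h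
      have h₂ := congrArg ((mappingCone.snd Φ).v n n (add_zero n)).hom h
      simp only [map_add, LinearMap.comp_apply, e1, e2, e3, e4, add_zero, zero_add] at h₁ h₂
      exact Prod.ext (β.symm.injective h₁) h₂
    · intro x
      refine ⟨(β (((mappingCone.fst Φ).1.v n (n + 1) rfl).hom x),
        ((mappingCone.snd Φ).v n n (add_zero n)).hom x), ?_⟩
      refine Eq.trans ?_
        (DFunLike.congr_fun (ModuleCat.hom_ext_iff.1 (mappingCone.id_X Φ n (n + 1) rfl)) x)
      exact congrArg (fun y => ((mappingCone.inl Φ).v (n + 1) n (by omega)).hom y +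
        ((mappingCone.inr Φ).f n).hom (((mappingCone.snd Φ).v n n (add_zero n)).hom x))
        (β.symm_apply_apply _)

end

end

/-! ### Saturation of submodules -/

section

open Filter

variable {A L : Type*} [CommRing A] [Ring L] (ι : A →+* L)

/-- The elements of `A` act locally nilpotently on `L` through commutators. -/
def IsAdNilpotent : Prop :=
  ∀ (a : A) (u : L), ∃ n : ℕ, (fun v : L => ι a * v - v * ι a)^[n] u = 0

lemma isAdNilpotent_id : IsAdNilpotent (RingHom.id A) := fun a u => ⟨1, by simp [mul_comm]⟩

namespace IsAdNilpotent

variable {ι} (hι : IsAdNilpotent ι)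

include hι

/-- The left Ore condition for the powers of an element of `A`. -/
lemma exists_pow_mul (a : A) (u : L) (p : ℕ) : ∃ (N : ℕ) (z : L), ι a ^ N * u = z * ι a ^ p := by
  have key : ∀ (n : ℕ) (u : L), (fun v : L => ι a * v - v * ι a)^[n] u = 0 →
      ∃ (N : ℕ) (z : L), ι a ^ N * u = z * ι a := by
    intro n
    induction n with
    | zero => exact fun u hu => ⟨0, 0, by simpa using hu⟩
    | succ n ih =>
      intro u hu
      obtain ⟨N, z, h⟩ := ih _ hu
      refine ⟨N + 1, z + ι a ^ N * u, ?_⟩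
      rw [add_mul, ← h, pow_succ]
      noncomm_ring
  induction p with
  | zero => exact ⟨0, u, by simp⟩
  | succ p ih =>
    obtain ⟨N, z, h⟩ := ih
    obtain ⟨n, hn⟩ := hι a z
    obtain ⟨N', z', h'⟩ := key n z hn
    refine ⟨N' + N, z', ?_⟩
    rw [pow_add, mul_assoc, h, ← mul_assoc, h', mul_assoc, pow_succ']

/-- The right Ore condition for the powers of an element of `A`. -/
lemma exists_mul_pow (a : A) (u : L) (p : ℕ) : ∃ (N : ℕ) (z : L), u * ι a ^ N = ι a ^ p * z := by
  have key : ∀ (n : ℕ) (u : L), (fun v : L => ι a * v - v * ι a)^[n] u = 0 →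
      ∃ (N : ℕ) (z : L), u * ι a ^ N = ι a * z := by
    intro n
    induction n with
    | zero => exact fun u hu => ⟨0, 0, by simpa using hu⟩
    | succ n ih =>
      intro u hu
      obtain ⟨N, z, h⟩ := ih _ hu
      refine ⟨N + 1, u * ι a ^ N - z, ?_⟩
      rw [mul_sub, ← h, pow_succ']
      noncomm_ring
  induction p with
  | zero => exact ⟨0, u, by simp⟩
  | succ p ih =>
    obtain ⟨N, z, h⟩ := ih
    obtain ⟨n, hn⟩ := hι a z
    obtain ⟨N', z', h'⟩ := key n z hn
    refine ⟨N + N', z', ?_⟩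
    rw [pow_add, ← mul_assoc, h, mul_assoc, h', ← mul_assoc, pow_succ]

lemma exists_mul_pow_eq_zero (a : A) (u : L) (p : ℕ) (hu : ι a ^ p * u = 0) :
    ∃ N : ℕ, u * ι a ^ N = 0 := by
  obtain ⟨n, hn⟩ := hι a u
  induction n generalizing u with
  | zero => exact ⟨0, by simpa using hn⟩
  | succ n ih =>
    obtain ⟨Q, hQ⟩ := ih (ι a * u - u * ι a) (by
      rw [mul_sub, ← mul_assoc, ← mul_assoc, hu, zero_mul, ← pow_succ, pow_succ', mul_assoc, hu,
        mul_zero, sub_zero]) hn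
    have key : ∀ j, ι a ^ j * u * ι a ^ Q = u * ι a ^ (Q + j) := by
      intro j
      induction j with
      | zero => simp
      | succ j ihj =>
        have : ι a * u * ι a ^ Q = u * ι a * ι a ^ Q := by rwa [sub_mul, sub_eq_zero] at hQ
        rw [← add_assoc, pow_succ _ (Q + j), ← mul_assoc u, ← ihj, pow_succ _ j, mul_assoc _ (ι a),
          mul_assoc, this, mul_assoc, mul_assoc, mul_assoc, ← pow_succ', pow_succ]
    exact ⟨Q + p, by rw [← key, hu, zero_mul]⟩

lemma exists_pow_mul_eq_zero (a : A) (u : L) (p : ℕ) (hu : u * ι a ^ p = 0) :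
    ∃ N : ℕ, ι a ^ N * u = 0 := by
  obtain ⟨n, hn⟩ := hι a u
  induction n generalizing u with
  | zero => exact ⟨0, by simpa using hn⟩
  | succ n ih =>
    obtain ⟨Q, hQ⟩ := ih (ι a * u - u * ι a) (by
      rw [sub_mul, mul_assoc, hu, mul_zero, mul_assoc, ← pow_succ', pow_succ, ← mul_assoc, hu,
        zero_mul, sub_zero]) hn
    have key : ∀ j, ι a ^ Q * (u * ι a ^ j) = ι a ^ (Q + j) * u := by
      intro j
      induction j with
      | zero => simp
      | succ j ihj =>
        have : ι a ^ Q * (ι a * u) = ι a ^ Q * (u * ι a) := by rwa [mul_sub, sub_eq_zero] at hQ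
        have h2 : ι a ^ (Q + j) * ι a = ι a * ι a ^ (Q + j) := (pow_succ _ _).symm.trans (pow_succ' _ _)
        have h1 : ι a ^ Q * ι a = ι a * ι a ^ Q := (pow_succ _ _).symm.trans (pow_succ' _ _)
        calc ι a ^ Q * (u * ι a ^ (j + 1)) = ι a ^ Q * (u * ι a) * ι a ^ j := by
              rw [pow_succ']; simp only [mul_assoc]
          _ = ι a ^ Q * ι a * (u * ι a ^ j) := by rw [← this]; simp only [mul_assoc]
          _ = ι a ^ (Q + (j + 1)) * u := by
              rw [h1, mul_assoc, ihj, ← mul_assoc, ← h2, ← pow_succ, add_assoc]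
    exact ⟨Q + p, by rw [← key, hu, mul_zero]⟩

/-- The elements that a power of `f` maps to a given submodule. -/
def saturation {M : Type*} [AddCommGroup M] [Module L M] (f : A) (N : Submodule L M) :
    Submodule L M where
  carrier := {x | ∃ n : ℕ, ι f ^ n • x ∈ N}
  zero_mem' := ⟨0, by simp⟩
  add_mem' := by
    rintro x y ⟨n, hx⟩ ⟨m, hy⟩
    refine ⟨m + n, ?_⟩
    rw [smul_add, pow_add, mul_smul]
    refine N.add_mem (N.smul_mem _ hx) ?_
    rw [((Commute.refl (ι f)).pow_pow m n).eq, mul_smul]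
    exact N.smul_mem _ hy
  smul_mem' := by
    rintro u x ⟨n, hx⟩
    obtain ⟨N', z, h⟩ := hι.exists_pow_mul f u n
    refine ⟨N', ?_⟩
    rw [smul_smul, h, mul_smul]
    exact N.smul_mem _ hx

variable {M M' : Type*} [AddCommGroup M] [Module L M] [AddCommGroup M'] [Module L M'] (f : A)

end IsAdNilpotent

variable {M M' M'' : Type*} [AddCommGroup M] [Module L M] [AddCommGroup M'] [Module L M']
  [AddCommGroup M''] [Module L M'']

/-- A homomorphism of `L`-modules whose kernel and cokernel are torsion for the powers of an
element `f` of `A`; that is, an isomorphism over the open set `D (f)`. -/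
def IsAwayIso (f : A) (h : M →ₗ[L] M') : Prop :=
  (∀ m, ∃ (n : ℕ) (y : M), ι f ^ n • m = h y) ∧ ∀ y, h y = 0 → ∃ n : ℕ, ι f ^ n • y = 0

variable {ι}

lemma IsAwayIso.comp {X X' X'' : Type*} [AddCommGroup X] [Module A X] [AddCommGroup X']
    [Module A X'] [AddCommGroup X''] [Module A X''] {f f' : A} {h : X →ₗ[A] X'} {h' : X' →ₗ[A] X''}
    (hh : IsAwayIso (.id A) f h) (hh' : IsAwayIso (.id A) f' h') :
    IsAwayIso (.id A) (f * f') (h' ∘ₗ h) := by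
  constructor
  · intro m
    obtain ⟨n, y, hy⟩ := hh'.1 m
    obtain ⟨n', y', hy'⟩ := hh.1 y
    simp only [RingHom.id_apply] at hy hy' ⊢
    refine ⟨n + n', (f ^ n * f' ^ n') • y', ?_⟩
    rw [LinearMap.comp_apply, map_smul, map_smul, ← hy', map_smul, ← hy, smul_smul, smul_smul]
    congr 1
    ring
  · intro y hy
    obtain ⟨n, hn⟩ := hh'.2 _ hy
    simp only [RingHom.id_apply] at hn
    rw [← map_smul] at hn
    obtain ⟨m, hm⟩ := hh.2 _ hn
    simp only [RingHom.id_apply] at hm ⊢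
    refine ⟨n + m, ?_⟩
    have : (f * f') ^ (n + m) = (f ^ n * f' ^ m) * (f ^ m * f' ^ n) := by ring
    rw [this, mul_smul, mul_smul (f ^ m), hm, smul_zero]

lemma span_range_pow_eq_top {K : Type*} {f : K → A} (hf : Ideal.span (Set.range f) = ⊤)
    (n : K → ℕ) : Ideal.span (Set.range fun k => f k ^ n k) = ⊤ := by
  by_contra h
  obtain ⟨m, hm, hle⟩ := Ideal.exists_le_maximal _ h
  refine hm.ne_top (top_unique (hf ▸ Ideal.span_le.2 ?_))
  rintro _ ⟨k, rfl⟩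
  exact hm.isPrime.mem_of_pow_mem _ (hle (Ideal.subset_span ⟨k, rfl⟩))

/-- An element that is, over each member of a covering, in a submodule, belongs to it. -/
lemma mem_of_forall_mem_saturation (hι : IsAdNilpotent ι) {K : Type*} {f : K → A}
    (hf : Ideal.span (Set.range f) = ⊤) {N : Submodule L M} {x : M}
    (hx : ∀ k, x ∈ hι.saturation (f k) N) : x ∈ N := by
  choose n hn using hx
  have h1 := span_range_pow_eq_top hf n
  let a : Ideal A :=
    { carrier := {a | ι a • x ∈ N}
      zero_mem' := by simp
      add_mem' := fun {a b} ha hb => by simpa [add_smul] using N.add_mem ha hb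
      smul_mem' := fun a b hb => by simpa [mul_smul] using N.smul_mem (ι a) hb }
  have h2 : (1 : A) ∈ a := by
    have : Ideal.span (Set.range fun k => f k ^ n k) ≤ a := Ideal.span_le.2 (by
      rintro _ ⟨k, rfl⟩
      simpa [a] using hn k)
    exact this (h1 ▸ trivial)
  simpa [a] using h2

end

/-! ### Extensions of locally free modules of countable rank -/

section

open Filter

variable {A L : Type*} [CommRing A] [Ring L] {ι : A →+* L} {M : Type*} [AddCommGroup M] [Module L M]
  {K : Type*} {I : K → Type*}

/-- The sum of a family of homomorphisms from free modules. -/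
noncomputable def sumCharts (h : ∀ k, (I k →₀ L) →ₗ[L] M) : ((Σ k, I k) →₀ L) →ₗ[L] M :=
  Finsupp.linearCombination L fun i => h i.1 (Finsupp.single i.2 1)

/-- The inclusion of the free module of one chart into the sum. -/
noncomputable def chartIncl (L : Type*) [Ring L] {K : Type*} (I : K → Type*) (k : K) :
    (I k →₀ L) →ₗ[L] ((Σ k, I k) →₀ L) :=
  Finsupp.lmapDomain L L (Sigma.mk k)

lemma sumCharts_single (h : ∀ k, (I k →₀ L) →ₗ[L] M) (i : Σ k, I k) :
    sumCharts h (Finsupp.single i 1) = h i.1 (Finsupp.single i.2 1) := by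
  simp [sumCharts]

lemma chartIncl_single (k : K) (b : I k) (u : L) :
    chartIncl L I k (Finsupp.single b u) = Finsupp.single ⟨k, b⟩ u := by
  simp [chartIncl]

lemma sumCharts_chartIncl (h : ∀ k, (I k →₀ L) →ₗ[L] M) (k : K) (y : I k →₀ L) :
    sumCharts h (chartIncl L I k y) = h k y := by
  have : sumCharts h ∘ₗ chartIncl L I k = h k := by
    ext b
    simp [chartIncl_single, sumCharts_single]
  exact DFunLike.congr_fun this y

lemma sumCharts_surjective (hι : IsAdNilpotent ι) {f : K → A}
    (hf : Ideal.span (Set.range f) = ⊤) {h : ∀ k, (I k →₀ L) →ₗ[L] M}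
    (hh : ∀ k, IsAwayIso ι (f k) (h k)) : Function.Surjective (sumCharts h) := fun m =>
  mem_of_forall_mem_saturation (N := LinearMap.range (sumCharts h)) hι hf fun k =>
    ((hh k).1 m).imp fun _ ⟨y, hy⟩ => ⟨chartIncl L I k y, by rw [sumCharts_chartIncl, hy]⟩

/-- The elements `f ^ p i • e i - y i`, where `y i` is in the free module of the chart `k`. -/
noncomputable def chartRel (ι : A →+* L) (f : A) {k : K} (p : (Σ k, I k) → ℕ)
    (y : (Σ k, I k) → (I k →₀ L)) (i : Σ k, I k) : (Σ k, I k) →₀ L :=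
  ι f ^ p i • Finsupp.single i 1 - chartIncl L I k (y i)

/-- Over the open set of a chart, the generators of the other charts are combinations of those
of the given one. -/
lemma exists_chartRel (f : A) (h : ∀ k, (I k →₀ L) →ₗ[L] M) (k : K) (hh : IsAwayIso ι f (h k)) :
    ∃ (p : (Σ k, I k) → ℕ) (y : (Σ k, I k) → (I k →₀ L)),
      (∀ i, chartRel ι f p y i ∈ LinearMap.ker (sumCharts h)) ∧
      ∀ b, chartRel ι f p y ⟨k, b⟩ = 0 := by
  have : ∀ i : Σ k, I k, ∃ (p : ℕ) (y : I k →₀ L),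
      ι f ^ p • Finsupp.single i 1 - chartIncl L I k y ∈ LinearMap.ker (sumCharts h) ∧
      (i.1 = k → ι f ^ p • Finsupp.single i 1 - chartIncl L I k y = 0) := by
    intro i
    by_cases hi : i.1 = k
    · obtain ⟨j, b⟩ := i
      subst hi
      refine ⟨0, Finsupp.single b 1, ?_⟩
      simp [chartIncl_single]
    · obtain ⟨n, y, hy⟩ := hh.1 (sumCharts h (Finsupp.single i 1))
      exact ⟨n, y, by rw [LinearMap.mem_ker, map_sub, map_smul, hy, sumCharts_chartIncl, sub_self],
        fun h => absurd h hi⟩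
  choose p y h1 h2 using this
  exact ⟨p, y, h1, fun b => h2 _ rfl⟩

/-- Over the open set of a chart, the kernel of `sumCharts h` is spanned by the relations that express
the generators of the other charts; those of generators in the support suffice. -/
lemma mem_saturation_span_chartRel (hι : IsAdNilpotent ι) {f : A} {h : ∀ k, (I k →₀ L) →ₗ[L] M}
    {k : K} (hh : IsAwayIso ι f (h k)) {p : (Σ k, I k) → ℕ} {y : (Σ k, I k) → (I k →₀ L)}
    (hr : ∀ i, chartRel ι f p y i ∈ LinearMap.ker (sumCharts h)) {F : Set (Σ k, I k)}
    {x : (Σ k, I k) →₀ L} (hx : sumCharts h x = 0) (hF : ↑x.support ⊆ F) :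
    x ∈ hι.saturation f (Submodule.span L (chartRel ι f p y '' F)) := by
  set W := Submodule.span L (chartRel ι f p y '' F)
  have h1 : x ∈ hι.saturation f (W ⊔ LinearMap.range (chartIncl L I k)) := by
    have : x ∈ Finsupp.supported L L F := hF
    rw [Finsupp.supported_eq_span_single] at this
    refine Submodule.span_le.2 ?_ this
    rintro _ ⟨i, hi, rfl⟩
    refine ⟨p i, Submodule.mem_sup.2 ⟨chartRel ι f p y i, Submodule.subset_span ⟨i, hi, rfl⟩,
      _, ⟨y i, rfl⟩, sub_add_cancel _ _⟩⟩
  obtain ⟨n, h1⟩ := h1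
  obtain ⟨w, hw, _, ⟨z, rfl⟩, hz⟩ := Submodule.mem_sup.1 h1
  have hW : W ≤ LinearMap.ker (sumCharts h) := Submodule.span_le.2 (by
    rintro _ ⟨i, _, rfl⟩
    exact hr i)
  have h2 : h k z = 0 := by
    have := congrArg (sumCharts h) hz
    rwa [map_add, LinearMap.mem_ker.1 (hW hw), map_smul, hx, smul_zero, zero_add,
      sumCharts_chartIncl] at this
  obtain ⟨m, hm⟩ := hh.2 z h2
  refine ⟨m + n, ?_⟩
  rw [pow_add, mul_smul, ← hz, smul_add, ← map_smul, hm, map_zero, add_zero]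
  exact W.smul_mem _ hw

/-- The properties of the right multiplication by `f`, on a free `L`-module. -/
structure IsRightMul {G : Type*} [AddCommGroup G] [Module L G] (ι : A →+* L) (f : A)
    (ρ : Module.End L G) : Prop where
  exists_smul : ∀ (u : G) (p : ℕ), ∃ (N : ℕ) (z : G), (ρ ^ N) u = ι f ^ p • z
  exists_pow : ∀ (u : G) (p : ℕ), ι f ^ p • u = 0 → ∃ N : ℕ, (ρ ^ N) u = 0

variable {G : Type*} [AddCommGroup G] [Module L G]

lemma IsRightMul.eventually_smul {f : A} {ρ : Module.End L G} (hρ : IsRightMul ι f ρ) (u : G)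
    (p : ℕ) : ∀ᶠ N in atTop, ∃ z : G, (ρ ^ N) u = ι f ^ p • z := by
  obtain ⟨N, z, h⟩ := hρ.exists_smul u p
  refine eventually_atTop.2 ⟨N, fun n hn => ⟨(ρ ^ (n - N)) z, ?_⟩⟩
  rw [← map_smul, ← h, ← Module.End.mul_apply, ← pow_add, Nat.sub_add_cancel hn]

lemma IsRightMul.eventually_pow {f : A} {ρ : Module.End L G} (hρ : IsRightMul ι f ρ) (u : G)
    (p : ℕ) (hu : ι f ^ p • u = 0) : ∀ᶠ N in atTop, (ρ ^ N) u = 0 := by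
  obtain ⟨N, h⟩ := hρ.exists_pow u p hu
  refine eventually_atTop.2 ⟨N, fun n hn => ?_⟩
  rw [← Nat.sub_add_cancel hn, pow_add, Module.End.mul_apply, h, map_zero]

/-- Up to a denominator, a homomorphism on the kernel of `sumCharts h` extends over one chart to
the free module, if only finitely many values are prescribed. -/
lemma exists_local_extension (hι : IsAdNilpotent ι) {f : A} {h : ∀ k, (I k →₀ L) →ₗ[L] M}
    {k : K} (hh : IsAwayIso ι f (h k)) {p : (Σ k, I k) → ℕ} {y : (Σ k, I k) → (I k →₀ L)}
    (hr : ∀ i, chartRel ι f p y i ∈ LinearMap.ker (sumCharts h))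
    (hr' : ∀ b, chartRel ι f p y ⟨k, b⟩ = 0) {ρ : Module.End L G} (hρ : IsRightMul ι f ρ)
    (ψ : LinearMap.ker (sumCharts h) →ₗ[L] G) (c : ((Σ k, I k) →₀ L) →ₗ[L] G)
    (X : Finset (LinearMap.ker (sumCharts h))) (F : Finset (Σ k, I k))
    (hc : ∀ i ∈ F, c (chartRel ι f p y i) = ψ ⟨_, hr i⟩) :
    ∀ᶠ N in atTop, ∃ c' : ((Σ k, I k) →₀ L) →ₗ[L] G, (∀ x ∈ X, c' x = (ρ ^ N) (ψ x)) ∧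
      ∀ i ∈ F, c' (Finsupp.single i 1) = (ρ ^ N) (c (Finsupp.single i 1)) := by
  classical
  let F' : Finset (Σ k, I k) := F ∪ X.biUnion fun x => x.1.support
  -- the values on the basis elements of the other charts are quotients by powers of `f`
  have h1 : ∀ᶠ N in atTop, ∀ i ∈ F', ∃ z : G,
      (ρ ^ N) (ψ ⟨_, hr i⟩ + c (chartIncl L I k (y i))) = ι f ^ p i • z :=
    F'.eventually_all.2 fun i _ => hρ.eventually_smul _ _
  obtain ⟨N, hN⟩ := h1.exists
  choose! z hz using hN
  let c₁ : ((Σ k, I k) →₀ L) →ₗ[L] G := Finsupp.linearCombination L fun i =>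
    if i.1 = k then (ρ ^ N) (c (Finsupp.single i 1)) else if i ∈ F' then z i else 0
  have hc₁ : ∀ i, c₁ (Finsupp.single i 1) =
      if i.1 = k then (ρ ^ N) (c (Finsupp.single i 1)) else if i ∈ F' then z i else 0 := fun i => by
    simp [c₁]
  have h2 : ∀ w, c₁ (chartIncl L I k w) = (ρ ^ N) (c (chartIncl L I k w)) := by
    intro w
    have : c₁ ∘ₗ chartIncl L I k = (ρ ^ N) ∘ₗ c ∘ₗ chartIncl L I k := by
      ext b
      simp [chartIncl_single, hc₁]
    exact DFunLike.congr_fun this w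
  have h3 : ∀ i ∈ F', c₁ (chartRel ι f p y i) = (ρ ^ N) (ψ ⟨_, hr i⟩) := by
    intro i hi
    by_cases hik : i.1 = k
    · obtain ⟨j, b⟩ := i
      obtain rfl : j = k := hik
      have : (⟨_, hr ⟨j, b⟩⟩ : LinearMap.ker (sumCharts h)) = 0 := Subtype.ext (hr' b)
      rw [this, hr', map_zero, map_zero, map_zero]
    · refine (map_sub c₁ _ _).trans ?_
      rw [map_smul, hc₁, if_neg hik, if_pos hi, ← hz i hi, h2, map_add, add_sub_cancel_right]
  have h4 : ∀ x ∈ X, ∃ n : ℕ, ι f ^ n • (c₁ x - (ρ ^ N) (ψ x)) = 0 := by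
    intro x hx
    obtain ⟨n, hn⟩ := mem_saturation_span_chartRel hι hh hr (F := ↑F') (x := x.1) x.2 (by
      intro i hi
      exact Finset.mem_union_right _ (Finset.mem_biUnion.2 ⟨x, hx, hi⟩))
    refine ⟨n, ?_⟩
    have h5 : Submodule.span L (chartRel ι f p y '' ↑F') ≤
        (LinearMap.eqLocus (c₁ ∘ₗ (LinearMap.ker (sumCharts h)).subtype) ((ρ ^ N) ∘ₗ ψ)).map
          (LinearMap.ker (sumCharts h)).subtype := Submodule.span_le.2 (by
      rintro _ ⟨i, hi, rfl⟩
      exact ⟨⟨_, hr i⟩, h3 i hi, rfl⟩)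
    obtain ⟨x', hx', hxx⟩ := h5 hn
    have : x' = ι f ^ n • x := Subtype.ext hxx
    rw [this] at hx'
    have hx'' : c₁ (ι f ^ n • x.1) = (ρ ^ N) (ψ (ι f ^ n • x)) := hx'
    rw [smul_sub, ← map_smul, ← map_smul, ← map_smul, hx'', sub_self]
  have h6 : ∀ i ∈ F, ∃ n : ℕ, ι f ^ n • (c₁ (Finsupp.single i 1) -
      (ρ ^ N) (c (Finsupp.single i 1))) = 0 := by
    intro i hi
    have e1 := h3 i (Finset.mem_union_left _ hi)
    rw [← hc i hi, chartRel, map_sub, h2, map_sub, map_sub, sub_left_inj, map_smul, map_smul,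
      map_smul] at e1
    exact ⟨p i, by rw [smul_sub, e1, sub_self]⟩
  choose! n hn using h4
  choose! m hm using h6
  have h7 : ∀ᶠ Q in atTop, (∀ x ∈ X, (ρ ^ Q) (c₁ x - (ρ ^ N) (ψ x)) = 0) ∧
      ∀ i ∈ F, (ρ ^ Q) (c₁ (Finsupp.single i 1) - (ρ ^ N) (c (Finsupp.single i 1))) = 0 :=
    (X.eventually_all.2 fun x hx => hρ.eventually_pow _ _ (hn x hx)).and
      (F.eventually_all.2 fun i hi => hρ.eventually_pow _ _ (hm i hi))
  have h8 := (tendsto_sub_atTop_nat N).eventually h7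
  filter_upwards [h8, eventually_ge_atTop N] with Q hQ hQN
  refine ⟨(ρ ^ (Q - N)) ∘ₗ c₁, fun x hx => ?_, fun i hi => ?_⟩
  · have := hQ.1 x hx
    rw [map_sub, sub_eq_zero, ← Module.End.mul_apply, ← pow_add, Nat.sub_add_cancel hQN] at this
    exact this
  · have := hQ.2 i hi
    rw [map_sub, sub_eq_zero, ← Module.End.mul_apply, ← pow_add, Nat.sub_add_cancel hQN] at this
    exact this

/-- For a module that is free of countable rank over each chart, the homomorphisms to `G` on the
kernel of the presentation `sumCharts h` extend to the free module.  The partial extensions on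
finitely many relations are glued by a partition of unity, which acts on the right; each of them
agrees with the previous one on more and more basis elements. -/
lemma exists_extension_of_countable [Fintype K] [∀ k, Countable (I k)] (hι : IsAdNilpotent ι)
    {f : K → A} {h : ∀ k, (I k →₀ L) →ₗ[L] M} (hf : Ideal.span (Set.range f) = ⊤)
    (hh : ∀ k, IsAwayIso ι (f k) (h k)) {ρ : K → Module.End L G}
    (hρ : ∀ k, IsRightMul ι (f k) (ρ k))
    (hpart : ∀ N : ℕ, ∃ α : K → Module.End L G, ∑ k, α k * ρ k ^ N = 1)
    (ψ : LinearMap.ker (sumCharts h) →ₗ[L] G) :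
    ∃ c : ((Σ k, I k) →₀ L) →ₗ[L] G, ∀ x, c x.1 = ψ x := by
  classical
  choose p y hr hr' using fun k => exists_chartRel (f k) h k (hh k)
  -- a homomorphism with the right values on the relations of `F` is replaced by one with the right
  -- values on those of `F'`, without a change on the generators in `F`
  have step : ∀ (c : ((Σ k, I k) →₀ L) →ₗ[L] G) (F F' : Finset (Σ k, I k)),
      (∀ i ∈ F, ∀ k, c (chartRel ι (f k) (p k) (y k) i) = ψ ⟨_, hr k i⟩) →
      ∃ c' : ((Σ k, I k) →₀ L) →ₗ[L] G,
        (∀ i ∈ F', ∀ k, c' (chartRel ι (f k) (p k) (y k) i) = ψ ⟨_, hr k i⟩) ∧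
        ∀ i ∈ F, c' (Finsupp.single i 1) = c (Finsupp.single i 1) := by
    intro c F F' hc
    let X : Finset (LinearMap.ker (sumCharts h)) :=
      Finset.univ.biUnion fun k => F'.image fun i => ⟨_, hr k i⟩
    have h1 : ∀ᶠ N in atTop, ∀ k, ∃ c' : ((Σ k, I k) →₀ L) →ₗ[L] G,
        (∀ x ∈ X, c' x = (ρ k ^ N) (ψ x)) ∧
        ∀ i ∈ F, c' (Finsupp.single i 1) = (ρ k ^ N) (c (Finsupp.single i 1)) :=
      eventually_all.2 fun k => exists_local_extension hι (hh k) (hr k) (hr' k) (hρ k) ψ c X F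
        fun i hi => hc i hi k
    obtain ⟨N, hN⟩ := h1.exists
    choose c' hc' using hN
    obtain ⟨α, hα⟩ := hpart N
    have h2 : ∀ g : G, ∑ k, α k ((ρ k ^ N) g) = g := fun g => by
      simpa using DFunLike.congr_fun hα g
    refine ⟨∑ k, α k ∘ₗ c' k, fun i hi k => ?_, fun i hi => ?_⟩
    · have hX : (⟨_, hr k i⟩ : LinearMap.ker (sumCharts h)) ∈ X :=
        Finset.mem_biUnion.2 ⟨k, Finset.mem_univ _, Finset.mem_image_of_mem _ hi⟩
      rw [LinearMap.sum_apply, ← h2 (ψ _)]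
      exact Finset.sum_congr rfl fun k' _ => congrArg (α k') ((hc' k').1 _ hX)
    · rw [LinearMap.sum_apply, ← h2 (c _)]
      exact Finset.sum_congr rfl fun k' _ => congrArg (α k') ((hc' k').2 _ hi)
  obtain ⟨e, he⟩ := exists_injective_nat (Σ k, I k)
  have hfin : ∀ n : ℕ, (e ⁻¹' (Set.Iio n)).Finite := fun n =>
    (Set.finite_Iio n).preimage he.injOn
  let F : ℕ → Finset (Σ k, I k) := fun n => (hfin n).toFinset
  have hF : ∀ n i, i ∈ F n ↔ e i < n := fun n i => by simp [F]
  let T := fun n => {c : ((Σ k, I k) →₀ L) →ₗ[L] G //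
    ∀ i ∈ F n, ∀ k, c (chartRel ι (f k) (p k) (y k) i) = ψ ⟨_, hr k i⟩}
  let c : ∀ n, T n := fun n => Nat.rec ⟨0, fun i hi => by simp [hF] at hi⟩
    (fun n c => ⟨(step c.1 (F n) (F (n + 1)) c.2).choose,
      (step c.1 (F n) (F (n + 1)) c.2).choose_spec.1⟩) n
  have hc : ∀ n i, e i < n → (c (n + 1)).1 (Finsupp.single i 1) = (c n).1 (Finsupp.single i 1) :=
    fun n i hi => (step (c n).1 (F n) (F (n + 1)) (c n).2).choose_spec.2 i ((hF n i).2 hi)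
  have hc' : ∀ i n, e i + 1 ≤ n →
      (c n).1 (Finsupp.single i 1) = (c (e i + 1)).1 (Finsupp.single i 1) := by
    intro i n hn
    induction n, hn using Nat.le_induction with
    | base => rfl
    | succ n hn ih => rw [hc n i hn, ih]
  -- the limit of the approximations, whose values on each generator become stationary
  let d : ((Σ k, I k) →₀ L) →ₗ[L] G :=
    Finsupp.linearCombination L fun i => (c (e i + 1)).1 (Finsupp.single i 1)
  have hd : ∀ x : (Σ k, I k) →₀ L, ∀ᶠ n in atTop, d x = (c n).1 x := by
    intro x
    have : ∀ᶠ n in atTop, ∀ i ∈ x.support, e i + 1 ≤ n :=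
      x.support.eventually_all.2 fun i _ => eventually_ge_atTop _
    filter_upwards [this] with n hn
    rw [Finsupp.linearCombination_apply, Finsupp.sum]
    conv_rhs => rw [← Finsupp.sum_single x, Finsupp.sum, map_sum]
    refine Finset.sum_congr rfl fun i hi => ?_
    rw [← hc' i n (hn i hi), ← map_smul, Finsupp.smul_single, smul_eq_mul, mul_one]
  have hdr : ∀ i k, d (chartRel ι (f k) (p k) (y k) i) = ψ ⟨_, hr k i⟩ := by
    intro i k
    obtain ⟨n, hn, hn'⟩ := ((hd (chartRel ι (f k) (p k) (y k) i)).and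
      (eventually_gt_atTop (e i))).exists
    rw [hn, (c n).2 i ((hF n i).2 hn') k]
  refine ⟨d, fun x => ?_⟩
  have h5 : x ∈ LinearMap.eqLocus (d ∘ₗ (LinearMap.ker (sumCharts h)).subtype) ψ := by
    refine mem_of_forall_mem_saturation (M := LinearMap.ker (sumCharts h)) hι hf fun k => ?_
    obtain ⟨n, hn⟩ := mem_saturation_span_chartRel hι (hh k) (hr k) (F := Set.univ) (x := x.1)
      x.2 (Set.subset_univ _)
    refine ⟨n, ?_⟩
    have h6 : Submodule.span L (chartRel ι (f k) (p k) (y k) '' Set.univ) ≤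
        (LinearMap.eqLocus (d ∘ₗ (LinearMap.ker (sumCharts h)).subtype) ψ).map
          (LinearMap.ker (sumCharts h)).subtype := Submodule.span_le.2 (by
      rintro _ ⟨i, -, rfl⟩
      exact ⟨⟨_, hr k i⟩, hdr i k, rfl⟩)
    obtain ⟨x', hx', hxx⟩ := h6 hn
    rwa [show x' = ι (f k) ^ n • x from Subtype.ext hxx] at hx'
  exact h5

end

/-! ### Projectivity of locally free modules of countable rank -/

section

open Filter

variable {A L : Type*} [CommRing A] [Ring L] {ι : A →+* L} {M : Type*} [AddCommGroup M] [Module L M]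
  {K : Type*} {I : K → Type*}

/-- The right multiplications on a free `L`-module. -/
noncomputable def rightMul (ι : A →+* L) (J : Type*) : A →+* Module.End L (J →₀ L) where
  toFun a := Finsupp.mapRange.linearMap (LinearMap.toSpanSingleton L L (ι a))
  map_one' := by ext; simp
  map_zero' := by ext; simp
  map_add' a b := by ext; simp
  map_mul' a b := by
    ext
    simp [← map_mul, mul_comm]

lemma rightMul_apply (J : Type*) (a : A) (x : J →₀ L) (j : J) : rightMul ι J a x j = x j * ι a := rfl

/-- As commutators with `ι f` are locally nilpotent on `L`, a high power of `ι f` on the right is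
divisible on the left by a given power of `ι f`, and likewise for torsion. -/
lemma isRightMul_rightMul (hι : IsAdNilpotent ι) (J : Type*) (f : A) :
    IsRightMul ι f (rightMul ι J f) where
  exists_smul u p := by
    have : ∀ᶠ N in atTop, ∃ z : J →₀ L, (rightMul ι J f ^ N) u = ι f ^ p • z := by
      induction u using Finsupp.induction_linear with
      | zero => exact .of_forall fun N => ⟨0, by simp⟩
      | add x y hx hy =>
        filter_upwards [hx, hy] with N ⟨z, hz⟩ ⟨z', hz'⟩
        exact ⟨z + z', by rw [map_add, hz, hz', smul_add]⟩
      | single j x =>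
        obtain ⟨N, z, h⟩ := hι.exists_mul_pow f x p
        refine eventually_atTop.2 ⟨N, fun n hn => ⟨Finsupp.single j (z * ι f ^ (n - N)), ?_⟩⟩
        ext i
        rw [← map_pow, rightMul_apply, map_pow, Finsupp.smul_apply]
        by_cases hij : i = j
        · subst hij
          rw [Finsupp.single_eq_same, Finsupp.single_eq_same, smul_eq_mul, ← mul_assoc, ← h,
            mul_assoc, ← pow_add, Nat.add_sub_cancel' hn]
        · rw [Finsupp.single_eq_of_ne hij, Finsupp.single_eq_of_ne hij, zero_mul, smul_zero]
    exact this.exists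
  exists_pow u p hu := by
    have : ∀ᶠ N in atTop, ∀ j ∈ u.support, u j * ι f ^ N = 0 :=
      u.support.eventually_all.2 fun j _ => by
        obtain ⟨N, h⟩ := hι.exists_mul_pow_eq_zero f (u j) p
          (by simpa using DFunLike.congr_fun hu j)
        refine eventually_atTop.2 ⟨N, fun n hn => ?_⟩
        rw [← Nat.add_sub_cancel' hn, pow_add, ← mul_assoc, h, zero_mul]
    obtain ⟨N, hN⟩ := this.exists
    refine ⟨N, ?_⟩
    ext j
    rw [← map_pow, rightMul_apply, map_pow]
    by_cases hj : j ∈ u.support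
    · exact hN j hj
    · rw [Finsupp.notMem_support_iff.1 hj, zero_mul]
      rfl

lemma exists_sum_mul_pow_eq_one [Fintype K] {f : K → A} (hf : Ideal.span (Set.range f) = ⊤)
    (N : ℕ) : ∃ a : K → A, ∑ k, a k * f k ^ N = 1 := by
  have h : (1 : A) ∈ Ideal.span (Set.range fun k => f k ^ N) := by
    rw [span_range_pow_eq_top hf fun _ => N]
    trivial
  exact (Ideal.mem_span_range_iff_exists_fun).1 h

lemma projective_of_retraction_ker {H : Type*} [AddCommGroup H] [Module L H] [Module.Projective L H]
    {P : H →ₗ[L] M} (hP : Function.Surjective P) (c : H →ₗ[L] LinearMap.ker P)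
    (hc : ∀ x, c x.1 = x) : Module.Projective L M := by
  let r : (H ⧸ LinearMap.ker P) →ₗ[L] H :=
    (LinearMap.ker P).liftQ (LinearMap.id - (LinearMap.ker P).subtype ∘ₗ c)
      (fun x hx => LinearMap.mem_ker.2 (sub_eq_zero.2 (congrArg Subtype.val (hc ⟨x, hx⟩)).symm))
  refine Module.Projective.of_split (r ∘ₗ (P.quotKerEquivOfSurjective hP).symm.toLinearMap) P
    (LinearMap.ext fun m => ?_)
  obtain ⟨x, rfl⟩ := hP m
  have : (P.quotKerEquivOfSurjective hP).symm (P x) = Submodule.Quotient.mk x :=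
    (LinearEquiv.symm_apply_eq _).2 rfl
  refine (congrArg (fun z => P (r z)) this).trans ?_
  change P (x - (c x).1) = P x
  rw [map_sub, (c x).2, sub_zero]

/-- The kernel of the presentation of a module that is free over each chart has the same property:
over a chart, it is free on the generators of the other charts. -/
lemma exists_charts_ker (hι : IsAdNilpotent ι) {f : K → A} {h : ∀ k, (I k →₀ L) →ₗ[L] M}
    (hh : ∀ k, IsAwayIso ι (f k) (h k)) :
    ∃ h' : ∀ k, ({i : Σ k, I k // i.1 ≠ k} →₀ L) →ₗ[L] LinearMap.ker (sumCharts h),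
      ∀ k, IsAwayIso (M' := LinearMap.ker (sumCharts h)) ι (f k) (h' k) := by
  choose p y hr hr' using fun k => exists_chartRel (f k) h k (hh k)
  refine ⟨fun k => Finsupp.linearCombination L fun i => ⟨_, hr k i.1⟩, fun k => ⟨fun x => ?_,
    fun z hz => ?_⟩⟩
  · obtain ⟨n, hn⟩ := mem_saturation_span_chartRel hι (hh k) (hr k) (F := Set.univ) (x := x.1)
      x.2 (Set.subset_univ _)
    have h6 : Submodule.span L (chartRel ι (f k) (p k) (y k) '' Set.univ) ≤
        (LinearMap.range (Finsupp.linearCombination L fun i : {i : Σ k, I k // i.1 ≠ k} =>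
          (⟨_, hr k i.1⟩ : LinearMap.ker (sumCharts h)))).map
          (LinearMap.ker (sumCharts h)).subtype := Submodule.span_le.2 (by
      rintro _ ⟨i, -, rfl⟩
      by_cases hi : i.1 = k
      · obtain ⟨j, b⟩ := i
        obtain rfl : j = k := hi
        rw [hr']
        exact Submodule.zero_mem _
      · exact ⟨⟨_, hr k i⟩, ⟨Finsupp.single ⟨i, hi⟩ 1, by simp⟩, rfl⟩)
    obtain ⟨_, ⟨z, rfl⟩, hz⟩ := h6 hn
    exact ⟨n, z, (Subtype.ext hz).symm⟩
  · have h1 : ∀ i : {i : Σ k, I k // i.1 ≠ k}, z i * ι (f k) ^ p k i.1 = 0 := by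
      intro i
      let π : ((Σ k, I k) →₀ L) →ₗ[L] ({i : Σ k, I k // i.1 ≠ k} →₀ L) :=
        Finsupp.lcomapDomain Subtype.val Subtype.val_injective
      have e1 : ∀ w : I k →₀ L, π (chartIncl L I k w) = 0 := by
        intro w
        have : π ∘ₗ chartIncl L I k = 0 := by
          ext b i
          have : (⟨k, b⟩ : Σ k, I k) ≠ i.1 := fun h => i.2 (h ▸ rfl)
          simp [π, chartIncl_single, Finsupp.lcomapDomain]
        exact DFunLike.congr_fun this w
      have e2 : ∀ i : {i : Σ k, I k // i.1 ≠ k}, π (chartRel ι (f k) (p k) (y k) i.1) =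
          Finsupp.single i (ι (f k) ^ p k i.1) := by
        intro i
        rw [chartRel, map_sub, e1, sub_zero, map_smul]
        have : π (Finsupp.single i.1 1) = Finsupp.single i 1 := by
          ext j
          change Finsupp.single i.1 (1 : L) j.1 = _
          by_cases hij : j = i
          · rw [hij, Finsupp.single_eq_same, Finsupp.single_eq_same]
          · rw [Finsupp.single_eq_of_ne hij, Finsupp.single_eq_of_ne fun h => hij (Subtype.ext h)]
        rw [this, Finsupp.smul_single, smul_eq_mul, mul_one]
      have e3 : (π ∘ₗ (LinearMap.ker (sumCharts h)).subtype ∘ₗ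
          Finsupp.linearCombination L fun i : {i : Σ k, I k // i.1 ≠ k} =>
            (⟨_, hr k i.1⟩ : LinearMap.ker (sumCharts h))) z = 0 := by
        rw [LinearMap.comp_apply, LinearMap.comp_apply, hz, map_zero, map_zero]
      have e4 : Finsupp.lapply i ∘ₗ (π ∘ₗ (LinearMap.ker (sumCharts h)).subtype ∘ₗ
          Finsupp.linearCombination L fun i : {i : Σ k, I k // i.1 ≠ k} =>
            (⟨_, hr k i.1⟩ : LinearMap.ker (sumCharts h))) =
          LinearMap.toSpanSingleton L L (ι (f k) ^ p k i.1) ∘ₗ Finsupp.lapply i := by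
        ext b
        by_cases hb : i = b
        · subst hb
          simp [e2]
        · simp [e2, Finsupp.single_eq_of_ne hb]
      have e5 := DFunLike.congr_fun e4 z
      rw [LinearMap.comp_apply, e3, map_zero] at e5
      exact e5.symm
    have h2 : ∀ᶠ n in atTop, ∀ i ∈ z.support, ι (f k) ^ n * z i = 0 :=
      z.support.eventually_all.2 fun i _ => by
        obtain ⟨N, h⟩ := hι.exists_pow_mul_eq_zero (f k) (z i) _ (h1 i)
        refine eventually_atTop.2 ⟨N, fun n hn => ?_⟩
        rw [← Nat.sub_add_cancel hn, pow_add, mul_assoc, h, mul_zero]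
    obtain ⟨n, hn⟩ := h2.exists
    refine ⟨n, Finsupp.ext fun i => ?_⟩
    by_cases hi : i ∈ z.support
    · exact hn i hi
    · rw [Finsupp.smul_apply, Finsupp.notMem_support_iff.1 hi, smul_zero]
      rfl

/-- Over a commutative ring, the identity of the kernel of the presentation extends to the free
module. -/
lemma projective_of_countable_charts_comm {M : Type*} [AddCommGroup M] [Module A M] [Finite K]
    [∀ k, Countable (I k)] {f : K → A} (hf : Ideal.span (Set.range f) = ⊤)
    {h : ∀ k, (I k →₀ A) →ₗ[A] M} (hh : ∀ k, IsAwayIso (.id A) (f k) (h k)) :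
    Module.Projective A M := by
  have := Fintype.ofFinite K
  have h1 : ∀ (f : A) (N : ℕ) (g : LinearMap.ker (sumCharts h)),
      (algebraMap A (Module.End A (LinearMap.ker (sumCharts h))) f ^ N) g = f ^ N • g := by
    intro f N g
    rw [← map_pow, Module.algebraMap_end_apply]
  obtain ⟨c, hc⟩ := exists_extension_of_countable (G := LinearMap.ker (sumCharts h)) isAdNilpotent_id hf hh
    (ρ := fun k => algebraMap A _ (f k))
    (fun k => ⟨fun u p => ⟨p, u, by rw [h1, RingHom.id_apply]⟩,
      fun u p hu => ⟨p, by rw [h1]; exact hu⟩⟩)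
    (fun N => by
      obtain ⟨a, ha⟩ := exists_sum_mul_pow_eq_one hf N
      refine ⟨fun k => algebraMap A _ (a k), ?_⟩
      rw [← map_one (algebraMap A _), ← ha, map_sum]
      exact Finset.sum_congr rfl fun k _ => by rw [map_mul, map_pow])
    LinearMap.id
  exact projective_of_retraction_ker (sumCharts_surjective isAdNilpotent_id hf hh) c hc

end

/-- The kernels of the presentations are of the same kind as the module, so that one may argue by
induction on the projective dimension. -/
lemma projective_of_countable_charts {A L : Type u} [CommRing A] [Ring L] {ι : A →+* L}
    (hι : IsAdNilpotent ι) {K : Type u} [Finite K] {f : K → A}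
    (hf : Ideal.span (Set.range f) = ⊤) (n : ℕ) : ∀ {M : Type u} [AddCommGroup M] [Module L M]
    {I : K → Type u} [∀ k, Countable (I k)] {h : ∀ k, (I k →₀ L) →ₗ[L] M}
    (_ : ∀ k, IsAwayIso ι (f k) (h k)) (_ : HasProjectiveDimensionLT (ModuleCat.of L M) (n + 1)),
    Module.Projective L M := by
  have := Fintype.ofFinite K
  induction n with
  | zero =>
    intro M _ _ I _ h hh hM
    rw [zero_add, ← projective_iff_hasProjectiveDimensionLT_one] at hM
    exact (IsProjective.iff_projective (R := L) M).2 hM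
  | succ n ih =>
    intro M _ _ I _ h hh hM
    have hP := sumCharts_surjective hι hf hh
    have hfree : Module.Projective L ((Σ k, I k) →₀ L) := .of_basis Finsupp.basisSingleOne
    obtain ⟨h', hh'⟩ := exists_charts_ker hι hh
    let S : ShortComplex (ModuleCat.{u} L) := ShortComplex.mk
      (X₁ := ModuleCat.of L (LinearMap.ker (sumCharts h))) (X₂ := ModuleCat.of L ((Σ k, I k) →₀ L))
      (X₃ := ModuleCat.of L M) (ModuleCat.ofHom (LinearMap.ker (sumCharts h)).subtype)
      (ModuleCat.ofHom (sumCharts h)) (ModuleCat.hom_ext (LinearMap.ext fun x => x.2))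
    have hS : S.ShortExact :=
      { exact := (ShortComplex.moduleCat_exact_iff _).2 fun x hx => ⟨⟨x, hx⟩, rfl⟩
        mono_f := (ModuleCat.mono_iff_injective _).2 Subtype.val_injective
        epi_g := (ModuleCat.epi_iff_surjective _).2 hP }
    have hH : Projective S.X₂ := (IsProjective.iff_projective (R := L) ((Σ k, I k) →₀ L)).1 hfree
    have hH' : HasProjectiveDimensionLT S.X₂ (n + 1) := inferInstance
    have hR : HasProjectiveDimensionLT S.X₁ (n + 1) :=
      hS.hasProjectiveDimensionLT_X₁ (n + 1) hH' hM
    have hproj : Module.Projective L (LinearMap.ker (sumCharts h)) := ih hh' hR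
    obtain ⟨s, hs⟩ := Module.projective_def'.1 hproj
    obtain ⟨c, hc⟩ := exists_extension_of_countable hι hf hh
      (ρ := fun k => rightMul ι (LinearMap.ker (sumCharts h)) (f k))
      (fun k => isRightMul_rightMul hι _ _)
      (fun N => by
        obtain ⟨a, ha⟩ := exists_sum_mul_pow_eq_one hf N
        refine ⟨fun k => rightMul ι _ (a k), ?_⟩
        rw [← map_one (rightMul ι _), ← ha, map_sum]
        exact Finset.sum_congr rfl fun k _ => by rw [map_mul, map_pow])
      s
    refine projective_of_retraction_ker hP (Finsupp.linearCombination L id ∘ₗ c) fun x => ?_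
    rw [LinearMap.comp_apply, hc]
    exact DFunLike.congr_fun hs x

/-! ### Reduction to countable rank -/

section

variable {A L : Type u} [CommRing A] [Ring L] {ι : A →+* L} {M : Type u} [AddCommGroup M]
  [Module L M] {K : Type u} {I : K → Type u}

/-- A set of generators of `M` is closed if over each chart `k` it spans the same submodule as those
of its members that belong to the chart; here `y k i` are the coefficients of the generator `i`. -/
def IsClosedUnder (y : ∀ k, (Σ k, I k) → (I k →₀ L)) (T : Set (Σ k, I k)) : Prop :=
  ∀ i ∈ T, ∀ k, ∀ b ∈ (y k i).support, (⟨k, b⟩ : Σ k, I k) ∈ T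

/-- A generator requires only countably many others, and the closure is reached in countably many
steps. -/
lemma exists_countable_isClosedUnder [Countable K] (y : ∀ k, (Σ k, I k) → (I k →₀ L)) (i : Σ k, I k) :
    ∃ T : Set (Σ k, I k), i ∈ T ∧ T.Countable ∧ IsClosedUnder y T := by
  let S : (Σ k, I k) → Set (Σ k, I k) := fun j => ⋃ k, Sigma.mk k '' ((y k j).support : Set (I k))
  have hS : ∀ j, (S j).Countable := fun j =>
    Set.countable_iUnion fun k => ((y k j).support.countable_toSet).image _
  let T : ℕ → Set (Σ k, I k) := fun n => Nat.rec {i} (fun _ T => ⋃ j ∈ T, S j) n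
  have hT : ∀ n, (T n).Countable := by
    intro n
    induction n with
    | zero => exact Set.countable_singleton i
    | succ n ih => exact ih.biUnion fun j _ => hS j
  refine ⟨⋃ n, T n, Set.mem_iUnion.2 ⟨0, rfl⟩, Set.countable_iUnion hT, fun j hj k b hb => ?_⟩
  obtain ⟨n, hn⟩ := Set.mem_iUnion.1 hj
  exact Set.mem_iUnion.2 ⟨n + 1, Set.mem_biUnion hn (Set.mem_iUnion.2 ⟨k, b, hb, rfl⟩)⟩

/-- The submodule spanned by a set of generators. -/
def chartSpan (h : ∀ k, (I k →₀ L) →ₗ[L] M) (T : Set (Σ k, I k)) : Submodule L M :=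
  Submodule.span L ((fun i : Σ k, I k => h i.1 (Finsupp.single i.2 1)) '' T)

lemma apply_mem_chartSpan (h : ∀ k, (I k →₀ L) →ₗ[L] M) (T : Set (Σ k, I k)) (k : K)
    (y : I k →₀ L) (hy : ∀ b ∈ y.support, (⟨k, b⟩ : Σ k, I k) ∈ T) : h k y ∈ chartSpan h T := by
  rw [← Finsupp.sum_single y, Finsupp.sum, map_sum]
  refine Submodule.sum_mem _ fun b hb => ?_
  have : Finsupp.single b (y b) = y b • Finsupp.single b 1 := by simp
  rw [this, map_smul]
  exact Submodule.smul_mem _ _ (Submodule.subset_span ⟨⟨k, b⟩, hy b hb, rfl⟩)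

/-- Over the open set of the chart `k`, the span of a closed set of generators is spanned by those of
its members that belong to `k`. -/
lemma exists_of_mem_chartSpan (hι : IsAdNilpotent ι) {h : ∀ k, (I k →₀ L) →ₗ[L] M} {f : A} {k : K}
    {p : (Σ k, I k) → ℕ} {y : ∀ k, (Σ k, I k) → (I k →₀ L)}
    (hy : ∀ i, ι f ^ p i • h i.1 (Finsupp.single i.2 1) = h k (y k i)) {T : Set (Σ k, I k)}
    (hT : IsClosedUnder y T) {x : M} (hx : x ∈ chartSpan h T) :
    ∃ (n : ℕ) (z : I k →₀ L), ι f ^ n • x = h k z ∧ ∀ b ∈ z.support, (⟨k, b⟩ : Σ k, I k) ∈ T := by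
  have h1 : chartSpan h T ≤ hι.saturation f
      ((Finsupp.supported L L {b : I k | (⟨k, b⟩ : Σ k, I k) ∈ T}).map (h k)) := by
    refine Submodule.span_le.2 ?_
    rintro _ ⟨i, hi, rfl⟩
    exact ⟨p i, y k i, fun b hb => hT i hi k b hb, (hy i).symm⟩
  obtain ⟨n, z, hz, hz'⟩ := h1 hx
  exact ⟨n, z, hz'.symm, fun b hb => hz hb⟩

/-- The subquotients that are defined by closed sets of generators are again free over each chart. -/
lemma exists_charts_subquotient (hι : IsAdNilpotent ι) {f : K → A} {h : ∀ k, (I k →₀ L) →ₗ[L] M}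
    (hh : ∀ k, IsAwayIso ι (f k) (h k)) {p : K → (Σ k, I k) → ℕ}
    {y : ∀ k, (Σ k, I k) → (I k →₀ L)}
    (hy : ∀ k i, ι (f k) ^ p k i • h i.1 (Finsupp.single i.2 1) = h k (y k i))
    {T T' : Set (Σ k, I k)} (hT : IsClosedUnder y T) (hT' : IsClosedUnder y T') :
    ∃ h' : ∀ k, ({b : I k // (⟨k, b⟩ : Σ k, I k) ∈ T' \ T} →₀ L) →ₗ[L]
      Submodule.map (chartSpan h T).mkQ (chartSpan h T'),
      ∀ k, IsAwayIso (M' := Submodule.map (chartSpan h T).mkQ (chartSpan h T')) ι (f k) (h' k) := by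
  classical
  let h' : ∀ k, ({b : I k // (⟨k, b⟩ : Σ k, I k) ∈ T' \ T} →₀ L) →ₗ[L]
      Submodule.map (chartSpan h T).mkQ (chartSpan h T') := fun k =>
    Finsupp.linearCombination L fun b => ⟨_, Submodule.mem_map_of_mem
      (Submodule.subset_span ⟨⟨k, b.1⟩, b.2.1, rfl⟩)⟩
  have hh' : ∀ k z, (h' k z).1 = (chartSpan h T).mkQ (h k (Finsupp.lmapDomain L L Subtype.val z)) := by
    intro k z
    have : (Submodule.subtype _) ∘ₗ h' k =
        (chartSpan h T).mkQ ∘ₗ h k ∘ₗ Finsupp.lmapDomain L L Subtype.val := by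
      ext b
      simp [h']
    exact DFunLike.congr_fun this z
  refine ⟨h', fun k => ⟨?_, fun z hz => ?_⟩⟩
  · rintro ⟨_, x, hx, rfl⟩
    obtain ⟨n, z, hz, hzT⟩ := exists_of_mem_chartSpan hι (hy k) hT' hx
    -- the coefficients on the generators in `T` do not matter
    refine ⟨n, Finsupp.comapDomain Subtype.val z Subtype.val_injective.injOn, Subtype.ext ?_⟩
    rw [hh']
    change ι (f k) ^ n • (chartSpan h T).mkQ x = _
    rw [← map_smul, hz, ← sub_eq_zero, ← map_sub, ← map_sub]
    refine (Submodule.Quotient.mk_eq_zero _).2 (apply_mem_chartSpan h T k _ fun b hb => ?_)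
    by_contra hbT
    refine Finsupp.mem_support_iff.1 hb ?_
    have e1 : (Finsupp.lmapDomain L L Subtype.val (Finsupp.comapDomain
        (Subtype.val : {b : I k // (⟨k, b⟩ : Σ k, I k) ∈ T' \ T} → I k) z
          Subtype.val_injective.injOn)) b = z b := by
      by_cases hb' : (⟨k, b⟩ : Σ k, I k) ∈ T'
      · exact Finsupp.mapDomain_apply Subtype.val_injective _
          (⟨b, hb', hbT⟩ : {b : I k // (⟨k, b⟩ : Σ k, I k) ∈ T' \ T})
      · have hzb : z b = 0 := by
          by_contra hne
          exact hb' (hzT b (Finsupp.mem_support_iff.2 hne))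
        rw [hzb]
        exact Finsupp.mapDomain_of_notMem_range _ _ fun ⟨c, hc⟩ => hb' (hc ▸ c.2.1)
    rw [Finsupp.sub_apply, e1, sub_self]
  · set w := Finsupp.lmapDomain L L Subtype.val z with hw
    have h1 : h k w ∈ chartSpan h T := by
      rw [← Submodule.Quotient.mk_eq_zero]
      exact (hh' k z).symm.trans (congrArg Subtype.val hz)
    obtain ⟨n, z', hz', hzT⟩ := exists_of_mem_chartSpan hι (hy k) hT h1
    rw [← map_smul, ← sub_eq_zero, ← map_sub] at hz'
    obtain ⟨m, hm⟩ := (hh k).2 _ hz'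
    refine ⟨m + n, Finsupp.ext fun b => ?_⟩
    have e1 := DFunLike.congr_fun hm b.1
    have e2 : z' b.1 = 0 := by
      by_contra hne
      exact b.2.2 (hzT b.1 (Finsupp.mem_support_iff.2 hne))
    have e3 : w b.1 = z b := Finsupp.mapDomain_apply Subtype.val_injective _ _
    rw [Finsupp.smul_apply, Finsupp.sub_apply, e2, sub_zero, Finsupp.smul_apply, e3, smul_smul,
      ← pow_add] at e1
    exact e1

/-- Kaplansky's argument: a lift along a surjection is extended from one closed set of generators to
another one, with countably many more elements, as the subquotient is projective. -/
lemma projective_of_charts [Finite K] (hι : IsAdNilpotent ι) {f : K → A}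
    (hf : Ideal.span (Set.range f) = ⊤)
    (hQ : ∀ {Q : Type u} [AddCommGroup Q] [Module L Q] {I' : K → Type u} [∀ k, Countable (I' k)]
      {h' : ∀ k, (I' k →₀ L) →ₗ[L] Q} (_ : ∀ k, IsAwayIso ι (f k) (h' k)), Module.Projective L Q)
    {h : ∀ k, (I k →₀ L) →ₗ[L] M} (hh : ∀ k, IsAwayIso ι (f k) (h k)) :
    Module.Projective L M := by
  choose p y hy using fun k (i : Σ k, I k) => (hh k).1 (h i.1 (Finsupp.single i.2 1))
  refine Module.Projective.of_lifting_property'' (R := L) (P := M) fun g hg => ?_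
  -- partial sections of `g` that are defined on the span of a closed set of generators
  let S : Set (M →ₗ.[L] (M →₀ L)) := {ψ | (∃ T, IsClosedUnder y T ∧ ψ.domain = chartSpan h T) ∧
    ∀ x : ψ.domain, g (ψ x) = x}
  obtain ⟨ψ, hψ⟩ := zorn_le₀ S (by
    intro c hcS hc
    have hd : DirectedOn (· ≤ ·) c := hc.directedOn
    have hT : ∀ ψ ∈ c, ∃ T, IsClosedUnder y T ∧ ψ.domain = chartSpan h T := fun ψ hψ => (hcS hψ).1
    choose! T hT hTd using hT
    refine ⟨LinearPMap.sSup c hd, ⟨⟨⋃ ψ ∈ c, T ψ, ?_, ?_⟩, ?_⟩, fun ψ hψ => LinearPMap.le_sSup hd hψ⟩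
    · intro i hi k b hb
      obtain ⟨ψ, hψ, hi⟩ := Set.mem_iUnion₂.1 hi
      exact Set.mem_iUnion₂.2 ⟨ψ, hψ, hT ψ hψ i hi k b hb⟩
    · rw [LinearPMap.domain_sSup, chartSpan, Set.image_iUnion₂, Submodule.span_iUnion₂, sSup_image]
      exact iSup_congr fun ψ => iSup_congr fun hψ => hTd ψ hψ
    · intro x
      have hle : sSup (LinearPMap.domain '' c) ≤ (LinearMap.eqLocus
          (g ∘ₗ (LinearPMap.sSup c hd).toFun) (Submodule.subtype _)).map (Submodule.subtype _) := by
        refine sSup_le ?_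
        rintro _ ⟨ψ, hψ, rfl⟩ x hx
        refine ⟨⟨x, (LinearPMap.le_sSup hd hψ).1 hx⟩, ?_, rfl⟩
        exact (congrArg g (LinearPMap.sSup_apply hd hψ ⟨x, hx⟩)).trans ((hcS hψ).2 ⟨x, hx⟩)
      obtain ⟨x', hx', hxx⟩ := hle x.2
      rwa [show x' = x from Subtype.ext hxx] at hx')
  have htop : ψ.domain = ⊤ := by
    obtain ⟨⟨⟨T, hT, hTd⟩, hψg⟩, hmax⟩ := hψ
    by_contra hne
    obtain ⟨i, hi⟩ : ∃ i : Σ k, I k, h i.1 (Finsupp.single i.2 1) ∉ ψ.domain := by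
      by_contra! hall
      refine hne (eq_top_iff.2 fun x _ => ?_)
      refine mem_of_forall_mem_saturation hι hf fun k => ?_
      obtain ⟨n, z, hz⟩ := (hh k).1 x
      refine ⟨n, ?_⟩
      rw [hz]
      have : LinearMap.range (h k) ≤ ψ.domain := by
        rintro _ ⟨w, rfl⟩
        induction w using Finsupp.induction_linear with
        | zero => simp
        | add a b ha hb => rw [map_add]; exact Submodule.add_mem _ ha hb
        | single b u =>
          have : Finsupp.single b u = u • Finsupp.single b 1 := by simp
          rw [this, map_smul]
          exact Submodule.smul_mem _ _ (hall ⟨k, b⟩)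
      exact this ⟨z, rfl⟩
    -- the section extends to the span of `T` and a countable closed set that contains `i`
    obtain ⟨T₀, hi₀, hc₀, hT₀⟩ := exists_countable_isClosedUnder y i
    have hT' : IsClosedUnder y (T ∪ T₀) := by
      rintro j (hj | hj) k b hb
      · exact Or.inl (hT j hj k b hb)
      · exact Or.inr (hT₀ j hj k b hb)
    obtain ⟨h', hh'⟩ := exists_charts_subquotient hι hh hy hT hT'
    have hcount : ∀ k, Countable {b : I k // (⟨k, b⟩ : Σ k, I k) ∈ (T ∪ T₀) \ T} := by
      intro k
      have := hc₀.to_subtype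
      refine Function.Injective.countable (β := T₀)
        (f := fun b => ⟨⟨k, b.1⟩, b.2.1.resolve_left b.2.2⟩) fun b b' hbb => ?_
      simpa [Subtype.ext_iff] using hbb
    have hproj := hQ hh'
    have hle : ψ.domain ≤ chartSpan h (T ∪ T₀) := by
      rw [hTd]
      exact Submodule.span_mono (Set.image_mono Set.subset_union_left)
    let q : chartSpan h (T ∪ T₀) →ₗ[L] Submodule.map (chartSpan h T).mkQ (chartSpan h (T ∪ T₀)) :=
      (chartSpan h T).mkQ.submoduleMap _
    have hq : Function.Surjective q := LinearMap.submoduleMap_surjective _ _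
    have hq0 : ∀ x : chartSpan h (T ∪ T₀), q x = 0 ↔ x.1 ∈ ψ.domain := by
      intro x
      rw [hTd, ← Submodule.Quotient.mk_eq_zero, Subtype.ext_iff]
      rfl
    obtain ⟨σ, hσ⟩ := Module.projective_lifting_property q LinearMap.id hq
    have hσ' : ∀ z, q (σ z) = z := DFunLike.congr_fun hσ
    obtain ⟨l, hl⟩ := Module.projective_lifting_property g ((Submodule.subtype _) ∘ₗ σ) hg
    have hl' : ∀ z, g (l z) = (σ z).1 := DFunLike.congr_fun hl
    let r : chartSpan h (T ∪ T₀) →ₗ[L] ψ.domain := LinearMap.codRestrict ψ.domain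
      ((Submodule.subtype _) ∘ₗ (LinearMap.id - σ ∘ₗ q)) fun x => by
        refine (hq0 (x - σ (q x))).1 ?_
        rw [map_sub, hσ', sub_self]
    have hr : ∀ x, (r x).1 = x.1 - (σ (q x)).1 := fun x => rfl
    let ψ' : M →ₗ.[L] (M →₀ L) := ⟨chartSpan h (T ∪ T₀), ψ.toFun ∘ₗ r + l ∘ₗ q⟩
    have hψ' : ∀ x : chartSpan h (T ∪ T₀), ψ' x = ψ (r x) + l (q x) := fun x => rfl
    have h1 : ψ' ∈ S := by
      refine ⟨⟨T ∪ T₀, hT', rfl⟩, fun (x : chartSpan h (T ∪ T₀)) => ?_⟩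
      rw [hψ', map_add, hψg, hl', hr, sub_add_cancel]
    have h2 : ψ ≤ ψ' := by
      refine ⟨hle, fun x x' hxx => ?_⟩
      have e1 : q x' = 0 := (hq0 x').2 (hxx ▸ x.2)
      have e2 : r x' = x := Subtype.ext (by rw [hr, e1, map_zero, ← hxx]; exact sub_zero _)
      exact ((hψ' x').trans (by rw [e1, e2, map_zero, add_zero])).symm
    exact hi ((hmax h1 h2).1 (Submodule.subset_span ⟨i, Or.inr hi₀, rfl⟩))
  refine ⟨ψ.toFun ∘ₗ LinearMap.codRestrict ψ.domain LinearMap.id fun x => htop ▸ trivial, ?_⟩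
  ext x
  exact hψ.1.2 ⟨x, htop ▸ trivial⟩

end

/-! ### Charts of locally free modules -/

section

open Filter

variable {A L : Type u} [CommRing A] [Ring L] {ι : A →+* L} {M : Type u} [AddCommGroup M]
  [Module L M]

lemma isAwayIso_of_isLocalizedModule {M N : ModuleCat.{u} L} {f : A} (g : M ⟶ N)
    (hg : IsLocalizedModule (.powers f) ((ModuleCat.restrictScalars ι).map g).hom) :
    IsAwayIso ι f g.hom := by
  constructor
  · intro y
    obtain ⟨⟨x, ⟨_, n, rfl⟩⟩, h⟩ := hg.surj y
    refine ⟨n, x, ?_⟩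
    have h' : ι (f ^ n) • y = g.hom x := h
    rwa [map_pow] at h'
  · intro x hx
    obtain ⟨⟨_, n, rfl⟩, h⟩ := hg.exists_of_eq (x₁ := x) (x₂ := (0 : M)) (hx.trans (map_zero _).symm)
    refine ⟨n, ?_⟩
    have h' : ι (f ^ n) • x = ι (f ^ n) • (0 : M) := h
    rwa [map_pow, smul_zero] at h'

/-- A homomorphism of `L`-modules to a module on which `f` is bijective, with kernel and cokernel of
`f`-power torsion, is a localization of the underlying `A`-modules. -/
lemma isLocalizedModule_of_isAwayIso {M N : ModuleCat.{u} L} {f : A} (g : M ⟶ N)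
    (hg : IsAwayIso ι f g.hom) (hN : Function.Bijective fun y : N => ι f • y) :
    IsLocalizedModule (.powers f) ((ModuleCat.restrictScalars ι).map g).hom where
  map_units := by
    rintro ⟨_, n, rfl⟩
    rw [Module.End.isUnit_iff]
    have : ∀ n : ℕ, Function.Bijective fun y : N => ι (f ^ n) • y := by
      intro n
      induction n with
      | zero =>
        convert Function.bijective_id using 1
        ext y
        simp
      | succ n ih =>
        convert ih.comp hN using 1
        ext y
        simp [pow_succ, mul_smul]
    exact this n
  surj y := by
    obtain ⟨n, x, h⟩ := hg.1 y
    refine ⟨(x, ⟨_, n, rfl⟩), ?_⟩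
    change ι (f ^ n) • y = _
    rw [map_pow]
    exact h
  exists_of_eq {x x'} h := by
    have key : ∀ x x' : M, g.hom x = g.hom x' → ∃ n : ℕ, ι (f ^ n) • x = ι (f ^ n) • x' := by
      intro x x' h
      rw [← sub_eq_zero, ← map_sub] at h
      obtain ⟨n, hn⟩ := hg.2 _ h
      exact ⟨n, by rwa [map_pow, ← sub_eq_zero, ← smul_sub]⟩
    obtain ⟨n, hn⟩ := key x x' h
    exact ⟨⟨_, n, rfl⟩, hn⟩

/-- The isomorphism of a localization with a localization of a free module lifts, up to denominators
on the basis elements, to a homomorphism to the module itself. -/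
lemma exists_chart_of_isAwayIso (hι : IsAdNilpotent ι) {f : A} {N : Type u} [AddCommGroup N]
    [Module L N] {I : Type u} {g : M →ₗ[L] N} {h : (I →₀ L) →ₗ[L] N} (hg : IsAwayIso ι f g)
    (hh : IsAwayIso ι f h) : ∃ h' : (I →₀ L) →ₗ[L] M, IsAwayIso ι f h' := by
  choose n m hm using fun i => hg.1 (h (Finsupp.single i 1))
  let h' : (I →₀ L) →ₗ[L] M := Finsupp.linearCombination L m
  -- multiplication of the basis elements by their denominators
  let D : (I →₀ L) →ₗ[L] (I →₀ L) :=
    Finsupp.linearCombination L fun i => Finsupp.single i (ι f ^ n i)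
  have hD : ∀ y i, D y i = y i * ι f ^ n i := by
    intro y i
    have : Finsupp.lapply i ∘ₗ D = LinearMap.toSpanSingleton L L (ι f ^ n i) ∘ₗ Finsupp.lapply i := by
      ext b
      by_cases hb : i = b
      · subst hb
        simp [D]
      · simp [D, Finsupp.single_eq_of_ne hb]
    exact DFunLike.congr_fun this y
  have hgh : ∀ y, g (h' y) = h (D y) := by
    intro y
    have : g ∘ₗ h' = h ∘ₗ D := by
      ext i
      have : Finsupp.single i (ι f ^ n i) = ι f ^ n i • Finsupp.single i 1 := by simp
      rw [LinearMap.comp_apply, LinearMap.comp_apply, LinearMap.comp_apply, LinearMap.comp_apply,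
        Finsupp.lsingle_apply, Finsupp.linearCombination_single, Finsupp.linearCombination_single,
        one_smul, one_smul, ← hm, this, map_smul]
    exact DFunLike.congr_fun this y
  refine ⟨h', fun x => ?_, fun y hy => ?_⟩
  · obtain ⟨r, y, hy⟩ := hh.1 (g x)
    have h1 : ∀ᶠ N in atTop, ∀ i ∈ y.support, ∃ z : L, ι f ^ N * y i = z * ι f ^ n i :=
      y.support.eventually_all.2 fun i _ => by
        obtain ⟨N, z, h⟩ := hι.exists_pow_mul f (y i) (n i)
        refine eventually_atTop.2 ⟨N, fun N' hN => ⟨ι f ^ (N' - N) * z, ?_⟩⟩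
        rw [← Nat.sub_add_cancel hN, pow_add, mul_assoc, h, ← mul_assoc, Nat.sub_add_cancel hN]
    obtain ⟨N, hN⟩ := h1.exists
    choose! z hz using hN
    let y' : I →₀ L := Finsupp.onFinset y.support (fun i => open Classical in
      if i ∈ y.support then z i else 0) fun i hi => by
        by_contra h
        simp only [if_neg h, ne_eq, not_true_eq_false] at hi
    have h2 : D y' = ι f ^ N • y := by
      ext i
      rw [hD, Finsupp.smul_apply, smul_eq_mul, Finsupp.onFinset_apply]
      by_cases hi : i ∈ y.support
      · rw [if_pos hi, hz i hi]
      · rw [if_neg hi, Finsupp.notMem_support_iff.1 hi, zero_mul, mul_zero]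
    have h3 : g (ι f ^ (N + r) • x - h' y') = 0 := by
      rw [map_sub, hgh, h2, map_smul, map_smul, ← hy, pow_add, mul_smul, sub_self]
    obtain ⟨s, hs⟩ := hg.2 _ h3
    refine ⟨s + (N + r), ι f ^ s • y', ?_⟩
    rw [pow_add, mul_smul, map_smul, ← sub_eq_zero, ← smul_sub, hs]
  · have h1 : h (D y) = 0 := by rw [← hgh, hy, map_zero]
    obtain ⟨r, hr⟩ := hh.2 _ h1
    have h2 : ∀ᶠ N in atTop, ∀ i ∈ y.support, ι f ^ N * y i = 0 :=
      y.support.eventually_all.2 fun i _ => by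
        have h3 := DFunLike.congr_fun hr i
        rw [Finsupp.smul_apply, hD, smul_eq_mul, ← mul_assoc] at h3
        obtain ⟨N, hN⟩ := hι.exists_pow_mul_eq_zero f _ _ h3
        refine eventually_atTop.2 ⟨N + r, fun N' hN' => ?_⟩
        rw [← Nat.sub_add_cancel hN', pow_add, pow_add, mul_assoc, mul_assoc, hN, mul_zero]
    obtain ⟨N, hN⟩ := h2.exists
    refine ⟨N, Finsupp.ext fun i => ?_⟩
    by_cases hi : i ∈ y.support
    · exact hN i hi
    · rw [Finsupp.smul_apply, Finsupp.notMem_support_iff.1 hi, smul_zero]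
      rfl

lemma IsLocallyFreeOver.exists_charts (hι : IsAdNilpotent ι) {M : ModuleCat.{u} L}
    (hM : IsLocallyFreeOver ι M) : ∃ (K : Type u) (_ : Finite K) (f : K → A) (I : K → Type u)
      (h : ∀ k, (I k →₀ L) →ₗ[L] M), Ideal.span (Set.range f) = ⊤ ∧
        ∀ k, IsAwayIso ι (f k) (h k) := by
  obtain ⟨S, hS, hM⟩ := hM
  obtain ⟨S', hS', hS''⟩ := (Ideal.span_eq_top_iff_finite S).1 hS
  have h1 : ∀ f : S', ∃ (I : Type u) (h : (I →₀ L) →ₗ[L] M), IsAwayIso ι f.1 h := by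
    intro f
    obtain ⟨I, N, g, h, hg, hh⟩ := hM f.1 (hS' f.2)
    exact ⟨I, exists_chart_of_isAwayIso hι (isAwayIso_of_isLocalizedModule g hg)
      (isAwayIso_of_isLocalizedModule h hh)⟩
  choose I h hh using h1
  exact ⟨S', inferInstance, Subtype.val, I, h, by simpa using hS'', hh⟩

lemma isLocallyFreeOver_of_free (ι : A →+* L) (M : ModuleCat.{u} L) [Module.Free L M] :
    IsLocallyFreeOver ι M := by
  let b := Module.Free.chooseBasis L M
  have h1 : ∀ {X Y : ModuleCat.{u} L} (g : X ⟶ Y), Function.Bijective g.hom →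
      IsLocalizedModule (.powers 1) ((ModuleCat.restrictScalars ι).map g).hom := fun g hg =>
    isLocalizedModule_of_isAwayIso g
      ⟨fun m => ⟨0, by simpa using (hg.2 m).imp fun _ h => h.symm⟩, fun y hy => ⟨0, by
        simpa using hg.1 (hy.trans (map_zero _).symm)⟩⟩ (by
        convert Function.bijective_id using 1
        ext y
        simp)
  refine ⟨{1}, by simp, ?_⟩
  rintro _ rfl
  exact ⟨_, M, 𝟙 M, ModuleCat.ofHom b.repr.symm.toLinearMap, h1 _ Function.bijective_id,
    h1 _ b.repr.symm.bijective⟩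

/-- Homomorphisms from free modules that become isomorphisms over an open covering show that a module
is locally free. -/
lemma isLocallyFreeOver_id_of_charts (M : ModuleCat.{u} A) {S : Set A} (hS : Ideal.span S = ⊤)
    (h : ∀ f ∈ S, ∃ (I : Type u) (h : (I →₀ A) →ₗ[A] M), IsAwayIso (.id A) f h) :
    IsLocallyFreeOver (.id A) M := by
  refine ⟨S, hS, fun f hf => ?_⟩
  obtain ⟨I, h, hh⟩ := h f hf
  let g := LocalizedModule.mkLinearMap (.powers f) M
  have hN : ∀ n : ℕ, Function.Bijective fun y : LocalizedModule (.powers f) M => f ^ n • y := fun n =>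
    (Module.End.isUnit_iff _).1 (IsLocalizedModule.map_units g (⟨f ^ n, n, rfl⟩ : Submonoid.powers f))
  have hg : IsAwayIso (.id A) f g := by
    constructor
    · intro y
      obtain ⟨⟨x, ⟨_, n, rfl⟩⟩, h⟩ := IsLocalizedModule.surj (.powers f) g y
      exact ⟨n, x, h⟩
    · intro x hx
      obtain ⟨⟨_, n, rfl⟩, h⟩ := IsLocalizedModule.exists_of_eq (S := .powers f) (f := g)
        (x₁ := x) (x₂ := 0) (hx.trans (map_zero _).symm)
      exact ⟨n, h.trans (smul_zero (A := M) (f ^ n))⟩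
  have hgh : IsAwayIso (.id A) f (g ∘ₗ h) := by
    constructor
    · intro y
      obtain ⟨n, x, hx⟩ := hg.1 y
      obtain ⟨m, z, hz⟩ := hh.1 x
      simp only [RingHom.id_apply] at hx hz ⊢
      refine ⟨m + n, z, ?_⟩
      rw [pow_add, mul_smul, hx, LinearMap.comp_apply, ← hz, map_smul]
    · intro z hz
      obtain ⟨n, hn⟩ := hg.2 _ hz
      rw [← map_smul] at hn
      obtain ⟨m, hm⟩ := hh.2 _ hn
      exact ⟨m + n, by rwa [pow_add, mul_smul]⟩
  have hN' : Function.Bijective fun y : LocalizedModule (.powers f) M => (RingHom.id A) f • y := by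
    simpa using hN 1
  exact ⟨I, ModuleCat.of A (LocalizedModule (.powers f) M), ModuleCat.ofHom g,
    ModuleCat.ofHom (g ∘ₗ h), isLocalizedModule_of_isAwayIso _ hg hN',
    isLocalizedModule_of_isAwayIso _ hgh hN'⟩

theorem projective_of_isLocallyFreeOver_id {M : ModuleCat.{u} A}
    (hM : IsLocallyFreeOver (.id A) M) : Module.Projective A M := by
  obtain ⟨K, _, f, I, h, hf, hh⟩ := hM.exists_charts isAdNilpotent_id
  exact projective_of_charts isAdNilpotent_id hf
    (fun hh' => projective_of_countable_charts_comm hf hh') hh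

end

/-! ### The order filtration of the ring of differential operators -/

namespace FormalCategory

variable {A F : Type u} [CommRing A] [Algebra ℂ A] [CommRing F] [Algebra ℂ F]
  {C : FormalCategory A F}

namespace DiffOp

@[simp] lemma sub_apply (φ ψ : C.DiffOp) (x : F) : (φ - ψ) x = φ x - ψ x := rfl

/-- The differential operators that vanish on `J ^ n`, that is, of order less than `n`. -/
def filtration (C : FormalCategory A F) (n : ℕ) : AddSubgroup C.DiffOp where
  carrier := {u | ∀ x ∈ C.J ^ n, u x = 0}
  zero_mem' _ _ := rfl
  add_mem' hu hv x hx := by rw [add_apply, hu x hx, hv x hx, add_zero]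
  neg_mem' {u} hu x hx := by
    change -(u x) = 0
    rw [hu x hx, neg_zero]

lemma filtration_mono {n m : ℕ} (h : n ≤ m) : filtration C n ≤ filtration C m :=
  fun _ hu x hx => hu x (Ideal.pow_le_pow_right h hx)

lemma exists_mem_filtration (u : C.DiffOp) : ∃ n, u ∈ filtration C n := u.exists_pow

lemma eq_zero_of_mem_filtration_zero {u : C.DiffOp} (hu : u ∈ filtration C 0) : u = 0 :=
  ext fun x => hu x (by simp)

lemma sub_s_e_mem (x : F) : x - C.s (C.e x) ∈ C.J := by
  rw [RingHom.mem_ker, map_sub, C.e_s, sub_self]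

lemma sub_t_e_mem (x : F) : x - C.t (C.e x) ∈ C.J := by
  rw [RingHom.mem_ker, map_sub, C.e_t, sub_self]

lemma t_sub_s_mem (a : A) : C.t a - C.s a ∈ C.J := by
  rw [RingHom.mem_ker, map_sub, C.e_s, C.e_t, sub_self]

lemma eq_ofA_of_mem_filtration_one {u : C.DiffOp} (hu : u ∈ filtration C 1) : u = C.ofA (u 1) := by
  ext x
  have h1 := hu (x - C.s (C.e x)) (by rw [pow_one]; exact sub_s_e_mem x)
  rw [map_sub, sub_eq_zero] at h1
  rw [h1, ofA_apply, mul_comm, ← map_s, mul_one]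

lemma ofA_mem_filtration (a : A) : C.ofA a ∈ filtration C 1 := fun x hx => by
  have : C.e x = 0 := by simpa using hx
  rw [ofA_apply, this, mul_zero]

lemma ofA_mul_mem_filtration {n : ℕ} (a : A) {u : C.DiffOp} (hu : u ∈ filtration C n) :
    C.ofA a * u ∈ filtration C n := fun x hx => by
  rw [ofA_mul, hu x hx, mul_zero]

lemma mul_ofA_mem_filtration {n : ℕ} (a : A) {u : C.DiffOp} (hu : u ∈ filtration C n) :
    u * C.ofA a ∈ filtration C n := fun x hx => by
  rw [mul_ofA, hu _ (Ideal.mul_mem_left _ _ hx)]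

lemma commutator_ofA_mem_filtration {n : ℕ} (a : A) {u : C.DiffOp} (hu : u ∈ filtration C (n + 1)) :
    C.ofA a * u - u * C.ofA a ∈ filtration C n := fun x hx => by
  rw [sub_apply, ofA_mul, mul_ofA, ← map_s, ← map_sub, ← sub_mul]
  refine hu _ ?_
  rw [pow_succ']
  refine Ideal.mul_mem_mul ?_ hx
  rw [← neg_sub]
  exact neg_mem (t_sub_s_mem a)

lemma isAdNilpotent_incl (C : FormalCategory A F) : IsAdNilpotent C.incl.toRingHom := by
  intro a u
  obtain ⟨n, hn⟩ := exists_mem_filtration u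
  refine ⟨n, ?_⟩
  induction n generalizing u with
  | zero => exact eq_zero_of_mem_filtration_zero hn
  | succ n ih => exact ih _ (commutator_ofA_mem_filtration a hn)

/-- The operator `z ↦ u (y z)`. -/
def contract (y : F) : C.DiffOp →+ C.DiffOp where
  toFun u := ⟨u.1.comp (AddMonoidHom.mulLeft y), fun a x => by
    change u (y * (C.s a * x)) = a * u (y * x)
    rw [mul_left_comm, map_s], u.exists_pow.imp fun _ hn x hx => hn _ (Ideal.mul_mem_left _ _ hx)⟩
  map_zero' := rfl
  map_add' _ _ := rfl

@[simp] lemma contract_apply (y : F) (u : C.DiffOp) (z : F) : contract y u z = u (y * z) := rfl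

lemma contract_mem_filtration {y : F} (hy : y ∈ C.J) {n : ℕ} {u : C.DiffOp}
    (hu : u ∈ filtration C (n + 1)) : contract y u ∈ filtration C n := fun x hx => by
  rw [contract_apply]
  refine hu _ ?_
  rw [pow_succ']
  exact Ideal.mul_mem_mul hy hx

lemma contract_mul_ofA (y : F) (a : A) (u : C.DiffOp) :
    contract y (u * C.ofA a) = contract y u * C.ofA a := by
  ext x
  rw [contract_apply, mul_ofA, mul_ofA, contract_apply, mul_left_comm]

set_option maxHeartbeats 800000 in
/-- The Leibniz rule for operators of order one, up to terms of lower order.  The comultiplication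
sends `y` in `J` to the sum of `y ⊗ 1`, of `1 ⊗ y` and of an element of `J ⊗ J`. -/
lemma exists_act_mul (τ : C.DiffOp) (hτ : τ ∈ filtration C 2) {y : F} (hy : y ∈ C.J) (N : ℕ) :
    ∃ j ∈ C.J, ∀ z, act (C.quotPoint (N + 1)) τ (y * z) =
      (C.quotPoint (N + 1)).hom y * act (C.quotPoint (N + 1)) τ z +
        (C.quotPoint (N + 1)).hom ((C.t (τ y) + j) * z) := by
  have hτ' : ∀ x ∈ C.J ^ 2, τ x = 0 := hτ
  set p := C.quotPoint (N + 1) with hp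
  set r := C.comp (p.map (extL p 2)) (extR p 2) (ext_comm p 2) with hr
  have e0 : ∀ n : ℕ, ∀ x ∈ C.J ^ (n + 1), C.e x = 0 := fun n x hx =>
    Ideal.pow_le_self n.succ_ne_zero hx
  -- the two projections of the pushout
  obtain ⟨b, hb, hb'⟩ := exists_desc p 2 (AlgHom.id ℂ _) (.unit C.e (p.hom.comp C.t))
    (fun x hx => by
      change p.hom (C.t (C.e x)) = 0
      rw [e0 1 x hx, map_zero, map_zero]) (fun a => by
      change p.hom (C.t a) = p.hom (C.t (C.e (C.s a)))
      rw [C.e_s])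
  let κ : ∀ n : ℕ, F ⧸ C.J ^ (n + 1) →ₐ[ℂ] F ⧸ C.J ^ 2 := fun n =>
    Ideal.Quotient.liftₐ _ ((C.quotPoint 2).hom.comp (C.s.comp C.e)) fun x hx => by
      rw [AlgHom.comp_apply, AlgHom.comp_apply, e0 n x hx, map_zero, map_zero]
  have hκ : ∀ n x, κ n ((C.quotPoint (n + 1)).hom x) = (C.quotPoint 2).hom (C.s (C.e x)) :=
    fun n x => rfl
  obtain ⟨c, hc, hc'⟩ := exists_desc p 2 (κ N) (C.quotPoint 2)
    (fun x hx => C.quotPoint_eq_zero le_rfl hx) (fun a => by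
      change (C.quotPoint 2).hom (C.s (C.e (C.t a))) = _
      rw [C.e_t])
  have hbr : ∀ x, b (r.hom x) = p.hom x := by
    intro x
    have e1 : (p.map (extL p 2)).map b = p := FormalPoint.ext fun x => hb _
    have h : ∀ a, p.hom (C.t a) = (FormalPoint.unit C.e (p.hom.comp C.t)).hom (C.s a) := fun a => by
      change p.hom (C.t a) = p.hom (C.t (C.e (C.s a)))
      rw [C.e_s]
    have e3 := C.map_comp b (p.map (extL p 2)) (extR p 2) (ext_comm p 2) (by rw [e1, hb']; exact h)
    rw [C.comp_congr _ e1 hb', C.comp_unit p h] at e3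
    exact congrArg (fun q : FormalPoint C.e _ => q.hom x) e3
  have hcr : ∀ x, c (r.hom x) = (C.quotPoint 2).hom x := by
    intro x
    have e1 : (p.map (extL p 2)).map c = .unit C.e ((C.quotPoint 2).hom.comp C.s) :=
      FormalPoint.ext fun x => hc _
    have h : ∀ a, (FormalPoint.unit C.e ((C.quotPoint 2).hom.comp C.s)).hom (C.t a) =
        (C.quotPoint 2).hom (C.s a) := fun a => by
      change (C.quotPoint 2).hom (C.s (C.e (C.t a))) = _
      rw [C.e_t]
    have e3 := C.map_comp c (p.map (extL p 2)) (extR p 2) (ext_comm p 2) (by rw [e1, hc']; exact h)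
    rw [C.comp_congr _ e1 hc', C.unit_comp (C.quotPoint 2) h] at e3
    exact congrArg (fun q : FormalPoint C.e _ => q.hom x) e3
  have hbR : ∀ x, b ((extR p 2).hom x) = p.hom (C.t (C.e x)) := fun x =>
    congrArg (fun q : FormalPoint C.e _ => q.hom x) hb'
  have hcR : ∀ x, c ((extR p 2).hom x) = (C.quotPoint 2).hom x := fun x =>
    congrArg (fun q : FormalPoint C.e _ => q.hom x) hc'
  have hcomm : ∀ a, extL p 2 (p.hom (C.t a)) = (extR p 2).hom (C.s a) := ext_comm p 2
  let I : AddSubgroup (Ext p 2) := AddSubgroup.closure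
    {w | ∃ x ∈ C.J, ∃ x' ∈ C.J, w = extL p 2 (p.hom x) * (extR p 2).hom x'}
  let inr : F ⧸ C.J ^ 2 →ₐ[ℂ] Ext p 2 := Pushout.inr _ _
  have hinr : ∀ x, inr ((C.quotPoint 2).hom x) = (extR p 2).hom x := fun x => rfl
  have key : ∀ w : Ext p 2, w - extL p 2 (b w) - inr (c w) + inr (κ 1 (c w)) ∈ I := by
    intro w
    induction w using ext_induction with
    | zero => simp
    | mul a x' =>
      obtain ⟨x, rfl⟩ := Ideal.Quotient.mkₐ_surjective ℂ _ a
      change extL p 2 (p.hom x) * _ - extL p 2 (b (extL p 2 (p.hom x) * _)) -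
        inr (c (extL p 2 (p.hom x) * _)) + inr (κ 1 (c (extL p 2 (p.hom x) * _))) ∈ I
      have e1 : extL p 2 (p.hom x) * (extR p 2).hom x' -
          extL p 2 (b (extL p 2 (p.hom x) * (extR p 2).hom x')) -
          inr (c (extL p 2 (p.hom x) * (extR p 2).hom x')) +
          inr (κ 1 (c (extL p 2 (p.hom x) * (extR p 2).hom x'))) =
          extL p 2 (p.hom (x - C.t (C.e x))) * (extR p 2).hom (x' - C.s (C.e x')) := by
        have e2 : c (extL p 2 (p.hom x) * (extR p 2).hom x') =
            (C.quotPoint 2).hom (C.s (C.e x) * x') := by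
          rw [map_mul, hc, hcR, map_mul]
          rfl
        rw [map_mul b, hb, hbR, e2, hκ 1, hinr, hinr, map_sub, map_sub, map_sub, hcomm]
        simp only [map_mul, C.e_s, AlgHom.id_apply, hcomm]
        ring
      rw [e1]
      exact AddSubgroup.subset_closure ⟨_, sub_t_e_mem x, _, sub_s_e_mem x', rfl⟩
    | add w w' hw hw' =>
      convert I.add_mem hw hw' using 1
      simp only [map_add]
      ring
  have hry : r.hom y - extL p 2 (p.hom y) - (extR p 2).hom y ∈ I := by
    have := key (r.hom y)
    have hy' : C.e y = 0 := hy
    rwa [hbr, hcr, hκ 1, hinr, hinr, hy', map_zero, map_zero, add_zero] at this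
  have hR : ∀ x ∈ C.J, ∀ w, extLin p τ 2 hτ' ((extR p 2).hom x * w) = p.hom (C.t (τ x)) * b w := by
    intro x hx w
    induction w using ext_induction with
    | zero => simp
    | mul a x' =>
      have e1 : τ (x * x') = C.e x' * τ x := by
        have h1 := hτ (x * (x' - C.s (C.e x'))) (by
          rw [pow_two]; exact Ideal.mul_mem_mul hx (sub_s_e_mem x'))
        rw [mul_sub, map_sub, sub_eq_zero, mul_comm x (C.s _), map_s] at h1
        exact h1
      rw [mul_left_comm, ← map_mul, extLin_L, extLin_R, e1, map_mul b, hb, hbR, map_mul C.t,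
        map_mul p.hom, AlgHom.id_apply]
      ring
    | add w w' hw hw' => rw [mul_add, map_add, hw, hw', map_add, mul_add]
  have hI : ∀ w ∈ I, ∃ j ∈ C.J, ∀ z, extLin p τ 2 hτ' (w * r.hom z) = p.hom (j * z) := by
    intro w hw
    induction hw using AddSubgroup.closure_induction with
    | mem w hw =>
      obtain ⟨x, hx, x', hx', rfl⟩ := hw
      refine ⟨x * C.t (τ x'), Ideal.mul_mem_right _ _ hx, fun z => ?_⟩
      rw [mul_assoc, extLin_L, hR x' hx', hbr, mul_assoc, map_mul, map_mul]
    | zero => exact ⟨0, zero_mem _, fun z => by simp⟩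
    | add w w' _ _ hw hw' =>
      obtain ⟨j, hj, h⟩ := hw
      obtain ⟨j', hj', h'⟩ := hw'
      exact ⟨j + j', add_mem hj hj', fun z => by rw [add_mul, map_add, h, h', add_mul, map_add]⟩
    | neg w _ hw =>
      obtain ⟨j, hj, h⟩ := hw
      exact ⟨-j, neg_mem hj, fun z => by rw [neg_mul, map_neg, h, neg_mul, map_neg]⟩
  obtain ⟨j, hj, h⟩ := hI _ hry
  refine ⟨j, hj, fun z => ?_⟩
  rw [act_eq_extLin p τ 2 hτ', act_eq_extLin p τ 2 hτ', ← hr, map_mul]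
  have e1 : r.hom y * r.hom z = extL p 2 (p.hom y) * r.hom z + (extR p 2).hom y * r.hom z +
      (r.hom y - extL p 2 (p.hom y) - (extR p 2).hom y) * r.hom z := by ring
  rw [e1, map_add, map_add, extLin_L, hR y hy, h, hbr]
  simp only [map_add, map_mul, add_mul]
  ring

lemma exists_act_eq (τ : C.DiffOp) (hτ : τ ∈ filtration C 2) (N n : ℕ) : ∀ x ∈ C.J ^ (n + 1),
    ∃ w ∈ C.J ^ n, act (C.quotPoint (N + 1)) τ x = (C.quotPoint (N + 1)).hom w := by
  induction n with
  | zero =>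
    intro x _
    obtain ⟨w, hw⟩ := Ideal.Quotient.mkₐ_surjective ℂ _ (act (C.quotPoint (N + 1)) τ x)
    exact ⟨w, by simp, hw.symm⟩
  | succ n ih =>
    intro x hx
    rw [pow_succ'] at hx
    refine Submodule.mul_induction_on hx (fun y hy z hz => ?_) (fun x x' hx hx' => ?_)
    · obtain ⟨j, hj, h⟩ := exists_act_mul τ hτ hy N
      obtain ⟨w, hw, hw'⟩ := ih z hz
      refine ⟨y * w + (C.t (τ y) + j) * z, add_mem ?_ (Ideal.mul_mem_left _ _ hz), ?_⟩
      · rw [pow_succ']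
        exact Ideal.mul_mem_mul hy hw
      · rw [h, hw', ← map_mul, ← map_add]
    · obtain ⟨w, hw, h⟩ := hx
      obtain ⟨w', hw', h'⟩ := hx'
      exact ⟨w + w', add_mem hw hw', by rw [map_add, h, h', map_add]⟩

lemma mul_apply_of_act_eq {n : ℕ} {u : C.DiffOp} (hu : u ∈ filtration C (n + 1)) (τ : C.DiffOp)
    {x w : F} (h : act (C.quotPoint (n + 1)) τ x = (C.quotPoint (n + 1)).hom w) :
    (u * τ) x = u w := by
  rw [mul_apply u τ (n + 1) (show ∀ x ∈ C.J ^ (n + 1), u x = 0 from hu), h]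
  rfl

lemma mul_mem_filtration {n : ℕ} {u τ : C.DiffOp} (hu : u ∈ filtration C n)
    (hτ : τ ∈ filtration C 2) : u * τ ∈ filtration C (n + 1) := fun x hx => by
  obtain ⟨w, hw, h⟩ := exists_act_eq τ hτ n n x hx
  rw [mul_apply_of_act_eq (filtration_mono n.le_succ hu) τ h]
  exact hu w hw

/-- The contraction with an element of `J` is a derivation, up to terms of lower order. -/
lemma contract_mul_sub_mem_filtration {n : ℕ} {u τ : C.DiffOp} (hu : u ∈ filtration C (n + 1))
    (hτ : τ ∈ filtration C 2) {y : F} (hy : y ∈ C.J) :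
    contract y (u * τ) - contract y u * τ - u * C.ofA (τ y) ∈ filtration C n := fun x hx => by
  obtain ⟨j, hj, h⟩ := exists_act_mul τ hτ hy n
  obtain ⟨w, hw⟩ := Ideal.Quotient.mkₐ_surjective ℂ _ (act (C.quotPoint (n + 1)) τ x)
  have hw' : act (C.quotPoint (n + 1)) τ x = (C.quotPoint (n + 1)).hom w := hw.symm
  have e1 := h x
  rw [hw', ← map_mul, ← map_add] at e1
  have h0 : u (j * x) = 0 := hu _ (by
    rw [pow_succ']
    exact Ideal.mul_mem_mul hj hx)
  rw [sub_apply, sub_apply, contract_apply, mul_apply_of_act_eq hu τ e1, mul_ofA,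
    mul_apply_of_act_eq (filtration_mono n.le_succ (contract_mem_filtration hy hu)) τ hw',
    contract_apply, add_mul, map_add, map_add, h0]
  ring

end DiffOp

end FormalCategory

/-! ### Dual bases of finitely generated projective modules -/

section DualBasis

variable {B Q : Type*} [CommRing B] [AddCommGroup Q] [Module B Q]

lemma exists_dual_basis [Module.Finite B Q] [Module.Projective B Q] :
    ∃ (n : ℕ) (x : Fin n → Q) (c : Fin n → Q →ₗ[B] B), ∀ z, ∑ i, c i z • x i = z := by
  obtain ⟨n, f, g, -, -, h⟩ := Module.Finite.exists_comp_eq_id_of_projective B Q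
  refine ⟨n, fun i => f (Pi.single i 1), fun i => LinearMap.proj i ∘ₗ g, fun z => ?_⟩
  have h1 := LinearMap.congr_fun h z
  rw [LinearMap.comp_apply, LinearMap.id_apply] at h1
  conv_rhs => rw [← h1, pi_eq_sum_univ' (g z), map_sum]
  exact Finset.sum_congr rfl fun i _ => by
    rw [map_smul]
    rfl

lemma Submonoid.exists_forall_of_finite {ι : Type*} [Finite ι] (S : Submonoid B)
    {p : ι → B → Prop} (h : ∀ i, ∃ s ∈ S, p i s) (hp : ∀ i s s', p i s → p i (s' * s)) :
    ∃ s ∈ S, ∀ i, p i s := by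
  classical
  have := Fintype.ofFinite ι
  choose s hs h using h
  refine ⟨∏ i, s i, _root_.prod_mem fun i _ => hs i, fun i => ?_⟩
  rw [← Finset.prod_erase_mul _ _ (Finset.mem_univ i)]
  exact hp _ _ _ (h i)

/-- A finitely generated projective module has a basis near every point; here denominators are
cleared. -/
lemma exists_local_dual_basis [Module.Finite B Q] [Module.Projective B Q] (p : Ideal B)
    [p.IsPrime] : ∃ f ∉ p, ∃ (r : ℕ) (y : Fin r → Q) (φ : Fin r → Q →ₗ[B] B),
      (∀ i j, φ i (y j) = if i = j then f else 0) ∧ ∀ x, ∑ i, φ i x • y i = f • x := by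
  obtain ⟨n, x, c, hx⟩ := exists_dual_basis (B := B) (Q := Q)
  let S := p.primeCompl
  let R := Localization.AtPrime p
  let M := LocalizedModule S Q
  let mk : Q →ₗ[B] M := LocalizedModule.mkLinearMap S Q
  have hfree : Module.Free R M := by
    have h : (⟨p, inferInstance⟩ : PrimeSpectrum B) ∈ Module.freeLocus B Q := by
      rw [Module.freeLocus_eq_univ]
      trivial
    exact Module.mem_freeLocus.1 h
  have hfin : Module.Finite R M := Module.Finite.of_isLocalizedModule S (Rₚ := R) mk
  let b := Module.finBasis R M
  set r := Module.finrank R M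
  obtain ⟨t, ht, hy⟩ := S.exists_forall_of_finite (p := fun j t => ∃ z, mk z = t • b j)
    (fun j => by
      obtain ⟨⟨z, s⟩, h⟩ := IsLocalizedModule.surj S mk (b j)
      exact ⟨s, s.2, z, h.symm⟩)
    (fun j s s' ⟨z, hz⟩ => ⟨s' • z, by rw [map_smul, hz, mul_smul]⟩)
  choose y hy using hy
  obtain ⟨s, hs, ha⟩ := S.exists_forall_of_finite
    (p := fun (l : Fin r × Fin n) s => ∃ a, algebraMap B R a = s • b.repr (mk (x l.2)) l.1)
    (fun l => by
      obtain ⟨⟨a, s⟩, h⟩ := IsLocalization.surj S (b.repr (mk (x l.2)) l.1)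
      exact ⟨s, s.2, a, by rw [Algebra.smul_def, mul_comm]; exact h.symm⟩)
    (fun l s s' ⟨a, h⟩ => ⟨s' * a, by
      rw [mul_smul, ← h, Algebra.smul_def, map_mul]⟩)
  choose a ha using ha
  let φ : Fin r → Q →ₗ[B] B := fun i => ∑ k, a (i, k) • c k
  have hφ : ∀ i z, algebraMap B R (φ i z) = s • b.repr (mk z) i := by
    intro i z
    have h1 : φ i z = ∑ k, a (i, k) * c k z := by
      simp only [φ, LinearMap.sum_apply, LinearMap.smul_apply, smul_eq_mul]
    have h2 : ∀ q : B, ∀ m : M, q • m = algebraMap B R q • m := fun q m =>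
      (algebraMap_smul R q m).symm
    conv_rhs => rw [← hx z, map_sum, map_sum]
    rw [h1, map_sum, Finsupp.finsetSum_apply, Finset.smul_sum]
    refine Finset.sum_congr rfl fun k _ => ?_
    rw [map_smul mk, h2, map_smul, Finsupp.smul_apply, map_mul, ha, Algebra.smul_def,
      Algebra.smul_def, smul_eq_mul]
    ring
  obtain ⟨u, hu, h1⟩ := S.exists_forall_of_finite
    (p := fun (l : Fin r × Fin r) u => u * φ l.1 (y l.2) = u * (if l.1 = l.2 then s * t else 0))
    (fun l => by
      have h : algebraMap B R (φ l.1 (y l.2)) = algebraMap B R (if l.1 = l.2 then s * t else 0) := by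
        rw [hφ, hy, ← algebraMap_smul R t, map_smul, Module.Basis.repr_self, Finsupp.smul_apply,
          Finsupp.single_apply, Algebra.smul_def, smul_eq_mul]
        rcases eq_or_ne l.1 l.2 with h | h
        · rw [if_pos h, if_pos h.symm, mul_one, map_mul]
        · rw [if_neg h, if_neg h.symm, mul_zero, mul_zero, map_zero]
      obtain ⟨u, hu⟩ := (IsLocalization.eq_iff_exists S R).1 h
      exact ⟨u, u.2, hu⟩)
    (fun l s s' h => by rw [mul_assoc, h, mul_assoc])
  obtain ⟨v, hv, h2⟩ := S.exists_forall_of_finite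
    (p := fun (k : Fin n) v => v • ∑ i, φ i (x k) • y i = v • (s * t) • x k)
    (fun k => by
      have h : mk (∑ i, φ i (x k) • y i) = mk ((s * t) • x k) := by
        rw [map_sum, map_smul]
        conv_rhs => rw [← b.sum_repr (mk (x k)), Finset.smul_sum]
        refine Finset.sum_congr rfl fun i _ => ?_
        rw [map_smul, hy, ← algebraMap_smul R (φ i (x k)), hφ, smul_comm _ t, mul_comm s, mul_smul,
          smul_assoc]
      obtain ⟨v, hv⟩ := (IsLocalizedModule.eq_iff_exists S mk).1 h
      exact ⟨v, v.2, hv⟩)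
    (fun k s s' h => by rw [mul_smul, h, ← mul_smul s'])
  refine ⟨u * v * (s * t), S.mul_mem (S.mul_mem hu hv) (S.mul_mem hs ht), r, y,
    fun i => (u * v) • φ i, fun i j => ?_, fun z => ?_⟩
  · rw [LinearMap.smul_apply, smul_eq_mul, mul_right_comm, h1 (i, j)]
    split_ifs <;> ring
  · have key : ∀ z, v • ∑ i, φ i z • y i = v • (s * t) • z := by
      intro z
      let Ψ : Q →ₗ[B] Q := v • ∑ i, (φ i).smulRight (y i)
      have hΨ : ∀ z, Ψ z = v • ∑ i, φ i z • y i := fun z => by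
        simp only [Ψ, LinearMap.smul_apply, LinearMap.sum_apply, LinearMap.smulRight_apply]
      rw [← hΨ]
      conv_lhs => rw [← hx z, map_sum]
      conv_rhs => rw [← hx z, Finset.smul_sum, Finset.smul_sum]
      refine Finset.sum_congr rfl fun k _ => ?_
      rw [map_smul, hΨ, h2]
      simp only [smul_smul]
      congr 1
      ring
    have h3 : ∑ i, ((u * v) • φ i) z • y i = u • v • ∑ i, φ i z • y i := by
      rw [Finset.smul_sum, Finset.smul_sum]
      refine Finset.sum_congr rfl fun i _ => ?_
      rw [LinearMap.smul_apply, smul_assoc, mul_smul]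
    rw [h3, key, ← mul_smul, ← mul_smul, mul_assoc u]

end DualBasis

/-! ### Coordinates of a formal category of smooth type -/

namespace FormalCategory

variable {A F : Type u} [CommRing A] [Algebra ℂ A] [CommRing F] [Algebra ℂ F]
  {C : FormalCategory A F}

namespace DiffOp

/-- The isomorphism `F / J ≃ A`. -/
noncomputable def quotEquiv (C : FormalCategory A F) : F ⧸ C.J ≃+* A :=
  RingHom.quotientKerEquivOfSurjective fun a => ⟨C.s a, C.e_s a⟩

lemma quotEquiv_mk (x : F) : quotEquiv C (Ideal.Quotient.mk C.J x) = C.e x := rfl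

/-- The functionals on `J / J ^ 2` are differential operators of order one. -/
lemma exists_of_cotangent (c : C.J.Cotangent →ₗ[F ⧸ C.J] F ⧸ C.J) :
    ∃ D ∈ filtration C 2, ∀ y (hy : y ∈ C.J), D y = quotEquiv C (c (C.J.toCotangent ⟨y, hy⟩)) := by
  let P : F →+ C.J :=
    { toFun x := ⟨x - C.s (C.e x), sub_s_e_mem x⟩
      map_zero' := by ext; simp
      map_add' x y := by ext; simp; ring }
  let D : F →+ A := (quotEquiv C).toRingHom.toAddMonoidHom.comp
    (c.toAddMonoidHom.comp (C.J.toCotangent.toAddMonoidHom.comp P))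
  have hD : ∀ y (hy : y ∈ C.J), D y = quotEquiv C (c (C.J.toCotangent ⟨y, hy⟩)) := by
    intro y hy
    have h : P y = ⟨y, hy⟩ := by
      ext
      change y - C.s (C.e y) = y
      rw [show C.e y = 0 from hy, map_zero, sub_zero]
    change quotEquiv C (c (C.J.toCotangent (P y))) = _
    rw [h]
  have hD2 : ∀ y ∈ C.J ^ 2, D y = 0 := by
    intro y hy
    rw [hD y (Ideal.pow_le_self two_ne_zero hy), (Ideal.toCotangent_eq_zero _ _).2 hy, map_zero,
      map_zero]
  refine ⟨⟨D, fun a x => ?_, 2, hD2⟩, hD2, hD⟩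
  have h : P (C.s a * x) = C.s a • P x := by
    ext
    change C.s a * x - C.s (C.e (C.s a * x)) = C.s a * (x - C.s (C.e x))
    rw [map_mul, C.e_s, map_mul]
    ring
  have h' : C.J.toCotangent (P (C.s a * x)) =
      Ideal.Quotient.mk C.J (C.s a) • C.J.toCotangent (P x) := by
    rw [h, map_smul]
    rfl
  change quotEquiv C (c (C.J.toCotangent (P (C.s a * x)))) =
    a * quotEquiv C (c (C.J.toCotangent (P x)))
  rw [h', map_smul, smul_eq_mul, map_mul, quotEquiv_mk, C.e_s]

lemma sub_sum_mem_sq {n : ℕ} (b : A) (x : Fin n → C.J) (c : Fin n → C.J.Cotangent →ₗ[F ⧸ C.J] F ⧸ C.J)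
    {D : Fin n → C.DiffOp}
    (hD : ∀ i y (hy : y ∈ C.J), D i y = quotEquiv C (c i (C.J.toCotangent ⟨y, hy⟩))) {y : F}
    (hy : y ∈ C.J) (h : ∑ i, c i (C.J.toCotangent ⟨y, hy⟩) • C.J.toCotangent (x i) =
      Ideal.Quotient.mk C.J (C.s b) • C.J.toCotangent ⟨y, hy⟩) :
    C.s b * y - ∑ i, C.s (D i y) * x i ∈ C.J ^ 2 := by
  have h1 : ∀ i, c i (C.J.toCotangent ⟨y, hy⟩) = Ideal.Quotient.mk C.J (C.s (D i y)) := fun i => by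
    apply (quotEquiv C).injective
    rw [← hD i y hy, quotEquiv_mk, C.e_s]
  have h2 : C.J.toCotangent (C.s b • ⟨y, hy⟩) = C.J.toCotangent (∑ i, C.s (D i y) • x i) := by
    rw [map_smul, map_sum]
    refine h.symm.trans (Finset.sum_congr rfl fun i _ => ?_)
    rw [h1, map_smul]
    rfl
  have h3 := (Ideal.toCotangent_eq _).1 h2
  simpa using h3

/-- A dual basis of `J / J ^ 2`. -/
lemma exists_dual_coordinates (hC : C.IsSmoothType) :
    ∃ (n : ℕ) (x : Fin n → F) (D : Fin n → C.DiffOp), (∀ i, x i ∈ C.J) ∧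
      (∀ i, D i ∈ filtration C 2) ∧ ∀ y ∈ C.J, y - ∑ i, C.s (D i y) * x i ∈ C.J ^ 2 := by
  have := hC.finite
  have := hC.projective
  obtain ⟨n, x, c, h⟩ := exists_dual_basis (B := F ⧸ C.J) (Q := C.J.Cotangent)
  choose x' hx' using fun i => C.J.toCotangent_surjective (x i)
  choose D hD hD' using fun i => exists_of_cotangent (c i)
  refine ⟨n, fun i => x' i, D, fun i => (x' i).2, hD, fun y hy => ?_⟩
  have h1 := sub_sum_mem_sq 1 x' c hD' hy (by
    rw [map_one, map_one, one_smul]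
    simp only [hx', h])
  rwa [map_one, one_mul] at h1

/-- Coordinates near every point, with denominators cleared. -/
lemma exists_local_coordinates (hC : C.IsSmoothType) : ∃ S : Set A, Ideal.span S = ⊤ ∧ ∀ g ∈ S,
    ∃ (r : ℕ) (y : Fin r → F) (D : Fin r → C.DiffOp), (∀ i, y i ∈ C.J) ∧
      (∀ i, D i ∈ filtration C 2) ∧ (∀ i j, D i (y j) = if i = j then g else 0) ∧
      ∀ z ∈ C.J, C.s g * z - ∑ i, C.s (D i z) * y i ∈ C.J ^ 2 := by
  have := hC.finite
  have := hC.projective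
  refine ⟨_, ?_, fun g hg => hg⟩
  by_contra hne
  obtain ⟨p, hp, hle⟩ := Ideal.exists_le_maximal _ hne
  obtain ⟨f, hf, r, x, c, h, h'⟩ := exists_local_dual_basis (Q := C.J.Cotangent)
    (p.comap (quotEquiv C).toRingHom)
  refine hf (hle (Ideal.subset_span ?_))
  choose x' hx' using fun i => C.J.toCotangent_surjective (x i)
  choose D hD hD' using fun i => exists_of_cotangent (c i)
  refine ⟨r, fun i => x' i, D, fun i => (x' i).2, hD, fun i j => ?_, fun y hy => ?_⟩
  · rw [hD' i _ (x' j).2]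
    change quotEquiv C (c i (C.J.toCotangent (x' j))) = if i = j then quotEquiv C f else 0
    rw [hx', h]
    split_ifs
    · rfl
    · exact map_zero _
  · refine sub_sum_mem_sq _ x' c hD' hy ?_
    simp only [hx', h']
    congr 1
    apply (quotEquiv C).injective
    rw [quotEquiv_mk, C.e_s]
    rfl

end DiffOp

end FormalCategory

/-! ### Local bases of the ring of differential operators -/

namespace FormalCategory

variable {A F : Type u} [CommRing A] [Algebra ℂ A] [CommRing F] [Algebra ℂ F]
  {C : FormalCategory A F}

namespace DiffOp

lemma sum_apply {ι : Type*} (S : Finset ι) (f : ι → C.DiffOp) (x : F) :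
    (∑ i ∈ S, f i) x = ∑ i ∈ S, f i x :=
  map_sum (⟨⟨fun u : C.DiffOp => u x, rfl⟩, fun _ _ => rfl⟩ : C.DiffOp →+ A) _ _

lemma prod_mem_pow_card {ι : Type*} {y : ι → F} (hy : ∀ i, y i ∈ C.J) (m : Multiset ι) :
    (m.map y).prod ∈ C.J ^ m.card := by
  induction m using Multiset.induction_on with
  | empty => simp
  | cons i m ih =>
    rw [Multiset.map_cons, Multiset.prod_cons, Multiset.card_cons, pow_succ']
    exact Ideal.mul_mem_mul (hy i) ih

/-- The action of a coordinate vector field on a monomial. -/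
lemma exists_act_monomial {ι : Type*} [DecidableEq ι] {y : ι → F} (hy : ∀ i, y i ∈ C.J) {g : A}
    (i : ι) {D : C.DiffOp} (hD : D ∈ filtration C 2) (h : ∀ j, D (y j) = if i = j then g else 0)
    (N : ℕ) (m : Multiset ι) : ∃ w ∈ C.J ^ m.card,
      act (C.quotPoint (N + 1)) D (m.map y).prod = (C.quotPoint (N + 1)).hom
        (m.count i * (C.s g * ((m.erase i).map y).prod) + w) := by
  induction m using Multiset.induction_on with
  | empty =>
    obtain ⟨w, hw⟩ := Ideal.Quotient.mkₐ_surjective ℂ _ (act (C.quotPoint (N + 1)) D 1)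
    refine ⟨w, by simp, ?_⟩
    rw [Multiset.map_zero, Multiset.prod_zero, Multiset.count_zero, Nat.cast_zero, zero_mul,
      zero_add]
    exact hw.symm
  | cons j m ih =>
    obtain ⟨q, hq, hq'⟩ := exists_act_mul D hD (hy j) N
    obtain ⟨w, hw, hw'⟩ := ih
    refine ⟨y j * w + (C.t (D (y j)) - C.s (D (y j)) + q) * (m.map y).prod, ?_, ?_⟩
    · rw [Multiset.card_cons, pow_succ']
      exact add_mem (Ideal.mul_mem_mul (hy j) hw)
        (Ideal.mul_mem_mul (add_mem (t_sub_s_mem _) hq) (prod_mem_pow_card hy m))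
    · rw [Multiset.map_cons, Multiset.prod_cons, hq', hw', ← map_mul, ← map_add, h]
      congr 1
      rcases eq_or_ne i j with rfl | hij
      · rw [if_pos rfl, Multiset.count_cons_self, Multiset.erase_cons_head]
        have : (m.count i : F) * (y i * ((m.erase i).map y).prod) =
            m.count i * (m.map y).prod := by
          by_cases hi : i ∈ m
          · rw [← Multiset.prod_cons, ← Multiset.map_cons, Multiset.cons_erase hi]
          · rw [Multiset.count_eq_zero_of_notMem hi, Nat.cast_zero, zero_mul, zero_mul]
        push_cast
        linear_combination C.s g * this
      · rw [if_neg hij, Multiset.count_cons_of_ne hij, Multiset.erase_cons_tail m hij.symm,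
          Multiset.map_cons, Multiset.prod_cons, map_zero, map_zero]
        ring

/-- Operators dual to the monomials of a given degree. -/
lemma exists_dual_monomial {r : ℕ} {y : Fin r → F} (hy : ∀ i, y i ∈ C.J) {g : A}
    {D : Fin r → C.DiffOp} (hD : ∀ i, D i ∈ filtration C 2)
    (h : ∀ i j, D i (y j) = if i = j then g else 0) (m : Multiset (Fin r)) :
    ∃ E ∈ filtration C (m.card + 1), ∀ m' : Multiset (Fin r), m'.card = m.card →
      E (m'.map y).prod = if m = m' then g ^ m.card else 0 := by
  induction m using Multiset.induction_on with
  | empty =>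
    refine ⟨1, ofA_mem_filtration 1, fun m' hm' => ?_⟩
    rw [Multiset.card_zero, Multiset.card_eq_zero] at hm'
    rw [hm', if_pos rfl, Multiset.map_zero, Multiset.prod_zero, one_apply, map_one,
      Multiset.card_zero, pow_zero]
  | cons i m ih =>
    obtain ⟨E, hE, hE'⟩ := ih
    refine ⟨C.ofA (algebraMap ℂ A (m.count i + 1 : ℂ)⁻¹) * (E * D i), ?_, fun m' hm' => ?_⟩
    · rw [Multiset.card_cons]
      exact ofA_mul_mem_filtration _ (mul_mem_filtration hE (hD i))
    · obtain ⟨w, hw, hw'⟩ := exists_act_monomial hy i (hD i) (h i) m.card m'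
      rw [Multiset.card_cons] at hm'
      rw [hm'] at hw
      rw [ofA_mul, mul_apply_of_act_eq hE _ hw', map_add, hE w hw, add_zero, ← map_natCast C.s,
        map_s, map_s]
      by_cases hi : i ∈ m'
      · rw [hE' _ (by rw [Multiset.card_erase_of_mem hi, hm']; rfl)]
        by_cases hm : m = m'.erase i
        · rw [if_pos hm, if_pos (by rw [hm, Multiset.cons_erase hi]), Multiset.card_cons,
            ← Multiset.cons_erase hi, Multiset.count_cons_self, ← hm, pow_succ', ← mul_assoc,
            ← map_natCast (algebraMap ℂ A), ← map_mul, Nat.cast_succ, inv_mul_cancel₀, map_one,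
            one_mul]
          exact Nat.cast_add_one_ne_zero _
        · rw [if_neg hm, if_neg (fun h => hm (by rw [← h, Multiset.erase_cons_head])), mul_zero,
            mul_zero, mul_zero]
      · rw [Multiset.count_eq_zero_of_notMem hi, Nat.cast_zero, zero_mul, mul_zero,
          if_neg (fun h => hi (by rw [← h]; exact Multiset.mem_cons_self i m))]

/-- An operator of order at most `N` that kills the monomials of degree `N` has order less than `N`,
up to a denominator. -/
lemma ofA_pow_mul_mem_filtration {r : ℕ} {y : Fin r → F} (hy : ∀ i, y i ∈ C.J) {g : A}
    {D : Fin r → C.DiffOp} (hg : ∀ z ∈ C.J, C.s g * z - ∑ i, C.s (D i z) * y i ∈ C.J ^ 2) {N : ℕ}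
    {u : C.DiffOp} (hu : u ∈ filtration C (N + 1))
    (hu' : ∀ m : Multiset (Fin r), m.card = N → u (m.map y).prod = 0) :
    C.ofA (g ^ N) * u ∈ filtration C N := by
  have key : ∀ (p : ℕ) (m : Multiset (Fin r)), m.card + p = N → ∀ z ∈ C.J ^ p,
      g ^ p * u ((m.map y).prod * z) = 0 := by
    intro p
    induction p with
    | zero =>
      intro m hm z _
      have h1 := hu ((m.map y).prod * (z - C.s (C.e z))) (by
        rw [pow_succ, ← hm]
        exact Ideal.mul_mem_mul (prod_mem_pow_card hy m) (sub_s_e_mem z))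
      rw [mul_sub, map_sub, sub_eq_zero, mul_comm _ (C.s _), map_s, hu' m hm, mul_zero] at h1
      rw [h1, mul_zero]
    | succ p ih =>
      intro m hm z hz
      rw [pow_succ'] at hz
      refine Submodule.mul_induction_on hz (fun j hj x hx => ?_) (fun x x' hx hx' => ?_)
      · have h1 := hu ((m.map y).prod * ((C.s g * j - ∑ i, C.s (D i j) * y i) * x)) (by
          rw [show N + 1 = m.card + (2 + p) by omega, pow_add, pow_add C.J 2]
          exact Ideal.mul_mem_mul (prod_mem_pow_card hy m) (Ideal.mul_mem_mul (hg j hj) hx))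
        have e1 : (m.map y).prod * ((C.s g * j - ∑ i, C.s (D i j) * y i) * x) =
            C.s g * ((m.map y).prod * (j * x)) -
              ∑ i, C.s (D i j) * (((i ::ₘ m).map y).prod * x) := by
          simp only [sub_mul, mul_sub, Finset.sum_mul, Finset.mul_sum, Multiset.map_cons,
            Multiset.prod_cons]
          congr 1
          · ring
          · exact Finset.sum_congr rfl fun i _ => by ring
        rw [e1, map_sub, map_s, map_sum, sub_eq_zero] at h1
        rw [pow_succ, mul_assoc, h1, Finset.mul_sum]
        refine Finset.sum_eq_zero fun i _ => ?_
        rw [map_s, mul_left_comm, ih (i ::ₘ m) (by rw [Multiset.card_cons]; omega) x hx, mul_zero]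
      · rw [mul_add, map_add, mul_add, hx, hx', add_zero]
  intro z hz
  have := key N 0 (by simp) z hz
  rwa [Multiset.map_zero, Multiset.prod_zero, one_mul, ← ofA_mul] at this

/-- Where there are coordinates, the operators dual to the monomials are a basis. -/
lemma exists_chart [Module A C.DiffOp] (hsmul : ∀ (a : A) (u : C.DiffOp), a • u = C.ofA a * u)
    {r : ℕ} {y : Fin r → F} (hy : ∀ i, y i ∈ C.J) {g : A} {D : Fin r → C.DiffOp}
    (hD : ∀ i, D i ∈ filtration C 2) (h : ∀ i j, D i (y j) = if i = j then g else 0)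
    (hg : ∀ z ∈ C.J, C.s g * z - ∑ i, C.s (D i z) * y i ∈ C.J ^ 2) :
    ∃ b : (Multiset (Fin r) →₀ A) →ₗ[A] C.DiffOp, IsAwayIso (.id A) g b := by
  choose E hE hE' using exists_dual_monomial hy hD h
  have hsmul' : ∀ (a : A) (u : C.DiffOp) (x : F), (a • u) x = a * u x := fun a u x => by
    rw [hsmul, ofA_mul]
  let b : (Multiset (Fin r) →₀ A) →ₗ[A] C.DiffOp := Finsupp.linearCombination A E
  refine ⟨b, fun u => ?_, fun z hz => ?_⟩
  · obtain ⟨N, hN⟩ := exists_mem_filtration u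
    induction N generalizing u with
    | zero => exact ⟨0, 0, by rw [eq_zero_of_mem_filtration_zero hN, smul_zero, map_zero]⟩
    | succ N ih =>
      obtain ⟨T, hT⟩ : ∃ T : Finset (Multiset (Fin r)), ∀ m, m ∈ T ↔ m.card = N :=
        ⟨Finset.univ.image fun m : Sym (Fin r) N => (m : Multiset (Fin r)), fun m =>
          ⟨fun h => by
            obtain ⟨m', -, rfl⟩ := Finset.mem_image.1 h
            exact m'.2, fun h => Finset.mem_image.2 ⟨⟨m, h⟩, Finset.mem_univ _, rfl⟩⟩⟩
      let z : Multiset (Fin r) →₀ A := ∑ m ∈ T, Finsupp.single m (u (m.map y).prod)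
      have hz : b z = ∑ m ∈ T, u (m.map y).prod • E m := by
        simp only [z, b, map_sum, Finsupp.linearCombination_single]
      have hu1 : g ^ N • u - b z ∈ filtration C (N + 1) := by
        rw [hsmul, hz]
        refine sub_mem (ofA_mul_mem_filtration _ hN) (sum_mem fun m hm => ?_)
        rw [hsmul, ← (hT m).1 hm]
        exact ofA_mul_mem_filtration _ (hE m)
      obtain ⟨n, z', hz'⟩ := ih _ (ofA_pow_mul_mem_filtration hy hg hu1 fun m hm => by
        rw [sub_apply, hsmul', hz, sum_apply, sub_eq_zero, Finset.sum_eq_single m]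
        · rw [hsmul', hE' _ _ rfl, if_pos rfl, hm, mul_comm]
        · intro m' hm' hne
          rw [hsmul', hE' _ _ (hm.trans ((hT m').1 hm').symm), if_neg hne, mul_zero]
        · exact fun h => absurd ((hT m).2 hm) h)
      refine ⟨n + N + N, z' + g ^ (n + N) • z, ?_⟩
      rw [RingHom.id_apply] at hz' ⊢
      rw [map_add, ← hz', map_smul, ← hsmul, smul_sub, smul_sub, smul_smul, smul_smul, smul_smul,
        pow_add, pow_add, sub_add_cancel]
  · have key : ∀ (N : ℕ) (z : Multiset (Fin r) →₀ A), (∀ m, z m ≠ 0 → m.card < N) → b z = 0 →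
        ∃ n : ℕ, g ^ n • z = 0 := by
      intro N
      induction N with
      | zero =>
        intro z hz _
        refine ⟨0, ?_⟩
        rw [pow_zero, one_smul]
        ext m
        by_contra hm
        exact absurd (hz m hm) (by omega)
      | succ N ih =>
        intro z hz hbz
        have h1 : ∀ m, m.card = N → g ^ N * z m = 0 := by
          intro m hm
          have h2 : (b z) (m.map y).prod = z m * g ^ N := by
            have h3 : b z = ∑ m' ∈ z.support, z m' • E m' := Finsupp.linearCombination_apply A z
            rw [h3, sum_apply, Finset.sum_eq_single m]
            · rw [hsmul', hE' _ _ rfl, if_pos rfl, hm]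
            · intro m' hm' hne
              rw [hsmul']
              rcases (Nat.lt_succ_iff.1 (hz m' (Finsupp.mem_support_iff.1 hm'))).lt_or_eq with h | h
              · rw [hE m' _ (Ideal.pow_le_pow_right (by omega) (prod_mem_pow_card hy m)), mul_zero]
              · rw [hE' _ _ (hm.trans h.symm), if_neg hne, mul_zero]
            · intro hm'
              rw [Finsupp.notMem_support_iff.1 hm', zero_smul]
              rfl
          rw [mul_comm, ← h2, hbz]
          rfl
        obtain ⟨n, hn⟩ := ih (g ^ N • z) (fun m hm => by
          rw [Finsupp.smul_apply, smul_eq_mul] at hm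
          have := hz m (right_ne_zero_of_mul hm)
          by_contra hlt
          exact hm (h1 m (by omega))) (by rw [map_smul, hbz, smul_zero])
        exact ⟨n + N, by rw [pow_add, mul_smul, hn]⟩
    exact key (z.support.sup Multiset.card + 1) z (fun m hm => Nat.lt_succ_of_le
      (Finset.le_sup (f := Multiset.card) (Finsupp.mem_support_iff.2 hm))) hz

end DiffOp

end FormalCategory

open scoped Pointwise in
/-- A module that is locally free over `L` is locally free over `A` if `L` is. -/
lemma isLocallyFreeOver_restrictScalars_of_charts {A L : Type u} [CommRing A] [Ring L]
    {ι : A →+* L} {S : Set A} (hS : Ideal.span S = ⊤)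
    (hL : ∀ g ∈ S, ∃ (K : Type) (b : (K →₀ A) →ₗ[A]
      (ModuleCat.restrictScalars ι).obj (ModuleCat.of L L)), IsAwayIso (.id A) g b)
    {M : ModuleCat.{u} L} {T : Type u} {f : T → A} {I : T → Type u} {h : ∀ k, (I k →₀ L) →ₗ[L] M}
    (hf : Ideal.span (Set.range f) = ⊤) (hh : ∀ k, IsAwayIso ι (f k) (h k)) :
    IsLocallyFreeOver (.id A) ((ModuleCat.restrictScalars ι).obj M) := by
  classical
  let _ : Module A L := Module.compHom L ι
  let _ : Module A M := Module.compHom M ι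
  have hsM : ∀ (a : A) (m : M), a • m = ι a • m := fun _ _ => rfl
  have hsL : ∀ (a : A) (m : L), a • m = ι a • m := fun _ _ => rfl
  refine isLocallyFreeOver_id_of_charts _ (S := S * Set.range f) (by
    rw [← Ideal.span_mul_span', hS, hf, Ideal.top_mul]) ?_
  rintro _ ⟨g, hg, _, ⟨k, rfl⟩, rfl⟩
  obtain ⟨K, b, hb⟩ := hL g hg
  let b' : (K →₀ A) →ₗ[A] L := b
  let B : (I k × K →₀ A) →ₗ[A] (I k →₀ L) :=
    Finsupp.mapRange.linearMap b' ∘ₗ (Finsupp.curryLinearEquiv A).toLinearMap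
  let H : (I k →₀ L) →ₗ[A] M :=
    { toFun := h k
      map_add' := map_add _
      map_smul' a x := by
        have : a • x = ι a • x := Finsupp.ext fun i => hsL a (x i)
        rw [this, map_smul]
        rfl }
  have hB : IsAwayIso (.id A) g B := by
    constructor
    · intro x
      have h1 : ∀ i, ∃ n : ℕ, ∃ z, g ^ n • x i = b' z := fun i => hb.1 (x i)
      obtain ⟨n, hn⟩ : ∃ n : ℕ, ∀ i ∈ x.support, ∃ z, g ^ n • x i = b' z := by
        have h2 : ∀ᶠ n in Filter.atTop, ∀ i ∈ x.support, ∃ z, g ^ n • x i = b' z := by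
          rw [Finset.eventually_all]
          intro i _
          obtain ⟨n, z, hz⟩ := h1 i
          filter_upwards [Filter.eventually_ge_atTop n] with m hm
          exact ⟨g ^ (m - n) • z, by rw [map_smul, ← hz, smul_smul, ← pow_add, Nat.sub_add_cancel hm]⟩
        exact h2.exists
      have h3 : ∀ i, ∃ z, g ^ n • x i = b' z := fun i => by
        by_cases hi : i ∈ x.support
        · exact hn i hi
        · exact ⟨0, by rw [Finsupp.notMem_support_iff.1 hi, smul_zero, map_zero]⟩
      choose z hz using h3
      refine ⟨n, (Finsupp.curryLinearEquiv A).symm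
        (Finsupp.onFinset x.support (fun i => if i ∈ x.support then z i else 0) (by
          intro i hi
          by_contra hi'
          exact hi (if_neg hi'))), ?_⟩
      ext i
      simp only [B, LinearMap.comp_apply, LinearEquiv.coe_coe, LinearEquiv.apply_symm_apply,
        Finsupp.mapRange.linearMap_apply, Finsupp.mapRange_apply, Finsupp.onFinset_apply]
      change g ^ n • x i = _
      split_ifs with hi
      · exact hz i
      · rw [Finsupp.notMem_support_iff.1 hi, smul_zero, map_zero]
    · intro x hx
      set x' := Finsupp.curryLinearEquiv A x with hx'
      have h1 : ∀ i, b' (x' i) = 0 := fun i => DFunLike.congr_fun hx i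
      obtain ⟨n, hn⟩ : ∃ n : ℕ, ∀ i ∈ x'.support, g ^ n • x' i = 0 := by
        have h2 : ∀ᶠ n in Filter.atTop, ∀ i ∈ x'.support, g ^ n • x' i = 0 := by
          rw [Finset.eventually_all]
          intro i _
          obtain ⟨n, hn⟩ := hb.2 _ (h1 i)
          rw [RingHom.id_apply] at hn
          filter_upwards [Filter.eventually_ge_atTop n] with m hm
          rw [← Nat.sub_add_cancel hm, pow_add, mul_smul, hn, smul_zero]
        exact h2.exists
      refine ⟨n, (Finsupp.curryLinearEquiv A).injective ?_⟩
      rw [RingHom.id_apply, map_smul, map_zero, ← hx']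
      ext1 i
      rw [Finsupp.smul_apply]
      by_cases hi : i ∈ x'.support
      · exact hn i hi
      · rw [Finsupp.notMem_support_iff.1 hi, smul_zero]
        rfl
  have hH : IsAwayIso (.id A) (f k) H := by
    constructor
    · intro m
      obtain ⟨n, y, hy⟩ := (hh k).1 m
      refine ⟨n, y, Eq.trans ?_ hy⟩
      rw [RingHom.id_apply, hsM, map_pow]
    · intro y hy
      obtain ⟨n, hn⟩ := (hh k).2 y hy
      refine ⟨n, Eq.trans ?_ hn⟩
      rw [RingHom.id_apply, ← map_pow]
      exact Finsupp.ext fun i => hsL _ (y i)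
  exact ⟨_, _, hB.comp hH⟩

namespace FormalCategory

variable {A F : Type u} [CommRing A] [Algebra ℂ A] [CommRing F] [Algebra ℂ F]
  {C : FormalCategory A F} (hC : C.IsSmoothType)

include hC

/-- In characteristic zero, the ring of differential operators is locally free over `A`. -/
lemma isLocallyFreeOver_restrictScalars_of_charts {M : ModuleCat.{u} C.DiffOp} {T : Type u}
    {f : T → A} {I : T → Type u} {h : ∀ k, (I k →₀ C.DiffOp) →ₗ[C.DiffOp] M}
    (hf : Ideal.span (Set.range f) = ⊤) (hh : ∀ k, IsAwayIso C.incl.toRingHom (f k) (h k)) :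
    IsLocallyFreeOver (.id A) ((ModuleCat.restrictScalars C.incl.toRingHom).obj M) := by
  obtain ⟨S, hS, h⟩ := DiffOp.exists_local_coordinates hC
  refine _root_.isLocallyFreeOver_restrictScalars_of_charts hS (fun g hg => ?_) hf hh
  obtain ⟨r, y, D, hy, hD, hDy, hg⟩ := h g hg
  let _ : Module A C.DiffOp := Module.compHom C.DiffOp C.incl.toRingHom
  exact ⟨_, DiffOp.exists_chart (fun a u => rfl) hy hD hDy hg⟩

lemma isLocallyFreeOver_restrictScalars {M : ModuleCat.{u} C.DiffOp}
    (hM : IsLocallyFreeOver C.incl.toRingHom M) :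
    IsLocallyFreeOver (.id A) ((ModuleCat.restrictScalars C.incl.toRingHom).obj M) := by
  obtain ⟨T, _, f, I, h, hf, hh⟩ := hM.exists_charts (DiffOp.isAdNilpotent_incl C)
  exact isLocallyFreeOver_restrictScalars_of_charts hC hf hh

/-- The bounded perfect complexes of locally free `L`-modules are such complexes over `A`. -/
lemma resPreservesBplf_incl : ResPreservesBplf C.incl := by
  intro E hE
  obtain ⟨⟨a, b, _, _⟩, hE', hE''⟩ := hE
  exact ⟨⟨a, b, inferInstance, inferInstance⟩,
    fun i => isLocallyFreeOver_restrictScalars hC (hE' i), hE''⟩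

end FormalCategory

/-! ### Symbols of differential operators -/

namespace FormalCategory

variable {A F : Type u} [CommRing A] [Algebra ℂ A] [CommRing F] [Algebra ℂ F]
  {C : FormalCategory A F}

namespace DiffOp

lemma apply_t_mul_of_mem {n : ℕ} {u : C.DiffOp} (hu : u ∈ filtration C (n + 1)) (a : A) {z : F}
    (hz : z ∈ C.J ^ n) : u (C.t a * z) = a * u z := by
  have h := hu ((C.t a - C.s a) * z) (by
    rw [pow_succ']
    exact Ideal.mul_mem_mul (t_sub_s_mem a) hz)
  rwa [sub_mul, map_sub, sub_eq_zero, map_s] at h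

lemma mul_apply_mul {D D' : C.DiffOp} (hD : D ∈ filtration C 2) (hD' : D' ∈ filtration C 2) {y z : F}
    (hy : y ∈ C.J) (hz : z ∈ C.J) : (D * D') (y * z) = D y * D' z + D' y * D z := by
  have h1 := contract_mul_sub_mem_filtration (n := 1) hD hD' hy z (by rwa [pow_one])
  rw [sub_apply, sub_apply, contract_apply, sub_sub, sub_eq_zero] at h1
  rw [h1, eq_ofA_of_mem_filtration_one (contract_mem_filtration hy hD), contract_apply, mul_one,
    ofA_mul, mul_ofA, apply_t_mul_of_mem hD _ (by rwa [pow_one])]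

/-- Vector fields are closed under commutators. -/
lemma commutator_mem_filtration {D D' : C.DiffOp} (hD : D ∈ filtration C 2)
    (hD' : D' ∈ filtration C 2) : D * D' - D' * D ∈ filtration C 2 := fun x hx => by
  rw [pow_two] at hx
  refine Submodule.mul_induction_on hx (fun y hy z hz => ?_) (fun x x' hx hx' => ?_)
  · rw [sub_apply, mul_apply_mul hD hD' hy hz, mul_apply_mul hD' hD hy hz]
    ring
  · rw [map_add, hx, hx', add_zero]

lemma contract_contract (y y' : F) (u : C.DiffOp) :
    contract y (contract y' u) = contract y' (contract y u) := ext fun z => by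
  rw [contract_apply, contract_apply, contract_apply, contract_apply, mul_left_comm]

/-- The Euler identity: on symbols of degree `n`, the contractions with coordinates followed by the
products with the dual vector fields add up to the multiplication by `n`. -/
lemma sum_contract_mul_sub_mem_filtration {m : ℕ} {x : Fin m → F} {D : Fin m → C.DiffOp}
    (hx : ∀ i, x i ∈ C.J) (hD : ∀ i, D i ∈ filtration C 2)
    (h : ∀ y ∈ C.J, y - ∑ i, C.s (D i y) * x i ∈ C.J ^ 2) {n : ℕ} {u : C.DiffOp}
    (hu : u ∈ filtration C (n + 1)) :
    ∑ i, contract (x i) u * D i - n • u ∈ filtration C n := by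
  have hsmul : ∀ (n : ℕ) (u : C.DiffOp) (z : F), (n • u) z = n * u z := fun n u z => by
    rw [← nsmul_eq_mul]
    exact map_nsmul (⟨⟨fun u : C.DiffOp => u z, rfl⟩, fun _ _ => rfl⟩ : C.DiffOp →+ A) n u
  intro z hz
  induction n generalizing u z with
  | zero =>
    have h0 : ∀ i, contract (x i) u = 0 := fun i =>
      eq_zero_of_mem_filtration_zero (contract_mem_filtration (hx i) hu)
    simp [h0]
  | succ n ih =>
    rw [pow_succ'] at hz
    refine Submodule.mul_induction_on hz (fun y hy z hz => ?_) (fun x x' hx hx' => ?_)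
    · have h1 := ih (contract_mem_filtration hy hu) z hz
      rw [sub_apply, sum_apply, hsmul, sub_eq_zero] at h1
      have h2 : ∀ i, (contract (x i) u * D i) (y * z) =
          (contract (x i) (contract y u) * D i) z + u (x i * (C.t (D i y) * z)) := by
        intro i
        have h3 := contract_mul_sub_mem_filtration (contract_mem_filtration (hx i) hu) (hD i) hy z hz
        rw [sub_apply, sub_apply, contract_apply, sub_sub, sub_eq_zero] at h3
        rw [h3, contract_contract, mul_ofA, contract_apply]
      have h4 : u ((y - ∑ i, C.t (D i y) * x i) * z) = 0 := by
        refine hu _ ?_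
        rw [show n + 1 + 1 = 2 + n by omega, pow_add]
        refine Ideal.mul_mem_mul ?_ hz
        have h5 : y - ∑ i, C.t (D i y) * x i =
            (y - ∑ i, C.s (D i y) * x i) - ∑ i, (C.t (D i y) - C.s (D i y)) * x i := by
          simp only [sub_mul, Finset.sum_sub_distrib]
          ring
        rw [h5]
        refine sub_mem (h y hy) (sum_mem fun i _ => ?_)
        rw [pow_two]
        exact Ideal.mul_mem_mul (t_sub_s_mem _) (hx i)
      rw [sub_mul, map_sub, sub_eq_zero, Finset.sum_mul, map_sum] at h4
      rw [sub_apply, sum_apply, hsmul, Finset.sum_congr rfl fun i _ => h2 i, Finset.sum_add_distrib,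
        h1, contract_apply]
      have h6 : ∀ i, u (x i * (C.t (D i y) * z)) = u (C.t (D i y) * x i * z) := fun i => by
        congr 1
        ring
      rw [Finset.sum_congr rfl fun i _ => h6 i, ← h4]
      push_cast
      ring
    · rw [map_add, hx, hx', add_zero]

end DiffOp

end FormalCategory

/-! ### Induced modules -/

section Induced

open scoped TensorProduct

variable {A L : Type u} [CommRing A] [Ring L] (ι : A →+* L)

/-- The ring `L`, as an `A`-module through the multiplication on the right. -/
@[nolint unusedArguments]
def RightMod (_ : A →+* L) : Type u := L

instance : AddCommGroup (RightMod ι) := inferInstanceAs (AddCommGroup L)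

instance : Module L (RightMod ι) := inferInstanceAs (Module L L)

instance : Module A (RightMod ι) where
  smul a u := (show L from u) * ι a
  one_smul u := by
    change (show L from u) * ι 1 = u
    rw [map_one, mul_one]
  mul_smul a b u := by
    change (show L from u) * ι (a * b) = (show L from u) * ι b * ι a
    rw [mul_comm a, map_mul, mul_assoc]
  smul_zero a := zero_mul (ι a)
  smul_add a u u' := add_mul (show L from u) u' (ι a)
  add_smul a b u := by
    change (show L from u) * ι (a + b) = (show L from u) * ι a + (show L from u) * ι b
    rw [map_add, mul_add]
  zero_smul u := by
    change (show L from u) * ι 0 = 0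
    rw [map_zero, mul_zero]

instance : SMulCommClass A L (RightMod ι) where
  smul_comm a v u := (mul_assoc v (show L from u) (ι a))

/-- The `L`-module `L ⊗_A N` that is induced by an `A`-module. -/
abbrev Induced (N : Type*) [AddCommGroup N] [Module A N] := RightMod ι ⊗[A] N

namespace Induced

variable {ι} {N : Type*} [AddCommGroup N] [Module A N]

variable (ι) in
/-- The pure tensor `u ⊗ ν`. -/
def tmul (u : L) (ν : N) : Induced ι N := (show RightMod ι from u) ⊗ₜ[A] ν

lemma smul_tmul (v u : L) (ν : N) : v • tmul ι u ν = tmul ι (v * u) ν := rfl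

lemma tmul_smul (u : L) (a : A) (ν : N) : tmul ι u (a • ν) = tmul ι (u * ι a) ν :=
  (TensorProduct.tmul_smul a (show RightMod ι from u) ν).trans
    (TensorProduct.smul_tmul' a (show RightMod ι from u) ν)

lemma add_tmul (u u' : L) (ν : N) : tmul ι (u + u') ν = tmul ι u ν + tmul ι u' ν :=
  TensorProduct.add_tmul (show RightMod ι from u) (show RightMod ι from u') ν

lemma tmul_add (u : L) (ν ν' : N) : tmul ι u (ν + ν') = tmul ι u ν + tmul ι u ν' :=
  TensorProduct.tmul_add (show RightMod ι from u) ν ν'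

/-- The additive map `u ↦ u ⊗ ν`. -/
def tmulLeft (ν : N) : L →+ Induced ι N := ⟨⟨fun u => tmul ι u ν, TensorProduct.zero_tmul _ _⟩,
  fun u u' => add_tmul u u' ν⟩

/-- The additive map `ν ↦ u ⊗ ν`. -/
def tmulRight (u : L) : N →+ Induced ι N := ⟨⟨fun ν => tmul ι u ν, TensorProduct.tmul_zero _ _⟩,
  tmul_add u⟩

lemma sum_tmul {K : Type*} (S : Finset K) (u : K → L) (ν : N) :
    tmul ι (∑ i ∈ S, u i) ν = ∑ i ∈ S, tmul ι (u i) ν := map_sum (tmulLeft ν) _ _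

lemma tmul_sum {K : Type*} (S : Finset K) (u : L) (ν : K → N) :
    tmul ι u (∑ i ∈ S, ν i) = ∑ i ∈ S, tmul ι u (ν i) := map_sum (tmulRight u) _ _

lemma sub_tmul (u u' : L) (ν : N) : tmul ι (u - u') ν = tmul ι u ν - tmul ι u' ν :=
  map_sub (tmulLeft ν) _ _

lemma nsmul_tmul (n : ℕ) (u : L) (ν : N) : tmul ι (n • u) ν = n • tmul ι u ν :=
  map_nsmul (tmulLeft ν) _ _

lemma tmul_nsmul (n : ℕ) (u : L) (ν : N) : tmul ι u (n • ν) = n • tmul ι u ν :=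
  map_nsmul (tmulRight u) _ _

@[elab_as_elim]
lemma induction {p : Induced ι N → Prop} (z : Induced ι N) (zero : p 0)
    (tmul : ∀ u ν, p (tmul ι u ν)) (add : ∀ z z', p z → p z' → p (z + z')) : p z :=
  TensorProduct.induction_on z zero tmul add

variable {X : Type*} [AddCommGroup X] [Module L X]

/-- The `L`-linear map `u ⊗ ν ↦ u φ(ν)` that is defined by an `A`-linear map. -/
def lift (φ : N →+ X) (hφ : ∀ (a : A) (ν : N), φ (a • ν) = ι a • φ ν) : Induced ι N →ₗ[L] X :=
  let f : RightMod ι ⊗[A] N →+ X := TensorProduct.liftAddHom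
    (⟨⟨fun u => ⟨⟨fun ν => (show L from u) • φ ν, by rw [map_zero, smul_zero]⟩, fun ν ν' =>
      (congrArg ((show L from u) • ·) (map_add φ ν ν')).trans (smul_add _ _ _)⟩, AddMonoidHom.ext fun ν => zero_smul L (φ ν)⟩, fun u u' =>
        AddMonoidHom.ext fun ν => add_smul (show L from u) (show L from u') (φ ν)⟩)
    (fun a u ν => by
      change ((show L from u) * ι a) • φ ν = (show L from u) • φ (a • ν)
      rw [hφ, mul_smul])
  { toFun := f
    map_add' := f.map_add
    map_smul' v z := by
      induction z using induction with
      | zero => exact (congrArg f (smul_zero v)).trans (by simp)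
      | tmul u ν => exact mul_smul v u (φ ν)
      | add z z' hz hz' =>
        rw [RingHom.id_apply] at hz hz' ⊢
        rw [smul_add, map_add, hz, hz', map_add, smul_add] }

lemma lift_tmul (φ : N →+ X) (hφ : ∀ (a : A) (ν : N), φ (a • ν) = ι a • φ ν) (u : L) (ν : N) :
    lift φ hφ (tmul ι u ν) = u • φ ν := rfl

lemma hom_ext {f g : Induced ι N →ₗ[L] X} (h : ∀ ν, f (tmul ι 1 ν) = g (tmul ι 1 ν)) : f = g := by
  ext1 z
  induction z using induction with
  | zero => rw [map_zero, map_zero]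
  | tmul u ν => rw [← mul_one u, ← smul_tmul, map_smul, map_smul, h]
  | add z z' hz hz' => rw [map_add, map_add, hz, hz']

/-- A map to the quotient by `H` that is linear lifts to a subgroup `G` if its values do. -/
lemma exists_lift [Module.Projective A N] {G H : AddSubgroup X}
    (hG : ∀ (a : A), ∀ x ∈ G, ι a • x ∈ G) (hH : ∀ (a : A), ∀ x ∈ H, ι a • x ∈ H) (σ : N → X)
    (hσ' : ∀ ν ν', σ ν + σ ν' - σ (ν + ν') ∈ H)
    (hσ : ∀ (a : A) (ν : N), ι a • σ ν - σ (a • ν) ∈ H) (h : ∀ ν, ∃ z ∈ G, z - σ ν ∈ H) :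
    ∃ φ : Induced ι N →ₗ[L] X, ∀ ν, φ (tmul ι 1 ν) ∈ G ∧ φ (tmul ι 1 ν) - σ ν ∈ H := by
  obtain ⟨s, hs⟩ := Module.projective_def.1 (inferInstance : Module.Projective A N)
  choose z hz hz' using h
  let ψ : (N →₀ A) →+ X := Finsupp.liftAddHom fun ν =>
    (AddMonoidHom.flip (smulAddHom L X) (z ν)).comp ι.toAddMonoidHom
  have hψ : ∀ ν a, ψ (Finsupp.single ν a) = ι a • z ν := fun ν a =>
    Finsupp.liftAddHom_apply_single _ _ _
  have hψ' : ∀ (a : A) t, ψ (a • t) = ι a • ψ t := by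
    intro a t
    induction t using Finsupp.induction_linear with
    | zero => rw [smul_zero, map_zero, smul_zero]
    | add t t' ht ht' => rw [smul_add, map_add, ht, ht', map_add, smul_add]
    | single ν b => rw [Finsupp.smul_single, hψ, hψ, smul_eq_mul, map_mul, mul_smul]
  have hψG : ∀ t, ψ t ∈ G := by
    intro t
    induction t using Finsupp.induction_linear with
    | zero => rw [map_zero]; exact zero_mem _
    | add t t' ht ht' => rw [map_add]; exact add_mem ht ht'
    | single ν b => rw [hψ]; exact hG _ _ (hz ν)
  have hψH : ∀ t, ψ t - σ (Finsupp.linearCombination A id t) ∈ H := by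
    intro t
    induction t using Finsupp.induction_linear with
    | zero => simpa using hσ 0 0
    | add t t' ht ht' =>
      convert add_mem (add_mem ht ht')
        (hσ' (Finsupp.linearCombination A id t) (Finsupp.linearCombination A id t')) using 1
      rw [map_add, map_add]
      abel
    | single ν b =>
      rw [hψ, Finsupp.linearCombination_single, id]
      convert add_mem (hH b _ (hz' ν)) (hσ b ν) using 1
      rw [smul_sub]
      abel
  refine ⟨lift (ψ.comp s.toAddMonoidHom) fun a ν => ?_, fun ν => ?_⟩
  · change ψ (s (a • ν)) = ι a • ψ (s ν)
    rw [map_smul, hψ']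
  · rw [lift_tmul, one_smul]
    refine ⟨hψG _, ?_⟩
    have := hψH (s ν)
    rwa [hs ν] at this

lemma projective [Module.Projective A N] : Module.Projective L (Induced ι N) := by
  refine .of_lifting_property'' fun f hf => ?_
  choose g hg using hf
  obtain ⟨φ, hφ⟩ := exists_lift (ι := ι) (N := N) (X := Induced ι N →₀ L)
    (G := ⊤) (H := f.toAddMonoidHom.ker) (fun _ _ _ => trivial) (fun a x hx => by
      change f (ι a • x) = 0
      rw [map_smul, show f x = 0 from hx, smul_zero]) (fun ν => g (tmul ι 1 ν)) (fun ν ν' => by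
      change f _ = 0
      rw [map_sub, map_add, hg, hg, hg, tmul_add, sub_self]) (fun a ν => by
      change f _ = 0
      rw [map_sub, map_smul, hg, hg, smul_tmul, tmul_smul, one_mul, mul_one, sub_self])
    (fun ν => ⟨g (tmul ι 1 ν), trivial, by rw [sub_self]; exact zero_mem _⟩)
  refine ⟨φ, hom_ext fun ν => ?_⟩
  have : f (φ (tmul ι 1 ν) - g (tmul ι 1 ν)) = 0 := (hφ ν).2
  rwa [map_sub, hg, sub_eq_zero] at this

end Induced

end Induced

/-! ### Alternating forms -/

section Forms

open AlternatingMap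

variable {A Ω M : Type*} [CommRing A] [AddCommGroup Ω] [Module A Ω] [AddCommGroup M] [Module A M]
  {p : ℕ}

/-- The contraction of alternating forms with an element. -/
def contractForm (x : Ω) : Ω [⋀^Fin (p + 1)]→ₗ[A] M →ₗ[A] Ω [⋀^Fin p]→ₗ[A] M where
  toFun ν := ν.curryLeft x
  map_add' _ _ := rfl
  map_smul' _ _ := rfl

/-- The exterior product of alternating forms with a linear form. -/
def wedgeForm (ξ : Ω →ₗ[A] A) : Ω [⋀^Fin p]→ₗ[A] M →ₗ[A] Ω [⋀^Fin (p + 1)]→ₗ[A] M where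
  toFun ν := alternatizeUncurryFin (ξ.smulRight ν)
  map_add' ν ν' := by
    rw [← alternatizeUncurryFin_add]
    congr 1
    ext x v
    simp
  map_smul' a ν := by
    rw [RingHom.id_apply, ← alternatizeUncurryFin_smul]
    congr 1
    ext x v
    simp [smul_comm a]

lemma wedgeForm_apply (ξ : Ω →ₗ[A] A) (ν : Ω [⋀^Fin p]→ₗ[A] M) (v : Fin (p + 1) → Ω) :
    wedgeForm ξ ν v = ∑ i : Fin (p + 1), (-1) ^ (i : ℕ) • ξ (v i) • ν (i.removeNth v) :=
  alternatizeUncurryFin_apply _ _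

lemma contractForm_apply (x : Ω) (ν : Ω [⋀^Fin (p + 1)]→ₗ[A] M) (v : Fin p → Ω) :
    contractForm x ν v = ν (Matrix.vecCons x v) := rfl

lemma contractForm_wedgeForm_zero (x : Ω) (ξ : Ω →ₗ[A] A) (ν : Ω [⋀^Fin 0]→ₗ[A] M) :
    contractForm x (wedgeForm ξ ν) = ξ x • ν := by
  ext v
  rw [contractForm_apply, wedgeForm_apply, Fin.sum_univ_one, Fin.val_zero, pow_zero, one_smul]
  exact congrArg (fun w => ξ x • ν w) (Subsingleton.elim _ _)

lemma contractForm_wedgeForm (x : Ω) (ξ : Ω →ₗ[A] A) (ν : Ω [⋀^Fin (p + 1)]→ₗ[A] M) :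
    contractForm x (wedgeForm ξ ν) + wedgeForm ξ (contractForm x ν) = ξ x • ν := by
  ext v
  rw [AlternatingMap.add_apply, contractForm_apply, wedgeForm_apply, wedgeForm_apply, Fin.sum_univ_succ, Fin.val_zero,
    pow_zero, one_smul, add_assoc, ← Finset.sum_add_distrib, Finset.sum_eq_zero, add_zero]
  · rfl
  · intro i _
    rw [contractForm_apply, Matrix.vecCons, Fin.cons_succ, Fin.val_succ, pow_succ, mul_neg_one,
      neg_smul, neg_add_eq_zero]
    congr 3
    ext j
    refine Fin.cases ?_ (fun j => ?_) j <;> simp [Fin.removeNth]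

lemma sum_wedgeForm_contractForm {m : ℕ} {x : Fin m → Ω} {ξ : Fin m → Ω →ₗ[A] A}
    (hξ : ∀ v, ∑ i, ξ i v • x i = v) (ν : Ω [⋀^Fin (p + 1)]→ₗ[A] M) :
    ∑ i, wedgeForm (ξ i) (contractForm (x i) ν) = (p + 1) • ν := by
  rw [← alternatizeUncurryFin_curryLeft]
  have h : ν.curryLeft = ∑ i, (ξ i).smulRight (contractForm (x i) ν) := by
    ext1 v
    conv_lhs => rw [← hξ v, map_sum]
    rw [LinearMap.sum_apply]
    exact Finset.sum_congr rfl fun i _ => map_smul _ _ _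
  rw [h]
  exact (map_sum (alternatizeUncurryFinLM (R := A) (M := Ω) (N := M) (n := p)) _ _).symm

lemma contractForm_contractForm (x y : Ω) (ν : Ω [⋀^Fin (p + 2)]→ₗ[A] M) :
    contractForm x (contractForm y ν) = -contractForm y (contractForm x ν) := by
  have h := curryLeft_same ν (x + y)
  simp only [map_add, curryLeft_add, LinearMap.add_apply, curryLeft_same, zero_add, add_zero] at h
  exact eq_neg_of_add_eq_zero_left h

lemma sum_smul_wedgeForm {m : ℕ} {x : Fin m → Ω} {ξ : Fin m → Ω →ₗ[A] A}
    (hξ : ∀ v, ∑ i, ξ i v • x i = v) (i : Fin m) (ν : Ω [⋀^Fin p]→ₗ[A] M) :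
    ∑ j, ξ i (x j) • wedgeForm (ξ j) ν = wedgeForm (ξ i) ν := by
  ext v
  have h : ∀ w, ξ i w = ∑ j, ξ i (x j) * ξ j w := fun w => by
    conv_lhs => rw [← hξ w, map_sum]
    exact Finset.sum_congr rfl fun j _ => by rw [map_smul, smul_eq_mul, mul_comm]
  have hsum : ∀ f : Fin m → Ω [⋀^Fin (p + 1)]→ₗ[A] M, (∑ j, f j) v = ∑ j, f j v := fun f =>
    map_sum (⟨⟨fun ν => ν v, rfl⟩, fun _ _ => rfl⟩ : Ω [⋀^Fin (p + 1)]→ₗ[A] M →+ M) _ _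
  have h' : ∀ k : Fin (p + 1), (-1 : ℤ) ^ (k : ℕ) • ξ i (v k) • ν (k.removeNth v) =
      ∑ j, (-1 : ℤ) ^ (k : ℕ) • (ξ i (x j) * ξ j (v k)) • ν (k.removeNth v) := fun k => by
    rw [h (v k), Finset.sum_smul, Finset.smul_sum]
  rw [hsum, wedgeForm_apply, Finset.sum_congr rfl fun k _ => h' k, Finset.sum_comm]
  refine Finset.sum_congr rfl fun j _ => ?_
  rw [AlternatingMap.smul_apply, wedgeForm_apply, Finset.smul_sum]
  exact Finset.sum_congr rfl fun k _ => by rw [smul_comm (ξ i (x j)), mul_smul]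

lemma projective_forms [Algebra ℂ A] [Module.Projective A M] {m : ℕ} {x : Fin m → Ω}
    {ξ : Fin m → Ω →ₗ[A] A} (hξ : ∀ v, ∑ i, ξ i v • x i = v) (p : ℕ) :
    Module.Projective A (Ω [⋀^Fin p]→ₗ[A] M) := by
  induction p with
  | zero => exact .of_equiv (AlternatingMap.constLinearEquivOfIsEmpty (R' := A))
  | succ p ih =>
    have : Module.Projective A (Fin m →₀ Ω [⋀^Fin p]→ₗ[A] M) := by
      classical
      exact .of_equiv (finsuppLequivDFinsupp A).symm
    have : Module.Projective A (Fin m → Ω [⋀^Fin p]→ₗ[A] M) :=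
      .of_equiv (Finsupp.linearEquivFunOnFinite A _ (Fin m))
    let f : (Fin m → Ω [⋀^Fin p]→ₗ[A] M) →ₗ[A] Ω [⋀^Fin (p + 1)]→ₗ[A] M :=
      algebraMap ℂ A (p + 1 : ℂ)⁻¹ • ∑ i, wedgeForm (ξ i) ∘ₗ LinearMap.proj i
    refine .of_split (LinearMap.pi fun i => contractForm (x i)) f ?_
    ext1 ν
    have h := sum_wedgeForm_contractForm hξ ν
    simp only [f, LinearMap.comp_apply, LinearMap.smul_apply, LinearMap.sum_apply,
      LinearMap.proj_apply, LinearMap.pi_apply, LinearMap.id_apply, h]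
    rw [← Nat.cast_smul_eq_nsmul A, smul_smul, ← map_natCast (algebraMap ℂ A), ← map_mul,
      Nat.cast_succ, inv_mul_cancel₀ (Nat.cast_add_one_ne_zero p), map_one, one_smul]

lemma subsingleton_forms {m : ℕ} {x : Fin m → Ω} {ξ : Fin m → Ω →ₗ[A] A}
    (hξ : ∀ v, ∑ i, ξ i v • x i = v) (hp : m < p) : Subsingleton (Ω [⋀^Fin p]→ₗ[A] M) := by
  classical
  refine subsingleton_of_forall_eq 0 fun ν => ?_
  ext v
  have h := (ν.toMultilinearMap).map_sum (fun k (i : Fin m) => ξ i (v k) • x i)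
  simp only [hξ] at h
  refine h.trans (Finset.sum_eq_zero fun r _ => ?_)
  obtain ⟨k, l, hkl, hr⟩ := Fintype.exists_ne_map_eq_of_card_lt r (by simpa using hp)
  rw [MultilinearMap.map_smul_univ]
  exact (congrArg _ (ν.map_eq_zero_of_eq (fun k => x (r k)) (congrArg x hr) hkl)).trans (smul_zero _)

end Forms

/-! ### The Koszul resolution -/

namespace FormalCategory

variable {A F : Type u} [CommRing A] [Algebra ℂ A] [CommRing F] [Algebra ℂ F]
  {C : FormalCategory A F}

namespace DiffOp

open Induced

/-- The `L`-module that is induced by an `A`-module. -/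
noncomputable abbrev Ind (C : FormalCategory A F) (N : Type*) [AddCommGroup N] [Module A N] :=
  Induced C.incl.toRingHom N

/-- The pure tensor `u ⊗ ν`. -/
noncomputable abbrev tmul {N : Type*} [AddCommGroup N] [Module A N] (u : C.DiffOp) (ν : N) : Ind C N :=
  Induced.tmul C.incl.toRingHom u ν

section

variable {N N' : Type*} [AddCommGroup N] [Module A N] [AddCommGroup N'] [Module A N']

variable (C N) in
/-- The filtration of an induced module by the order of differential operators. -/
noncomputable def indFil (n : ℕ) : AddSubgroup (Ind C N) :=
  AddSubgroup.closure {z | ∃ u ∈ filtration C n, ∃ ν : N, z = tmul u ν}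

lemma tmul_mem_indFil {n : ℕ} {u : C.DiffOp} (hu : u ∈ filtration C n) (ν : N) :
    tmul u ν ∈ indFil C N n := AddSubgroup.subset_closure ⟨u, hu, ν, rfl⟩

@[elab_as_elim]
lemma indFil_induction {n : ℕ} {p : ∀ z : Ind C N, z ∈ indFil C N n → Prop}
    (zero : p 0 (zero_mem _)) (tmul : ∀ u hu ν, p (tmul u ν) (tmul_mem_indFil hu ν))
    (add : ∀ z z' hz hz', p z hz → p z' hz' → p (z + z') (add_mem hz hz')) {z : Ind C N}
    (hz : z ∈ indFil C N n) : p z hz := by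
  induction hz using AddSubgroup.closure_induction'' with
  | zero => exact zero
  | mem z hz =>
    obtain ⟨u, hu, ν, rfl⟩ := hz
    exact tmul u hu ν
  | neg_mem z hz =>
    obtain ⟨u, hu, ν, rfl⟩ := hz
    have h : DiffOp.tmul (-u) ν = -DiffOp.tmul u ν := map_neg (tmulLeft ν) u
    simpa only [h] using tmul _ (neg_mem hu) ν
  | add z z' hz hz' h h' => exact add z z' hz hz' h h'

lemma indFil_mono {n n' : ℕ} (h : n ≤ n') : indFil C N n ≤ indFil C N n' :=
  AddSubgroup.closure_mono fun _ ⟨u, hu, ν, hz⟩ => ⟨u, filtration_mono h hu, ν, hz⟩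

lemma exists_mem_indFil (z : Ind C N) : ∃ n, z ∈ indFil C N n := by
  induction z using Induced.induction with
  | zero => exact ⟨0, zero_mem _⟩
  | tmul u ν => exact (exists_mem_filtration u).imp fun n hn => tmul_mem_indFil hn ν
  | add z z' hz hz' =>
    obtain ⟨n, hn⟩ := hz
    obtain ⟨n', hn'⟩ := hz'
    exact ⟨max n n', add_mem (indFil_mono (le_max_left _ _) hn) (indFil_mono (le_max_right _ _) hn')⟩

lemma eq_zero_of_mem_indFil_zero {z : Ind C N} (hz : z ∈ indFil C N 0) : z = 0 := by
  induction hz using indFil_induction with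
  | zero => rfl
  | tmul u hu ν =>
    rw [eq_zero_of_mem_filtration_zero hu]
    exact (tmulLeft ν).map_zero
  | add z z' _ _ hz hz' => rw [hz, hz', add_zero]

lemma tmul_ofA (u : C.DiffOp) (a : A) (ν : N) : tmul (u * C.ofA a) ν = tmul u (a • ν) :=
  (tmul_smul u a ν).symm

lemma exists_of_mem_indFil_one {z : Ind C N} (hz : z ∈ indFil C N 1) : ∃ ν, z = tmul 1 ν := by
  induction hz using indFil_induction with
  | zero => exact ⟨0, (tmulRight 1).map_zero.symm⟩
  | tmul u hu ν =>
    refine ⟨u 1 • ν, ?_⟩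
    rw [← tmul_ofA, one_mul, ← eq_ofA_of_mem_filtration_one hu]
  | add z z' _ _ hz hz' =>
    obtain ⟨ν, rfl⟩ := hz
    obtain ⟨ν', rfl⟩ := hz'
    exact ⟨ν + ν', (tmul_add _ _ _).symm⟩

lemma ofA_smul_mem_indFil {n : ℕ} (a : A) {z : Ind C N} (hz : z ∈ indFil C N n) :
    C.ofA a • z ∈ indFil C N n := by
  induction hz using indFil_induction with
  | zero => rw [smul_zero]; exact zero_mem _
  | tmul u hu ν => exact tmul_mem_indFil (ofA_mul_mem_filtration a hu) ν
  | add z z' _ _ hz hz' => rw [smul_add]; exact add_mem hz hz'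

lemma smul_mem_indFil {n : ℕ} {u : C.DiffOp} (hu : u ∈ filtration C n) {z : Ind C N}
    (hz : z ∈ indFil C N 1) : u • z ∈ indFil C N n := by
  obtain ⟨ν, rfl⟩ := exists_of_mem_indFil_one hz
  rw [Induced.smul_tmul, mul_one]
  exact tmul_mem_indFil hu ν

lemma ofA_inv_smul {k : ℕ} (hk : k ≠ 0) {X : Type*} [AddCommGroup X] [Module C.DiffOp X] (z : X) :
    C.ofA (algebraMap ℂ A (k : ℂ)⁻¹) • k • z = z := by
  rw [← Nat.cast_smul_eq_nsmul C.DiffOp, smul_smul, ← map_natCast (ofARingHom C)]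
  change (ofARingHom C _ * ofARingHom C k) • z = z
  rw [← map_mul, ← map_natCast (algebraMap ℂ A), ← map_mul, inv_mul_cancel₀ (Nat.cast_ne_zero.2 hk),
    map_one, map_one, one_smul]

/-- The contraction with `y`, as an `A`-linear map for the multiplication on the right. -/
noncomputable def contractRight (y : F) :
    RightMod C.incl.toRingHom →ₗ[A] RightMod C.incl.toRingHom where
  toFun u := contract (C := C) y u
  map_add' u u' := (contract (C := C) y).map_add u u'
  map_smul' a u := contract_mul_ofA (C := C) y a u

/-- The map `u ⊗ ν ↦ u(y -) ⊗ f(ν)`. -/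
noncomputable def contractTmul (y : F) (f : N →ₗ[A] N') : Ind C N →+ Ind C N' :=
  (TensorProduct.map (contractRight y) f).toAddMonoidHom

end

variable {m : ℕ} {x : Fin m → F} {D : Fin m → C.DiffOp} {Ω M : Type u} [AddCommGroup Ω] [Module A Ω]
  [AddCommGroup M] [Module A M] {X : Fin m → Ω} {ξ : Fin m → Ω →ₗ[A] A} {p : ℕ}

/-- The homotopy of the Koszul complex. -/
noncomputable def koszulHomotopy (x : Fin m → F) (ξ : Fin m → Ω →ₗ[A] A) :
    Ind C (Ω [⋀^Fin p]→ₗ[A] M) →+ Ind C (Ω [⋀^Fin (p + 1)]→ₗ[A] M) :=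
  ∑ j, contractTmul (x j) (wedgeForm (ξ j))

lemma koszulHomotopy_tmul (u : C.DiffOp) (ν : Ω [⋀^Fin p]→ₗ[A] M) :
    koszulHomotopy x ξ (tmul u ν) = ∑ j, tmul (contract (x j) u) (wedgeForm (ξ j) ν) := by
  rw [koszulHomotopy, AddMonoidHom.finsetSum_apply]
  rfl

/-- The principal part of the differential of the Koszul complex. -/
noncomputable def koszulSymbol (D : Fin m → C.DiffOp) (X : Fin m → Ω) (ν : Ω [⋀^Fin (p + 1)]→ₗ[A] M) :
    Ind C (Ω [⋀^Fin p]→ₗ[A] M) := ∑ i, tmul (D i) (contractForm (X i) ν)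

lemma koszulSymbol_add (ν ν' : Ω [⋀^Fin (p + 1)]→ₗ[A] M) :
    koszulSymbol D X (ν + ν') = koszulSymbol D X ν + koszulSymbol D X ν' := by
  simp only [koszulSymbol, map_add, tmul_add, Finset.sum_add_distrib]

lemma smul_koszulSymbol_sub_mem_indFil (hD : ∀ i, D i ∈ filtration C 2) (a : A)
    (ν : Ω [⋀^Fin (p + 1)]→ₗ[A] M) :
    C.ofA a • koszulSymbol D X ν - koszulSymbol D X (a • ν) ∈ indFil C _ 1 := by
  rw [koszulSymbol, koszulSymbol, Finset.smul_sum, ← Finset.sum_sub_distrib]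
  refine sum_mem fun i _ => ?_
  rw [map_smul, ← tmul_ofA, Induced.smul_tmul, ← sub_tmul]
  exact tmul_mem_indFil (commutator_ofA_mem_filtration a (hD i)) _

/-- A differential of the Koszul complex: a map with the right principal part. -/
noncomputable def IsKoszul (D : Fin m → C.DiffOp) (X : Fin m → Ω)
    (d : Ind C (Ω [⋀^Fin (p + 1)]→ₗ[A] M) →ₗ[C.DiffOp] Ind C (Ω [⋀^Fin p]→ₗ[A] M)) : Prop :=
  ∀ ν, d (tmul 1 ν) - koszulSymbol D X ν ∈ indFil C _ 1

section

variable (hx : ∀ i, x i ∈ C.J)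

include hx

lemma koszulHomotopy_mem_indFil {n : ℕ} {z : Ind C (Ω [⋀^Fin p]→ₗ[A] M)}
    (hz : z ∈ indFil C _ (n + 1)) : koszulHomotopy x ξ z ∈ indFil C _ n := by
  induction hz using indFil_induction with
  | zero => rw [map_zero]; exact zero_mem _
  | tmul u hu ν =>
    rw [koszulHomotopy_tmul]
    exact sum_mem fun j _ => tmul_mem_indFil (contract_mem_filtration (hx j) hu) _
  | add z z' _ _ hz hz' => rw [map_add]; exact add_mem hz hz'

lemma d_koszulHomotopy_tmul_sub_mem
    {d : Ind C (Ω [⋀^Fin (p + 1)]→ₗ[A] M) →ₗ[C.DiffOp] Ind C (Ω [⋀^Fin p]→ₗ[A] M)}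
    (hd : IsKoszul D X d) {n : ℕ} {u : C.DiffOp} (hu : u ∈ filtration C (n + 1))
    (ν : Ω [⋀^Fin p]→ₗ[A] M) :
    d (koszulHomotopy x ξ (tmul u ν)) - ∑ i, ∑ j, tmul (contract (x j) u * D i)
      (contractForm (X i) (wedgeForm (ξ j) ν)) ∈ indFil C _ n := by
  rw [koszulHomotopy_tmul, map_sum, Finset.sum_comm, ← Finset.sum_sub_distrib]
  refine sum_mem fun j _ => ?_
  have h := smul_mem_indFil (contract_mem_filtration (hx j) hu) (hd (wedgeForm (ξ j) ν))
  rw [smul_sub, ← map_smul, Induced.smul_tmul, mul_one, koszulSymbol, Finset.smul_sum] at h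
  exact h

variable (hξ : ∀ v, ∑ i, ξ i v • X i = v) (hξD : ∀ i j, ξ i (X j) = D i (x j))
  (hD : ∀ i, D i ∈ filtration C 2)

include hξ hξD hD

lemma koszulHomotopy_d_tmul_sub_mem
    {d : Ind C (Ω [⋀^Fin (p + 1)]→ₗ[A] M) →ₗ[C.DiffOp] Ind C (Ω [⋀^Fin p]→ₗ[A] M)}
    (hd : IsKoszul D X d) {n : ℕ} {u : C.DiffOp} (hu : u ∈ filtration C (n + 1))
    (ν : Ω [⋀^Fin (p + 1)]→ₗ[A] M) :
    koszulHomotopy x ξ (d (tmul u ν)) - ((∑ i, ∑ j, tmul (contract (x j) u * D i)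
      (wedgeForm (ξ j) (contractForm (X i) ν))) + (p + 1) • tmul u ν) ∈ indFil C _ n := by
  have h := koszulHomotopy_mem_indFil (ξ := ξ) hx (smul_mem_indFil hu (hd ν))
  rw [smul_sub, ← map_smul, Induced.smul_tmul, mul_one, koszulSymbol, Finset.smul_sum, map_sub,
    map_sum] at h
  have e1 : (p + 1) • tmul u ν =
      ∑ i, ∑ j, tmul (u * C.ofA (D i (x j))) (wedgeForm (ξ j) (contractForm (X i) ν)) := by
    rw [← tmul_nsmul, ← sum_wedgeForm_contractForm hξ ν, tmul_sum]
    refine Finset.sum_congr rfl fun i _ => ?_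
    rw [← sum_smul_wedgeForm hξ i, tmul_sum]
    refine Finset.sum_congr rfl fun j _ => ?_
    rw [tmul_ofA, hξD]
  have h2 := sum_mem fun i (_ : i ∈ Finset.univ) => sum_mem fun j (_ : j ∈ Finset.univ) =>
    tmul_mem_indFil (contract_mul_sub_mem_filtration hu (hD i) (hx j))
      (wedgeForm (ξ j) (contractForm (X i) ν))
  convert add_mem h h2 using 1
  rw [e1]
  simp only [sub_tmul, Finset.sum_sub_distrib, Induced.smul_tmul, koszulHomotopy_tmul]
  abel

variable (hD' : ∀ y ∈ C.J, y - ∑ i, C.s (D i y) * x i ∈ C.J ^ 2)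

include hD'

lemma sum_tmul_contract_mul_sub_mem {N : Type*} [AddCommGroup N] [Module A N] {n : ℕ}
    {u : C.DiffOp} (hu : u ∈ filtration C (n + 1)) (ν : N) :
    ∑ i, ∑ j, tmul (contract (x j) u * D i) (ξ j (X i) • ν) - n • tmul u ν ∈ indFil C N n := by
  have h1 : ∀ j, ∑ i, D i * C.ofA (D j (x i)) - D j ∈ filtration C 1 := by
    intro j y hy
    rw [pow_one] at hy
    have h2 := hD j _ (hD' y hy)
    rw [map_sub, map_sum, sub_eq_zero] at h2
    rw [sub_apply, sum_apply, h2, ← Finset.sum_sub_distrib]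
    refine Finset.sum_eq_zero fun i _ => ?_
    rw [mul_ofA, map_s, apply_t_mul_of_mem (hD i) _ (by rwa [pow_one]), mul_comm, sub_self]
  have h3 := sum_mem fun j (_ : j ∈ Finset.univ) =>
    mul_ofA_mem_filtration ((∑ i, D i * C.ofA (D j (x i)) - D j) 1)
      (contract_mem_filtration (hx j) hu)
  simp only [← eq_ofA_of_mem_filtration_one (h1 _)] at h3
  have h4 := tmul_mem_indFil (add_mem h3 (sum_contract_mul_sub_mem_filtration hx hD hD' hu)) ν
  convert h4 using 1
  simp only [mul_sub, Finset.sum_sub_distrib, sub_add_sub_cancel, Finset.mul_sum]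
  refine Eq.trans ?_ (sub_tmul (ι := C.incl.toRingHom) _ _ ν).symm
  rw [nsmul_tmul, sum_tmul, Finset.sum_comm]
  congr 1
  refine Finset.sum_congr rfl fun j _ => ?_
  rw [sum_tmul]
  refine Finset.sum_congr rfl fun i _ => ?_
  rw [← tmul_ofA, mul_assoc, hξD]

/-- The homotopy formula in degree zero. -/
lemma d_koszulHomotopy_zero_sub_mem
    {d : Ind C (Ω [⋀^Fin 1]→ₗ[A] M) →ₗ[C.DiffOp] Ind C (Ω [⋀^Fin 0]→ₗ[A] M)}
    (hd : IsKoszul D X d) {n : ℕ} {z : Ind C (Ω [⋀^Fin 0]→ₗ[A] M)}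
    (hz : z ∈ indFil C _ (n + 1)) : d (koszulHomotopy x ξ z) - n • z ∈ indFil C _ n := by
  induction hz using indFil_induction with
  | zero => simp
  | tmul u hu ν =>
    have h1 := d_koszulHomotopy_tmul_sub_mem (ξ := ξ) hx hd hu ν
    have h2 := sum_tmul_contract_mul_sub_mem hx hξ hξD hD hD' hu ν
    simp only [contractForm_wedgeForm_zero] at h1
    convert add_mem h1 h2 using 1
    abel
  | add z z' _ _ hz hz' =>
    convert add_mem hz hz' using 1
    rw [map_add, map_add, smul_add]
    abel

/-- The homotopy formula in positive degrees. -/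
lemma d_koszulHomotopy_add_sub_mem
    {d' : Ind C (Ω [⋀^Fin (p + 2)]→ₗ[A] M) →ₗ[C.DiffOp] Ind C (Ω [⋀^Fin (p + 1)]→ₗ[A] M)}
    {d : Ind C (Ω [⋀^Fin (p + 1)]→ₗ[A] M) →ₗ[C.DiffOp] Ind C (Ω [⋀^Fin p]→ₗ[A] M)}
    (hd' : IsKoszul D X d') (hd : IsKoszul D X d) {n : ℕ} {z : Ind C (Ω [⋀^Fin (p + 1)]→ₗ[A] M)}
    (hz : z ∈ indFil C _ (n + 1)) :
    d' (koszulHomotopy x ξ z) + koszulHomotopy x ξ (d z) - (n + (p + 1)) • z ∈ indFil C _ n := by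
  induction hz using indFil_induction with
  | zero => simp
  | tmul u hu ν =>
    have h1 := d_koszulHomotopy_tmul_sub_mem (ξ := ξ) hx hd' hu ν
    have h2 := sum_tmul_contract_mul_sub_mem hx hξ hξD hD hD' hu ν
    have h3 := koszulHomotopy_d_tmul_sub_mem hx hξ hξD hD hd hu ν
    simp only [← contractForm_wedgeForm, tmul_add, Finset.sum_add_distrib] at h2
    convert add_mem (add_mem h1 h3) h2 using 1
    rw [add_smul]
    abel
  | add z z' _ _ hz hz' =>
    convert add_mem hz hz' using 1
    simp only [map_add, smul_add]
    abel

end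

end DiffOp

end FormalCategory

namespace FormalCategory

variable {A F : Type u} [CommRing A] [Algebra ℂ A] [CommRing F] [Algebra ℂ F]
  {C : FormalCategory A F}

namespace DiffOp

open Induced

variable {m : ℕ} {x : Fin m → F} {D : Fin m → C.DiffOp} {Ω M : Type u} [AddCommGroup Ω] [Module A Ω]
  [AddCommGroup M] [Module A M] {X : Fin m → Ω} {ξ : Fin m → Ω →ₗ[A] A} {p : ℕ}

/-- The properties of the cycles of degree `p` of the Koszul complex that allow to construct the
next differential. -/
structure IsKoszulCycles (x : Fin m → F) (D : Fin m → C.DiffOp) (X : Fin m → Ω)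
    (ξ : Fin m → Ω →ₗ[A] A)
    (Z : Submodule C.DiffOp (Ind C (Ω [⋀^Fin p]→ₗ[A] M))) : Prop where
  eq_zero : ∀ z ∈ Z, z ∈ indFil C _ 1 → z = 0
  exists_symbol : ∀ ν : Ω [⋀^Fin (p + 1)]→ₗ[A] M, ∃ z ∈ Z, z - koszulSymbol D X ν ∈ indFil C _ 1
  homotopy : ∀ {d : Ind C (Ω [⋀^Fin (p + 1)]→ₗ[A] M) →ₗ[C.DiffOp] Ind C (Ω [⋀^Fin p]→ₗ[A] M)},
    IsKoszul D X d → ∀ n : ℕ, ∀ z ∈ Z, z ∈ indFil C _ (n + 1) →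
      d (koszulHomotopy x ξ z) - (n + p) • z ∈ indFil C _ n

variable (hx : ∀ i, x i ∈ C.J) (hξ : ∀ v, ∑ i, ξ i v • X i = v)
  (hξD : ∀ i j, ξ i (X j) = D i (x j)) (hD : ∀ i, D i ∈ filtration C 2)
  (hD' : ∀ y ∈ C.J, y - ∑ i, C.s (D i y) * x i ∈ C.J ^ 2)

include hx in
/-- The next differential maps onto the cycles, with control of the filtrations. -/
lemma IsKoszulCycles.exists_eq {Z : Submodule C.DiffOp (Ind C (Ω [⋀^Fin p]→ₗ[A] M))}
    (hZ : IsKoszulCycles x D X ξ Z)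
    {d : Ind C (Ω [⋀^Fin (p + 1)]→ₗ[A] M) →ₗ[C.DiffOp] Ind C (Ω [⋀^Fin p]→ₗ[A] M)}
    (hd : IsKoszul D X d) (hdZ : ∀ y, d y ∈ Z) (n : ℕ) :
    ∀ z ∈ Z, z ∈ indFil C _ (n + 1) → ∃ y ∈ indFil C _ n, d y = z := by
  induction n with
  | zero => exact fun z hz hz' => ⟨0, zero_mem _, by rw [map_zero, hZ.eq_zero z hz hz']⟩
  | succ n ih =>
    intro z hz hz'
    obtain ⟨y, hy, hy'⟩ := ih (d (koszulHomotopy x ξ z) - (n + 1 + p) • z)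
      (sub_mem (hdZ _) (Z.smul_of_tower_mem _ hz)) (by exact_mod_cast hZ.homotopy hd (n + 1) z hz hz')
    refine ⟨C.ofA (algebraMap ℂ A ((n + 1 + p : ℕ) : ℂ)⁻¹) • (koszulHomotopy x ξ z - y),
      ofA_smul_mem_indFil _ (sub_mem (koszulHomotopy_mem_indFil hx hz') (indFil_mono n.le_succ hy)),
      ?_⟩
    rw [map_smul, map_sub, hy', sub_sub_cancel]
    exact ofA_inv_smul (by omega) z

include hD in
/-- The leading term of the Koszul differential has square zero: second order operators commute up to
first order ones, while contractions of alternating forms anticommute. -/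
lemma sum_smul_koszulSymbol_mem (ν : Ω [⋀^Fin (p + 2)]→ₗ[A] M) :
    ∑ i, D i • koszulSymbol D X (contractForm (X i) ν) ∈ indFil C _ 2 := by
  have h1 : ∀ i, D i • koszulSymbol D X (contractForm (X i) ν) =
      ∑ j, tmul (D i * D j) (contractForm (X j) (contractForm (X i) ν)) := fun i => by
    rw [koszulSymbol, Finset.smul_sum]
    rfl
  simp only [h1]
  set S := ∑ i, ∑ j, tmul (D i * D j) (contractForm (X j) (contractForm (X i) ν)) with hS
  have h2 : 2 • S ∈ indFil C _ 2 := by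
    have h3 : S = -∑ i, ∑ j, tmul (D j * D i) (contractForm (X j) (contractForm (X i) ν)) := by
      rw [hS, Finset.sum_comm, ← Finset.sum_neg_distrib]
      refine Finset.sum_congr rfl fun i _ => ?_
      rw [← Finset.sum_neg_distrib]
      refine Finset.sum_congr rfl fun j _ => ?_
      rw [contractForm_contractForm (X j)]
      exact ((map_neg (tmulRight _) _).symm.trans (by rw [neg_neg]; rfl)).symm
    rw [two_smul]
    nth_rw 2 [h3]
    rw [hS, ← sub_eq_add_neg, ← Finset.sum_sub_distrib]
    refine sum_mem fun i _ => ?_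
    rw [← Finset.sum_sub_distrib]
    refine sum_mem fun j _ => ?_
    rw [← sub_tmul]
    exact tmul_mem_indFil (commutator_mem_filtration (hD i) (hD j)) _
  rw [← ofA_inv_smul (C := C) two_ne_zero S]
  exact ofA_smul_mem_indFil _ h2

include hx hξ hξD hD hD'

/-- One step of the construction of the Koszul complex. -/
lemma IsKoszulCycles.exists_next [Module.Projective A M]
    {Z : Submodule C.DiffOp (Ind C (Ω [⋀^Fin p]→ₗ[A] M))} (hZ : IsKoszulCycles x D X ξ Z) :
    ∃ d : Ind C (Ω [⋀^Fin (p + 1)]→ₗ[A] M) →ₗ[C.DiffOp] Ind C (Ω [⋀^Fin p]→ₗ[A] M),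
      LinearMap.range d = Z ∧ IsKoszulCycles x D X ξ (LinearMap.ker d) := by
  have := projective_forms (M := M) hξ (p + 1)
  obtain ⟨d, hd⟩ := Induced.exists_lift (ι := C.incl.toRingHom) (G := Z.toAddSubgroup)
    (H := indFil C _ 1) (fun a z hz => Z.smul_mem _ hz) (fun a z hz => ofA_smul_mem_indFil a hz)
    (koszulSymbol (M := M) (p := p) D X)
    (fun ν ν' => by rw [koszulSymbol_add, sub_self]; exact zero_mem _)
    (smul_koszulSymbol_sub_mem_indFil hD) hZ.exists_symbol
  have hd' : IsKoszul D X d := fun ν => (hd ν).2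
  have hdZ : ∀ y, d y ∈ Z := fun y => by
    induction y using Induced.induction with
    | zero => rw [map_zero]; exact zero_mem _
    | tmul u ν =>
      rw [← mul_one u, ← Induced.smul_tmul, map_smul]
      exact Z.smul_mem _ (hd ν).1
    | add y y' h h' => rw [map_add]; exact add_mem h h'
  refine ⟨d, le_antisymm (fun _ ⟨y, hy⟩ => hy ▸ hdZ y) fun z hz => ?_, ?_, fun ν => ?_, ?_⟩
  · obtain ⟨n, hn⟩ := exists_mem_indFil z
    obtain ⟨y, -, hy⟩ := hZ.exists_eq hx hd' hdZ n z hz (indFil_mono n.le_succ hn)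
    exact ⟨y, hy⟩
  · intro z hz hz'
    obtain ⟨ν, rfl⟩ := exists_of_mem_indFil_one hz'
    have h1 := eq_zero_of_mem_indFil_zero
      (koszulHomotopy_d_tmul_sub_mem (n := 0) hx hξ hξD hD hd' (ofA_mem_filtration 1) ν)
    have h2 : ∀ j, contract (x j) (C.ofA 1) = 0 := fun j =>
      eq_zero_of_mem_filtration_zero (contract_mem_filtration (hx j) (ofA_mem_filtration 1))
    have h3 : d (tmul (C.ofA 1) ν) = 0 := hz
    simp only [h2, h3, zero_mul, map_zero] at h1
    have h4 : ∀ N : Type u, ∀ _ : AddCommGroup N, ∀ _ : Module A N, ∀ n : N,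
        tmul (0 : C.DiffOp) n = 0 := fun N _ _ n => (tmulLeft n).map_zero
    simp only [h4, Finset.sum_const_zero, zero_add, zero_sub, neg_eq_zero] at h1
    rw [← ofA_inv_smul (C := C) p.succ_ne_zero (tmul 1 ν)]
    exact (congrArg _ h1).trans (smul_zero _)
  · have h1 : d (koszulSymbol D X ν) ∈ indFil C _ 2 := by
      have h2 : d (koszulSymbol D X ν) - ∑ i, D i • koszulSymbol D X (contractForm (X i) ν) ∈
          indFil C _ 2 := by
        rw [koszulSymbol, map_sum, ← Finset.sum_sub_distrib]
        refine sum_mem fun i _ => ?_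
        have h3 := smul_mem_indFil (hD i) (hd' (contractForm (X i) ν))
        rwa [smul_sub, ← map_smul, Induced.smul_tmul, mul_one] at h3
      simpa only [sub_add_cancel] using add_mem h2 (sum_smul_koszulSymbol_mem (X := X) hD ν)
    obtain ⟨y, hy, hy'⟩ := hZ.exists_eq hx hd' hdZ 1 _ (hdZ _) h1
    refine ⟨koszulSymbol D X ν - y, ?_, ?_⟩
    · rw [LinearMap.mem_ker, map_sub, hy', sub_self]
    · rw [sub_sub_cancel_left]
      exact neg_mem hy
  · intro d' hd'' n z hz hz'
    have h1 := d_koszulHomotopy_add_sub_mem hx hξ hξD hD hD' hd'' hd' hz'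
    rwa [LinearMap.mem_ker.1 hz, map_zero, add_zero] at h1

variable [Module C.DiffOp M] (hM : ∀ (a : A) (z : M), a • z = C.ofA a • z)

omit hx hξ hξD hD hD' in
include hM in
lemma exists_augmentation : ∃ d : Ind C (Ω [⋀^Fin 0]→ₗ[A] M) →ₗ[C.DiffOp] M,
    ∀ u ν, d (tmul u ν) = u • ν 0 :=
  ⟨Induced.lift (⟨⟨fun ν => ν 0, rfl⟩, fun _ _ => rfl⟩ : Ω [⋀^Fin 0]→ₗ[A] M →+ M)
    fun a ν => hM a (ν 0), fun _ _ => rfl⟩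

/-- The first step of the Koszul resolution: the kernel of the action `L ⊗ M → M`. -/
lemma isKoszulCycles_zero {d : Ind C (Ω [⋀^Fin 0]→ₗ[A] M) →ₗ[C.DiffOp] M}
    (hd : ∀ u ν, d (tmul u ν) = u • ν 0) : IsKoszulCycles x D X ξ (LinearMap.ker d) := by
  refine ⟨fun z hz hz' => ?_, fun ν => ?_, fun hd' n z hz hz' => ?_⟩
  · obtain ⟨ν, rfl⟩ := exists_of_mem_indFil_one hz'
    rw [LinearMap.mem_ker, hd, one_smul] at hz
    have : ν = 0 := by
      ext v
      rw [Subsingleton.elim v 0, hz]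
      rfl
    rw [this]
    exact (tmulRight 1).map_zero
  · let μ : Ω [⋀^Fin 0]→ₗ[A] M := AlternatingMap.constOfIsEmpty A Ω (Fin 0) (d (koszulSymbol D X ν))
    refine ⟨koszulSymbol D X ν - tmul 1 μ, ?_, ?_⟩
    · rw [LinearMap.mem_ker, map_sub, hd, one_smul]
      exact sub_self _
    · rw [sub_sub_cancel_left]
      exact neg_mem (tmul_mem_indFil (ofA_mem_filtration 1) μ)
  · exact d_koszulHomotopy_zero_sub_mem hx hξ hξD hD hD' hd' hz'

end DiffOp

end FormalCategory

section ProjectiveDimension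

variable {R : Type u} [Ring R] {P M : Type u} [AddCommGroup P] [Module R P] [AddCommGroup M]
  [Module R M] [Module.Projective R P] {f : P →ₗ[R] M} (hf : Function.Surjective f) {n : ℕ}

include hf

omit [Module.Projective R P] in
lemma shortExact_ker : (ShortComplex.mk (X₁ := ModuleCat.of R (LinearMap.ker f))
    (X₂ := ModuleCat.of R P) (X₃ := ModuleCat.of R M) (ModuleCat.ofHom (LinearMap.ker f).subtype)
    (ModuleCat.ofHom f) (ModuleCat.hom_ext (LinearMap.ext fun x => x.2))).ShortExact :=
  { exact := (ShortComplex.moduleCat_exact_iff _).2 fun x hx => ⟨⟨x, hx⟩, rfl⟩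
    mono_f := (ModuleCat.mono_iff_injective _).2 Subtype.val_injective
    epi_g := (ModuleCat.epi_iff_surjective _).2 hf }

lemma hasProjectiveDimensionLT_succ_of_ker
    (h : HasProjectiveDimensionLT (ModuleCat.of R (LinearMap.ker f)) n) :
    HasProjectiveDimensionLT (ModuleCat.of R M) (n + 1) := by
  have : Projective (ModuleCat.of R P) := (IsProjective.iff_projective (R := R) P).1 inferInstance
  have : HasProjectiveDimensionLT (ModuleCat.of R P) (n + 1) := by
    rw [add_comm]
    infer_instance
  exact (shortExact_ker hf).hasProjectiveDimensionLT_X₃ n h this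

/-- The kernel of a surjection from a projective module has smaller projective dimension. -/
lemma hasProjectiveDimensionLT_ker (h : HasProjectiveDimensionLT (ModuleCat.of R M) (n + 2)) :
    HasProjectiveDimensionLT (ModuleCat.of R (LinearMap.ker f)) (n + 1) := by
  have : Projective (ModuleCat.of R P) := (IsProjective.iff_projective (R := R) P).1 inferInstance
  have : HasProjectiveDimensionLT (ModuleCat.of R P) (n + 1) := by
    rw [add_comm]
    infer_instance
  exact (shortExact_ker hf).hasProjectiveDimensionLT_X₁ (n + 1) this h

end ProjectiveDimension

namespace FormalCategory

variable {A F : Type u} [CommRing A] [Algebra ℂ A] [CommRing F] [Algebra ℂ F]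
  {C : FormalCategory A F}

namespace DiffOp

variable {m : ℕ} {x : Fin m → F} {D : Fin m → C.DiffOp} {Ω M : Type u} [AddCommGroup Ω] [Module A Ω]
  [AddCommGroup M] [Module A M] {X : Fin m → Ω} {ξ : Fin m → Ω →ₗ[A] A}

variable (hx : ∀ i, x i ∈ C.J) (hξ : ∀ v, ∑ i, ξ i v • X i = v)
  (hξD : ∀ i j, ξ i (X j) = D i (x j)) (hD : ∀ i, D i ∈ filtration C 2)
  (hD' : ∀ y ∈ C.J, y - ∑ i, C.s (D i y) * x i ∈ C.J ^ 2) [Module.Projective A M]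

include hx hξ hξD hD hD'

lemma IsKoszulCycles.hasProjectiveDimensionLT (k : ℕ) : ∀ {p : ℕ}
    {Z : Submodule C.DiffOp (Ind C (Ω [⋀^Fin p]→ₗ[A] M))} (_ : IsKoszulCycles x D X ξ Z)
    (_ : m ≤ p + k), HasProjectiveDimensionLT (ModuleCat.of C.DiffOp Z) k := by
  induction k with
  | zero =>
    intro p Z hZ hp
    obtain ⟨d, hd, -⟩ := hZ.exists_next hx hξ hξD hD hD'
    have hs := subsingleton_forms (M := M) (p := p + 1) hξ (by omega)
    have h0 : ∀ y : Ind C (Ω [⋀^Fin (p + 1)]→ₗ[A] M), y = 0 := fun y => by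
      induction y using Induced.induction with
      | zero => rfl
      | tmul u ν =>
        rw [Subsingleton.elim ν 0]
        exact (Induced.tmulRight u).map_zero
      | add y y' h h' => rw [h, h', add_zero]
    rw [hasProjectiveDimensionLT_zero_iff_isZero]
    have : Subsingleton Z := subsingleton_of_forall_eq 0 fun ⟨z, hz⟩ => Subtype.ext (by
      rw [← hd] at hz
      obtain ⟨y, hy⟩ := hz
      exact hy.symm.trans (by rw [h0 y, map_zero]; rfl))
    exact ModuleCat.isZero_of_subsingleton _
  | succ k ih =>
    intro p Z hZ hp
    obtain ⟨d, hd, hd'⟩ := hZ.exists_next hx hξ hξD hD hD'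
    have := projective_forms (M := M) hξ (p + 1)
    have : Module.Projective C.DiffOp (Ind C (Ω [⋀^Fin (p + 1)]→ₗ[A] M)) := Induced.projective
    subst hd
    have h1 := ih hd' (by omega)
    rw [← LinearMap.ker_rangeRestrict d] at h1
    exact hasProjectiveDimensionLT_succ_of_ker d.surjective_rangeRestrict h1

end DiffOp

/-- The `L`-modules that are projective over `A` have bounded projective dimension. After as many
steps of the Koszul resolution as there are coordinates, the alternating forms vanish, and so do the
cycles. -/
lemma exists_hasProjectiveDimensionLT (hC : C.IsSmoothType) : ∃ m : ℕ, ∀ M : ModuleCat.{u} C.DiffOp,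
    Module.Projective A ((ModuleCat.restrictScalars C.incl.toRingHom).obj M) →
      HasProjectiveDimensionLT M (m + 1) := by
  obtain ⟨m, x, D, hx, hD, hD'⟩ := DiffOp.exists_dual_coordinates hC
  refine ⟨m, fun M hM => ?_⟩
  -- the module of cotangent vectors is realized by the coordinates of its elements
  let Ω : Submodule A (Fin m → A) := Submodule.span A (Set.range fun j i => D i (x j))
  let X : Fin m → Ω := fun j => ⟨fun i => D i (x j), Submodule.subset_span ⟨j, rfl⟩⟩
  let ξ : Fin m → Ω →ₗ[A] A := fun i => LinearMap.proj i ∘ₗ Ω.subtype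
  have hξ : ∀ v, ∑ i, ξ i v • X i = v := by
    intro v
    let f : (Fin m → A) →ₗ[A] (Fin m → A) :=
      ∑ i, (LinearMap.proj i).smulRight (X i : Fin m → A)
    have hf : ∀ v, f v = ∑ i, v i • (X i : Fin m → A) := fun v => by
      simp only [f, LinearMap.sum_apply, LinearMap.smulRight_apply, LinearMap.proj_apply]
    have h1 : Set.EqOn f (LinearMap.id : (Fin m → A) →ₗ[A] (Fin m → A))
        (Set.range fun j i => D i (x j)) := by
      rintro _ ⟨j, rfl⟩
      rw [hf]
      ext k
      have h2 := hD k _ (hD' (x j) (hx j))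
      rw [map_sub, map_sum, sub_eq_zero] at h2
      rw [LinearMap.id_apply, Finset.sum_apply]
      refine Eq.trans ?_ h2.symm
      exact Finset.sum_congr rfl fun i _ => ((D k).map_s _ _).symm
    refine Subtype.ext ?_
    rw [Submodule.coe_sum]
    exact (hf v).symm.trans (LinearMap.eqOn_span h1 v.2)
  let _ : Module A M := Module.compHom M C.incl.toRingHom
  have hM' : Module.Projective A M := hM
  obtain ⟨d, hd⟩ := DiffOp.exists_augmentation (C := C) (Ω := Ω) (M := M) fun a z => rfl
  have hZ := DiffOp.isKoszulCycles_zero (X := X) (ξ := ξ) hx hξ (fun _ _ => rfl) hD hD' hd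
  have h1 := hZ.hasProjectiveDimensionLT hx hξ (fun _ _ => rfl) hD hD' m (by omega)
  have := projective_forms (M := M) hξ 0
  have : Module.Projective C.DiffOp (DiffOp.Ind C (Ω [⋀^Fin 0]→ₗ[A] M)) := Induced.projective
  refine hasProjectiveDimensionLT_succ_of_ker (f := d) (fun z => ?_) h1
  refine ⟨DiffOp.tmul 1 (AlternatingMap.constOfIsEmpty A Ω (Fin 0) z), ?_⟩
  rw [hd, one_smul]
  rfl

end FormalCategory

namespace FormalCategory

variable {A F : Type u} [CommRing A] [Algebra ℂ A] [CommRing F] [Algebra ℂ F]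
  {C : FormalCategory A F}

/-- Locally free `L`-modules are projective: modules with charts of countable rank have finite
projective dimension, as they are projective over `A`. -/
theorem projective_of_isLocallyFreeOver (hC : C.IsSmoothType) {M : ModuleCat.{u} C.DiffOp}
    (hM : IsLocallyFreeOver C.incl.toRingHom M) : Module.Projective C.DiffOp M := by
  obtain ⟨m, hm⟩ := exists_hasProjectiveDimensionLT hC
  obtain ⟨K, _, f, I, h, hf, hh⟩ := hM.exists_charts (DiffOp.isAdNilpotent_incl C)
  refine projective_of_charts (DiffOp.isAdNilpotent_incl C) hf (fun {Q} _ _ _ _ _ hh' => ?_) hh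
  exact projective_of_countable_charts (DiffOp.isAdNilpotent_incl C) hf m hh'
    (hm (.of _ Q) (projective_of_isLocallyFreeOver_id
      (isLocallyFreeOver_restrictScalars_of_charts hC (M := .of _ Q) hf hh')))

end FormalCategory

/-! ### Chain maps with a lifting property -/

section

variable {R : Type u} [Ring R] {K Y : CochainComplex (ModuleCat.{u} R) ℤ}

/-- The lifting property in degree `i`: if the image under `φ` of a cycle `z` of degree `i + 1` is
the boundary of `y`, then `z` is the boundary of some `x` with `φ x = y`. This implies that the
mapping cone of `φ` is exact in degree `i`. -/
def LiftsAt (φ : K ⟶ Y) (i : ℤ) : Prop :=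
  ∀ (z : K.X (i + 1)) (y : Y.X i), (K.d (i + 1) (i + 2)).hom z = 0 →
    (φ.f (i + 1)).hom z = (Y.d i (i + 1)).hom y →
      ∃ x : K.X i, (K.d i (i + 1)).hom x = z ∧ (φ.f i).hom x = y

/-- A cycle of the mapping cone of `φ` that has degree `i`, up to a sign. -/
def coneCycles (φ : K ⟶ Y) (i : ℤ) : Submodule R (K.X (i + 1) × Y.X i) :=
  LinearMap.ker ((K.d (i + 1) (i + 2)).hom ∘ₗ LinearMap.fst R _ _) ⊓
    LinearMap.ker ((φ.f (i + 1)).hom ∘ₗ LinearMap.fst R _ _ -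
      (Y.d i (i + 1)).hom ∘ₗ LinearMap.snd R _ _)

lemma mem_coneCycles {φ : K ⟶ Y} {i : ℤ} {x : K.X (i + 1) × Y.X i} : x ∈ coneCycles φ i ↔
    (K.d (i + 1) (i + 2)).hom x.1 = 0 ∧ (φ.f (i + 1)).hom x.1 = (Y.d i (i + 1)).hom x.2 := by
  rw [coneCycles, Submodule.mem_inf, LinearMap.mem_ker, LinearMap.mem_ker, LinearMap.sub_apply,
    sub_eq_zero]
  rfl

lemma hom_d_d (i j l : ℤ) (x : K.X i) : (K.d j l).hom ((K.d i j).hom x) = 0 :=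
  DFunLike.congr_fun (ModuleCat.hom_ext_iff.1 (K.d_comp_d i j l)) x

lemma hom_f_d (φ : K ⟶ Y) (i j : ℤ) (x : K.X i) :
    (φ.f j).hom ((K.d i j).hom x) = (Y.d i j).hom ((φ.f i).hom x) :=
  (DFunLike.congr_fun (ModuleCat.hom_ext_iff.1 (φ.comm i j)) x).symm

/-- The cycles in degree `i` are the kernel of the surjection from `K.X (i + 1) × Y.X i` to the cycles
in degree `i + 1`, which splits if the latter are projective. -/
lemma projective_coneCycles_step {φ : K ⟶ Y} {i j : ℤ} (hij : i + 1 = j) (hφ : LiftsAt φ j)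
    [Module.Projective R (K.X j)] [Module.Projective R (Y.X i)]
    [Module.Projective R (coneCycles φ j)] : Module.Projective R (coneCycles φ i) := by
  subst hij
  let T : K.X (i + 1) × Y.X i →ₗ[R] coneCycles φ (i + 1) := LinearMap.codRestrict _
    (LinearMap.prod ((K.d (i + 1) (i + 1 + 1)).hom ∘ₗ LinearMap.fst R _ _)
      ((φ.f (i + 1)).hom ∘ₗ LinearMap.fst R _ _ - (Y.d i (i + 1)).hom ∘ₗ LinearMap.snd R _ _))
    fun x => by
      refine mem_coneCycles.2 ⟨hom_d_d _ _ _ _, ?_⟩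
      change _ = (Y.d _ _).hom ((φ.f (i + 1)).hom x.1 - (Y.d i (i + 1)).hom x.2)
      rw [map_sub, hom_d_d, sub_zero]
      exact hom_f_d φ _ _ _
  have hT : Function.Surjective T := by
    rintro ⟨⟨z, y⟩, hzy⟩
    obtain ⟨h₁, h₂⟩ := mem_coneCycles.1 hzy
    obtain ⟨x, hx, hx'⟩ := hφ z y h₁ h₂
    refine ⟨(x, 0), Subtype.ext (Prod.ext hx ?_)⟩
    change (φ.f (i + 1)).hom x - (Y.d i (i + 1)).hom 0 = y
    rw [map_zero, sub_zero, hx']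
  have hk : LinearMap.ker T = coneCycles φ i := by
    ext x
    rw [LinearMap.mem_ker, mem_coneCycles, ← Subtype.val_inj]
    have e : i + 1 + 1 = i + 2 := by ring
    refine Prod.ext_iff.trans (and_congr ?_ sub_eq_zero)
    change (K.d (i + 1) (i + 1 + 1)).hom x.1 = 0 ↔ _
    rw [e]
  obtain ⟨s, hs⟩ := Module.projective_lifting_property T LinearMap.id hT
  rw [← hk]
  refine .of_split (LinearMap.ker T).subtype (LinearMap.codRestrict _ (LinearMap.id - s ∘ₗ T)
    fun x => ?_) ?_
  · rw [LinearMap.mem_ker, LinearMap.sub_apply, map_sub]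
    exact sub_eq_zero.2 (DFunLike.congr_fun hs (T x)).symm
  · ext1 x
    refine Subtype.ext ?_
    change x.1 - s (T x.1) = x.1
    rw [LinearMap.mem_ker.1 x.2, map_zero, sub_zero]

/-- If the mapping cone of `φ` is exact above some degree, and if it is bounded above and consists
of projective modules, then its modules of cycles are projective. -/
lemma projective_coneCycles {φ : K ⟶ Y} (b : ℤ) (hK : ∀ i, b < i → Subsingleton (K.X i))
    (hY : ∀ i, b < i → Subsingleton (Y.X i)) (hK' : ∀ i, Module.Projective R (K.X i))
    (hY' : ∀ i, Module.Projective R (Y.X i)) (n : ℤ) (hφ : ∀ i, n < i → LiftsAt φ i) :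
    Module.Projective R (coneCycles φ n) := by
  have key : ∀ (r : ℕ) (i : ℤ), n ≤ i → b < i + r → Module.Projective R (coneCycles φ i) := by
    intro r
    induction r with
    | zero =>
      intro i _ hi
      have := hK (i + 1) (by simp at hi; omega)
      have := hY i (by simpa using hi)
      have : Subsingleton (coneCycles φ i) := inferInstance
      infer_instance
    | succ r ih =>
      intro i hni hi
      have := ih (i + 1) (by omega) (by push_cast at hi; omega)
      exact projective_coneCycles_step rfl (hφ _ (by omega))
  exact key (b + 1 - n).toNat n le_rfl (by omega)

lemma quasiIso_of_liftsAt {φ : K ⟶ Y} (hφ : ∀ i, LiftsAt φ i) : QuasiIso φ := by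
  -- maps from a free module that covers the given one can be lifted on the generators
  have lift : ∀ {A Q : ModuleCat.{u} R} (p : A → Q → Prop), (∀ a, ∃ q, p a q) →
      ∃ c : (A →₀ R) →ₗ[R] Q, ∀ a, p a (c (Finsupp.single a 1)) := fun p hp => by
    choose c hc using hp
    exact ⟨Finsupp.linearCombination R c, fun a => by simpa using hc a⟩
  have epi : ∀ A : ModuleCat.{u} R, Epi (ModuleCat.ofHom (X := (A →₀ R)) (Y := A)
      (Finsupp.linearCombination R (id : A → A))) := fun A =>
    (ModuleCat.epi_iff_surjective _).2 fun a => ⟨Finsupp.single a 1, by simp⟩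
  refine ⟨fun j => ?_⟩
  obtain ⟨i, rfl⟩ : ∃ i, j = i + 1 := ⟨j - 1, by ring⟩
  rw [quasiIsoAt_iff_isIso_homologyMap]
  have : Mono (HomologicalComplex.homologyMap φ (i + 1)) := by
    rw [HomologicalComplex.mono_homologyMap_iff_up_to_refinements φ i (i + 1) (i + 2) (by simp)
      (by simp; ring)]
    intro A x₂ h₂ y₁ h₁
    obtain ⟨c, hc⟩ := lift (fun a x => (K.d i (i + 1)).hom x = x₂.hom a) fun a => by
      obtain ⟨x, hx, -⟩ := hφ i (x₂.hom a) (y₁.hom a)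
        (DFunLike.congr_fun (ModuleCat.hom_ext_iff.1 h₂) a)
        (DFunLike.congr_fun (ModuleCat.hom_ext_iff.1 h₁) a)
      exact ⟨x, hx⟩
    refine ⟨_, _, epi A, ModuleCat.ofHom c, ModuleCat.hom_ext (Finsupp.lhom_ext' fun a =>
      LinearMap.ext_ring ?_)⟩
    simpa using (hc a).symm
  have : Epi (HomologicalComplex.homologyMap φ (i + 1)) := by
    rw [HomologicalComplex.epi_homologyMap_iff_up_to_refinements φ i (i + 1) (i + 2) (by simp)
      (by simp; ring)]
    intro A y₂ h₂
    have h₃ := fun a => DFunLike.congr_fun (ModuleCat.hom_ext_iff.1 h₂) a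
    have e : i + 1 + 1 = i + 2 := by ring
    obtain ⟨c, hc⟩ := lift (fun a x => (K.d (i + 1) (i + 2)).hom x = 0 ∧
        (φ.f (i + 1)).hom x = y₂.hom a) fun a => by
      have := hφ (i + 1) 0 (y₂.hom a) (map_zero _) (by
        rw [map_zero]
        refine Eq.symm ?_
        rw [e]
        exact h₃ a)
      rwa [e] at this
    refine ⟨_, _, epi A, ModuleCat.ofHom c, ModuleCat.hom_ext (Finsupp.lhom_ext' fun a =>
      LinearMap.ext_ring ?_), 0, ModuleCat.hom_ext (Finsupp.lhom_ext' fun a =>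
      LinearMap.ext_ring ?_)⟩
    · simpa using (hc a).1
    · simpa using (hc a).2.symm
  exact isIso_of_mono_of_epi _

lemma isStrictlyLE_of_subsingleton {b : ℤ} (hK : ∀ i, b < i → Subsingleton (K.X i)) :
    K.IsStrictlyLE b :=
  (CochainComplex.isStrictlyLE_iff K b).2 fun i hi => by
    have := hK i hi
    exact ModuleCat.isZero_of_subsingleton _

/-- A chain map with the lifting property in all degrees, between complexes of projective modules
that are bounded above, is a homotopy equivalence. -/
lemma exists_homotopyEquiv_of_liftsAt {φ : K ⟶ Y} (b : ℤ)
    (hK : ∀ i, b < i → Subsingleton (K.X i)) (hY : ∀ i, b < i → Subsingleton (Y.X i))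
    (hK' : ∀ i, Module.Projective R (K.X i)) (hY' : ∀ i, Module.Projective R (Y.X i))
    (hφ : ∀ i, LiftsAt φ i) : ∃ e : HomotopyEquiv K Y, e.hom = φ := by
  have := isStrictlyLE_of_subsingleton hK
  have := isStrictlyLE_of_subsingleton hY
  have : ∀ i, Projective (K.X i) := fun i => (IsProjective.iff_projective (R := R) (K.X i)).1 (hK' i)
  have : ∀ i, Projective (Y.X i) := fun i => (IsProjective.iff_projective (R := R) (Y.X i)).1 (hY' i)
  have := CochainComplex.isKProjective_of_projective K b
  have := CochainComplex.isKProjective_of_projective Y b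
  exact (CochainComplex.IsKProjective.quasiIso_iff φ).1 (quasiIso_of_liftsAt hφ)

lemma isInnerEquivalence_ofHom {k : Type w} [Field k] [Algebra k R] (e : HomotopyEquiv K Y) :
    (dgCpx.{w, u, u} k R).IsInnerEquivalence (x := K) (y := Y) (Cochain.ofHom e.hom) := by
  have key : ∀ {K Y : CochainComplex (ModuleCat.{u} R) ℤ} {f : K ⟶ Y} {g : Y ⟶ K},
      Homotopy (f ≫ g) (𝟙 K) → ∃ h : Cochain K K (-1),
        (Cochain.ofHom f).comp (Cochain.ofHom g) (add_zero 0) - Cochain.ofHom (𝟙 K) =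
          δ (-1) 0 h := fun h => ⟨Cochain.ofHomotopy h, by
    rw [δ_ofHomotopy, Cochain.ofHom_comp]⟩
  exact ⟨δ_ofHom _, Cochain.ofHom e.inv, δ_ofHom _, key e.homotopyHomInvId, key e.homotopyInvHomId⟩

end

/-- Perfection is invariant under homotopy equivalences. -/
lemma IsPerfectCpx.of_homotopyEquiv {A : Type u} [CommRing A]
    {K Y : CochainComplex (ModuleCat.{u} A) ℤ} (e : HomotopyEquiv K Y) (h : IsPerfectCpx K) :
    IsPerfectCpx Y := by
  obtain ⟨S, hS, h⟩ := h
  refine ⟨S, hS, fun f hf => ?_⟩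
  obtain ⟨P, Z, p, q, hP, hp, hq⟩ := h f hf
  let e' := (ModuleCat.localizedModuleFunctor (Submonoid.powers f)).mapHomotopyEquiv e
  have : QuasiIso e'.hom := inferInstance
  exact ⟨P, Z, p, q ≫ e'.hom, hP, hp, inferInstance⟩

/-! ### Resolutions of weak complexes -/

section

variable {k : Type w} [Field k] {A L : Type u} [CommRing A] [Algebra k A] [Ring L] [Algebra k L]
  {ι : A →ₐ[k] L}

open WordCochain

/-- The morphism of complexes of `A`-modules that underlies a closed weak morphism of degree `0`. -/
noncomputable def underlyingMap {X Y : (wpx.{w, v, u} ι).Obj} (f : (wpx.{w, v, u} ι).Hom X Y 0)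
    (hf : (wpx.{w, v, u} ι).d 0 1 rfl f = 0) :
    Quiver.Hom (V := CochainComplex (ModuleCat.{v} A) ℤ) X.1 Y.1 :=
  Cocycle.homOf (Cocycle.mk (weakHomProj ι X.1 Y.1 0 f) 1 rfl
    (((wpxProj ι).map_d 0 1 rfl f).symm.trans
      ((congrArg ((wpxProj ι).map 1) hf).trans (map_zero _))))

lemma ofHom_underlyingMap {X Y : (wpx.{w, v, u} ι).Obj} (f : (wpx.{w, v, u} ι).Hom X Y 0)
    (hf : (wpx.{w, v, u} ι).d 0 1 rfl f = 0) :
    Cochain.ofHom (underlyingMap f hf) = weakHomProj ι X.1 Y.1 0 f :=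
  Cocycle.cochain_ofHom_homOf_eq_coe _

variable {P : CochainComplex (ModuleCat.{u} L) ℤ} {Y : (wpx.{w, u, u} ι).Obj}

/-- A partial resolution of the weak complex `Y`: a complex of free `L`-modules, concentrated in the
degrees from `n` to `b`, with a closed weak morphism to `Y` that has the lifting property in the
degrees from `m` on. -/
structure IsPartialResolution (f : (wpx.{w, u, u} ι).Hom (weakifyObj ι P) Y 0) (n m b : ℤ) :
    Prop where
  closed : (wpx.{w, u, u} ι).d 0 1 rfl f = 0
  free : ∀ i, Module.Free L (P.X i)
  below : ∀ i, i < n → Subsingleton (P.X i)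
  above : ∀ i, b < i → Subsingleton (P.X i)
  lifts : ∀ i, m ≤ i → ∀ (z : P.X (i + 1)) (y : (toBase k Y.1).X i),
    (P.d (i + 1) (i + 2)).hom z = 0 →
    emptyWord f (i + 1) z = ((toBase k Y.1).d i (i + 1)).hom y →
    ∃ x : P.X i, (P.d i (i + 1)).hom x = z ∧ emptyWord f i x = y

/-- A free module with a compatible map to `Y` on its basis can be attached to a partial resolution in
a degree `q ≤ m`; the lifting property is preserved, as the terms above degree `q` do not change. -/
lemma IsPartialResolution.attach {f : (wpx.{w, u, u} ι).Hom (weakifyObj ι P) Y 0} {n m b : ℤ}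
    (H : IsPartialResolution f n m b) {q n' : ℤ} (hn : n' ≤ n) (hq : n' ≤ q) (hqb : q ≤ b)
    (hqm : q ≤ m) {J : Type u} (φ : (J →₀ L) →ₗ[L] P.X (q + 1))
    (hφ : ∀ m, (P.d (q + 1) (q + 2)).hom (φ m) = 0) (e : J → (toBase k Y.1).X q)
    (he : ∀ j, ((toBase k Y.1).d q (q + 1)).hom (e j) =
      emptyWord f (q + 1) (φ (Finsupp.single j 1))) :
    ∃ (P' : CochainComplex (ModuleCat.{u} L) ℤ)
      (f' : (wpx.{w, u, u} ι).Hom (weakifyObj ι P') Y 0) (inr : ∀ i, P.X i →ₗ[L] P'.X i)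
      (b' : (J →₀ L) →ₗ[L] P'.X q), IsPartialResolution f' n' m b ∧
      (∀ i j x, (P'.d i j).hom (inr i x) = inr j ((P.d i j).hom x)) ∧
      (∀ m, (P'.d q (q + 1)).hom (b' m) = inr (q + 1) (φ m)) ∧
      (∀ i x, emptyWord f' i (inr i x) = emptyWord f i x) ∧
      (∀ j, emptyWord f' q (b' (Finsupp.single j 1)) = e j) ∧
      (∀ i, Function.Injective (inr i)) ∧
      (∀ i, i ≠ q → Function.Surjective (inr i)) ∧
      Function.Bijective (fun x : (J →₀ L) × P.X q => b' x.1 + inr q x.2) := by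
  obtain ⟨P', f', inr, b', h₁, h₂, h₃, h₄, h₅, h₆, h₇⟩ := exists_wpx_attach q φ hφ f H.closed e he
  have inj : ∀ i, Function.Injective (inr i) := fun i => by
    by_cases hi : i = q
    · subst hi
      intro x y hxy
      have := @h₇.1 (0, x) (0, y) (by simpa using hxy)
      exact congrArg Prod.snd this
    · exact (h₆ i hi).1
  refine ⟨P', f', inr, b', ⟨h₁, fun i => ?_, fun i hi => ?_, fun i hi => ?_, ?_⟩, h₂, h₃, h₄, h₅,
    inj, fun i hi => (h₆ i hi).2, h₇⟩
  · have := H.free i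
    by_cases hi : i = q
    · subst hi
      let T : ((J →₀ L) × P.X i) →ₗ[L] P'.X i := b'.coprod (inr i)
      exact Module.Free.of_equiv (LinearEquiv.ofBijective T h₇)
    · exact Module.Free.of_equiv (LinearEquiv.ofBijective _ (h₆ i hi))
  · have := H.below i (by omega)
    exact (h₆ i (by omega)).2.subsingleton
  · have := H.above i (by omega)
    exact (h₆ i (by omega)).2.subsingleton
  · intro i hi z y hz hy
    obtain ⟨z, rfl⟩ := (h₆ (i + 1) (by omega)).2 z
    rw [h₂] at hz
    rw [h₄] at hy
    obtain ⟨x, rfl, rfl⟩ := H.lifts i hi z y (inj _ (hz.trans (map_zero _).symm)) hy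
    exact ⟨inr i x, h₂ _ _ _, h₄ _ _⟩

/-- Attaching cells to all cycles of a mapping cone, so as to make it exact in one more degree. -/
lemma IsPartialResolution.exists_step {f : (wpx.{w, u, u} ι).Hom (weakifyObj ι P) Y 0} {n b : ℤ}
    (H : IsPartialResolution f (n + 1) (n + 1) b) (hn : n ≤ b) :
    ∃ (P' : CochainComplex (ModuleCat.{u} L) ℤ)
      (f' : (wpx.{w, u, u} ι).Hom (weakifyObj ι P') Y 0), IsPartialResolution f' n n b := by
  let J := {p : P.X (n + 1) × (toBase k Y.1).X n // (P.d (n + 1) (n + 2)).hom p.1 = 0 ∧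
    emptyWord f (n + 1) p.1 = ((toBase k Y.1).d n (n + 1)).hom p.2}
  let φ : (J →₀ L) →ₗ[L] P.X (n + 1) := Finsupp.linearCombination L fun j : J => j.1.1
  have hφ₁ : ∀ j, φ (Finsupp.single j 1) = j.1.1 := fun j => by simp [φ]
  have hφ : ∀ m, (P.d (n + 1) (n + 2)).hom (φ m) = 0 := fun m => by
    have : (P.d (n + 1) (n + 2)).hom ∘ₗ φ = 0 := Finsupp.lhom_ext' fun j =>
      LinearMap.ext_ring ((congrArg (P.d (n + 1) (n + 2)).hom (hφ₁ j)).trans j.2.1)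
    exact DFunLike.congr_fun this m
  obtain ⟨P', f', inr, b', h, h₂, h₃, h₄, h₅, h₆, h₇, -⟩ := H.attach (n' := n) (by omega) le_rfl hn
    (by omega) φ hφ (fun j => j.1.2) (fun j => j.2.2.symm.trans (congrArg _ (hφ₁ j).symm))
  refine ⟨P', f', h.closed, h.free, h.below, h.above, fun i hi z y hz hy => ?_⟩
  by_cases hin : i = n
  · subst hin
    obtain ⟨z, rfl⟩ := h₇ (i + 1) (by omega) z
    rw [h₂] at hz
    rw [h₄] at hy
    let j : J := ⟨(z, y), h₆ _ (hz.trans (map_zero _).symm), hy⟩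
    exact ⟨b' (Finsupp.single j 1), (h₃ _).trans (congrArg (inr _) (hφ₁ j)), h₅ j⟩
  · exact h.lifts i (by omega) z y hz hy

/-- Partial resolutions are built downwards from the top degree, by attaching in each degree a free
module on all pairs that are to be lifted. -/
lemma exists_isPartialResolution (Y : (wpx.{w, u, u} ι).Obj) {b : ℤ}
    (hY : ∀ i, b < i → Subsingleton ((toBase k Y.1).X i)) (n : ℤ) (hn : n ≤ b + 1) :
    ∃ (P : CochainComplex (ModuleCat.{u} L) ℤ)
      (f : (wpx.{w, u, u} ι).Hom (weakifyObj ι P) Y 0), IsPartialResolution f n n b := by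
  obtain ⟨r, rfl⟩ : ∃ r : ℕ, n = b + 1 - r := ⟨(b + 1 - n).toNat, by omega⟩
  induction r with
  | zero =>
    let P : CochainComplex (ModuleCat.{u} L) ℤ :=
      (HomologicalComplex.single (ModuleCat.{u} L) (ComplexShape.up ℤ) 0).obj (ModuleCat.of L PUnit)
    have hP : ∀ i, Subsingleton (P.X i) := fun i =>
      ModuleCat.subsingleton_of_isZero (((HomologicalComplex.single (ModuleCat.{u} L) (ComplexShape.up ℤ) 0 ⋙
        HomologicalComplex.eval (ModuleCat.{u} L) (ComplexShape.up ℤ) i).map_isZero (ModuleCat.isZero_of_subsingleton _)))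
    refine ⟨P, 0, map_zero _, fun i => inferInstance, fun i _ => hP i, fun i _ => hP i,
      fun i hi z y _ _ => ⟨0, Subsingleton.elim _ _, ?_⟩⟩
    have := hY i (by simp at hi; omega)
    exact Subsingleton.elim _ _
  | succ r ih =>
    obtain ⟨P, f, H⟩ := ih (by push_cast at hn; omega)
    have e : b + 1 - (r : ℤ) = b + 1 - (r + 1 : ℕ) + 1 := by push_cast; ring
    rw [e] at H
    exact H.exists_step (by push_cast; omega)

lemma IsPartialResolution.liftsAt {f : (wpx.{w, u, u} ι).Hom (weakifyObj ι P) Y 0} {n m b : ℤ}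
    (H : IsPartialResolution f n m b) (i : ℤ) (hi : m ≤ i) :
    LiftsAt (underlyingMap f H.closed) i := H.lifts i hi

end

/-! ### The final cells -/

/-- The Eilenberg swindle: a projective module is absorbed by some free module. -/
lemma exists_prod_free_equiv_free (R : Type u) [Ring R] (M : Type u) [AddCommGroup M] [Module R M]
    [Module.Projective R M] : ∃ I : Type u, Nonempty ((M × (I →₀ R)) ≃ₗ[R] (I →₀ R)) := by
  obtain ⟨s, hs⟩ := Module.projective_def'.1 (inferInstance : Module.Projective R M)
  let p : (M →₀ R) →ₗ[R] M := Finsupp.linearCombination R id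
  have hs' : ∀ x, p (s x) = x := DFunLike.congr_fun hs
  let K := LinearMap.ker p
  have hb : Function.Bijective (s.coprod K.subtype) := by
    constructor
    · refine (injective_iff_map_eq_zero _).2 fun ⟨x, y⟩ h => ?_
      have h₁ : s x + y.1 = 0 := h
      have h₂ := congrArg p h₁
      rw [map_add, hs', LinearMap.mem_ker.1 y.2, add_zero, map_zero] at h₂
      rw [h₂, map_zero, zero_add] at h₁
      exact Prod.ext h₂ (Subtype.ext h₁)
    · exact fun y => ⟨(p y, ⟨y - s (p y), by
        rw [LinearMap.mem_ker, map_sub, hs', sub_self]⟩), add_sub_cancel _ _⟩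
  let e₁ : (M × K) ≃ₗ[R] (M →₀ R) := LinearEquiv.ofBijective _ hb
  let e₂ : (ℕ →₀ (M × K)) ≃ₗ[R] (ℕ →₀ M) × (ℕ →₀ K) := LinearEquiv.ofLinearMap
    (LinearMap.prod (Finsupp.mapRange.linearMap (LinearMap.fst R M K))
      (Finsupp.mapRange.linearMap (LinearMap.snd R M K)))
    (LinearMap.coprod (Finsupp.mapRange.linearMap (LinearMap.inl R M K))
      (Finsupp.mapRange.linearMap (LinearMap.inr R M K)))
    (by ext <;> simp) (by ext <;> simp)
  let e₃ : (M × (ℕ →₀ M)) ≃ₗ[R] (ℕ →₀ M) :=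
    (((Finsupp.uniqueLinearEquiv R M PUnit.unit.{1}).symm.prodCongr (.refl R (ℕ →₀ M))).trans
      (Finsupp.sumFinsuppLEquivProdFinsupp R).symm).trans
      (Finsupp.domLCongr ((Equiv.sumComm _ _).trans Equiv.natSumPUnitEquivNat))
  let e₄ : (ℕ →₀ (M × K)) ≃ₗ[R] (ℕ × M →₀ R) :=
    (Finsupp.mapRange.linearEquiv e₁).trans (Finsupp.curryLinearEquiv R).symm
  let e₅ : (M × (ℕ →₀ (M × K))) ≃ₗ[R] (ℕ →₀ (M × K)) :=
    ((((LinearEquiv.refl R M).prodCongr e₂).trans (LinearEquiv.prodAssoc R _ _ _).symm).trans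
      (e₃.prodCongr (.refl R _))).trans e₂.symm
  exact ⟨ℕ × M, ⟨(((LinearEquiv.refl R M).prodCongr e₄.symm).trans e₅).trans e₄⟩⟩

section

variable {k : Type w} [Field k] {A L : Type u} [CommRing A] [Algebra k A] [Ring L] [Algebra k L]
  {ι : A →ₐ[k] L}

open WordCochain

variable {P : CochainComplex (ModuleCat.{u} L) ℤ} {Y : (wpx.{w, u, u} ι).Obj}

/-- Below the degrees of `Y`, a partial resolution is exact, and so its modules of cycles are
successive syzygies. -/
lemma IsPartialResolution.hasProjectiveDimensionLT_cycles
    {f : (wpx.{w, u, u} ι).Hom (weakifyObj ι P) Y 0} {n m b : ℤ}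
    (H : IsPartialResolution f n m b) {i j : ℤ} (hij : i + 1 = j) (hi : m ≤ i)
    (hYj : Subsingleton ((toBase k Y.1).X j)) {r : ℕ}
    (h : HasProjectiveDimensionLT (ModuleCat.of L (LinearMap.ker (P.d j (j + 1)).hom)) (r + 2)) :
    HasProjectiveDimensionLT (ModuleCat.of L (LinearMap.ker (P.d i (i + 1)).hom)) (r + 1) := by
  subst hij
  have := H.free i
  let g : P.X i →ₗ[L] LinearMap.ker (P.d (i + 1) (i + 1 + 1)).hom :=
    LinearMap.codRestrict _ (P.d i (i + 1)).hom fun x => hom_d_d _ _ _ x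
  have hg : Function.Surjective g := by
    rintro ⟨z, hz⟩
    have e : i + 1 + 1 = i + 2 := by ring
    rw [e] at hz
    obtain ⟨x, hx, -⟩ := H.lifts i hi z 0 hz (Subsingleton.elim _ _)
    exact ⟨x, Subtype.ext hx⟩
  have hk : LinearMap.ker g = LinearMap.ker (P.d i (i + 1)).hom := LinearMap.ker_codRestrict _ _ _
  rw [← hk]
  exact hasProjectiveDimensionLT_ker hg h

/-- The cycles just below the degrees of `Y` are, over `A`, cycles of the mapping cone of a map
between bounded above complexes of projective modules, which is exact from this degree on. -/
lemma IsPartialResolution.projective_cycles {f : (wpx.{w, u, u} ι).Hom (weakifyObj ι P) Y 0}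
    {n m b c : ℤ} (H : IsPartialResolution f n m b) (hc : m ≤ c + 1)
    (hA : ∀ M : ModuleCat.{u} L, Module.Free L M →
      Module.Projective A ((ModuleCat.restrictScalars ι.toRingHom).obj M))
    (hY : ∀ i, Module.Projective A
      (HomologicalComplex.X (V := ModuleCat.{u} A) (c := ComplexShape.up ℤ) Y.1 i))
    (hYb : ∀ i, b < i → Subsingleton ((toBase k Y.1).X i))
    (hYc : Subsingleton ((toBase k Y.1).X (c + 1))) :
    Module.Projective A ((ModuleCat.restrictScalars ι.toRingHom).obj
      (ModuleCat.of L (LinearMap.ker (P.d (c + 1) (c + 1 + 1)).hom))) := by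
  have e : ∀ x : P.X (c + 1), (P.d (c + 1) (c + 1 + 1)).hom x = 0 ↔
      (P.d (c + 1) (c + 2)).hom x = 0 := fun x => by
    rw [show c + 1 + 1 = c + 2 by ring]
  have := projective_coneCycles (φ := underlyingMap f H.closed) b H.above hYb
    (fun i => hA _ (H.free i)) hY c fun i hi => H.liftsAt i (by omega)
  let Z := (ModuleCat.restrictScalars ι.toRingHom).obj
      (ModuleCat.of L (LinearMap.ker (P.d (c + 1) (c + 1 + 1)).hom))
  let s : Z →ₗ[A] coneCycles (underlyingMap f H.closed) c :=
    { toFun := fun z => ⟨(z.1, 0), mem_coneCycles.2 ⟨(e z.1).1 z.2, Subsingleton.elim (α := (toBase k Y.1).X (c + 1)) _ _⟩⟩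
      map_add' := fun z z' => Subtype.ext (Prod.ext rfl (add_zero _).symm)
      map_smul' := fun a z => Subtype.ext (Prod.ext rfl (smul_zero _).symm) }
  let t : coneCycles (underlyingMap f H.closed) c →ₗ[A] Z :=
    { toFun := fun x => ⟨x.1.1, (e x.1.1).2 (mem_coneCycles.1 x.2).1⟩
      map_add' := fun _ _ => rfl
      map_smul' := fun _ _ => rfl }
  exact .of_split s t rfl

/-- Attaching two last families of cells, the second one to a free module that is the sum of the
first one and of the cycles of lowest degree, completes a partial resolution. -/
lemma IsPartialResolution.exists_final {f : (wpx.{w, u, u} ι).Hom (weakifyObj ι P) Y 0} {q b : ℤ}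
    (H : IsPartialResolution f (q + 1) (q + 1) b) (hq : q + 1 ≤ b)
    (hY : ∀ i, i ≤ q + 1 → Subsingleton ((toBase k Y.1).X i))
    (hZ : Module.Projective L (LinearMap.ker (P.d (q + 1) (q + 1 + 1)).hom)) :
    ∃ (P' : CochainComplex (ModuleCat.{u} L) ℤ)
      (f' : (wpx.{w, u, u} ι).Hom (weakifyObj ι P') Y 0), ∀ m, IsPartialResolution f' q m b := by
  obtain ⟨I, ⟨E⟩⟩ := exists_prod_free_equiv_free L (LinearMap.ker (P.d (q + 1) (q + 1 + 1)).hom)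
  obtain ⟨P₁, f₁, inr₁, b₁, H₁, d₁, d₁', -, -, inj₁, surj₁, bij₁⟩ := H.attach (q := q + 1)
    (n' := q + 1) le_rfl le_rfl hq le_rfl (J := I) 0 (fun _ => map_zero _) 0
    fun j => (map_zero _).trans (map_zero _).symm
  let φ₀ : (LinearMap.ker (P.d (q + 1) (q + 1 + 1)).hom × (I →₀ L)) →ₗ[L] P₁.X (q + 1) :=
    (inr₁ (q + 1) ∘ₗ Submodule.subtype _).coprod b₁
  have hφ₀ : Function.Injective φ₀ := fun x y hxy => by
    have := @bij₁.1 (x.2, x.1.1) (y.2, y.1.1) ((add_comm _ _).trans (hxy.trans (add_comm _ _)))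
    exact Prod.ext (Subtype.ext (Prod.ext_iff.1 this).2) (Prod.ext_iff.1 this).1
  have hdb : ∀ g, (P₁.d (q + 1) (q + 1 + 1)).hom (b₁ g) = 0 := fun g => (d₁' g).trans (map_zero _)
  have hdφ₀ : ∀ x, (P₁.d (q + 1) (q + 1 + 1)).hom (φ₀ x) = 0 := fun x => by
    refine (map_add _ _ _).trans ((congrArg₂ (· + ·) ?_ (hdb x.2)).trans (add_zero _))
    exact (d₁ _ _ _).trans ((congrArg _ x.1.2).trans (map_zero _))
  have hφ₀' : ∀ z, (P₁.d (q + 1) (q + 1 + 1)).hom z = 0 → ∃ x, φ₀ x = z := fun z hz => by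
    obtain ⟨⟨g, x⟩, rfl⟩ := bij₁.2 z
    have h₁ := hz
    rw [map_add, hdb, zero_add, d₁] at h₁
    exact ⟨(⟨x, inj₁ _ (h₁.trans (map_zero _).symm)⟩, g), add_comm _ _⟩
  have e : q + 1 + 1 = q + 2 := by ring
  obtain ⟨P₂, f₂, inr₂, b₂, H₂, d₂, d₂', -, -, inj₂, surj₂, bij₂⟩ := H₁.attach (q := q)
    (n' := q) (by omega) le_rfl (by omega) (by omega) (φ₀ ∘ₗ E.symm.toLinearMap)
    (fun x => by rw [← e]; exact hdφ₀ _) 0 fun j => by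
      have := hY (q + 1) le_rfl
      exact Subsingleton.elim _ _
  refine ⟨P₂, f₂, fun m => ⟨H₂.closed, H₂.free, H₂.below, H₂.above, fun i _ z y hz hy => ?_⟩⟩
  by_cases hi : q + 1 ≤ i
  · exact H₂.lifts i hi z y hz hy
  have := hY i (by omega)
  suffices h : ∃ x : P₂.X i, (P₂.d i (i + 1)).hom x = z from
    h.imp fun x hx => ⟨hx, Subsingleton.elim _ _⟩
  by_cases hi' : i = q
  · subst hi'
    obtain ⟨z, rfl⟩ := surj₂ (i + 1) (by omega) z
    rw [d₂] at hz
    have hz' := inj₂ _ (hz.trans (map_zero _).symm)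
    rw [← e] at hz'
    obtain ⟨x, rfl⟩ := hφ₀' z hz'
    refine ⟨b₂ (E x), (d₂' _).trans ?_⟩
    exact congrArg (fun x => inr₂ (i + 1) (φ₀ x)) (E.symm_apply_apply x)
  refine ⟨0, (map_zero _).trans ?_⟩
  by_cases hi'' : i + 1 = q
  · subst hi''
    obtain ⟨⟨g, x⟩, rfl⟩ := bij₂.2 z
    have := H₁.below (i + 1) (by omega)
    obtain rfl : x = 0 := Subsingleton.elim _ _
    have e' : i + 2 = i + 1 + 1 := by ring
    rw [e'] at hz
    change (P₂.d (i + 1) (i + 1 + 1)).hom (b₂ g + inr₂ (i + 1) 0) = 0 at hz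
    rw [map_zero, add_zero, d₂'] at hz
    have h₁ : φ₀ (E.symm g) = φ₀ 0 := (inj₂ _ (hz.trans (map_zero _).symm)).trans (map_zero _).symm
    have h₂ : g = 0 := E.symm.injective ((hφ₀ h₁).trans (map_zero _).symm)
    rw [h₂]
    exact ((congrArg₂ (· + ·) (map_zero b₂) (map_zero (inr₂ (i + 1)))).trans (add_zero _)).symm
  · have := H₂.below (i + 1) (by omega)
    exact Subsingleton.elim _ _

/-- A weak complex with a bounded complex of projective modules underlying it has a finite free
resolution, if the `L`-modules that are projective over `A` have bounded projective dimension. -/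
lemma exists_resolution {m : ℕ} (hpd : ∀ M : ModuleCat.{u} L,
      Module.Projective A ((ModuleCat.restrictScalars ι.toRingHom).obj M) →
        HasProjectiveDimensionLT M (m + 1))
    (hA : ∀ M : ModuleCat.{u} L, Module.Free L M →
      Module.Projective A ((ModuleCat.restrictScalars ι.toRingHom).obj M))
    (hY : ∀ i, Module.Projective A
      (HomologicalComplex.X (V := ModuleCat.{u} A) (c := ComplexShape.up ℤ) Y.1 i))
    {a b : ℤ} (hab : a ≤ b) (hYa : ∀ i, i < a → Subsingleton ((toBase k Y.1).X i))
    (hYb : ∀ i, b < i → Subsingleton ((toBase k Y.1).X i)) :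
    ∃ (P : CochainComplex (ModuleCat.{u} L) ℤ) (f : (wpx.{w, u, u} ι).Hom (weakifyObj ι P) Y 0)
      (n : ℤ), ∀ m, IsPartialResolution f n m b := by
  obtain ⟨P, f, H⟩ := exists_isPartialResolution Y hYb (a - 2 - m + 1) (by omega)
  have key : ∀ (r s : ℕ) (c : ℤ), r + s = m → a - 2 - r = c → HasProjectiveDimensionLT
      (ModuleCat.of L (LinearMap.ker (P.d (c + 1) (c + 1 + 1)).hom)) (s + 1) := by
    intro r
    induction r with
    | zero =>
      intro s c hs hc
      obtain rfl : s = m := by omega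
      exact hpd _ (H.projective_cycles (by simp at hc; omega) hA hY hYb
        (hYa _ (by simp at hc; omega)))
    | succ r ih =>
      intro s c hs hc
      push_cast at hc
      exact H.hasProjectiveDimensionLT_cycles rfl (by omega) (hYa _ (by omega))
        (ih (s + 1) (c + 1) (by omega) (by omega))
  have hZ := key m 0 _ rfl rfl
  rw [zero_add, ← projective_iff_hasProjectiveDimensionLT_one] at hZ
  obtain ⟨P', f', H'⟩ := H.exists_final (by omega) (fun i hi => hYa i (by omega))
    ((IsProjective.iff_projective (R := L) _).2 hZ)
  exact ⟨P', f', _, H'⟩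

end

/-! ### The quasi-equivalence -/

section

variable {k : Type w} [Field k] {A L : Type u} [CommRing A] [Algebra k A] [Ring L] [Algebra k L]
  {ι : A →ₐ[k] L}

/-- Every weak complex with a bounded complex of projective modules underlying it is related by an
inner equivalence to the weakification of a bounded complex of free modules. -/
lemma exists_isInnerEquivalence_weakify {m : ℕ} (hpd : ∀ M : ModuleCat.{u} L,
      Module.Projective A ((ModuleCat.restrictScalars ι.toRingHom).obj M) →
        HasProjectiveDimensionLT M (m + 1))
    (hA : ∀ M : ModuleCat.{u} L, Module.Free L M →
      Module.Projective A ((ModuleCat.restrictScalars ι.toRingHom).obj M))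
    (Y : (wpx.{w, u, u} ι).Obj) (hYbdd : IsBoundedCpx (R := A) Y.1)
    (hY : ∀ i, Module.Projective A
      (HomologicalComplex.X (V := ModuleCat.{u} A) (c := ComplexShape.up ℤ) Y.1 i)) :
    ∃ (P : CochainComplex (ModuleCat.{u} L) ℤ) (f : (wpx.{w, u, u} ι).Hom (weakifyObj ι P) Y 0),
      (wpx.{w, u, u} ι).IsInnerEquivalence f ∧ IsBoundedCpx P ∧ (∀ i, Module.Free L (P.X i)) ∧
      (IsPerfectCpx (A := A) Y.1 → IsPerfectCpx (resCpx ι P)) := by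
  obtain ⟨a, b, ha, hb⟩ := hYbdd
  have hYa : ∀ i, i < a → Subsingleton ((toBase k Y.1).X i) := fun i hi =>
    ModuleCat.subsingleton_of_isZero (R := A)
      (CochainComplex.isZero_of_isStrictlyGE (C := ModuleCat.{u} A) Y.1 a i hi)
  have hYb : ∀ i, max a b < i → Subsingleton ((toBase k Y.1).X i) := fun i hi =>
    ModuleCat.subsingleton_of_isZero (R := A)
      (CochainComplex.isZero_of_isStrictlyLE (C := ModuleCat.{u} A) Y.1 b i (lt_of_le_of_lt (le_max_right a b) hi))
  obtain ⟨P, f, n, H⟩ := exists_resolution hpd hA hY (le_max_left a b) hYa hYb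
  have H₀ := H 0
  obtain ⟨e, he⟩ := exists_homotopyEquiv_of_liftsAt (φ := underlyingMap f H₀.closed) (max a b)
    H₀.above hYb (fun i => hA _ (H₀.free i)) hY fun i => (H i).liftsAt i le_rfl
  refine ⟨P, f, wpx_isInnerEquivalence H₀.closed ?_, ⟨n, max a b, ?_, ?_⟩, H₀.free,
    IsPerfectCpx.of_homotopyEquiv e.symm⟩
  · have := isInnerEquivalence_ofHom (k := k) e
    rw [he, ofHom_underlyingMap] at this
    exact this
  · exact (CochainComplex.isStrictlyGE_iff P n).2 fun i hi => by
      have := H₀.below i hi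
      exact ModuleCat.isZero_of_subsingleton _
  · exact isStrictlyLE_of_subsingleton H₀.above

end

namespace FormalCategory

variable {A F : Type u} [CommRing A] [Algebra ℂ A] [CommRing F] [Algebra ℂ F]
  {C : FormalCategory A F}

lemma projective_restrictScalars_of_free (hC : C.IsSmoothType) (M : ModuleCat.{u} C.DiffOp)
    [Module.Free C.DiffOp M] :
    Module.Projective A ((ModuleCat.restrictScalars C.incl.toRingHom).obj M) :=
  projective_of_isLocallyFreeOver_id
    (isLocallyFreeOver_restrictScalars hC (isLocallyFreeOver_of_free C.incl.toRingHom M))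

end FormalCategory

theorem mainTheorem4 {A F : Type u} [CommRing A] [Algebra ℂ A] [Algebra.FiniteType ℂ A]
    [CommRing F] [Algebra ℂ F] (C : FormalCategory A F) (hC : C.IsSmoothType) :
    ∃ h : ResPreservesBplf C.incl,
      ((weakifyBplf₀ h).IsQuasiEquivalence ∧
        (weakifyBplf₀ h).comp (wpxProjBplf₀ C.incl) = strictProjBplf h) ∧
      ((weakifyBplf h).IsQuasiEquivalence ∧
        (weakifyBplf h).comp (wpxProjBplf C.incl) = strictProjBplf h) := by
  have hqff : ∀ E F : CochainComplex (ModuleCat.{u} C.DiffOp) ℤ, IsBplfOver C.incl E →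
      (weakify (k := ℂ) C.incl).QFFAt (C := dgCpx ℂ C.DiffOp) E F := fun E F hE =>
    qffAt_weakify hE.1 fun i => C.projective_of_isLocallyFreeOver hC (hE.2.1 i)
  have hqff₀ : ∀ E F : CochainComplex (ModuleCat.{u} C.DiffOp) ℤ, IsBplfOver C.incl E →
      (weakify₀ (k := ℂ) C.incl).QFFAt (C := dgCpx ℂ C.DiffOp) E F := fun E F hE =>
    DGFunctor.QFFAt.of_comp (G := wpx₀Incl C.incl) (hqff E F hE) (qffAt_wpx₀Incl _ _)
  have hess : ∀ Y : (wpxBplf C.incl).Obj, ∃ (P : CochainComplex (ModuleCat.{u} C.DiffOp) ℤ)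
      (f : (wpx C.incl).Hom (weakifyObj C.incl P) Y.1 0), IsBplfOver C.incl P ∧
        (wpx C.incl).IsInnerEquivalence f := fun Y => by
    obtain ⟨m, hm⟩ := C.exists_hasProjectiveDimensionLT hC
    obtain ⟨P, f, hf, hP, hP', hP''⟩ := exists_isInnerEquivalence_weakify hm
      (fun M _ => C.projective_restrictScalars_of_free hC M) Y.1 Y.2.1
      fun i => projective_of_isLocallyFreeOver_id (Y.2.2.1 i)
    refine ⟨P, f, ⟨hP, fun i => ?_, hP'' Y.2.2.2⟩, hf⟩
    have := hP' i
    exact isLocallyFreeOver_of_free _ _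
  refine ⟨C.resPreservesBplf_incl hC, ⟨⟨fun E F => hqff₀ E.1 F.1 E.2, fun Y => ?_⟩, rfl⟩,
    ⟨⟨fun E F => hqff E.1 F.1 E.2, fun Y => ?_⟩, rfl⟩⟩
  · obtain ⟨P, f, hP, hf⟩ := hess Y
    obtain ⟨f₀, hf₀⟩ := DGFunctor.QFFAt.exists_isInnerEquivalence (F := wpx₀Incl C.incl)
      (qffAt_wpx₀Incl _ _) (qffAt_wpx₀Incl _ _) (qffAt_wpx₀Incl _ _) (qffAt_wpx₀Incl _ _) hf
    exact ⟨⟨P, hP⟩, f₀, hf₀⟩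
  · obtain ⟨P, f, hP, hf⟩ := hess Y
    exact ⟨⟨P, hP⟩, f, hf⟩
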